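/- **Setting.** Let $K\ge 1$, $0<\tau_1\le\dots\le\tau_K$, $T_i=[-\tau_i,0]$. Let $A_0,A_i\in\mathbb R^{n\times n}$, $B_1\in\mathbb R^{n\times r}$, $B_2\in\mathbb R^{n\times m}$, $C_{10},C_{1i}\in\mathbb R^{p\times n}$, $C_2\in\mathbb R^{q\times n}$, $C_{30},C_{3i}\in\mathbb R^{p_1\times n}$, $D_1\in\mathbb R^{p\times r}$, $D_3\in\mathbb R^{p_1\times r}$ ($i\in\{1,\dots,K\}$). The closed loop with gains $K_\bullet$, $L_\bullet$ is, for $t\ge 0$, $$\begin{aligned} \dot x(t)&=A_0x(t)+\textstyle\sum_iA_ix(t-\tau_i)+B_1w(t)+B_2u(t),\\ \dot{\hat x}(t)&=A_0\hat x(t)+\textstyle\sum_iA_i\hat\phi_i(t,-\tau_i)+B_2u(t)+L_1b_0(t)+\sum_iL_{2i}b_i(t,-\tau_i)+\sum_i\int_{-\tau_i}^0L_{3i}(s)b_i(t,s)\,ds,\\ \partial_t\hat\phi_i(t,s)&=\partial_s\hat\phi_i(t,s)+L_{4i}(s)b_0(t)+\textstyle\sum_jL_{5ij}(s)b_j(t,-\tau_j)+L_{6i}(s)b_i(t,s)+\sum_j\int_{-\tau_j}^0L_{7ij}(s,\theta)b_j(t,\theta)\,d\theta,\\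 \hat\phi_i(t,0)&=\hat x(t),\quad b_0(t)=C_2(\hat x(t)-x(t)),\quad b_i(t,s)=C_2(\hat\phi_i(t,s)-x(t+s)),\\ u(t)&=K_0\hat x(t)+\textstyle\sum_iK_{1i}\hat\phi_i(t,-\tau_i)+\sum_i\int_{-\tau_i}^0K_{2i}(s)\hat\phi_i(t,s)\,ds,\\ z(t)&=C_{10}x(t)+\textstyle\sum_iC_{1i}x(t-\tau_i)+D_1w(t),\\ z_e(t)&=C_{30}(\hat x(t)-x(t))+\textstyle\sum_iC_{3i}(\hat\phi_i(t,-\tau_i)-x(t-\tau_i))+D_3w(t), \end{aligned}$$ with $x(t)=0$ for $t\le0$, $\hat x(0)=0$, $\hat\phi_i(0,\cdot)=0$. Solutions are strong solutions: $x,\hat x$ are locally absolutely continuous, $\hat\phi_i(t,\cdot)\in W^{1,2}(T_i)$ for every $t\ge 0$, $\partial_s\hat\phi_i\in L_2([0,t_1]\times T_i)$ for all $t_1$, and the equations hold in time-integrated form. **Positivity sets.** For a quadruple $\{P,Q_i,S_i,R_{ij}\}$ with $P\in\mathbb R^{a\times a}$, $Q_i(s)\in\mathbb R^{a\times b}$,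 $S_i(s),R_{ij}(s,\theta)\in\mathbb R^{b\times b}$, write $\{P,Q_i,S_i,R_{ij}\}\in\Xi_{d,a,b,K}$ if, with $a_i=\tau_i/\tau_K$, the functions on $[-\tau_K,0]$ $$\tilde P=P,\quad \tilde Q(s)=[\sqrt{a_1}Q_1(a_1s)\cdots\sqrt{a_K}Q_K(a_Ks)],\quad \tilde S(s)=\operatorname{diag}(S_i(a_is)),\quad \tilde R(s,\theta)=[\sqrt{a_ia_j}R_{ij}(a_is,a_j\theta)]_{ij}$$ are the sum of two quadruples of the form $$\begin{aligned} P&=\tfrac1{\tau_K}\textstyle\int_{-\tau_K}^0g(s)ds\,M_{11},\qquad Q(s)=\tfrac1{\tau_K}\big(g(s)M_{12}Y_1(s)+\int_{-\tau_K}^0g(\eta)M_{13}Y_2(\eta,s)d\eta\big),\\ S(s)&=\tfrac1{\tau_K}g(s)Y_1(s)^TM_{22}Y_1(s),\\ R(s,\theta)&=g(s)Y_1(s)^TM_{23}Y_2(s,\theta)+g(\theta)Y_2(\theta,s)^TM_{32}Y_1(\theta)+\textstyle\int_{-\tau_K}^0g(\eta)Y_2(\eta,s)^TM_{33}Y_2(\eta,\theta)d\eta,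 \end{aligned}$$ with $M=[M_{ij}]_{i,j\le 3}\succeq0$, one with $g(s)=1$, the other with $g(s)=-s(s+\tau_K)$; here $Y_1(s)=Y_d(s)\otimes I_{bK}$, $Y_2(s,\theta)=Y_d(s,\theta)\otimes I_{bK}$, where $Y_d$ lists all monomials of (total) degree at most $d$. $-\{P,Q_i,S_i,R_{ij}\}$ is the entrywise negative. **The map $\mathcal L_1$.** For $\{P,Q_i,S_i,R_{ij}\}$ with all blocks $n\times n$, $\gamma_1>0$, matrices $H_0,H_{1i}\in\mathbb R^{m\times n}$ and polynomials $H_{2i}$ with values in $\mathbb R^{m\times n}$, put $$\begin{aligned} &E_{10}=A_0P+\textstyle\sum_i(\tau_KA_iQ_i(-\tau_i)^T+\tfrac12S_i(0))+B_2H_0,\quad E_{11}=\tfrac1{\tau_K}C_{10}P+\sum_iC_{1i}Q_i(-\tau_i)^T,\\ &E_{12i}=C_{1i}S_i(-\tau_i),\qquad E_{13i}=\tau_KA_iS_i(-\tau_i)+B_2H_{1i}, \end{aligned}$$ $$E_1=\begin{bmatrix}-\frac{\gamma_1}{\tau_K}I_p&\frac1{\tau_K}D_1&E_{11}&[E_{12i}]_i\\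 *^T&-\frac{\gamma_1}{\tau_K}I_r&B_1^T&0\\ *^T&*^T&E_{10}+E_{10}^T&[E_{13i}]_i\\ *^T&*^T&*^T&\operatorname{diag}(-S_i(-\tau_i))\end{bmatrix},$$ $$F_{1i}(s)=\begin{bmatrix}\frac1{\tau_K}\big(C_{10}Q_i(s)+\sum_jC_{1j}R_{ji}(-\tau_j,s)\big)\\0\\A_0Q_i(s)+\dot Q_i(s)+\sum_jA_jR_{ji}(-\tau_j,s)+B_2H_{2i}(s)\\0\end{bmatrix},$$ $N_{1i}=\dot S_i$, and $G_{1ij}(s,\theta)=\partial_s\big(R_{ij}(s,\theta)\big)+\partial_\theta\big(R_{ji}(\theta,s)^T\big)$. **The map $\mathcal L_2$.** For such a quadruple, $\gamma_2>0$, matrices $Z_1,Z_{2i}$ and polynomials $Z_{3i},Z_{4i},Z_{5ij},Z_{6i}$ (in $s$), $Z_{7ij}$ (in $s,\theta$), all with values in $\mathbb R^{n\times q}$, put $$E_2=\begin{bmatrix}-\frac{\gamma_2}{\tau_K}I_r&\frac1{\tau_K}D_3^T&-(PB_1)^T&0\\ *^T&-\frac{\gamma_2}{\tau_K}I_{p_1}&\frac1{\tau_K}C_{30}&[\frac1{\tau_K}C_{3i}]_i\\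 *^T&*^T&E_{210}&[E_{21i}]_i\\ *^T&*^T&*^T&\operatorname{diag}(-S_i(-\tau_i))\end{bmatrix},\qquad F_{2i}(s)=\begin{bmatrix}-B_1^TQ_i(s)\\0\\F_{20i}(s)\\ [F_{2ji}(s)]_j\end{bmatrix},$$ $$\begin{aligned} E_{210}&=PA_0+A_0^TP+\textstyle\sum_i(Q_i(0)+Q_i(0)^T+S_i(0))+Z_1C_2+C_2^TZ_1^T,\qquad E_{21i}=PA_i-Q_i(-\tau_i)+Z_{2i}C_2,\\ F_{20i}(s)&=A_0^TQ_i(s)+\tfrac1{\tau_K}\textstyle\sum_jR_{ij}(s,0)^T-\dot Q_i(s)+Z_{3i}(s)C_2+C_2^TZ_{4i}(s)^T,\\ F_{2ji}(s)&=A_j^TQ_i(s)-\tfrac1{\tau_K}R_{ij}(s,-\tau_j)^T+C_2^TZ_{5ij}(s)^T,\\ N_{2i}(s)&=-\dot S_i(s)+Z_{6i}(s)C_2+C_2^TZ_{6i}(s)^T,\\ G_{2ij}(s,\theta)&=-\partial_sR_{ij}(s,\theta)-\partial_\theta R_{ij}(s,\theta)+\tau_K\big(Z_{7ij}(s,\theta)C_2+C_2^TZ_{7ji}(\theta,s)^T\big).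 \end{aligned}$$ **The maps $\mathcal L_c$, $\mathcal L_o$.** For a polynomial quadruple with all blocks $n\times n$, write $Q_i(s)=\mathsf H_iY(s)$, $R_{ij}(s,\theta)=Y(s)^T\Gamma_{ij}Y(\theta)$ with $Y(s)=(1,s,\dots,s^\delta)^T\otimes I_n$ ($\delta$ large enough), $\mathsf H=[\mathsf H_1\cdots\mathsf H_K]$, $\mathsf\Gamma=\frac1{\tau_K}[\Gamma_{ij}]_{ij}$, $\mathsf K=\operatorname{diag}\big(\int_{-\tau_i}^0YS_i^{-1}Y^Tds\big)$, and $$\hat{\mathsf H}=P^{-1}\mathsf H(\mathsf K\mathsf H^TP^{-1}\mathsf H-I-\mathsf K\mathsf\Gamma)^{-1},\qquad \hat{\mathsf\Gamma}=-(\hat{\mathsf H}^T\mathsf H+\mathsf\Gamma)(I+\mathsf K\mathsf\Gamma)^{-1},$$ $$\hat P=(I-\hat{\mathsf H}\mathsf K\mathsf H^T)P^{-1},\quad \hat Q_i=\tfrac1{\tau_K}\hat{\mathsf H}_iYS_i^{-1},\quad \hat S_i=\tfrac1{\tau_K^2}S_i^{-1},\quad \hat R_{ij}(s,\theta)=\tfrac1{\tau_K}S_i(s)^{-1}Y(s)^T\hat{\mathsf\Gamma}_{ij}Y(\theta)S_j(\theta)^{-1}.$$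 $\{K_0,K_{1i},K_{2i}\}=\mathcal L_c(\{P,Q_i,S_i,R_{ij}\},\{H_0,H_{1i},H_{2i}\})$ means $$\begin{aligned} K_0&=H_0\hat P+\tau_K\textstyle\sum_iH_{1i}\hat Q_i(-\tau_i)^T+\tau_K\sum_i\int_{-\tau_i}^0H_{2i}\hat Q_i^Tds,\qquad K_{1i}=\tau_KH_{1i}\hat S_i(-\tau_i),\\ K_{2i}(s)&=H_0\hat Q_i(s)+\textstyle\sum_jH_{1j}\hat R_{ji}(-\tau_j,s)+\tau_KH_{2i}(s)\hat S_i(s)+\sum_j\int_{-\tau_j}^0H_{2j}(\eta)\hat R_{ji}(\eta,s)d\eta, \end{aligned}$$ and $\{L_1,\dots,L_{7ij}\}=\mathcal L_o(\{P,Q_i,S_i,R_{ij}\},\{Z_1,\dots,Z_{7ij}\})$ means $$\begin{aligned} L_1&=\hat PZ_1+\tau_K\textstyle\sum_j\int_{-\tau_j}^0\hat Q_jZ_{4j}d\eta,\qquad L_{2i}=\hat PZ_{2i}+\tau_K\sum_j\int_{-\tau_j}^0\hat Q_jZ_{5ji}d\eta,\\ L_{3i}(s)&=\hat PZ_{3i}(s)+\tau_K\hat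 Q_i(s)Z_{6i}(s)+\tau_K\textstyle\sum_j\int_{-\tau_j}^0\hat Q_j(\eta)Z_{7ji}(\eta,s)d\eta,\\ L_{4i}(s)&=\tau_K\hat Q_i(s)^TZ_1+\tau_K^2\hat S_i(s)Z_{4i}(s)+\tau_K\textstyle\sum_j\int_{-\tau_j}^0\hat R_{ij}(s,\eta)Z_{4j}(\eta)d\eta,\\ L_{5ij}(s)&=\tau_K\hat Q_i(s)^TZ_{2j}+\tau_K^2\hat S_i(s)Z_{5ij}(s)+\tau_K\textstyle\sum_l\int_{-\tau_l}^0\hat R_{il}(s,\eta)Z_{5lj}(\eta)d\eta,\qquad L_{6i}=\tau_K^2\hat S_iZ_{6i},\\ L_{7ij}(s,\theta)&=\tau_K\hat Q_i(s)^TZ_{3j}(\theta)+\tau_K^2\hat S_i(s)Z_{7ij}(s,\theta)+\tau_K\hat R_{ij}(s,\theta)Z_{6j}(\theta)+\tau_K\textstyle\sum_l\int_{-\tau_l}^0\hat R_{il}(s,\eta)Z_{7lj}(\eta,\theta)d\eta. \end{aligned}$$ **Theorem.** Let $d\in\mathbb N$, $\epsilon,\epsilon_1,\epsilon_2,\gamma_1,\gamma_2,\rho>0$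 and $\epsilon_3\ge0$. Let $\{P_1,Q_{1i},S_{1i},R_{1ij}\}$ and $\{P_2,Q_{2i},S_{2i},R_{2ij}\}$ be polynomial quadruples with all blocks $n\times n$, and let $H_0,H_{1i},H_{2i}$ and $Z_1,\dots,Z_{7ij}$ be as above. Suppose that $S_{1i}(s)=S_{1i}(s)^T$, $R_{1ij}(s,\theta)=R_{1ji}(\theta,s)^T$, $P_1=\tau_KQ_{1i}(0)^T+\tau_KS_{1i}(0)$ and $Q_{1j}(s)=R_{1ij}(0,s)$ for all $i,j$, and that $$\begin{aligned} \{P_1-\epsilon I,Q_{1i},S_{1i}-\epsilon I,R_{1ij}\}&\in\Xi_{d,n,n,K}, & -\{E_1+\epsilon_1\hat I_1,F_{1i},N_{1i}+\epsilon_1I,G_{1ij}\}&\in\Xi_{d,p+r+n(K+1),n,K},\\ \{P_2-\epsilon I,Q_{2i},S_{2i}-\epsilon I,R_{2ij}\}&\in\Xi_{d,n,n,K}, & -\{E_2+\epsilon_2\hat I_2,F_{2i},N_{2i}+\epsilon_2I,G_{2ij}\}&\in\Xi_{d,r+p_1+n(K+1),n,K}, \end{aligned}$$ where $\{E_1,F_{1i},N_{1i},G_{1ij}\}=\mathcal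 L_1(\{P_1,Q_{1i},S_{1i},R_{1ij}\},\{H_0,H_{1i},H_{2i}\})$, $\{E_2,F_{2i},N_{2i},G_{2ij}\}=\mathcal L_2(\{P_2,Q_{2i},S_{2i},R_{2ij}\},\{Z_1,\dots,Z_{7ij}\})$, $\hat I_1=\operatorname{diag}(0_{p+r},I_n,0_{nK})$, $\hat I_2=\operatorname{diag}(0_{r+p_1},I_n,0_{nK})$. Let $$\{K_0,K_{1i},K_{2i}\}=\mathcal L_c(\{P_1,Q_{1i},S_{1i},R_{1ij}\},\{H_0,H_{1i},H_{2i}\}),\qquad \{L_1,\dots,L_{7ij}\}=\mathcal L_o(\{P_2,Q_{2i},S_{2i},R_{2ij}\},\{Z_1,\dots,Z_{7ij}\}),$$ and suppose further that $-\{E_3+\epsilon_3\hat I_3,F_{3i},N_{3i},0\}\in\Xi_{d,n(K+2),2n,K}$, where $\hat I_3=\operatorname{diag}(I_n,0_n,0_{nK})$ and $$E_3=\begin{bmatrix}-\epsilon_1I&B_2K_0&B_2K_{11}&\cdots&B_2K_{1K}\\ *^T&-\rho\epsilon_2I&0&\cdots&0\\ *^T&*^T&0&\cdots&0\\ \vdots&\vdots&\vdots&\ddots&\vdots\\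 *^T&*^T&*^T&\cdots&0\end{bmatrix},\quad F_{3i}(s)=\begin{bmatrix}B_2K_{2i}(s)&0\\0&0\\ \vdots&\vdots\\0&0\end{bmatrix},\quad N_{3i}=\begin{bmatrix}-\rho\epsilon_2I&0\\0&-\epsilon_1I\end{bmatrix}.$$ Then, whenever $w\in L_2([0,\infty);\mathbb R^r)$, $z$ and $z_e$ satisfy the closed-loop equations with these gains for some $x$, $\hat x$, $\hat\phi_i$, $$\|z\|_{L_2}\le\sqrt{\gamma_1(\gamma_1+\rho\gamma_2)}\,\|w\|_{L_2}\qquad\text{and}\qquad\|z_e\|_{L_2}\le\gamma_2\,\|w\|_{L_2}.$$ -/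

import Mathlib

open MeasureTheory Polynomial
open scoped Matrix ENNReal

noncomputable section

namespace MultiDelay

/-! ### Matrix-valued functions -/

/-- Entrywise derivative of a matrix-valued function of one real variable. -/
def matDeriv {a b : Type*} (M : ℝ → Matrix a b ℝ) (s : ℝ) : Matrix a b ℝ :=
  Matrix.of fun i j => deriv (fun t => M t i j) s

/-- Entrywise integral of a matrix-valued function over an interval. -/
def matInt {a b : Type*} (u v : ℝ) (M : ℝ → Matrix a b ℝ) : Matrix a b ℝ :=
  Matrix.of fun i j => ∫ s in u..v, M s i j

/-- Evaluation of a polynomial matrix in one variable. -/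
def ev {a b : Type*} (M : Matrix a b ℝ[X]) (s : ℝ) : Matrix a b ℝ :=
  M.map (Polynomial.eval s)

/-- Evaluation of a polynomial matrix in two variables at `(s, θ)`. -/
def ev₂ {a b : Type*} (M : Matrix a b ℝ[X][X]) (s θ : ℝ) : Matrix a b ℝ :=
  M.map (fun p => Polynomial.evalEval s θ p)

/-- The block row `[M₁ ⋯ M_K]`. -/
def blockRow {ι a b : Type*} (M : ι → Matrix a b ℝ) : Matrix a (b × ι) ℝ :=
  Matrix.of fun i j => M j.2 i j.1

/-- The block column with blocks `M₁, …, M_K`. -/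
def blockCol {ι a b : Type*} (M : ι → Matrix a b ℝ) : Matrix (a × ι) b ℝ :=
  Matrix.of fun i j => M i.2 i.1 j

/-! ### Parameters of the operators on `ℝᵐ × L₂[-τ₁,0]ⁿ × ⋯ × L₂[-τ_K,0]ⁿ` -/

/-- A quadruple `{P, Q_i, S_i, R_ij}`.  It stands for the operator
`(x, φ_i) ↦ (P x + ∑ᵢ ∫ Q_i φ_i, τ_K Q_iᵀ x + τ_K S_i φ_i + ∑ⱼ ∫ R_ij(·,θ) φ_j(θ) dθ)`. -/
structure Params (ι μ ν : Type*) where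
  P : Matrix μ μ ℝ
  Q : ι → ℝ → Matrix μ ν ℝ
  S : ι → ℝ → Matrix ν ν ℝ
  R : ι → ι → ℝ → ℝ → Matrix ν ν ℝ

/-- `-{P, Q_i, S_i, R_ij}`. -/
def Params.neg {ι μ ν : Type*} (Θ : Params ι μ ν) : Params ι μ ν where
  P := -Θ.P
  Q := fun i s => -Θ.Q i s
  S := fun i s => -Θ.S i s
  R := fun i j s θ => -Θ.R i j s θ

/-- `{P + U, Q_i, S_i + c I, R_ij}`. -/
def Params.shift {ι μ ν : Type*} [DecidableEq ν] (Θ : Params ι μ ν)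
    (U : Matrix μ μ ℝ) (c : ℝ) : Params ι μ ν where
  P := Θ.P + U
  Q := Θ.Q
  S := fun i s => Θ.S i s + c • (1 : Matrix ν ν ℝ)
  R := Θ.R

/-! ### The positivity sets `Ξ` -/

/-- The monomial matrix `Y_d(s) ⊗ I`, where `Y_d(s) = (1, s, …, s^d)ᵀ`. -/
def mono₁ (d : ℕ) (ν : Type*) [DecidableEq ν] (s : ℝ) : Matrix (Fin (d + 1) × ν) ν ℝ :=
  Matrix.of fun a j => if a.2 = j then s ^ (a.1 : ℕ) else 0

/-- Exponents `(a, b)` with `a + b ≤ d`. -/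
abbrev Exps (d : ℕ) : Type :=
  {ab : Fin (d + 1) × Fin (d + 1) // (ab.1 : ℕ) + (ab.2 : ℕ) ≤ d}

/-- The monomial matrix `Y_d(s,θ) ⊗ I`, where `Y_d(s,θ)` lists the monomials `s^a θ^b` of
total degree at most `d`. -/
def mono₂ (d : ℕ) (ν : Type*) [DecidableEq ν] (s θ : ℝ) : Matrix (Exps d × ν) ν ℝ :=
  Matrix.of fun a j => if a.2 = j then s ^ (a.1.1.1 : ℕ) * θ ^ (a.1.1.2 : ℕ) else 0

/-- Gram matrices, with `3 × 3` block structure conforming to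
`(x, (Y_d(η) ⊗ I) φ(η), ∫ (Y_d(η,s) ⊗ I) φ(s) ds)`. -/
abbrev Gram (d : ℕ) (μ ν : Type*) : Type _ :=
  Matrix (μ ⊕ ((Fin (d + 1) × ν) ⊕ (Exps d × ν))) (μ ⊕ ((Fin (d + 1) × ν) ⊕ (Exps d × ν))) ℝ

section Gram

variable {d : ℕ} {μ ν : Type*} [Fintype ν] [DecidableEq ν]

/-- With `M₁₁` the first diagonal block of `M`: `P = (1/T) ∫ g M₁₁`. -/
def Gram.toP (M : Gram d μ ν) (T : ℝ) (g : ℝ → ℝ) : Matrix μ μ ℝ :=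
  (T⁻¹ * ∫ s in (-T)..0, g s) • M.toBlocks₁₁

/-- `Q(s) = (1/T) (g(s) M₁₂ Y(s) + ∫ g(η) M₁₃ Y(η,s) dη)`. -/
def Gram.toQ (M : Gram d μ ν) (T : ℝ) (g : ℝ → ℝ) (s : ℝ) : Matrix μ ν ℝ :=
  T⁻¹ • (g s • (M.toBlocks₁₂.toCols₁ * mono₁ d ν s)
    + matInt (-T) 0 fun η => g η • (M.toBlocks₁₂.toCols₂ * mono₂ d ν η s))

/-- `S(s) = (1/T) g(s) Y(s)ᵀ M₂₂ Y(s)`. -/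
def Gram.toS (M : Gram d μ ν) (T : ℝ) (g : ℝ → ℝ) (s : ℝ) : Matrix ν ν ℝ :=
  (T⁻¹ * g s) • ((mono₁ d ν s)ᵀ * M.toBlocks₂₂.toBlocks₁₁ * mono₁ d ν s)

/-- `R(s,θ) = g(s) Y(s)ᵀ M₂₃ Y(s,θ) + g(θ) Y(θ,s)ᵀ M₃₂ Y(θ) + ∫ g(η) Y(η,s)ᵀ M₃₃ Y(η,θ) dη`. -/
def Gram.toR (M : Gram d μ ν) (T : ℝ) (g : ℝ → ℝ) (s θ : ℝ) : Matrix ν ν ℝ :=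
  g s • ((mono₁ d ν s)ᵀ * M.toBlocks₂₂.toBlocks₁₂ * mono₂ d ν s θ)
    + g θ • ((mono₂ d ν θ s)ᵀ * M.toBlocks₂₂.toBlocks₂₁ * mono₁ d ν θ)
    + matInt (-T) 0 fun η =>
        g η • ((mono₂ d ν η s)ᵀ * M.toBlocks₂₂.toBlocks₂₂ * mono₂ d ν η θ)

end Gram

/-- The set `Ξ_{d,m,n,K}` for the delays `τ₁ ≤ ⋯ ≤ τ_K` (here `K = k + 1`): after rescaling all
the delay channels to `[-τ_K, 0]` (with `a_i = τ_i / τ_K`) and stacking them, the quadruple is a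
sum of two quadruples built from positive semidefinite Gram matrices, with multipliers
`g(s) = 1` and `g(s) = -s (s + τ_K)`. -/
def Xi (d : ℕ) {k : ℕ} (τ : Fin (k + 1) → ℝ) {μ ν : Type*} [Fintype μ] [Fintype ν]
    [DecidableEq ν] : Set (Params (Fin (k + 1)) μ ν) :=
  {Θ | ∃ M N : Gram d μ (ν × Fin (k + 1)), M.PosSemidef ∧ N.PosSemidef ∧
    let T : ℝ := τ (Fin.last k)
    let a : Fin (k + 1) → ℝ := fun i => τ i / T
    let g₁ : ℝ → ℝ := fun _ => 1
    let g₂ : ℝ → ℝ := fun s => -s * (s + T)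
    Θ.P = M.toP T g₁ + N.toP T g₂ ∧
    (∀ s ∈ Set.Icc (-T) 0,
      blockRow (fun i => √(a i) • Θ.Q i (a i * s)) = M.toQ T g₁ s + N.toQ T g₂ s) ∧
    (∀ s ∈ Set.Icc (-T) 0,
      Matrix.blockDiagonal (fun i => Θ.S i (a i * s)) = M.toS T g₁ s + N.toS T g₂ s) ∧
    (∀ s ∈ Set.Icc (-T) 0, ∀ θ ∈ Set.Icc (-T) 0,
      blockCol (fun i => blockRow (fun j => √(a i * a j) • Θ.R i j (a i * s) (a j * θ)))
        = M.toR T g₁ s θ + N.toR T g₂ s θ)}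

/-! ### The system -/

/-- The data of a linear system with `K = k + 1` delays: state in `ℝⁿ`, actuated input in `ℝᵐ`,
measured output in `ℝ^q`, disturbance in `ℝʳ`, regulated output in `ℝᵖ`, regulated estimation
error in `ℝ^{p₁}`. -/
structure DelaySystem (k n m q r p p₁ : ℕ) where
  τ : Fin (k + 1) → ℝ
  τ_pos : ∀ i, 0 < τ i
  τ_mono : Monotone τ
  A₀ : Matrix (Fin n) (Fin n) ℝ
  A : Fin (k + 1) → Matrix (Fin n) (Fin n) ℝ
  B₁ : Matrix (Fin n) (Fin r) ℝ
  B₂ : Matrix (Fin n) (Fin m) ℝ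
  C₁₀ : Matrix (Fin p) (Fin n) ℝ
  C₁ : Fin (k + 1) → Matrix (Fin p) (Fin n) ℝ
  C₂ : Matrix (Fin q) (Fin n) ℝ
  C₃₀ : Matrix (Fin p₁) (Fin n) ℝ
  C₃ : Fin (k + 1) → Matrix (Fin p₁) (Fin n) ℝ
  D₁ : Matrix (Fin p) (Fin r) ℝ
  D₃ : Matrix (Fin p₁) (Fin r) ℝ

/-- The largest delay `τ_K`. -/
def DelaySystem.T {k n m q r p p₁ : ℕ} (sys : DelaySystem k n m q r p p₁) : ℝ :=
  sys.τ (Fin.last k)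

/-! ### Decision variables -/

/-- A polynomial quadruple `{P, Q_i, S_i, R_ij}` with square blocks.  The polynomials `Q_i` and
`R_ij` are given by their coefficients with respect to the monomials up to an arbitrary degree
`deg`: `Q_i(s) = H_i Y(s)` and `R_ij(s,θ) = Y(s)ᵀ Γ_ij Y(θ)`. -/
structure PolyParams (k n : ℕ) where
  deg : ℕ
  P : Matrix (Fin n) (Fin n) ℝ
  H : Fin (k + 1) → Matrix (Fin n) (Fin (deg + 1) × Fin n) ℝ
  S : Fin (k + 1) → Matrix (Fin n) (Fin n) ℝ[X]
  Γ : Fin (k + 1) → Fin (k + 1) →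
    Matrix (Fin (deg + 1) × Fin n) (Fin (deg + 1) × Fin n) ℝ

/-- The quadruple of functions given by a polynomial quadruple. -/
def PolyParams.eval {k n : ℕ} (Θ : PolyParams k n) : Params (Fin (k + 1)) (Fin n) (Fin n) where
  P := Θ.P
  Q := fun i s => Θ.H i * mono₁ Θ.deg (Fin n) s
  S := fun i s => ev (Θ.S i) s
  R := fun i j s θ => (mono₁ Θ.deg (Fin n) s)ᵀ * Θ.Γ i j * mono₁ Θ.deg (Fin n) θ

/-- The structural conditions under which the operator is self-adjoint and maps the state space
`X = {(x, φ_i) : φ_i ∈ W₂, φ_i(0) = x}` to itself. -/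
structure StateSpacePreserving {k n : ℕ} (τ : Fin (k + 1) → ℝ)
    (Θ : Params (Fin (k + 1)) (Fin n) (Fin n)) : Prop where
  S_symm : ∀ i, ∀ s ∈ Set.Icc (-τ i) 0, Θ.S i s = (Θ.S i s)ᵀ
  R_symm : ∀ i j, ∀ s ∈ Set.Icc (-τ i) 0, ∀ θ ∈ Set.Icc (-τ j) 0,
    Θ.R i j s θ = (Θ.R j i θ s)ᵀ
  P_eq : ∀ i, Θ.P = τ (Fin.last k) • (Θ.Q i 0)ᵀ + τ (Fin.last k) • Θ.S i 0
  Q_eq : ∀ i j, ∀ s ∈ Set.Icc (-τ j) 0, Θ.Q j s = Θ.R i j 0 s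

/-- The decision variables `{H₀, H₁ᵢ, H₂ᵢ}` of the controller synthesis. -/
structure ControlVars (k n m : ℕ) where
  H₀ : Matrix (Fin m) (Fin n) ℝ
  H₁ : Fin (k + 1) → Matrix (Fin m) (Fin n) ℝ
  H₂ : Fin (k + 1) → Matrix (Fin m) (Fin n) ℝ[X]

/-- The decision variables `{Z₁, Z₂ᵢ, …, Z₇ᵢⱼ}` of the estimator synthesis. -/
structure EstimVars (k n q : ℕ) where
  Z₁ : Matrix (Fin n) (Fin q) ℝ
  Z₂ : Fin (k + 1) → Matrix (Fin n) (Fin q) ℝ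
  Z₃ : Fin (k + 1) → Matrix (Fin n) (Fin q) ℝ[X]
  Z₄ : Fin (k + 1) → Matrix (Fin n) (Fin q) ℝ[X]
  Z₅ : Fin (k + 1) → Fin (k + 1) → Matrix (Fin n) (Fin q) ℝ[X]
  Z₆ : Fin (k + 1) → Matrix (Fin n) (Fin q) ℝ[X]
  Z₇ : Fin (k + 1) → Fin (k + 1) → Matrix (Fin n) (Fin q) ℝ[X][X]

/-! ### The maps `𝓛₁` and `𝓛₂` -/

section LMI

variable {k n m q r p p₁ : ℕ}

/-- Index set of the finite-dimensional part `(v, ω, x, φ₁(-τ₁), …, φ_K(-τ_K))`. -/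
abbrev LmiIdx (k n a b : ℕ) : Type := (Fin a ⊕ Fin b) ⊕ (Fin n ⊕ (Fin n × Fin (k + 1)))

/-- The map `𝓛₁`: the quadruple `{E₁, F₁ᵢ, N₁ᵢ, G₁ᵢⱼ}`. -/
def mapL₁ (sys : DelaySystem k n m q r p p₁) (γ : ℝ)
    (Θ : Params (Fin (k + 1)) (Fin n) (Fin n)) (ℋ : ControlVars k n m) :
    Params (Fin (k + 1)) (LmiIdx k n p r) (Fin n) :=
  let T := sys.T
  let E₁₀ : Matrix (Fin n) (Fin n) ℝ := sys.A₀ * Θ.P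
    + ∑ i, (T • (sys.A i * (Θ.Q i (-sys.τ i))ᵀ) + (1 / 2 : ℝ) • Θ.S i 0) + sys.B₂ * ℋ.H₀
  let E₁₁ : Matrix (Fin p) (Fin n) ℝ :=
    T⁻¹ • (sys.C₁₀ * Θ.P) + ∑ i, sys.C₁ i * (Θ.Q i (-sys.τ i))ᵀ
  let E₁₂ : Matrix (Fin p) (Fin n × Fin (k + 1)) ℝ :=
    blockRow fun i => sys.C₁ i * Θ.S i (-sys.τ i)
  let E₁₃ : Matrix (Fin n) (Fin n × Fin (k + 1)) ℝ :=
    blockRow fun i => T • (sys.A i * Θ.S i (-sys.τ i)) + sys.B₂ * ℋ.H₁ i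
  let U : Matrix (Fin p ⊕ Fin r) (Fin n ⊕ (Fin n × Fin (k + 1))) ℝ :=
    Matrix.fromBlocks E₁₁ E₁₂ sys.B₁ᵀ 0
  { P := Matrix.fromBlocks
      (Matrix.fromBlocks (-(γ / T) • 1) (T⁻¹ • sys.D₁) (T⁻¹ • sys.D₁ᵀ) (-(γ / T) • 1))
      U Uᵀ
      (Matrix.fromBlocks (E₁₀ + E₁₀ᵀ) E₁₃ E₁₃ᵀ
        (Matrix.blockDiagonal fun i => -Θ.S i (-sys.τ i)))
    Q := fun i s => Matrix.fromRows
      (Matrix.fromRows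
        (T⁻¹ • (sys.C₁₀ * Θ.Q i s + ∑ j, sys.C₁ j * Θ.R j i (-sys.τ j) s)) 0)
      (Matrix.fromRows
        (sys.A₀ * Θ.Q i s + matDeriv (Θ.Q i) s + ∑ j, sys.A j * Θ.R j i (-sys.τ j) s
          + sys.B₂ * ev (ℋ.H₂ i) s) 0)
    S := fun i s => matDeriv (Θ.S i) s
    R := fun i j s θ =>
      matDeriv (fun s' => Θ.R i j s' θ) s + (matDeriv (fun θ' => Θ.R j i θ' s) θ)ᵀ }

/-- The map `𝓛₂`: the quadruple `{E₂, F₂ᵢ, N₂ᵢ, G₂ᵢⱼ}`. -/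
def mapL₂ (sys : DelaySystem k n m q r p p₁) (γ : ℝ)
    (Θ : Params (Fin (k + 1)) (Fin n) (Fin n)) (𝒵 : EstimVars k n q) :
    Params (Fin (k + 1)) (LmiIdx k n r p₁) (Fin n) :=
  let T := sys.T
  let E₂₁₀ : Matrix (Fin n) (Fin n) ℝ := Θ.P * sys.A₀ + sys.A₀ᵀ * Θ.P
    + ∑ i, (Θ.Q i 0 + (Θ.Q i 0)ᵀ + Θ.S i 0) + 𝒵.Z₁ * sys.C₂ + sys.C₂ᵀ * 𝒵.Z₁ᵀ
  let E₂₁ : Matrix (Fin n) (Fin n × Fin (k + 1)) ℝ :=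
    blockRow fun i => Θ.P * sys.A i - Θ.Q i (-sys.τ i) + 𝒵.Z₂ i * sys.C₂
  let U : Matrix (Fin r ⊕ Fin p₁) (Fin n ⊕ (Fin n × Fin (k + 1))) ℝ :=
    Matrix.fromBlocks (-(Θ.P * sys.B₁)ᵀ) 0
      (T⁻¹ • sys.C₃₀) (blockRow fun i => T⁻¹ • sys.C₃ i)
  { P := Matrix.fromBlocks
      (Matrix.fromBlocks (-(γ / T) • 1) (T⁻¹ • sys.D₃ᵀ) (T⁻¹ • sys.D₃) (-(γ / T) • 1))
      U Uᵀ
      (Matrix.fromBlocks E₂₁₀ E₂₁ E₂₁ᵀ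
        (Matrix.blockDiagonal fun i => -Θ.S i (-sys.τ i)))
    Q := fun i s => Matrix.fromRows
      (Matrix.fromRows (-(sys.B₁ᵀ * Θ.Q i s)) 0)
      (Matrix.fromRows
        (sys.A₀ᵀ * Θ.Q i s + T⁻¹ • ∑ j, (Θ.R i j s 0)ᵀ - matDeriv (Θ.Q i) s
          + ev (𝒵.Z₃ i) s * sys.C₂ + sys.C₂ᵀ * (ev (𝒵.Z₄ i) s)ᵀ)
        (blockCol fun j => (sys.A j)ᵀ * Θ.Q i s - T⁻¹ • (Θ.R i j s (-sys.τ j))ᵀ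
          + sys.C₂ᵀ * (ev (𝒵.Z₅ i j) s)ᵀ))
    S := fun i s => -matDeriv (Θ.S i) s + ev (𝒵.Z₆ i) s * sys.C₂
      + sys.C₂ᵀ * (ev (𝒵.Z₆ i) s)ᵀ
    R := fun i j s θ =>
      -matDeriv (fun s' => Θ.R i j s' θ) s - matDeriv (fun θ' => Θ.R i j s θ') θ
        + T • (ev₂ (𝒵.Z₇ i j) s θ * sys.C₂ + sys.C₂ᵀ * (ev₂ (𝒵.Z₇ j i) θ s)ᵀ) }

/-- `diag(0, I_n, 0_{nK})`, with the identity in the block of the present state. -/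
def stateProj (k n a b : ℕ) : Matrix (LmiIdx k n a b) (LmiIdx k n a b) ℝ :=
  Matrix.fromBlocks 0 0 0 (Matrix.fromBlocks 1 0 0 0)

end LMI

/-! ### The inverse operator and the gains -/

section Gains

variable {k n m q : ℕ}

/-- The parameters of the inverse of the operator given by the polynomial quadruple
`{P, Q_i, S_i, R_ij}`, `Q_i = H_i Y`, `R_ij = Yᵀ Γ_ij Y`.  With
`𝐊 = diag(∫_{-τ_i}^0 Y S_i⁻¹ Yᵀ)`, `𝐇 = [H₁ ⋯ H_K]` and `𝚪 = τ_K⁻¹ (Γ_ij)`, put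
`Ĥ = P⁻¹ 𝐇 (𝐊 𝐇ᵀ P⁻¹ 𝐇 - I - 𝐊 𝚪)⁻¹` and `Γ̂ = -(Ĥᵀ 𝐇 + 𝚪) (I + 𝐊 𝚪)⁻¹`. The inverse has
parameters `(I - Ĥ 𝐊 𝐇ᵀ) P⁻¹`, `τ_K⁻¹ Ĥ_i Y S_i⁻¹`, `τ_K⁻² S_i⁻¹`,
`τ_K⁻¹ S_i⁻¹ Yᵀ Γ̂_ij Y S_j⁻¹`. -/
def PolyParams.inverse (τ : Fin (k + 1) → ℝ) (Θ : PolyParams k n) :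
    Params (Fin (k + 1)) (Fin n) (Fin n) :=
  let T := τ (Fin.last k)
  let Y := mono₁ Θ.deg (Fin n)
  let Kb : Matrix ((Fin (Θ.deg + 1) × Fin n) × Fin (k + 1))
      ((Fin (Θ.deg + 1) × Fin n) × Fin (k + 1)) ℝ :=
    Matrix.blockDiagonal fun i => matInt (-τ i) 0 fun s => Y s * (ev (Θ.S i) s)⁻¹ * (Y s)ᵀ
  let Hb : Matrix (Fin n) ((Fin (Θ.deg + 1) × Fin n) × Fin (k + 1)) ℝ := blockRow Θ.H
  let Γb : Matrix ((Fin (Θ.deg + 1) × Fin n) × Fin (k + 1))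
      ((Fin (Θ.deg + 1) × Fin n) × Fin (k + 1)) ℝ :=
    T⁻¹ • blockCol fun i => blockRow fun j => Θ.Γ i j
  let Hh : Matrix (Fin n) ((Fin (Θ.deg + 1) × Fin n) × Fin (k + 1)) ℝ :=
    Θ.P⁻¹ * Hb * (Kb * Hbᵀ * Θ.P⁻¹ * Hb - 1 - Kb * Γb)⁻¹
  let Γh : Matrix ((Fin (Θ.deg + 1) × Fin n) × Fin (k + 1))
      ((Fin (Θ.deg + 1) × Fin n) × Fin (k + 1)) ℝ :=
    -((Hhᵀ * Hb + Γb) * (1 + Kb * Γb)⁻¹)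
  { P := (1 - Hh * Kb * Hbᵀ) * Θ.P⁻¹
    Q := fun i s =>
      T⁻¹ • (Hh.submatrix id (fun a => (a, i)) * Y s * (ev (Θ.S i) s)⁻¹)
    S := fun i s => (T⁻¹ ^ 2) • (ev (Θ.S i) s)⁻¹
    R := fun i j s θ =>
      T⁻¹ • ((ev (Θ.S i) s)⁻¹ * (Y s)ᵀ
        * Γh.submatrix (fun a => (a, i)) (fun b => (b, j)) * Y θ * (ev (Θ.S j) θ)⁻¹) }

/-- Controller gains `{K₀, K₁ᵢ, K₂ᵢ}`. -/
structure ControlGains (k n m : ℕ) where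
  K₀ : Matrix (Fin m) (Fin n) ℝ
  K₁ : Fin (k + 1) → Matrix (Fin m) (Fin n) ℝ
  K₂ : Fin (k + 1) → ℝ → Matrix (Fin m) (Fin n) ℝ

/-- Estimator gains `{L₁, L₂ᵢ, …, L₇ᵢⱼ}`. -/
structure EstimGains (k n q : ℕ) where
  L₁ : Matrix (Fin n) (Fin q) ℝ
  L₂ : Fin (k + 1) → Matrix (Fin n) (Fin q) ℝ
  L₃ : Fin (k + 1) → ℝ → Matrix (Fin n) (Fin q) ℝ
  L₄ : Fin (k + 1) → ℝ → Matrix (Fin n) (Fin q) ℝ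
  L₅ : Fin (k + 1) → Fin (k + 1) → ℝ → Matrix (Fin n) (Fin q) ℝ
  L₆ : Fin (k + 1) → ℝ → Matrix (Fin n) (Fin q) ℝ
  L₇ : Fin (k + 1) → Fin (k + 1) → ℝ → ℝ → Matrix (Fin n) (Fin q) ℝ

/-- The map `𝓛_c`: the gains of `𝒦 = ℋ Θ⁻¹`. -/
def mapLc (τ : Fin (k + 1) → ℝ) (Θ : PolyParams k n) (ℋ : ControlVars k n m) :
    ControlGains k n m :=
  let T := τ (Fin.last k)
  let J := Θ.inverse τ
  { K₀ := ℋ.H₀ * J.P + T • ∑ i, ℋ.H₁ i * (J.Q i (-τ i))ᵀ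
      + T • ∑ i, matInt (-τ i) 0 fun s => ev (ℋ.H₂ i) s * (J.Q i s)ᵀ
    K₁ := fun i => T • (ℋ.H₁ i * J.S i (-τ i))
    K₂ := fun i s => ℋ.H₀ * J.Q i s + ∑ j, ℋ.H₁ j * J.R j i (-τ j) s
      + T • (ev (ℋ.H₂ i) s * J.S i s)
      + ∑ j, matInt (-τ j) 0 fun η => ev (ℋ.H₂ j) η * J.R j i η s }

/-- The map `𝓛_o`: the gains of `𝓛 = Θ⁻¹ 𝒵`. -/
def mapLo (τ : Fin (k + 1) → ℝ) (Θ : PolyParams k n) (𝒵 : EstimVars k n q) :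
    EstimGains k n q :=
  let T := τ (Fin.last k)
  let J := Θ.inverse τ
  { L₁ := J.P * 𝒵.Z₁ + T • ∑ j, matInt (-τ j) 0 fun η => J.Q j η * ev (𝒵.Z₄ j) η
    L₂ := fun i => J.P * 𝒵.Z₂ i
      + T • ∑ j, matInt (-τ j) 0 fun η => J.Q j η * ev (𝒵.Z₅ j i) η
    L₃ := fun i s => J.P * ev (𝒵.Z₃ i) s + T • (J.Q i s * ev (𝒵.Z₆ i) s)
      + T • ∑ j, matInt (-τ j) 0 fun η => J.Q j η * ev₂ (𝒵.Z₇ j i) η s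
    L₄ := fun i s => T • ((J.Q i s)ᵀ * 𝒵.Z₁) + T ^ 2 • (J.S i s * ev (𝒵.Z₄ i) s)
      + T • ∑ j, matInt (-τ j) 0 fun η => J.R i j s η * ev (𝒵.Z₄ j) η
    L₅ := fun i j s => T • ((J.Q i s)ᵀ * 𝒵.Z₂ j) + T ^ 2 • (J.S i s * ev (𝒵.Z₅ i j) s)
      + T • ∑ l, matInt (-τ l) 0 fun η => J.R i l s η * ev (𝒵.Z₅ l j) η
    L₆ := fun i s => T ^ 2 • (J.S i s * ev (𝒵.Z₆ i) s)
    L₇ := fun i j s θ => T • ((J.Q i s)ᵀ * ev (𝒵.Z₃ j) θ)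
      + T ^ 2 • (J.S i s * ev₂ (𝒵.Z₇ i j) s θ) + T • (J.R i j s θ * ev (𝒵.Z₆ j) θ)
      + T • ∑ l, matInt (-τ l) 0 fun η => J.R i l s η * ev₂ (𝒵.Z₇ l j) η θ }

end Gains

/-! ### The coupling block -/

section Coupling

variable {k n m q r p p₁ : ℕ}

/-- The quadruple `{E₃, F₃ᵢ, N₃ᵢ, 0}`, acting on
`(h₁, e₁, e₂₁(-τ₁), …, e₂K(-τ_K))` and `(e₂ᵢ(s), h₂ᵢ(s))`. -/
def coupling (sys : DelaySystem k n m q r p p₁) (𝒦 : ControlGains k n m) (ε₁ ε₂ ρ : ℝ) :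
    Params (Fin (k + 1)) (Fin n ⊕ (Fin n ⊕ (Fin n × Fin (k + 1)))) (Fin n ⊕ Fin n) :=
  let V : Matrix (Fin n) (Fin n ⊕ (Fin n × Fin (k + 1))) ℝ :=
    Matrix.fromCols (sys.B₂ * 𝒦.K₀) (blockRow fun i => sys.B₂ * 𝒦.K₁ i)
  { P := Matrix.fromBlocks (-ε₁ • 1) V Vᵀ (Matrix.fromBlocks (-(ρ * ε₂) • 1) 0 0 0)
    Q := fun i s => Matrix.fromBlocks (sys.B₂ * 𝒦.K₂ i s) 0 0 0
    S := fun _ _ => Matrix.fromBlocks (-(ρ * ε₂) • 1) 0 0 (-ε₁ • 1)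
    R := fun _ _ _ _ => 0 }

/-- `diag(I_n, 0_n, 0_{nK})`. -/
def couplingProj (k n : ℕ) : Matrix (Fin n ⊕ (Fin n ⊕ (Fin n × Fin (k + 1))))
    (Fin n ⊕ (Fin n ⊕ (Fin n × Fin (k + 1)))) ℝ :=
  Matrix.fromBlocks 1 0 0 0

end Coupling

/-! ### The closed loop -/

section ClosedLoop

variable {k n m q r p p₁ : ℕ}

/-- `u(t) = K₀ x̂(t) + ∑ᵢ K₁ᵢ φ̂ᵢ(t,-τᵢ) + ∑ᵢ ∫ K₂ᵢ(s) φ̂ᵢ(t,s) ds`. -/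
def control (τ : Fin (k + 1) → ℝ) (𝒦 : ControlGains k n m) (xh : ℝ → Fin n → ℝ)
    (φ : Fin (k + 1) → ℝ → ℝ → Fin n → ℝ) (t : ℝ) : Fin m → ℝ :=
  𝒦.K₀ *ᵥ xh t + ∑ i, 𝒦.K₁ i *ᵥ φ i t (-τ i)
    + ∑ i, ∫ s in (-τ i)..0, 𝒦.K₂ i s *ᵥ φ i t s

/-- The correction of the present state: `L₁ b₀ + ∑ᵢ L₂ᵢ bᵢ(-τᵢ) + ∑ᵢ ∫ L₃ᵢ(s) bᵢ(s) ds`. -/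
def injectPresent (τ : Fin (k + 1) → ℝ) (𝓛 : EstimGains k n q) (b₀ : Fin q → ℝ)
    (b : Fin (k + 1) → ℝ → Fin q → ℝ) : Fin n → ℝ :=
  𝓛.L₁ *ᵥ b₀ + ∑ i, 𝓛.L₂ i *ᵥ b i (-τ i) + ∑ i, ∫ s in (-τ i)..0, 𝓛.L₃ i s *ᵥ b i s

/-- The correction of the history in channel `i`:
`L₄ᵢ(s) b₀ + ∑ⱼ L₅ᵢⱼ(s) bⱼ(-τⱼ) + L₆ᵢ(s) bᵢ(s) + ∑ⱼ ∫ L₇ᵢⱼ(s,θ) bⱼ(θ) dθ`. -/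
def injectHistory (τ : Fin (k + 1) → ℝ) (𝓛 : EstimGains k n q) (b₀ : Fin q → ℝ)
    (b : Fin (k + 1) → ℝ → Fin q → ℝ) (i : Fin (k + 1)) (s : ℝ) : Fin n → ℝ :=
  𝓛.L₄ i s *ᵥ b₀ + ∑ j, 𝓛.L₅ i j s *ᵥ b j (-τ j) + 𝓛.L₆ i s *ᵥ b i s
    + ∑ j, ∫ θ in (-τ j)..0, 𝓛.L₇ i j s θ *ᵥ b j θ

/-- `w`, `z`, `z_e` satisfy the closed-loop equations with plant state `x`, estimated state `xh`
and estimated histories `φ i t s`, `s ∈ [-τᵢ, 0]`, all started from zero.  The differential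
equations are read in the strong sense and are written in integrated form: `x`, `xh` are
continuous, every `φ i t` is in `W^{1,2}[-τᵢ, 0]` with derivative `ψ i t` and value `xh t` at
`s = 0`, `ψ i` is square integrable on `[0, t₁] × [-τᵢ, 0]` for all `t₁`, and the equation
`∂ₜ φᵢ = ∂ₛ φᵢ + correction` is integrated in time. -/
structure ClosedLoop (sys : DelaySystem k n m q r p p₁) (𝒦 : ControlGains k n m)
    (𝓛 : EstimGains k n q) (w : ℝ → Fin r → ℝ) (x xh : ℝ → Fin n → ℝ)
    (φ : Fin (k + 1) → ℝ → ℝ → Fin n → ℝ) (z : ℝ → Fin p → ℝ) (ze : ℝ → Fin p₁ → ℝ) :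
    Prop where
  x_cont : Continuous x
  x_zero : ∀ t ≤ 0, x t = 0
  x_eq : ∀ t, 0 ≤ t → x t = ∫ σ in (0 : ℝ)..t,
    (sys.A₀ *ᵥ x σ + ∑ i, sys.A i *ᵥ x (σ - sys.τ i) + sys.B₁ *ᵥ w σ
      + sys.B₂ *ᵥ control sys.τ 𝒦 xh φ σ)
  xh_cont : ContinuousOn xh (Set.Ici 0)
  xh_eq : ∀ t, 0 ≤ t → xh t = ∫ σ in (0 : ℝ)..t,
    (sys.A₀ *ᵥ xh σ + ∑ i, sys.A i *ᵥ φ i σ (-sys.τ i)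
      + sys.B₂ *ᵥ control sys.τ 𝒦 xh φ σ
      + injectPresent sys.τ 𝓛 (sys.C₂ *ᵥ xh σ - sys.C₂ *ᵥ x σ)
          (fun j s => sys.C₂ *ᵥ φ j σ s - sys.C₂ *ᵥ x (σ + s)))
  φ_eq : ∃ ψ : Fin (k + 1) → ℝ → ℝ → Fin n → ℝ, ∀ i,
    (∀ t₁, 0 ≤ t₁ → MemLp (Function.uncurry (ψ i)) 2
      ((volume : Measure (ℝ × ℝ)).restrict (Set.Icc 0 t₁ ×ˢ Set.Icc (-sys.τ i) 0))) ∧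
    (∀ t, 0 ≤ t → MemLp (ψ i t) 2 (volume.restrict (Set.Icc (-sys.τ i) 0)) ∧
      ∀ s ∈ Set.Icc (-sys.τ i) 0, φ i t s = xh t - ∫ θ in s..0, ψ i t θ) ∧
    (∀ t, 0 ≤ t → ∀ᵐ s ∂(volume.restrict (Set.Icc (-sys.τ i) 0)),
      φ i t s = ∫ σ in (0 : ℝ)..t,
        (ψ i σ s + injectHistory sys.τ 𝓛 (sys.C₂ *ᵥ xh σ - sys.C₂ *ᵥ x σ)
          (fun j s' => sys.C₂ *ᵥ φ j σ s' - sys.C₂ *ᵥ x (σ + s')) i s))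
  z_eq : ∀ᵐ t ∂(volume.restrict (Set.Ici (0 : ℝ))),
    z t = sys.C₁₀ *ᵥ x t + ∑ i, sys.C₁ i *ᵥ x (t - sys.τ i) + sys.D₁ *ᵥ w t
  ze_eq : ∀ᵐ t ∂(volume.restrict (Set.Ici (0 : ℝ))),
    ze t = sys.C₃₀ *ᵥ (xh t - x t)
      + ∑ i, sys.C₃ i *ᵥ (φ i t (-sys.τ i) - x (t - sys.τ i)) + sys.D₃ *ᵥ w t

end ClosedLoop

/-- The norm of `L₂([0,∞); ℝᵃ)`, with the Euclidean norm on `ℝᵃ`. -/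
def normL₂ {a : ℕ} (f : ℝ → Fin a → ℝ) : ℝ≥0∞ :=
  eLpNorm (fun t => WithLp.toLp 2 (f t)) 2 (volume.restrict (Set.Ici (0 : ℝ)))

end MultiDelay

end

open MultiDelay

/-! The proof is a storage-function argument on pairs (present state, histories) with the inner
product ⟨x, y⟩ = T x₀·y₀ + ∑ᵢ ∫ xᵢ·yᵢ, where T = τ_K (`pairing`). Let Θ₁ and Θ₂ be the operators of
the two quadruples.

Positivity. The quadratic form of a quadruple in Ξ is a sum of two integrals ∫ g(η) v(η)ᵀ M v(η) dη
with g ≥ 0 and M ⪰ 0 (`Gram.form_eq`, `Xi.form_nonneg`). So Θ₁ and Θ₂ are self-adjoint and, because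
of the shift by ε, coercive. Coercivity makes nonsingular the matrices that the explicit inverse has
to invert: a kernel vector is the moment vector of some h with ⟨Θh, h⟩ = 0 and therefore vanishes
(`PolyParams.invBlocks`). The formulas then do give a right inverse (`PolyParams.op_invSep`), and
the gains are the compositions 𝒦 = ℋ Θ₁⁻¹ (`gainOp_mapLc`) and 𝓛 = Θ₂⁻¹ 𝒵 (`injectPresent_mapLo`,
`injectHistory_mapLo`).

Estimation error. Let e be the estimated state minus the true one, both taken with their histories.
The control cancels from its equation, so e is driven by w alone. Take V₂ = ⟨Θ₂e, e⟩. Since 𝓛 = Θ₂⁻¹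
𝒵, self-adjointness turns ⟨Θ₂e, 𝓛C₂e⟩ into ⟨e, 𝒵C₂e⟩, and integration by parts in s shows that the
form of 𝓛₂ at (w, v, e) equals V₂' + 2 v·z_e - γ₂|w|² - γ₂|v|² (`form_mapL₂`). With v = z_e/γ₂ the
matrix inequality reads V₂' ≤ γ₂|w|² - |z_e|²/γ₂ - T ε₂ ‖e‖² (`error_dissipation`).

Plant. Dually, V₁ = ⟨Θ₁⁻¹x, x⟩ is studied in the variable h = Θ₁⁻¹x, in which the nominal feedback
is ℋh. The structural conditions on the first quadruple ensure hᵢ(0) = h₀, which integration by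
parts requires (`form_mapL₁`). The actual control is 𝒦x + 𝒦e, so V₁' ≤ γ₁|w|² - |z|²/γ₁ - T ε₁ ‖h‖²
+ 2T h₀·B₂𝒦e (`state_dissipation`), and the coupling condition bounds 2 h₀·B₂𝒦e by ε₁‖h‖² + ρ ε₂‖e‖²
(`coupling_bound`). Hence (V₁ + ρV₂)' ≤ (γ₁ + ργ₂)|w|² - |z|²/γ₁. Both storage functions start at
zero and stay nonnegative, so integrating this inequality, and the one for V₂ alone, yields the two
gains (`integral_le_of_storage`).

Regularity. Solutions are only strong, so every time derivative is handled in integrated form. The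
operators are separable: their quadratic forms consist of products of the present state and finitely
many moments, and of one integral with kernel S. Each piece is absolutely continuous in time by the
product rule and Fubini's theorem (`SepOp.Regular.energy`). -/

open MeasureTheory Polynomial
open scoped Matrix ENNReal

noncomputable section

namespace MultiDelay

/-! ### Absolutely continuous functions -/

/-- `u` is an absolutely continuous function on `[a, b]` with derivative `u'`. -/
structure IsPrim (u u' : ℝ → ℝ) (a b : ℝ) : Prop where
  le : a ≤ b
  int : IntervalIntegrable u' volume a b
  eq : ∀ s ∈ Set.Icc a b, u s = u a + ∫ t in a..s, u' t

namespace IsPrim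

variable {u u' v v' : ℝ → ℝ} {a b : ℝ}

lemma mono (h : IsPrim u u' a b) {c : ℝ} (hc : c ∈ Set.Icc a b) : IsPrim u u' a c :=
  ⟨hc.1, h.int.mono_set (by
    rw [Set.uIcc_of_le hc.1, Set.uIcc_of_le h.le]; exact Set.Icc_subset_Icc_right hc.2),
    fun s hs => h.eq s ⟨hs.1, hs.2.trans hc.2⟩⟩

lemma integral_eq (h : IsPrim u u' a b) : ∫ t in a..b, u' t = u b - u a := by
  rw [h.eq b ⟨h.le, le_rfl⟩]; ring

lemma continuousOn (h : IsPrim u u' a b) : ContinuousOn u (Set.Icc a b) := by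
  have h1 : ContinuousOn (fun s => u a + ∫ t in a..s, u' t) (Set.Icc a b) := by
    have := intervalIntegral.continuousOn_primitive_interval (a := a) (b := b) (f := u')
      (μ := volume) (by
        rw [Set.uIcc_of_le h.le]
        exact (intervalIntegrable_iff_integrableOn_Icc_of_le h.le).1 h.int)
    rw [Set.uIcc_of_le h.le] at this
    exact continuousOn_const.add this
  exact h1.congr fun s hs => h.eq s hs

lemma congr_deriv (h : IsPrim u u' a b)
    (hv : ∀ᵐ t, t ∈ Set.Ioc a b → u' t = v' t) : IsPrim u v' a b := by
  have hv' : ∀ᵐ t, t ∈ Set.uIoc a b → u' t = v' t := by rwa [Set.uIoc_of_le h.le]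
  refine ⟨h.le, h.int.congr_ae ?_, fun s hs => ?_⟩
  · exact (ae_restrict_iff' measurableSet_uIoc).2 hv'
  · rw [h.eq s hs]
    congr 1
    refine intervalIntegral.integral_congr_ae ?_
    rw [Set.uIoc_of_le hs.1]
    filter_upwards [hv] with t ht hts
    exact ht ⟨hts.1, hts.2.trans hs.2⟩

lemma congr (h : IsPrim u u' a b) (hv : ∀ s ∈ Set.Icc a b, u s = v s) : IsPrim v u' a b :=
  ⟨h.le, h.int, fun s hs => by
    rw [← hv s hs, ← hv a ⟨le_rfl, h.le⟩, h.eq s hs]⟩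

/-- On the interval `u` and `v` agree with the primitives of `u'` and `v'`. These are absolutely
continuous, so integration by parts applies to them, and Lebesgue differentiation identifies their
derivatives almost everywhere. -/
lemma mul (hu : IsPrim u u' a b) (hv : IsPrim v v' a b) :
    IsPrim (fun s => u s * v s) (fun s => u' s * v s + u s * v' s) a b := by
  have key : ∀ c ∈ Set.Icc a b,
      ∫ s in a..c, (u' s * v s + u s * v' s) = u c * v c - u a * v a := by
    intro c hc
    have hu := hu.mono hc
    have hv := hv.mono hc
    have hI := Set.uIcc_of_le hc.1
    set U := fun s => u a + ∫ t in a..s, u' t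
    set V := fun s => v a + ∫ t in a..s, v' t
    have acU : AbsolutelyContinuousOnInterval U a c :=
      (LipschitzOnWith.absolutelyContinuousOnInterval
        ((LipschitzWith.const (u a)).lipschitzOnWith)).add
        (hu.int.absolutelyContinuousOnInterval_intervalIntegral (by simp))
    have acV : AbsolutelyContinuousOnInterval V a c :=
      (LipschitzOnWith.absolutelyContinuousOnInterval
        ((LipschitzWith.const (v a)).lipschitzOnWith)).add
        (hv.int.absolutelyContinuousOnInterval_intervalIntegral (by simp))
    have h := acU.integral_deriv_mul_eq_sub acV
    have e1 : ∀ s ∈ Set.Icc a c, U s = u s := fun s hs => (hu.eq s hs).symm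
    have e2 : ∀ s ∈ Set.Icc a c, V s = v s := fun s hs => (hv.eq s hs).symm
    rw [e1 c ⟨hc.1, le_rfl⟩, e2 c ⟨hc.1, le_rfl⟩, e1 a ⟨le_rfl, hc.1⟩,
      e2 a ⟨le_rfl, hc.1⟩] at h
    rw [← h]
    refine intervalIntegral.integral_congr_ae ?_
    filter_upwards [hu.int.ae_hasDerivAt_integral, hv.int.ae_hasDerivAt_integral]
      with s h1 h2 hs
    have hs' : s ∈ Set.uIcc a c := Set.uIoc_subset_uIcc hs
    have d1 : deriv U s = u' s :=
      ((h1 hs' a (by simp)).const_add (u a)).deriv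
    have d2 : deriv V s = v' s :=
      ((h2 hs' a (by simp)).const_add (v a)).deriv
    rw [hI] at hs'
    rw [d1, d2, e1 s hs', e2 s hs']
  refine ⟨hu.le, ?_, fun s hs => ?_⟩
  · refine (hu.int.mul_continuousOn ?_).add (hv.int.continuousOn_mul ?_)
    · rw [Set.uIcc_of_le hu.le]; exact hv.continuousOn
    · rw [Set.uIcc_of_le hu.le]; exact hu.continuousOn
  · rw [key s hs]; ring

lemma add (hu : IsPrim u u' a b) (hv : IsPrim v v' a b) :
    IsPrim (fun s => u s + v s) (fun s => u' s + v' s) a b :=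
  ⟨hu.le, hu.int.add hv.int, fun s hs => by
    have h1 := hu.mono hs
    have h2 := hv.mono hs
    rw [intervalIntegral.integral_add h1.int h2.int, h1.integral_eq, h2.integral_eq]; ring⟩

lemma const (c : ℝ) (h : a ≤ b) : IsPrim (fun _ => c) (fun _ => 0) a b :=
  ⟨h, by simp, by simp⟩

lemma const_mul (hu : IsPrim u u' a b) (c : ℝ) :
    IsPrim (fun s => c * u s) (fun s => c * u' s) a b := by
  simpa using (IsPrim.const c hu.le).mul hu

lemma sub (hu : IsPrim u u' a b) (hv : IsPrim v v' a b) :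
    IsPrim (fun s => u s - v s) (fun s => u' s - v' s) a b := by
  have := hu.add (hv.const_mul (-1))
  simpa [sub_eq_add_neg] using this

lemma sum {ι : Type*} (t : Finset ι) {f f' : ι → ℝ → ℝ} (hab : a ≤ b)
    (h : ∀ i ∈ t, IsPrim (f i) (f' i) a b) :
    IsPrim (fun s => ∑ i ∈ t, f i s) (fun s => ∑ i ∈ t, f' i s) a b := by
  classical
  induction t using Finset.induction_on with
  | empty => simpa using IsPrim.const 0 hab
  | insert i t hi ih =>
    simp only [Finset.sum_insert hi]
    exact (h i (Finset.mem_insert_self i t)).add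
      (ih fun j hj => h j (Finset.mem_insert_of_mem hj))

lemma of_hasDerivAt (hab : a ≤ b) (h : ∀ s ∈ Set.Icc a b, HasDerivAt u (u' s) s)
    (hc : ContinuousOn u' (Set.Icc a b)) : IsPrim u u' a b := by
  have hi : IntervalIntegrable u' volume a b :=
    ContinuousOn.intervalIntegrable (by rwa [Set.uIcc_of_le hab])
  refine ⟨hab, hi, fun s hs => ?_⟩
  rw [intervalIntegral.integral_eq_sub_of_hasDerivAt]
  · ring
  · intro t ht
    rw [Set.uIcc_of_le hs.1] at ht
    exact h t ⟨ht.1, ht.2.trans hs.2⟩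
  · refine hi.mono_set ?_
    rw [Set.uIcc_of_le hs.1, Set.uIcc_of_le hab]; exact Set.Icc_subset_Icc_right hs.2

end IsPrim

/-- Product rule for `x ⬝ᵥ M y` with a constant matrix. -/
lemma IsPrim.dot_mulVec {α β : Type*} [Fintype α] [Fintype β] {a b : ℝ} (hab : a ≤ b)
    {x x' : ℝ → α → ℝ} {y y' : ℝ → β → ℝ} (M : Matrix α β ℝ)
    (hx : ∀ i, IsPrim (fun t => x t i) (fun t => x' t i) a b)
    (hy : ∀ i, IsPrim (fun t => y t i) (fun t => y' t i) a b) :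
    IsPrim (fun t => x t ⬝ᵥ M *ᵥ y t) (fun t => x' t ⬝ᵥ M *ᵥ y t + x t ⬝ᵥ M *ᵥ y' t) a b := by
  simp only [dotProduct, Matrix.mulVec, ← Finset.sum_add_distrib]
  refine IsPrim.sum _ hab fun i _ => (hx i).mul (IsPrim.sum _ hab fun j _ => (hy j).const_mul _)

/-- Product rule for `x ⬝ᵥ M y`. -/
lemma IsPrim.dot_mulVec' {α β : Type*} [Fintype α] [Fintype β] {a b : ℝ} (hab : a ≤ b)
    {x x' : ℝ → α → ℝ} {y y' : ℝ → β → ℝ} {M M' : ℝ → Matrix α β ℝ}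
    (hx : ∀ i, IsPrim (fun t => x t i) (fun t => x' t i) a b)
    (hM : ∀ i j, IsPrim (fun t => M t i j) (fun t => M' t i j) a b)
    (hy : ∀ i, IsPrim (fun t => y t i) (fun t => y' t i) a b) :
    IsPrim (fun t => x t ⬝ᵥ M t *ᵥ y t)
      (fun t => x' t ⬝ᵥ M t *ᵥ y t + x t ⬝ᵥ (M' t *ᵥ y t + M t *ᵥ y' t)) a b := by
  simp only [dotProduct, Matrix.mulVec, ← Finset.sum_add_distrib, Pi.add_apply]
  refine IsPrim.sum _ hab fun i _ => (hx i).mul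
    (IsPrim.sum _ hab fun j _ => (hM i j).mul (hy j))

/-! ### Square integrable functions on rectangles -/

section L2

/-- Cauchy–Schwarz against the constant 1: expand `∫ (m f - I)² ≥ 0`, with `m` the total mass and
`I` the integral of `f`, and divide by `m`. -/
lemma sq_integral_le {α : Type*} [MeasurableSpace α] {μ : Measure α} [IsFiniteMeasure μ]
    {f : α → ℝ} (hf : MemLp f 2 μ) :
    (∫ x, f x ∂μ) ^ 2 ≤ μ.real Set.univ * ∫ x, f x ^ 2 ∂μ := by
  set m := μ.real Set.univ
  set I := ∫ x, f x ∂μ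
  have h1 : Integrable f μ := hf.integrable (by norm_num)
  have h2 := hf.integrable_sq
  have hm : 0 ≤ m := measureReal_nonneg
  rcases hm.eq_or_lt with hm0 | hm0
  · have : μ = 0 := by
      rw [← Measure.measure_univ_eq_zero]
      simpa [m, measureReal_def, ENNReal.toReal_eq_zero_iff] using hm0.symm
    simp [I, this]
  · have h3 : 0 ≤ ∫ x, (m * f x - I) ^ 2 ∂μ := integral_nonneg fun x => sq_nonneg _
    have h4 : ∫ x, (m * f x - I) ^ 2 ∂μ = m ^ 2 * (∫ x, f x ^ 2 ∂μ) - 2 * m * I * I + I ^ 2 * m := by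
      have e : (fun x => (m * f x - I) ^ 2)
          = fun x => (m ^ 2 * f x ^ 2 - (2 * m * I) * f x) + I ^ 2 := by
        funext x; ring
      rw [e, integral_add, integral_sub, integral_const_mul, integral_const_mul, integral_const]
      · simp only [smul_eq_mul]; ring
      · exact h2.const_mul _
      · exact h1.const_mul _
      · exact (h2.const_mul _).sub (h1.const_mul _)
      · exact integrable_const _
    have h5 : 0 ≤ m * (m * (∫ x, f x ^ 2 ∂μ) - I ^ 2) := by
      rw [h4] at h3; nlinarith
    have := nonneg_of_mul_nonneg_right h5 hm0
    linarith

/-- By `sq_integral_le` on almost every slice, the square of the integral is at most the mass of `μ`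
times `∫ F²`, which is integrable in `y` by Fubini's theorem. -/
lemma memLp_integral_left {α β : Type*} [MeasurableSpace α] [MeasurableSpace β]
    {μ : Measure α} {ν : Measure β} [IsFiniteMeasure μ] [SFinite ν]
    {F : α × β → ℝ} (hF : MemLp F 2 (μ.prod ν)) :
    MemLp (fun y => ∫ x, F (x, y) ∂μ) 2 ν := by
  have hm : AEStronglyMeasurable (fun y => ∫ x, F (x, y) ∂μ) ν :=
    hF.1.prod_swap.integral_prod_right'
  rw [memLp_two_iff_integrable_sq hm]
  have h2 := hF.integrable_sq
  refine Integrable.mono' ((h2.integral_prod_right).const_mul (μ.real Set.univ)) (hm.pow 2) ?_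
  have hm' := hF.1.prod_swap.prodMk_left
  filter_upwards [h2.prod_left_ae, hm'] with y h3 h4
  rw [Real.norm_of_nonneg (sq_nonneg _)]
  exact sq_integral_le ((memLp_two_iff_integrable_sq h4).2 h3)

lemma memLp_integral_right {α β : Type*} [MeasurableSpace α] [MeasurableSpace β]
    {μ : Measure α} {ν : Measure β} [SFinite μ] [IsFiniteMeasure ν]
    {F : α × β → ℝ} (hF : MemLp F 2 (μ.prod ν)) :
    MemLp (fun x => ∫ y, F (x, y) ∂ν) 2 μ :=
  memLp_integral_left (F := fun p => F (p.2, p.1))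
    (hF.comp_measurePreserving Measure.measurePreserving_swap)

/-- The primitive is dominated by `∫ |g σ y|` over the whole interval. This bound depends on `y`
alone and is square integrable by `memLp_integral_left`. What takes work is joint measurability. -/
lemma memLp_primitive_left {β : Type*} [MeasurableSpace β] {ν : Measure β} [IsFiniteMeasure ν]
    {c t : ℝ} {g : ℝ → β → ℝ}
    (hg : MemLp (fun p : ℝ × β => g p.1 p.2) 2 ((volume.restrict (Set.Ioc c t)).prod ν)) :
    MemLp (fun p : ℝ × β => ∫ σ in c..p.1, g σ p.2) 2
      ((volume.restrict (Set.Ioc c t)).prod ν) := by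
  set μ := volume.restrict (Set.Ioc c t)
  have hN : MemLp (fun p : ℝ × β => ∫ σ, |g σ p.2| ∂μ) 2 (μ.prod ν) :=
    (memLp_integral_left (F := fun p => |g p.1 p.2|) hg.abs).comp_snd μ
  have hfst : ∀ᵐ p ∂(μ.prod ν), p.1 ∈ Set.Ioc c t :=
    Measure.quasiMeasurePreserving_fst.ae (ae_restrict_mem measurableSet_Ioc)
  refine hN.mono ?_ ?_
  · obtain ⟨G, hG, hgG⟩ := hg.1
    have hae : ∀ᵐ p ∂(μ.prod ν), ∀ᵐ σ ∂μ, g σ p.2 = G (σ, p.2) := by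
      have h1 : ∀ᵐ y ∂ν, ∀ᵐ σ ∂μ, g σ y = G (σ, y) :=
        Measure.ae_ae_of_ae_prod (Measure.measurePreserving_swap.quasiMeasurePreserving.ae hgG)
      exact Measure.quasiMeasurePreserving_snd.ae h1
    -- The variable upper limit becomes an indicator in the integrand, so the primitive is a
    -- parameter integral over a fixed set. `G` is a strongly measurable version of `g`.
    refine AEStronglyMeasurable.congr
      (f := fun p : ℝ × β => ∫ σ, (Set.Ioc c p.1).indicator (fun σ => G (σ, p.2)) σ ∂μ) ?_ ?_
    · refine StronglyMeasurable.aestronglyMeasurable ?_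
      refine StronglyMeasurable.integral_prod_right
        (f := fun (p : ℝ × β) σ => (Set.Ioc c p.1).indicator (fun σ => G (σ, p.2)) σ) ?_
      have : (Function.uncurry fun (p : ℝ × β) σ =>
          (Set.Ioc c p.1).indicator (fun σ => G (σ, p.2)) σ)
          = Set.indicator {q : (ℝ × β) × ℝ | c < q.2 ∧ q.2 ≤ q.1.1}
            (fun q => G (q.2, q.1.2)) := by
        funext q
        simp only [Function.uncurry, Set.indicator, Set.mem_Ioc, Set.mem_ofPred_eq]
      rw [this]
      refine StronglyMeasurable.indicator ?_ ?_
      · exact hG.comp_measurable (by fun_prop)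
      · exact (measurableSet_lt measurable_const measurable_snd).inter
          (measurableSet_le measurable_snd (measurable_fst.comp measurable_fst))
    · filter_upwards [hae, hfst] with p hp hpt
      rw [integral_indicator measurableSet_Ioc, Measure.restrict_restrict measurableSet_Ioc,
        Set.inter_eq_left.2 (Set.Ioc_subset_Ioc_right hpt.2), intervalIntegral.integral_of_le hpt.1.le]
      refine integral_congr_ae ?_
      exact ae_mono (Measure.restrict_mono (Set.Ioc_subset_Ioc_right hpt.2) le_rfl)
        (hp.mono fun σ h => h.symm)
  · have hint : ∀ᵐ p ∂(μ.prod ν), Integrable (fun σ => g σ p.2) μ := by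
      have h1 : ∀ᵐ y ∂ν, Integrable (fun σ => g σ y) μ :=
        (hg.integrable (by norm_num)).prod_left_ae
      exact Measure.quasiMeasurePreserving_snd.ae h1
    filter_upwards [hfst, hint] with p hp hi
    rw [intervalIntegral.integral_of_le hp.1.le]
    refine (norm_integral_le_integral_norm _).trans ?_
    refine le_trans ?_ (le_abs_self _)
    exact setIntegral_mono_set (s := Set.Ioc c p.1) (t := Set.Ioc c t) hi.norm
      (Filter.Eventually.of_forall fun _ => norm_nonneg _)
      (Set.Ioc_subset_Ioc_right hp.2).eventuallyLE

/-- Lebesgue measure on `(0, t] × (a, b]`. -/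
abbrev rect (t a b : ℝ) : Measure (ℝ × ℝ) :=
  (volume.restrict (Set.Ioc 0 t)).prod (volume.restrict (Set.Ioc a b))

lemma memLp_primitive_right {t a b : ℝ} {g : ℝ → ℝ → ℝ}
    (hg : MemLp (fun p : ℝ × ℝ => g p.1 p.2) 2 (rect t a b)) :
    MemLp (fun p : ℝ × ℝ => ∫ θ in a..p.2, g p.1 θ) 2 (rect t a b) :=
  (memLp_primitive_left (g := fun θ σ => g σ θ)
    (hg.comp_measurePreserving Measure.measurePreserving_swap)).comp_measurePreserving
      Measure.measurePreserving_swap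

lemma exists_bound_of_continuousOn {κ : ℝ → ℝ} {a b : ℝ} (h : ContinuousOn κ (Set.Icc a b)) :
    ∃ C, ∀ s ∈ Set.Icc a b, |κ s| ≤ C :=
  isCompact_Icc.exists_bound_of_continuousOn h

lemma memLp_mul_snd {t a b : ℝ} {κ : ℝ → ℝ} (hκ : ContinuousOn κ (Set.Icc a b))
    {F : ℝ → ℝ → ℝ} (hF : MemLp (fun p : ℝ × ℝ => F p.1 p.2) 2 (rect t a b)) :
    MemLp (fun p : ℝ × ℝ => κ p.2 * F p.1 p.2) 2 (rect t a b) := by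
  obtain ⟨C, hC⟩ := exists_bound_of_continuousOn hκ
  have hm : AEStronglyMeasurable κ (volume.restrict (Set.Ioc a b)) :=
    (hκ.mono Set.Ioc_subset_Icc_self).aestronglyMeasurable measurableSet_Ioc
  refine hF.of_le_mul (c := C) (hm.comp_snd.mul hF.1) ?_
  have : ∀ᵐ p ∂(rect t a b), p.2 ∈ Set.Ioc a b :=
    Measure.quasiMeasurePreserving_snd.ae (ae_restrict_mem measurableSet_Ioc)
  filter_upwards [this] with p hp
  rw [norm_mul]
  exact mul_le_mul_of_nonneg_right (hC _ (Set.Ioc_subset_Icc_self hp)) (norm_nonneg _)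

lemma integrable_mul_snd {t a b : ℝ} {κ : ℝ → ℝ} (hκ : ContinuousOn κ (Set.Icc a b))
    {F : ℝ → ℝ → ℝ} (hF : Integrable (fun p : ℝ × ℝ => F p.1 p.2) (rect t a b)) :
    Integrable (fun p : ℝ × ℝ => κ p.2 * F p.1 p.2) (rect t a b) := by
  obtain ⟨C, hC⟩ := exists_bound_of_continuousOn hκ
  have hm : AEStronglyMeasurable κ (volume.restrict (Set.Ioc a b)) :=
    (hκ.mono Set.Ioc_subset_Icc_self).aestronglyMeasurable measurableSet_Ioc
  refine hF.bdd_mul (c := C) hm.comp_snd ?_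
  have : ∀ᵐ p ∂(rect t a b), p.2 ∈ Set.Ioc a b :=
    Measure.quasiMeasurePreserving_snd.ae (ae_restrict_mem measurableSet_Ioc)
  filter_upwards [this] with p hp
  exact hC _ (Set.Ioc_subset_Icc_self hp)

lemma rect_mono {t t' a b : ℝ} (h : t ≤ t') : rect t a b ≤ rect t' a b :=
  Measure.prod_mono (Measure.restrict_mono (Set.Ioc_subset_Ioc_right h) le_rfl) le_rfl

/-- Differentiation under the integral sign, in integrated form. -/
lemma isPrim_integral {t a b : ℝ} (ht : 0 ≤ t) (hab : a ≤ b) {U F : ℝ → ℝ → ℝ}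
    (hF : Integrable (fun p : ℝ × ℝ => F p.1 p.2) (rect t a b))
    (hU : ∀ σ ∈ Set.Icc 0 t, ∀ᵐ s ∂(volume.restrict (Set.Ioc a b)),
      U σ s = ∫ σ' in (0 : ℝ)..σ, F σ' s) :
    IsPrim (fun σ => ∫ s in a..b, U σ s) (fun σ => ∫ s in a..b, F σ s) 0 t := by
  have key : ∀ σ ∈ Set.Icc 0 t,
      ∫ s in a..b, U σ s = ∫ σ' in (0 : ℝ)..σ, ∫ s in a..b, F σ' s := by
    intro σ hσ
    have hF' : Integrable (fun p : ℝ × ℝ => F p.1 p.2) (rect σ a b) :=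
      hF.mono_measure (rect_mono hσ.2)
    rw [intervalIntegral.integral_of_le hσ.1, intervalIntegral.integral_of_le hab,
      integral_congr_ae (hU σ hσ)]
    simp_rw [intervalIntegral.integral_of_le hσ.1, intervalIntegral.integral_of_le hab]
    exact (integral_integral_swap hF').symm
  refine ⟨ht, ?_, fun s hs => ?_⟩
  · rw [intervalIntegrable_iff_integrableOn_Ioc_of_le ht]
    simp_rw [intervalIntegral.integral_of_le hab]
    exact hF.integral_prod_left
  · rw [key s hs, key 0 ⟨le_rfl, ht⟩]; simp

end L2

/-! ### Time derivatives of moments and of quadratic integrals -/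

section Pairing

variable {α β : Type*} [Fintype α] [Fintype β] {t a b : ℝ}

/-- Componentwise integral of a vector-valued function. -/
def vint {α : Type*} (a b : ℝ) (f : ℝ → α → ℝ) : α → ℝ := fun i => ∫ s in a..b, f s i

/-- The finite-rank part of a separable operator sees a history only through such moments, so its
time derivative reduces to that of scalar functions. The null set in `hu` may depend on `σ`: only
the integral over `s` at each fixed time matters. -/
lemma isPrim_moment {α : Type*} (ht : 0 ≤ t) (hab : a ≤ b) {u g : ℝ → ℝ → β → ℝ} {W : ℝ → Matrix α β ℝ}
    (hW : ∀ i j, ContinuousOn (fun s => W s i j) (Set.Icc a b))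
    (hg : ∀ i, MemLp (fun p : ℝ × ℝ => g p.1 p.2 i) 2 (rect t a b))
    (hu : ∀ σ ∈ Set.Icc 0 t, ∀ᵐ s ∂(volume.restrict (Set.Ioc a b)),
      ∀ i, u σ s i = ∫ σ' in (0 : ℝ)..σ, g σ' s i) (i : α) :
    IsPrim (fun σ => vint a b (fun s => W s *ᵥ u σ s) i)
      (fun σ => vint a b (fun s => W s *ᵥ g σ s) i) 0 t := by
  have hgi : ∀ j, Integrable (fun p : ℝ × ℝ => g p.1 p.2 j) (rect t a b) :=
    fun j => (hg j).integrable (by norm_num)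
  refine isPrim_integral (U := fun σ s => (W s *ᵥ u σ s) i)
    (F := fun σ s => (W s *ᵥ g σ s) i) ht hab ?_ ?_
  · simp only [Matrix.mulVec, dotProduct]
    exact integrable_finsetSum _ fun j _ =>
      integrable_mul_snd (F := fun σ s => g σ s j) (hW i j) (hgi j)
  · intro σ hσ
    have h1 : ∀ᵐ s ∂(volume.restrict (Set.Ioc a b)), ∀ j,
        Integrable (fun σ' => g σ' s j) (volume.restrict (Set.Ioc 0 t)) :=
      ae_all_iff.2 fun j => (hgi j).prod_left_ae
    filter_upwards [hu σ hσ, h1] with s hs h1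
    simp only [Matrix.mulVec, dotProduct, hs]
    rw [intervalIntegral.integral_finsetSum]
    · simp_rw [intervalIntegral.integral_const_mul]
    · intro j _
      refine IntervalIntegrable.const_mul ?_ _
      rw [intervalIntegrable_iff_integrableOn_Ioc_of_le hσ.1]
      exact (h1 j).mono_measure (Measure.restrict_mono (Set.Ioc_subset_Ioc_right hσ.2) le_rfl)

/-- For almost every `s` the product rule holds in time, and Fubini's theorem integrates it over
`s`. The argument runs with the primitives `U` and `V`, since joint measurability of `u` and `v` is
not assumed. -/
lemma isPrim_integral_dot (ht : 0 ≤ t) (hab : a ≤ b) {u g : ℝ → ℝ → α → ℝ}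
    {v h : ℝ → ℝ → β → ℝ} {M : ℝ → Matrix α β ℝ}
    (hM : ∀ i j, ContinuousOn (fun s => M s i j) (Set.Icc a b))
    (hg : ∀ i, MemLp (fun p : ℝ × ℝ => g p.1 p.2 i) 2 (rect t a b))
    (hh : ∀ i, MemLp (fun p : ℝ × ℝ => h p.1 p.2 i) 2 (rect t a b))
    (hu : ∀ σ ∈ Set.Icc 0 t, ∀ᵐ s ∂(volume.restrict (Set.Ioc a b)),
      ∀ i, u σ s i = ∫ σ' in (0 : ℝ)..σ, g σ' s i)
    (hv : ∀ σ ∈ Set.Icc 0 t, ∀ᵐ s ∂(volume.restrict (Set.Ioc a b)),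
      ∀ i, v σ s i = ∫ σ' in (0 : ℝ)..σ, h σ' s i) :
    IsPrim (fun σ => ∫ s in a..b, u σ s ⬝ᵥ M s *ᵥ v σ s)
      (fun σ => ∫ s in a..b, (g σ s ⬝ᵥ M s *ᵥ v σ s + u σ s ⬝ᵥ M s *ᵥ h σ s)) 0 t := by
  set U : ℝ → ℝ → α → ℝ := fun σ s i => ∫ σ' in (0 : ℝ)..σ, g σ' s i
  set V : ℝ → ℝ → β → ℝ := fun σ s i => ∫ σ' in (0 : ℝ)..σ, h σ' s i
  have hU : ∀ i, MemLp (fun p : ℝ × ℝ => U p.1 p.2 i) 2 (rect t a b) :=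
    fun i => memLp_primitive_left (g := fun σ s => g σ s i) (hg i)
  have hV : ∀ i, MemLp (fun p : ℝ × ℝ => V p.1 p.2 i) 2 (rect t a b) :=
    fun i => memLp_primitive_left (g := fun σ s => h σ s i) (hh i)
  have hint : ∀ {X : ℝ → ℝ → α → ℝ} {Z : ℝ → ℝ → β → ℝ},
      (∀ i, MemLp (fun p : ℝ × ℝ => X p.1 p.2 i) 2 (rect t a b)) →
      (∀ i, MemLp (fun p : ℝ × ℝ => Z p.1 p.2 i) 2 (rect t a b)) →
      Integrable (fun p : ℝ × ℝ => X p.1 p.2 ⬝ᵥ M p.2 *ᵥ Z p.1 p.2) (rect t a b) := by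
    intro X Z hX hZ
    simp only [dotProduct, Matrix.mulVec]
    refine integrable_finsetSum _ fun i _ => ?_
    exact (hX i).integrable_mul (memLp_finsetSum _ fun j _ =>
      memLp_mul_snd (F := fun σ s => Z σ s j) (hM i j) (hZ j))
  have main : IsPrim (fun σ => ∫ s in a..b, u σ s ⬝ᵥ M s *ᵥ v σ s)
      (fun σ => ∫ s in a..b, (g σ s ⬝ᵥ M s *ᵥ V σ s + U σ s ⬝ᵥ M s *ᵥ h σ s)) 0 t := by
    refine isPrim_integral (U := fun σ s => u σ s ⬝ᵥ M s *ᵥ v σ s)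
      (F := fun σ s => g σ s ⬝ᵥ M s *ᵥ V σ s + U σ s ⬝ᵥ M s *ᵥ h σ s) ht hab
      ((hint hg hV).add (hint hU hh)) ?_
    intro σ hσ
    have h1 : ∀ᵐ s ∂(volume.restrict (Set.Ioc a b)), ∀ j,
        Integrable (fun σ' => g σ' s j) (volume.restrict (Set.Ioc 0 t)) :=
      ae_all_iff.2 fun j => ((hg j).integrable (by norm_num)).prod_left_ae
    have h2 : ∀ᵐ s ∂(volume.restrict (Set.Ioc a b)), ∀ j,
        Integrable (fun σ' => h σ' s j) (volume.restrict (Set.Ioc 0 t)) :=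
      ae_all_iff.2 fun j => ((hh j).integrable (by norm_num)).prod_left_ae
    filter_upwards [hu σ hσ, hv σ hσ, h1, h2] with s hus hvs h1 h2
    have pU : ∀ i, IsPrim (fun σ => U σ s i) (fun σ => g σ s i) 0 t := fun i =>
      ⟨ht, by rw [intervalIntegrable_iff_integrableOn_Ioc_of_le ht]; exact h1 i,
        fun s' _ => by simp [U]⟩
    have pV : ∀ i, IsPrim (fun σ => V σ s i) (fun σ => h σ s i) 0 t := fun i =>
      ⟨ht, by rw [intervalIntegrable_iff_integrableOn_Ioc_of_le ht]; exact h2 i,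
        fun s' _ => by simp [V]⟩
    have e := (IsPrim.dot_mulVec ht (M s) pU pV).eq σ hσ
    have hu' : u σ s = U σ s := funext hus
    have hv' : v σ s = V σ s := funext hvs
    have hU0 : U 0 s = 0 := by funext i; simp [U]
    rw [hu', hv', e, hU0, zero_dotProduct, zero_add]
  -- At every fixed time `U` and `V` equal `u` and `v` for almost every `s`, so the integral over
  -- `s` is the same.
  refine main.congr_deriv (Filter.Eventually.of_forall fun σ hσ => ?_)
  rw [intervalIntegral.integral_of_le hab, intervalIntegral.integral_of_le hab]
  refine integral_congr_ae ?_
  filter_upwards [hu σ ⟨hσ.1.le, hσ.2⟩, hv σ ⟨hσ.1.le, hσ.2⟩] with s hus hvs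
  have hu' : u σ s = U σ s := funext hus
  have hv' : v σ s = V σ s := funext hvs
  rw [hu', hv']

end Pairing

/-! ### Integrals of matrices and vectors -/

section VecInt

variable {α β : Type*} [Fintype α] [Fintype β] {a b : ℝ}

lemma intervalIntegrable_fun_sum {ι : Type*} (t : Finset ι) {f : ι → ℝ → ℝ}
    (hf : ∀ i ∈ t, IntervalIntegrable (f i) volume a b) :
    IntervalIntegrable (fun s => ∑ i ∈ t, f i s) volume a b := by
  simpa only [Finset.sum_fn] using IntervalIntegrable.sum t hf

lemma dot_vint (x : α → ℝ) {f : ℝ → α → ℝ}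
    (hf : ∀ i, IntervalIntegrable (fun s => f s i) volume a b) :
    x ⬝ᵥ vint a b f = ∫ s in a..b, x ⬝ᵥ f s := by
  simp only [vint, dotProduct]
  rw [intervalIntegral.integral_finsetSum fun i _ => (hf i).const_mul _]
  simp_rw [intervalIntegral.integral_const_mul]

lemma mulVec_vint {α : Type*} (M : Matrix α β ℝ) {f : ℝ → β → ℝ}
    (hf : ∀ i, IntervalIntegrable (fun s => f s i) volume a b) :
    M *ᵥ vint a b f = vint a b fun s => M *ᵥ f s := by
  funext i
  exact dot_vint (M i) hf

lemma vint_add {α : Type*} {f g : ℝ → α → ℝ}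
    (hf : ∀ i, IntervalIntegrable (fun s => f s i) volume a b)
    (hg : ∀ i, IntervalIntegrable (fun s => g s i) volume a b) :
    vint a b (fun s => f s + g s) = vint a b f + vint a b g := by
  funext i
  exact intervalIntegral.integral_add (hf i) (hg i)

lemma vint_congr {α : Type*} {f g : ℝ → α → ℝ} (hab : a ≤ b)
    (h : ∀ s ∈ Set.Icc a b, f s = g s) : vint a b f = vint a b g := by
  funext i
  refine intervalIntegral.integral_congr fun s hs => ?_
  rw [Set.uIcc_of_le hab] at hs
  exact congrFun (h s hs) i

lemma vint_sum {α ι : Type*} (t : Finset ι) {f : ι → ℝ → α → ℝ}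
    (hf : ∀ j ∈ t, ∀ i, IntervalIntegrable (fun s => f j s i) volume a b) :
    vint a b (fun s => ∑ j ∈ t, f j s) = ∑ j ∈ t, vint a b (f j) := by
  funext i
  simp only [vint, Finset.sum_apply]
  exact intervalIntegral.integral_finsetSum fun j hj => hf j hj i

lemma vint_smul {α : Type*} (c : ℝ) (f : ℝ → α → ℝ) :
    vint a b (fun s => c • f s) = c • vint a b f := by
  funext i
  simp [vint]

/-- Passes from the vector-valued integrals of the closed-loop equations to the componentwise
integrals of the operator algebra. Integrability is needed: without it the former is zero as soon as
one component fails. -/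
lemma intervalIntegral_eq_vint {f : ℝ → α → ℝ}
    (hf : ∀ i, IntervalIntegrable (fun s => f s i) volume a b) :
    ∫ s in a..b, f s = vint a b f := by
  funext i
  simp only [vint, intervalIntegral, Pi.sub_apply]
  rw [eval_integral (fun i => (hf i).1), eval_integral (fun i => (hf i).2)]

lemma matInt_mulVec {α : Type*} {M : ℝ → Matrix α β ℝ}
    (hM : ∀ i j, IntervalIntegrable (fun s => M s i j) volume a b) (x : β → ℝ) :
    matInt a b M *ᵥ x = vint a b fun s => M s *ᵥ x := by
  funext i
  simp only [matInt, Matrix.mulVec, dotProduct, vint, Matrix.of_apply]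
  rw [intervalIntegral.integral_finsetSum fun j _ => (hM i j).mul_const _]
  simp_rw [intervalIntegral.integral_mul_const]

lemma dot_matInt_mulVec {M : ℝ → Matrix α β ℝ}
    (hM : ∀ i j, IntervalIntegrable (fun s => M s i j) volume a b) (x : α → ℝ) (y : β → ℝ) :
    x ⬝ᵥ matInt a b M *ᵥ y = ∫ s in a..b, x ⬝ᵥ M s *ᵥ y := by
  rw [matInt_mulVec hM, dot_vint]
  intro i
  simp only [Matrix.mulVec, dotProduct]
  exact intervalIntegrable_fun_sum _ fun j _ => (hM i j).mul_const _

lemma integral_swap_of_continuous {F : ℝ → ℝ → ℝ} (hF : Continuous (Function.uncurry F))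
    (a b c d : ℝ) : ∫ x in a..b, ∫ y in c..d, F x y = ∫ y in c..d, ∫ x in a..b, F x y := by
  refine intervalIntegral_intervalIntegral_swap ?_
  exact (hF.continuousOn.integrableOn_compact (isCompact_uIcc.prod isCompact_uIcc)).mono_set
    (Set.prod_mono Set.uIoc_subset_uIcc Set.uIoc_subset_uIcc)

lemma continuous_vint {α X : Type*} [TopologicalSpace X] {f : X → ℝ → α → ℝ}
    (hf : Continuous (Function.uncurry f)) : Continuous fun x => vint a b (f x) := by
  refine continuous_pi fun i => ?_
  exact intervalIntegral.continuous_parametric_intervalIntegral_of_continuous'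
    (f := fun x s => f x s i) ((continuous_apply i).comp hf) a b

lemma transpose_matInt {α β : Type*} (M : ℝ → Matrix α β ℝ) :
    (matInt a b M)ᵀ = matInt a b fun s => (M s)ᵀ := rfl

end VecInt

@[fun_prop]
lemma continuous_mono₁ (d : ℕ) (ν : Type*) [DecidableEq ν] : Continuous (mono₁ d ν) := by
  refine continuous_matrix fun i j => ?_
  simp only [mono₁, Matrix.of_apply]
  split_ifs <;> fun_prop

lemma continuous_mono₂ (d : ℕ) (ν : Type*) [DecidableEq ν] :
    Continuous fun p : ℝ × ℝ => mono₂ d ν p.1 p.2 := by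
  refine continuous_matrix fun i j => ?_
  simp only [mono₂, Matrix.of_apply]
  split_ifs <;> fun_prop

@[fun_prop]
lemma Continuous.mono₂ {X : Type*} [TopologicalSpace X] (d : ℕ) (ν : Type*) [DecidableEq ν]
    {f g : X → ℝ} (hf : Continuous f) (hg : Continuous g) :
    Continuous fun x => MultiDelay.mono₂ d ν (f x) (g x) :=
  (continuous_mono₂ d ν).comp (hf.prodMk hg)

@[fun_prop]
lemma Continuous.mono₁ {X : Type*} [TopologicalSpace X] (d : ℕ) (ν : Type*) [DecidableEq ν]
    {f : X → ℝ} (hf : Continuous f) :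
    Continuous fun x => MultiDelay.mono₁ d ν (f x) :=
  (continuous_mono₁ d ν).comp hf

/-! ### Positivity of the quadratic forms of Gram matrices -/

section GramForm

variable {d : ℕ} {μ ν : Type*} [Fintype μ] [Fintype ν] [DecidableEq ν]

/-- Symmetry serves only to merge the cross terms with `x`. The two mixed terms in `y` and `z` stay
apart because `Gram.toR` contains the blocks `M₂₃` and `M₃₂` separately. -/
lemma dotProduct_gram_mulVec {α β γ : Type*} [Fintype α] [Fintype β] [Fintype γ]
    {M : Matrix (α ⊕ (β ⊕ γ)) (α ⊕ (β ⊕ γ)) ℝ} (hM : M.IsHermitian)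
    (x : α → ℝ) (y : β → ℝ) (z : γ → ℝ) :
    Sum.elim x (Sum.elim y z) ⬝ᵥ M *ᵥ Sum.elim x (Sum.elim y z) =
      x ⬝ᵥ M.toBlocks₁₁ *ᵥ x + 2 * (x ⬝ᵥ M.toBlocks₁₂.toCols₁ *ᵥ y)
      + 2 * (x ⬝ᵥ M.toBlocks₁₂.toCols₂ *ᵥ z) + y ⬝ᵥ M.toBlocks₂₂.toBlocks₁₁ *ᵥ y
      + y ⬝ᵥ M.toBlocks₂₂.toBlocks₁₂ *ᵥ z + z ⬝ᵥ M.toBlocks₂₂.toBlocks₂₁ *ᵥ y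
      + z ⬝ᵥ M.toBlocks₂₂.toBlocks₂₂ *ᵥ z := by
  have h : ∀ i j, M i j = M j i := fun i j => by simpa using hM.apply j i
  have e1 : ∑ i, y i * ∑ j, M (Sum.inr (Sum.inl i)) (Sum.inl j) * x j
      = ∑ i, x i * ∑ j, M (Sum.inl i) (Sum.inr (Sum.inl j)) * y j := by
    simp_rw [Finset.mul_sum]
    rw [Finset.sum_comm]
    refine Finset.sum_congr rfl fun i _ => Finset.sum_congr rfl fun j _ => ?_
    rw [h (Sum.inl i)]; ring
  have e2 : ∑ i, z i * ∑ j, M (Sum.inr (Sum.inr i)) (Sum.inl j) * x j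
      = ∑ i, x i * ∑ j, M (Sum.inl i) (Sum.inr (Sum.inr j)) * z j := by
    simp_rw [Finset.mul_sum]
    rw [Finset.sum_comm]
    refine Finset.sum_congr rfl fun i _ => Finset.sum_congr rfl fun j _ => ?_
    rw [h (Sum.inl i)]; ring
  simp only [dotProduct, Matrix.mulVec, Fintype.sum_sum_type, Sum.elim_inl, Sum.elim_inr,
    Matrix.toBlocks₁₁, Matrix.toBlocks₁₂, Matrix.toBlocks₂₁, Matrix.toBlocks₂₂, Matrix.toCols₁,
    Matrix.toCols₂, Matrix.of_apply, mul_add, Finset.sum_add_distrib]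
  rw [e1, e2]
  ring

lemma Gram.continuous_toQ {μ : Type*} (M : Gram d μ ν) (T : ℝ) {g : ℝ → ℝ} (hg : Continuous g) :
    Continuous (M.toQ T g) := by
  unfold Gram.toQ
  have h : Continuous fun s => matInt (-T) 0 fun η =>
      g η • (M.toBlocks₁₂.toCols₂ * mono₂ d ν η s) := by
    refine continuous_matrix fun i j => ?_
    refine intervalIntegral.continuous_parametric_intervalIntegral_of_continuous'
      (f := fun s η => (g η • (M.toBlocks₁₂.toCols₂ * mono₂ d ν η s)) i j) ?_ _ _
    exact Continuous.matrix_elem (A := fun p : ℝ × ℝ =>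
      g p.2 • (M.toBlocks₁₂.toCols₂ * mono₂ d ν p.2 p.1)) (by fun_prop) i j
  fun_prop

lemma Gram.continuous_toS {μ : Type*} (M : Gram d μ ν) (T : ℝ) {g : ℝ → ℝ} (hg : Continuous g) :
    Continuous (M.toS T g) := by
  unfold Gram.toS
  fun_prop

lemma Gram.continuous_toR {μ : Type*} (M : Gram d μ ν) (T : ℝ) {g : ℝ → ℝ} (hg : Continuous g) :
    Continuous fun p : ℝ × ℝ => M.toR T g p.1 p.2 := by
  unfold Gram.toR
  have h : Continuous fun p : ℝ × ℝ => matInt (-T) 0 fun η =>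
      g η • ((mono₂ d ν η p.1)ᵀ * M.toBlocks₂₂.toBlocks₂₂ * mono₂ d ν η p.2) := by
    refine continuous_matrix fun i j => ?_
    refine intervalIntegral.continuous_parametric_intervalIntegral_of_continuous'
      (f := fun (p : ℝ × ℝ) η =>
        (g η • ((mono₂ d ν η p.1)ᵀ * M.toBlocks₂₂.toBlocks₂₂ * mono₂ d ν η p.2)) i j) ?_ _ _
    exact Continuous.matrix_elem (A := fun p : (ℝ × ℝ) × ℝ =>
      g p.2 • ((mono₂ d ν p.2 p.1.1)ᵀ * M.toBlocks₂₂.toBlocks₂₂ * mono₂ d ν p.2 p.1.2))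
      (by fun_prop) i j
  fun_prop

/-- The quadratic form of the operator attached to a Gram matrix. -/
def Gram.form (M : Gram d μ ν) (T : ℝ) (g : ℝ → ℝ) (x : μ → ℝ) (φ : ℝ → ν → ℝ) : ℝ :=
  T * (x ⬝ᵥ M.toP T g *ᵥ x) + 2 * T * (∫ s in (-T)..0, x ⬝ᵥ M.toQ T g s *ᵥ φ s)
    + T * (∫ s in (-T)..0, φ s ⬝ᵥ M.toS T g s *ᵥ φ s)
    + ∫ s in (-T)..0, ∫ θ in (-T)..0, φ s ⬝ᵥ M.toR T g s θ *ᵥ φ θ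

/-- The construction of the quadruple is undone. With `m η = ∫ Y(η,s) φ(s) ds`, exchanging the order
of integration turns each term of the form into one block of the quadratic form of `M` at `(x, Y(η)
φ(η), m η)`, weighted by `g(η)`. The factors `1/T` in `P`, `Q`, `S` cancel the factors `T` of the
form; `R` carries neither. -/
lemma Gram.form_eq (M : Gram d μ ν) (hM : M.IsHermitian) {T : ℝ} (hT : 0 < T) {g : ℝ → ℝ}
    (hg : Continuous g) (x : μ → ℝ) {φ : ℝ → ν → ℝ} (hφ : Continuous φ) :
    M.form T g x φ = ∫ η in (-T)..0, g η *
      (Sum.elim x (Sum.elim (mono₁ d ν η *ᵥ φ η) (vint (-T) 0 fun s => mono₂ d ν η s *ᵥ φ s)) ⬝ᵥ M *ᵥ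
        Sum.elim x (Sum.elim (mono₁ d ν η *ᵥ φ η) (vint (-T) 0 fun s => mono₂ d ν η s *ᵥ φ s))) := by
  set y : ℝ → Fin (d + 1) × ν → ℝ := fun η => mono₁ d ν η *ᵥ φ η
  set m : ℝ → Exps d × ν → ℝ := fun η => vint (-T) 0 fun s => mono₂ d ν η s *ᵥ φ s
  have hy : Continuous y := by fun_prop
  have hm : Continuous m := continuous_vint (f := fun η s => mono₂ d ν η s *ᵥ φ s) (by
    show Continuous fun p : ℝ × ℝ => mono₂ d ν p.1 p.2 *ᵥ φ p.2
    fun_prop)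
  have hmη : ∀ η i, IntervalIntegrable (fun s => (mono₂ d ν η s *ᵥ φ s) i) volume (-T) 0 := by
    intro η i
    refine Continuous.intervalIntegrable ?_ _ _
    exact (continuous_apply i).comp (by fun_prop : Continuous fun s => mono₂ d ν η s *ᵥ φ s)
  set M11 := M.toBlocks₁₁
  set M12 := M.toBlocks₁₂.toCols₁
  set M13 := M.toBlocks₁₂.toCols₂
  set M22 := M.toBlocks₂₂.toBlocks₁₁
  set M23 := M.toBlocks₂₂.toBlocks₁₂
  set M32 := M.toBlocks₂₂.toBlocks₂₁
  set M33 := M.toBlocks₂₂.toBlocks₂₂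
  have hT' := hT.ne'
  have t1 : T * (x ⬝ᵥ M.toP T g *ᵥ x) = ∫ η in (-T)..0, g η * (x ⬝ᵥ M11 *ᵥ x) := by
    rw [intervalIntegral.integral_mul_const, Gram.toP, Matrix.smul_mulVec, dotProduct_smul]
    simp only [smul_eq_mul, M11]
    field_simp
  have t2 : 2 * T * (∫ s in (-T)..0, x ⬝ᵥ M.toQ T g s *ᵥ φ s)
      = (∫ η in (-T)..0, g η * (2 * (x ⬝ᵥ M12 *ᵥ y η)))
        + ∫ η in (-T)..0, g η * (2 * (x ⬝ᵥ M13 *ᵥ m η)) := by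
    have e1 : ∀ s, x ⬝ᵥ M.toQ T g s *ᵥ φ s = T⁻¹ * (g s * (x ⬝ᵥ M12 *ᵥ y s)
        + ∫ η in (-T)..0, g η * (x ⬝ᵥ M13 *ᵥ mono₂ d ν η s *ᵥ φ s)) := by
      intro s
      rw [Gram.toQ, Matrix.smul_mulVec, Matrix.add_mulVec, dotProduct_smul, dotProduct_add,
        dot_matInt_mulVec]
      · simp only [Matrix.smul_mulVec, dotProduct_smul, smul_eq_mul, ← Matrix.mulVec_mulVec, y, M12, M13]
      · intro i j
        refine Continuous.intervalIntegrable ?_ _ _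
        exact Continuous.matrix_elem (A := fun η => g η • (M13 * mono₂ d ν η s)) (by fun_prop) i j
    have e2 : ∫ s in (-T)..0, ∫ η in (-T)..0, g η * (x ⬝ᵥ M13 *ᵥ mono₂ d ν η s *ᵥ φ s)
        = ∫ η in (-T)..0, g η * (x ⬝ᵥ M13 *ᵥ m η) := by
      rw [integral_swap_of_continuous]
      · refine intervalIntegral.integral_congr fun η _ => ?_
        simp only [m]
        rw [mulVec_vint _ (hmη η), dot_vint, intervalIntegral.integral_const_mul]
        intro i
        refine Continuous.intervalIntegrable ?_ _ _
        exact (continuous_apply i).comp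
          (by fun_prop : Continuous fun s => M13 *ᵥ mono₂ d ν η s *ᵥ φ s)
      · show Continuous fun p : ℝ × ℝ => g p.2 * (x ⬝ᵥ M13 *ᵥ mono₂ d ν p.2 p.1 *ᵥ φ p.1)
        fun_prop
    simp_rw [e1]
    rw [intervalIntegral.integral_const_mul, intervalIntegral.integral_add, e2]
    · simp_rw [mul_left_comm _ (2 : ℝ)]
      rw [intervalIntegral.integral_const_mul, intervalIntegral.integral_const_mul]
      field_simp
    · exact Continuous.intervalIntegrable (by fun_prop) _ _
    · refine Continuous.intervalIntegrable ?_ _ _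
      refine intervalIntegral.continuous_parametric_intervalIntegral_of_continuous'
        (f := fun s η => g η * (x ⬝ᵥ M13 *ᵥ mono₂ d ν η s *ᵥ φ s)) ?_ _ _
      show Continuous fun p : ℝ × ℝ => g p.2 * (x ⬝ᵥ M13 *ᵥ mono₂ d ν p.2 p.1 *ᵥ φ p.1)
      fun_prop
  have t3 : T * (∫ s in (-T)..0, φ s ⬝ᵥ M.toS T g s *ᵥ φ s)
      = ∫ η in (-T)..0, g η * (y η ⬝ᵥ M22 *ᵥ y η) := by
    rw [← intervalIntegral.integral_const_mul]
    refine intervalIntegral.integral_congr fun s _ => ?_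
    simp only [Gram.toS, Matrix.smul_mulVec, dotProduct_smul, smul_eq_mul, ← Matrix.mulVec_mulVec, y]
    rw [Matrix.dotProduct_mulVec, Matrix.vecMul_transpose]
    field_simp
    rfl
  -- The three summands of `R` yield the `M₂₃`, `M₃₂` and `M₃₃` terms. The first needs no exchange
  -- of integrals, the second exchanges `s` and `θ`, and the third moves `η` outside both.
  have t4 : ∫ s in (-T)..0, ∫ θ in (-T)..0, φ s ⬝ᵥ M.toR T g s θ *ᵥ φ θ
      = (∫ η in (-T)..0, g η * (y η ⬝ᵥ M23 *ᵥ m η)) + (∫ η in (-T)..0, g η * (m η ⬝ᵥ M32 *ᵥ y η))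
        + ∫ η in (-T)..0, g η * (m η ⬝ᵥ M33 *ᵥ m η) := by
    have c33 : Continuous fun p : (ℝ × ℝ) × ℝ => g p.2 *
        ((mono₂ d ν p.2 p.1.1 *ᵥ φ p.1.1) ⬝ᵥ M33 *ᵥ mono₂ d ν p.2 p.1.2 *ᵥ φ p.1.2) := by
      fun_prop
    have e1 : ∀ s θ, φ s ⬝ᵥ M.toR T g s θ *ᵥ φ θ =
        g s * (y s ⬝ᵥ M23 *ᵥ mono₂ d ν s θ *ᵥ φ θ)
        + g θ * ((mono₂ d ν θ s *ᵥ φ s) ⬝ᵥ M32 *ᵥ y θ)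
        + ∫ η in (-T)..0, g η *
            ((mono₂ d ν η s *ᵥ φ s) ⬝ᵥ M33 *ᵥ mono₂ d ν η θ *ᵥ φ θ) := by
      intro s θ
      rw [Gram.toR, Matrix.add_mulVec, Matrix.add_mulVec, dotProduct_add, dotProduct_add,
        dot_matInt_mulVec]
      · simp only [Matrix.smul_mulVec, dotProduct_smul, smul_eq_mul, ← Matrix.mulVec_mulVec, y]
        simp only [Matrix.dotProduct_mulVec (φ s), Matrix.vecMul_transpose]
        rfl
      · intro i j
        refine Continuous.intervalIntegrable ?_ _ _
        exact Continuous.matrix_elem (A := fun η =>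
          g η • ((mono₂ d ν η s)ᵀ * M33 * mono₂ d ν η θ)) (by fun_prop) i j
    have i1 : ∀ s, ∫ θ in (-T)..0, g s * (y s ⬝ᵥ M23 *ᵥ mono₂ d ν s θ *ᵥ φ θ)
        = g s * (y s ⬝ᵥ M23 *ᵥ m s) := by
      intro s
      simp only [m]
      rw [mulVec_vint _ (hmη s), dot_vint, intervalIntegral.integral_const_mul]
      intro i
      refine Continuous.intervalIntegrable ?_ _ _
      exact (continuous_apply i).comp
        (by fun_prop : Continuous fun θ => M23 *ᵥ mono₂ d ν s θ *ᵥ φ θ)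
    have i2 : ∀ θ, ∫ s in (-T)..0, g θ * ((mono₂ d ν θ s *ᵥ φ s) ⬝ᵥ M32 *ᵥ y θ)
        = g θ * (m θ ⬝ᵥ M32 *ᵥ y θ) := by
      intro θ
      simp only [m]
      simp_rw [dotProduct_comm _ (M32 *ᵥ y θ)]
      rw [dot_vint _ (hmη θ), intervalIntegral.integral_const_mul]
    have i3 : ∀ s η, ∫ θ in (-T)..0, g η *
        ((mono₂ d ν η s *ᵥ φ s) ⬝ᵥ M33 *ᵥ mono₂ d ν η θ *ᵥ φ θ)
        = g η * ((mono₂ d ν η s *ᵥ φ s) ⬝ᵥ M33 *ᵥ m η) := by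
      intro s η
      simp only [m]
      rw [mulVec_vint _ (hmη η), dot_vint, intervalIntegral.integral_const_mul]
      intro i
      refine Continuous.intervalIntegrable ?_ _ _
      exact (continuous_apply i).comp
        (by fun_prop : Continuous fun θ => M33 *ᵥ mono₂ d ν η θ *ᵥ φ θ)
    have i4 : ∀ η, ∫ s in (-T)..0, g η * ((mono₂ d ν η s *ᵥ φ s) ⬝ᵥ M33 *ᵥ m η)
        = g η * (m η ⬝ᵥ M33 *ᵥ m η) := by
      intro η
      simp_rw [dotProduct_comm _ (M33 *ᵥ m η)]
      rw [dot_vint _ (hmη η), intervalIntegral.integral_const_mul]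
    have c3 : ∀ s, Continuous fun θ => ∫ η in (-T)..0, g η *
        ((mono₂ d ν η s *ᵥ φ s) ⬝ᵥ M33 *ᵥ mono₂ d ν η θ *ᵥ φ θ) := fun s =>
      intervalIntegral.continuous_parametric_intervalIntegral_of_continuous' (by
        show Continuous fun p : ℝ × ℝ => g p.2 *
          ((mono₂ d ν p.2 s *ᵥ φ s) ⬝ᵥ M33 *ᵥ mono₂ d ν p.2 p.1 *ᵥ φ p.1)
        fun_prop) _ _
    have e2 : ∀ s, ∫ θ in (-T)..0, φ s ⬝ᵥ M.toR T g s θ *ᵥ φ θ =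
        g s * (y s ⬝ᵥ M23 *ᵥ m s)
        + (∫ θ in (-T)..0, g θ * ((mono₂ d ν θ s *ᵥ φ s) ⬝ᵥ M32 *ᵥ y θ))
        + ∫ η in (-T)..0, g η * ((mono₂ d ν η s *ᵥ φ s) ⬝ᵥ M33 *ᵥ m η) := by
      intro s
      simp_rw [e1]
      rw [intervalIntegral.integral_add, intervalIntegral.integral_add, i1,
        integral_swap_of_continuous]
      · simp_rw [i3]
      · show Continuous fun p : ℝ × ℝ => g p.2 *
          ((mono₂ d ν p.2 s *ᵥ φ s) ⬝ᵥ M33 *ᵥ mono₂ d ν p.2 p.1 *ᵥ φ p.1)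
        fun_prop
      · exact Continuous.intervalIntegrable (by fun_prop) _ _
      · exact Continuous.intervalIntegrable (by fun_prop) _ _
      · exact Continuous.intervalIntegrable (by fun_prop) _ _
      · exact (c3 s).intervalIntegrable _ _
    have c4 : Continuous fun p : ℝ × ℝ =>
        g p.2 * ((mono₂ d ν p.2 p.1 *ᵥ φ p.1) ⬝ᵥ M32 *ᵥ y p.2) := by fun_prop
    have c5 : Continuous fun p : ℝ × ℝ =>
        g p.2 * ((mono₂ d ν p.2 p.1 *ᵥ φ p.1) ⬝ᵥ M33 *ᵥ m p.2) := by fun_prop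
    simp_rw [e2]
    rw [intervalIntegral.integral_add, intervalIntegral.integral_add,
      
      integral_swap_of_continuous
        (F := fun s θ => g θ * ((mono₂ d ν θ s *ᵥ φ s) ⬝ᵥ M32 *ᵥ y θ)) c4,
      integral_swap_of_continuous
        (F := fun s η => g η * ((mono₂ d ν η s *ᵥ φ s) ⬝ᵥ M33 *ᵥ m η)) c5]
    · simp_rw [i2, i4]
    · exact Continuous.intervalIntegrable (by fun_prop) _ _
    · exact (intervalIntegral.continuous_parametric_intervalIntegral_of_continuous' c4
        _ _).intervalIntegrable _ _
    · exact Continuous.intervalIntegrable (Continuous.add (by fun_prop)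
        (intervalIntegral.continuous_parametric_intervalIntegral_of_continuous' c4 _ _)) _ _
    · exact (intervalIntegral.continuous_parametric_intervalIntegral_of_continuous' c5
        _ _).intervalIntegrable _ _
  rw [Gram.form, t1, t2, t3, t4]
  have e : ∀ η, Sum.elim x (Sum.elim (mono₁ d ν η *ᵥ φ η)
        (vint (-T) 0 fun s => mono₂ d ν η s *ᵥ φ s)) ⬝ᵥ M *ᵥ
        Sum.elim x (Sum.elim (mono₁ d ν η *ᵥ φ η) (vint (-T) 0 fun s => mono₂ d ν η s *ᵥ φ s))
      = x ⬝ᵥ M11 *ᵥ x + 2 * (x ⬝ᵥ M12 *ᵥ y η) + 2 * (x ⬝ᵥ M13 *ᵥ m η) + y η ⬝ᵥ M22 *ᵥ y η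
        + y η ⬝ᵥ M23 *ᵥ m η + m η ⬝ᵥ M32 *ᵥ y η + m η ⬝ᵥ M33 *ᵥ m η :=
    fun η => dotProduct_gram_mulVec hM x (y η) (m η)
  simp_rw [e]
  have ii : ∀ {f : ℝ → ℝ}, Continuous f → IntervalIntegrable f volume (-T) 0 :=
    fun h => h.intervalIntegrable _ _
  simp only [mul_add]
  rw [intervalIntegral.integral_add, intervalIntegral.integral_add, intervalIntegral.integral_add,
    intervalIntegral.integral_add, intervalIntegral.integral_add, intervalIntegral.integral_add]
  · ring
  all_goals exact ii (by fun_prop)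

lemma Gram.form_nonneg (M : Gram d μ ν) (hM : M.PosSemidef) {T : ℝ} (hT : 0 < T) {g : ℝ → ℝ}
    (hg : Continuous g) (hg0 : ∀ s ∈ Set.Icc (-T) 0, 0 ≤ g s) (x : μ → ℝ) {φ : ℝ → ν → ℝ}
    (hφ : Continuous φ) : 0 ≤ M.form T g x φ := by
  rw [M.form_eq hM.1 hT hg x hφ]
  refine intervalIntegral.integral_nonneg (by linarith) fun η hη => mul_nonneg (hg0 η hη) ?_
  simpa using hM.dotProduct_mulVec_nonneg (Sum.elim x (Sum.elim (mono₁ d ν η *ᵥ φ η)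
    (vint (-T) 0 fun s => mono₂ d ν η s *ᵥ φ s)))

end GramForm

/-! ### The quadratic form of a quadruple in `Ξ` -/

section XiForm

variable {d k : ℕ} {μ ν : Type*} [Fintype μ] [Fintype ν] [DecidableEq ν]
  {τ : Fin (k + 1) → ℝ} {Θ : Params (Fin (k + 1)) μ ν}

/-- The quadratic form `⟨h, Θ h⟩`, with `h = (v, h_i)`, of the operator given by `Θ`. -/
def Params.form {μ ν : Type*} [Fintype μ] [Fintype ν] (τ : Fin (k + 1) → ℝ)
    (Θ : Params (Fin (k + 1)) μ ν) (v : μ → ℝ)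
    (h : Fin (k + 1) → ℝ → ν → ℝ) : ℝ :=
  τ (Fin.last k) * (v ⬝ᵥ Θ.P *ᵥ v)
    + 2 * τ (Fin.last k) * (∑ i, ∫ s in (-τ i)..0, v ⬝ᵥ Θ.Q i s *ᵥ h i s)
    + τ (Fin.last k) * (∑ i, ∫ s in (-τ i)..0, h i s ⬝ᵥ Θ.S i s *ᵥ h i s)
    + ∑ i, ∑ j, ∫ s in (-τ i)..0, ∫ θ in (-τ j)..0, h i s ⬝ᵥ Θ.R i j s θ *ᵥ h j θ

/-- Allows histories given on the delay intervals to be replaced by continuous extensions to the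
line. -/
lemma Params.form_congr {μ ν : Type*} [Fintype μ] [Fintype ν] (hτ : ∀ i, 0 < τ i)
    (Θ : Params (Fin (k + 1)) μ ν) (v : μ → ℝ)
    {h h' : Fin (k + 1) → ℝ → ν → ℝ} (hh : ∀ i, ∀ s ∈ Set.Icc (-τ i) 0, h i s = h' i s) :
    Θ.form τ v h = Θ.form τ v h' := by
  have hI : ∀ i, Set.uIcc (-τ i) 0 = Set.Icc (-τ i) 0 := fun i =>
    Set.uIcc_of_le (by linarith [hτ i])
  have e1 : ∀ i, ∫ s in (-τ i)..0, v ⬝ᵥ Θ.Q i s *ᵥ h i s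
      = ∫ s in (-τ i)..0, v ⬝ᵥ Θ.Q i s *ᵥ h' i s := fun i =>
    intervalIntegral.integral_congr fun s hs => by
      rw [hI] at hs; simp only [hh i s hs]
  have e2 : ∀ i, ∫ s in (-τ i)..0, h i s ⬝ᵥ Θ.S i s *ᵥ h i s
      = ∫ s in (-τ i)..0, h' i s ⬝ᵥ Θ.S i s *ᵥ h' i s := fun i =>
    intervalIntegral.integral_congr fun s hs => by
      rw [hI] at hs; simp only [hh i s hs]
  have e3 : ∀ i j, ∫ s in (-τ i)..0, ∫ θ in (-τ j)..0, h i s ⬝ᵥ Θ.R i j s θ *ᵥ h j θ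
      = ∫ s in (-τ i)..0, ∫ θ in (-τ j)..0, h' i s ⬝ᵥ Θ.R i j s θ *ᵥ h' j θ := fun i j =>
    intervalIntegral.integral_congr fun s hs => intervalIntegral.integral_congr fun θ hθ => by
      rw [hI] at hs hθ; simp only [hh i s hs, hh j θ hθ]
  simp only [Params.form, e1, e2, e3]

/-- The `i`-th channel, rescaled to `[-T, 0]` and placed in the stacked space. -/
def channel {ν : Type*} (a : Fin (k + 1) → ℝ) (h : Fin (k + 1) → ℝ → ν → ℝ) (i : Fin (k + 1))
    (s : ℝ) : ν × Fin (k + 1) → ℝ :=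
  fun p => if p.2 = i then √(a i) * h i (a i * s) p.1 else 0

lemma continuous_channel {ν : Type*} (a : Fin (k + 1) → ℝ) {h : Fin (k + 1) → ℝ → ν → ℝ}
    (hh : ∀ i, Continuous (h i)) (i : Fin (k + 1)) : Continuous (channel a h i) := by
  refine continuous_pi fun p => ?_
  unfold channel
  split_ifs
  · exact continuous_const.mul ((continuous_apply p.1).comp ((hh i).comp (by fun_prop)))
  · exact continuous_const

lemma mulVec_channel {α ν : Type*} [Fintype ν] (C : Matrix α (ν × Fin (k + 1)) ℝ) (a : Fin (k + 1) → ℝ)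
    (h : Fin (k + 1) → ℝ → ν → ℝ) (i : Fin (k + 1)) (s : ℝ) :
    C *ᵥ channel a h i s = √(a i) • (C.submatrix id (fun b => (b, i)) *ᵥ h i (a i * s)) := by
  funext x
  simp only [Matrix.mulVec, dotProduct, channel, Fintype.sum_prod_type, Pi.smul_apply,
    smul_eq_mul, Matrix.submatrix_apply, id, mul_ite, mul_zero, Finset.sum_ite_eq',
    Finset.mem_univ, if_true, Finset.mul_sum]
  exact Finset.sum_congr rfl fun b _ => by ring

lemma channel_dot {ν : Type*} [Fintype ν] (y : ν × Fin (k + 1) → ℝ) (a : Fin (k + 1) → ℝ)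
    (h : Fin (k + 1) → ℝ → ν → ℝ) (i : Fin (k + 1)) (s : ℝ) :
    channel a h i s ⬝ᵥ y = √(a i) * (h i (a i * s) ⬝ᵥ fun b => y (b, i)) := by
  simp only [dotProduct, channel, Fintype.sum_prod_type, ite_mul, zero_mul, Finset.sum_ite_eq',
    Finset.mem_univ, if_true, Finset.mul_sum]
  exact Finset.sum_congr rfl fun b _ => by ring

lemma integral_rescale {T τ : ℝ} (hT : 0 < T) (hτ : 0 < τ) (f : ℝ → ℝ) :
    ∫ s in (-τ)..0, f s = ∫ s in (-T)..0, (τ / T) * f (τ / T * s) := by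
  have h : τ / T ≠ 0 := by positivity
  rw [intervalIntegral.integral_const_mul, intervalIntegral.integral_comp_mul_left _ h,
    mul_zero, smul_eq_mul, ← mul_assoc, mul_inv_cancel₀ h, one_mul]
  congr 1
  field_simp

lemma mul_mem_Icc_rescale {T τ : ℝ} (hT : 0 < T) (hτ : 0 < τ) {s : ℝ}
    (hs : s ∈ Set.Icc (-τ) 0) :
    ∃ s' ∈ Set.Icc (-T) 0, s = τ / T * s' := by
  refine ⟨T / τ * s, ⟨?_, ?_⟩, by field_simp⟩
  · have h1 := hs.1
    have : -T = T / τ * (-τ) := by field_simp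
    rw [this]
    exact mul_le_mul_of_nonneg_left h1 (by positivity)
  · exact mul_nonpos_of_nonneg_of_nonpos (by positivity) hs.2

/-- The substitution `s = aᵢ s'` in channel `i` costs a Jacobian `aᵢ = √aᵢ √aᵢ`. In the `Q` term one
root comes from the stacked history and one from the kernel; in the `S` term both come from the two
histories; in the `R` term `√(aᵢ aⱼ)` and the two histories together give `aᵢ aⱼ`. -/
lemma Xi.form_eq_of_stacked {μ ν : Type*} [Fintype μ] [Fintype ν]
    {Θ : Params (Fin (k + 1)) μ ν} {T : ℝ} (hT : T = τ (Fin.last k)) (hτ : ∀ i, 0 < τ i)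
    (C : ℝ → Matrix μ (ν × Fin (k + 1)) ℝ) (D : ℝ → Matrix (ν × Fin (k + 1)) (ν × Fin (k + 1)) ℝ)
    (E : ℝ → ℝ → Matrix (ν × Fin (k + 1)) (ν × Fin (k + 1)) ℝ)
    (cC : Continuous C) (cD : Continuous D) (cE : Continuous fun p : ℝ × ℝ => E p.1 p.2)
    (hQ : ∀ s ∈ Set.Icc (-T) 0,
      blockRow (fun i => √(τ i / T) • Θ.Q i (τ i / T * s)) = C s)
    (hS : ∀ s ∈ Set.Icc (-T) 0,
      Matrix.blockDiagonal (fun i => Θ.S i (τ i / T * s)) = D s)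
    (hR : ∀ s ∈ Set.Icc (-T) 0, ∀ θ ∈ Set.Icc (-T) 0,
      blockCol (fun i => blockRow (fun j =>
        √(τ i / T * (τ j / T)) • Θ.R i j (τ i / T * s) (τ j / T * θ))) = E s θ)
    (v : μ → ℝ) {h : Fin (k + 1) → ℝ → ν → ℝ} (hh : ∀ i, Continuous (h i)) :
    Θ.form τ v h = T * (v ⬝ᵥ Θ.P *ᵥ v)
      + 2 * T * (∫ s in (-T)..0, v ⬝ᵥ C s *ᵥ ∑ i, channel (fun i => τ i / T) h i s)
      + T * (∫ s in (-T)..0, (∑ i, channel (fun i => τ i / T) h i s) ⬝ᵥ D s *ᵥ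
          ∑ i, channel (fun i => τ i / T) h i s)
      + ∫ s in (-T)..0, ∫ θ in (-T)..0, (∑ i, channel (fun i => τ i / T) h i s) ⬝ᵥ E s θ *ᵥ
          ∑ i, channel (fun i => τ i / T) h i θ := by
  have hT0 : 0 < T := hT ▸ hτ _
  have ha : ∀ i, 0 < τ i / T := fun i => div_pos (hτ i) hT0
  set a : Fin (k + 1) → ℝ := fun i => τ i / T
  have hI : Set.uIcc (-T) 0 = Set.Icc (-T) 0 := Set.uIcc_of_le (by linarith)
  set χ := channel a h
  have hχ : ∀ i, Continuous (χ i) := continuous_channel a hh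
  have sq : ∀ i, √(a i) * √(a i) = a i := fun i => Real.mul_self_sqrt (ha i).le
  have t1 : ∑ i, ∫ s in (-τ i)..0, v ⬝ᵥ Θ.Q i s *ᵥ h i s
      = ∫ s in (-T)..0, v ⬝ᵥ C s *ᵥ ∑ i, χ i s := by
    simp_rw [Matrix.mulVec_sum, dotProduct_sum]
    rw [intervalIntegral.integral_finsetSum
      fun i _ => Continuous.intervalIntegrable (by fun_prop) _ _]
    refine Finset.sum_congr rfl fun i _ => ?_
    rw [integral_rescale hT0 (hτ i)]
    refine intervalIntegral.integral_congr fun s hs => ?_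
    rw [hI] at hs
    have hQ' : (C s).submatrix id (fun b => (b, i)) = √(a i) • Θ.Q i (a i * s) := by
      rw [← hQ s hs]; rfl
    simp only [χ, mulVec_channel, hQ', Matrix.smul_mulVec, dotProduct_smul, smul_eq_mul]
    rw [← mul_assoc, sq]
  have t2 : ∑ i, ∫ s in (-τ i)..0, h i s ⬝ᵥ Θ.S i s *ᵥ h i s
      = ∫ s in (-T)..0, (∑ i, χ i s) ⬝ᵥ D s *ᵥ ∑ i, χ i s := by
    have e : ∀ s ∈ Set.uIcc (-T) 0, (∑ i, χ i s) ⬝ᵥ D s *ᵥ ∑ i, χ i s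
        = ∑ i, χ i s ⬝ᵥ D s *ᵥ χ i s := by
      intro s hs
      rw [hI] at hs
      rw [Matrix.mulVec_sum, sum_dotProduct]
      refine Finset.sum_congr rfl fun i _ => ?_
      -- Distinct channels do not interact, because `D` is block diagonal.
      rw [dotProduct_sum, Finset.sum_eq_single i]
      · intro j _ hj
        simp only [χ, mulVec_channel, dotProduct_smul, channel_dot]
        have : (fun b => ((D s).submatrix id (fun b => (b, j)) *ᵥ h j (a j * s)) (b, i)) = 0 := by
          funext b
          rw [← hS s hs]
          simp [Matrix.mulVec, dotProduct, Matrix.blockDiagonal_apply, hj.symm]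
        rw [this]; simp
      · simp
    rw [intervalIntegral.integral_congr e, intervalIntegral.integral_finsetSum
      fun i _ => Continuous.intervalIntegrable (by fun_prop) _ _]
    refine Finset.sum_congr rfl fun i _ => ?_
    rw [integral_rescale hT0 (hτ i)]
    refine intervalIntegral.integral_congr fun s hs => ?_
    rw [hI] at hs
    simp only [χ, mulVec_channel, dotProduct_smul, channel_dot, smul_eq_mul]
    have : (fun b => ((D s).submatrix id (fun b => (b, i)) *ᵥ h i (a i * s)) (b, i))
        = Θ.S i (a i * s) *ᵥ h i (a i * s) := by
      funext b
      rw [← hS s hs]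
      simp [Matrix.mulVec, dotProduct, Matrix.blockDiagonal_apply, a]
    rw [this, ← mul_assoc, sq]
  have t3 : ∑ i, ∑ j, ∫ s in (-τ i)..0, ∫ θ in (-τ j)..0, h i s ⬝ᵥ Θ.R i j s θ *ᵥ h j θ
      = ∫ s in (-T)..0, ∫ θ in (-T)..0, (∑ i, χ i s) ⬝ᵥ E s θ *ᵥ ∑ i, χ i θ := by
    have cij : ∀ i j, Continuous fun p : ℝ × ℝ => χ i p.1 ⬝ᵥ E p.1 p.2 *ᵥ χ j p.2 := by
      intro i j; fun_prop
    have e : ∀ s, ∫ θ in (-T)..0, (∑ i, χ i s) ⬝ᵥ E s θ *ᵥ ∑ i, χ i θ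
        = ∑ i, ∑ j, ∫ θ in (-T)..0, χ i s ⬝ᵥ E s θ *ᵥ χ j θ := by
      intro s
      simp_rw [Matrix.mulVec_sum, sum_dotProduct, dotProduct_sum]
      rw [intervalIntegral.integral_finsetSum]
      · refine Finset.sum_congr rfl fun i _ => ?_
        rw [intervalIntegral.integral_finsetSum]
        intro j _
        exact ((cij i j).comp (by fun_prop : Continuous fun θ => (s, θ))).intervalIntegrable _ _
      · intro i _
        refine intervalIntegrable_fun_sum _ fun j _ => ?_
        exact ((cij i j).comp (by fun_prop : Continuous fun θ => (s, θ))).intervalIntegrable _ _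
    simp_rw [e]
    have ci : ∀ i j, IntervalIntegrable
        (fun s => ∫ θ in (-T)..0, χ i s ⬝ᵥ E s θ *ᵥ χ j θ) volume (-T) 0 := fun i j =>
      (intervalIntegral.continuous_parametric_intervalIntegral_of_continuous'
        (cij i j) _ _).intervalIntegrable _ _
    rw [intervalIntegral.integral_finsetSum fun i _ =>
      intervalIntegrable_fun_sum _ fun j _ => ci i j]
    refine Finset.sum_congr rfl fun i _ => ?_
    rw [intervalIntegral.integral_finsetSum fun j _ => ci i j]
    refine Finset.sum_congr rfl fun j _ => ?_
    rw [integral_rescale hT0 (hτ i)]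
    refine intervalIntegral.integral_congr fun s hs => ?_
    rw [hI] at hs
    rw [integral_rescale hT0 (hτ j), ← intervalIntegral.integral_const_mul]
    refine intervalIntegral.integral_congr fun θ hθ => ?_
    rw [hI] at hθ
    simp only [χ, mulVec_channel, dotProduct_smul, channel_dot, smul_eq_mul]
    have : (fun b => ((E s θ).submatrix id (fun b => (b, j)) *ᵥ h j (a j * θ)) (b, i))
        = √(a i * a j) • (Θ.R i j (a i * s) (a j * θ) *ᵥ h j (a j * θ)) := by
      funext b
      rw [← hR s hs θ hθ]
      simp [Matrix.mulVec, dotProduct, blockCol, blockRow, Finset.mul_sum, mul_assoc, a]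
    rw [this, dotProduct_smul, smul_eq_mul, Real.sqrt_mul (ha i).le]
    linear_combination (-(a j) * (h i (a i * s) ⬝ᵥ Θ.R i j (a i * s) (a j * θ) *ᵥ h j (a j * θ)))
      * sq i - (√(a i) * √(a i) * (h i (a i * s) ⬝ᵥ Θ.R i j (a i * s) (a j * θ) *ᵥ
        h j (a j * θ))) * sq j
  rw [Params.form, ← hT, t1, t2, t3]

/-- In the stacked variable the form is the sum of the forms of the two Gram matrices, with weights
`1` and `-s (s + T)`. Both weights are nonnegative on `[-T, 0]`, so `Gram.form_nonneg` applies to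
each. -/
lemma Xi.form_nonneg_of_continuous (hτ : ∀ i, 0 < τ i) (hΘ : Θ ∈ Xi d τ) (v : μ → ℝ)
    {h : Fin (k + 1) → ℝ → ν → ℝ} (hh : ∀ i, Continuous (h i)) : 0 ≤ Θ.form τ v h := by
  obtain ⟨M, N, hM, hN, hP, hQ, hS, hR⟩ := hΘ
  set T := τ (Fin.last k) with hT
  have hT0 : 0 < T := hτ _
  have c1 : Continuous fun _ : ℝ => (1 : ℝ) := continuous_const
  have c2 : Continuous fun s : ℝ => -s * (s + T) := by fun_prop
  rw [Xi.form_eq_of_stacked (Θ := Θ) hT hτ _ _ _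
    ((M.continuous_toQ T c1).add (N.continuous_toQ T c2))
    ((M.continuous_toS T c1).add (N.continuous_toS T c2))
    ((M.continuous_toR T c1).add (N.continuous_toR T c2)) hQ hS hR v hh]
  set φ : ℝ → ν × Fin (k + 1) → ℝ := fun s => ∑ i, channel (fun i => τ i / T) h i s
  have hφ : Continuous φ := continuous_finsetSum _ fun i _ => continuous_channel _ hh i
  have p1 := M.form_nonneg hM hT0 c1 (fun _ _ => zero_le_one) v hφ
  have p2 := N.form_nonneg hN hT0 c2 (fun s hs => by nlinarith [hs.1, hs.2]) v hφ
  have cR : ∀ {M : Gram d μ (ν × Fin (k + 1))} {g : ℝ → ℝ}, Continuous g →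
      Continuous fun p : ℝ × ℝ => φ p.1 ⬝ᵥ M.toR T g p.1 p.2 *ᵥ φ p.2 := by
    intro M g hg
    have := M.continuous_toR T hg
    fun_prop
  have cQ : ∀ {M : Gram d μ (ν × Fin (k + 1))} {g : ℝ → ℝ}, Continuous g →
      Continuous fun s => v ⬝ᵥ M.toQ T g s *ᵥ φ s := by
    intro M g hg
    have := M.continuous_toQ T hg
    fun_prop
  have cS : ∀ {M : Gram d μ (ν × Fin (k + 1))} {g : ℝ → ℝ}, Continuous g →
      Continuous fun s => φ s ⬝ᵥ M.toS T g s *ᵥ φ s := by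
    intro M g hg
    have := M.continuous_toS T hg
    fun_prop
  have key : ∀ s, ∫ θ in (-T)..0, (φ s ⬝ᵥ M.toR T (fun _ => 1) s θ *ᵥ φ θ
      + φ s ⬝ᵥ N.toR T (fun s => -s * (s + T)) s θ *ᵥ φ θ)
      = (∫ θ in (-T)..0, φ s ⬝ᵥ M.toR T (fun _ => 1) s θ *ᵥ φ θ)
        + ∫ θ in (-T)..0, φ s ⬝ᵥ N.toR T (fun s => -s * (s + T)) s θ *ᵥ φ θ := fun s =>
    intervalIntegral.integral_add
      (((cR c1).comp (by fun_prop : Continuous fun θ => (s, θ))).intervalIntegrable _ _)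
      (((cR c2).comp (by fun_prop : Continuous fun θ => (s, θ))).intervalIntegrable _ _)
  change 0 ≤ T * (v ⬝ᵥ Θ.P *ᵥ v)
    + 2 * T * (∫ s in (-T)..0, v ⬝ᵥ
        (M.toQ T (fun _ => 1) s + N.toQ T (fun s => -s * (s + T)) s) *ᵥ φ s)
    + T * (∫ s in (-T)..0, φ s ⬝ᵥ
        (M.toS T (fun _ => 1) s + N.toS T (fun s => -s * (s + T)) s) *ᵥ φ s)
    + ∫ s in (-T)..0, ∫ θ in (-T)..0, φ s ⬝ᵥ
        (M.toR T (fun _ => 1) s θ + N.toR T (fun s => -s * (s + T)) s θ) *ᵥ φ θ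
  simp only [hP, Matrix.add_mulVec, dotProduct_add]
  simp_rw [key]
  rw [intervalIntegral.integral_add ((cQ c1).intervalIntegrable _ _)
      ((cQ c2).intervalIntegrable _ _),
    intervalIntegral.integral_add ((cS c1).intervalIntegrable _ _)
      ((cS c2).intervalIntegrable _ _),
    intervalIntegral.integral_add
      ((intervalIntegral.continuous_parametric_intervalIntegral_of_continuous'
        (cR c1) _ _).intervalIntegrable _ _)
      ((intervalIntegral.continuous_parametric_intervalIntegral_of_continuous'
        (cR c2) _ _).intervalIntegrable _ _)]
  refine (add_nonneg p1 p2).trans_eq ?_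
  simp only [Gram.form]
  ring

/-- Each history is extended to the line by its end values, which does not change the form. -/
lemma Xi.form_nonneg (hτ : ∀ i, 0 < τ i) (hΘ : Θ ∈ Xi d τ) (v : μ → ℝ)
    {h : Fin (k + 1) → ℝ → ν → ℝ} (hh : ∀ i, ContinuousOn (h i) (Set.Icc (-τ i) 0)) :
    0 ≤ Θ.form τ v h := by
  have hle : ∀ i, -τ i ≤ 0 := fun i => by linarith [hτ i]
  rw [Params.form_congr hτ Θ v
    (h' := fun i => Set.IccExtend (hle i) ((Set.Icc (-τ i) 0).domRestrict (h i)))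
    (fun i s hs => by rw [Set.IccExtend_of_mem _ _ hs]; rfl)]
  exact Xi.form_nonneg_of_continuous hτ hΘ v fun i =>
    (continuousOn_iff_continuous_domRestrict.1 (hh i)).Icc_extend'

lemma Xi.P_transpose (hΘ : Θ ∈ Xi d τ) : Θ.Pᵀ = Θ.P := by
  obtain ⟨M, N, hM, hN, hP, -⟩ := hΘ
  have e : ∀ {M : Gram d μ (ν × Fin (k + 1))}, M.PosSemidef →
      (M.toBlocks₁₁)ᵀ = M.toBlocks₁₁ := fun hM => by
    ext i j
    exact hM.1.apply (Sum.inl i) (Sum.inl j)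
  rw [hP, Matrix.transpose_add]
  simp only [Gram.toP, Matrix.transpose_smul, e hM, e hN]

/-- At the rescaled point, `S i s` is a diagonal block of a sum of matrices `Yᵀ M₂₂ Y` with
nonnegative weights. -/
lemma Xi.S_posSemidef (hτ : ∀ i, 0 < τ i) (hΘ : Θ ∈ Xi d τ) (i : Fin (k + 1)) {s : ℝ}
    (hs : s ∈ Set.Icc (-τ i) 0) : (Θ.S i s).PosSemidef := by
  obtain ⟨M, N, hM, hN, -, -, hS, -⟩ := hΘ
  have hT0 : 0 < τ (Fin.last k) := hτ _
  obtain ⟨s', hs', rfl⟩ := mul_mem_Icc_rescale hT0 (hτ i) hs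
  have e : ∀ {M : Gram d μ (ν × Fin (k + 1))} {g : ℝ → ℝ}, M.PosSemidef → 0 ≤ g s' →
      (M.toS (τ (Fin.last k)) g s').PosSemidef := fun {M g} hM hg => by
    unfold Gram.toS
    refine Matrix.PosSemidef.smul ?_ (mul_nonneg (inv_nonneg.2 hT0.le) hg)
    have h22 : (M.toBlocks₂₂.toBlocks₁₁).PosSemidef :=
      hM.submatrix (fun i => Sum.inr (Sum.inl i))
    simpa using h22.conjTranspose_mul_mul_same (mono₁ d (ν × Fin (k + 1)) s')
  have h := ((e (g := fun _ => 1) hM zero_le_one).add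
    (e (g := fun s => -s * (s + τ (Fin.last k))) hN (by nlinarith [hs'.1, hs'.2]))).submatrix
      (fun b => (b, i))
  rw [← hS s' hs'] at h
  convert h using 1
  ext b c
  simp [Matrix.blockDiagonal_apply]

/-- Transposing the Gram expression swaps its `M₂₃` and `M₃₂` terms and fixes the `M₃₃` term. The
nonzero factor `√(aᵢ aⱼ)` is cancelled at the end. -/
lemma Xi.R_transpose (hτ : ∀ i, 0 < τ i) (hΘ : Θ ∈ Xi d τ) (i j : Fin (k + 1)) {s θ : ℝ}
    (hs : s ∈ Set.Icc (-τ i) 0) (hθ : θ ∈ Set.Icc (-τ j) 0) :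
    (Θ.R i j s θ)ᵀ = Θ.R j i θ s := by
  obtain ⟨M, N, hM, hN, -, -, -, hR⟩ := hΘ
  have hT0 : 0 < τ (Fin.last k) := hτ _
  obtain ⟨s', hs', rfl⟩ := mul_mem_Icc_rescale hT0 (hτ i) hs
  obtain ⟨θ', hθ', rfl⟩ := mul_mem_Icc_rescale hT0 (hτ j) hθ
  have e : ∀ {M : Gram d μ (ν × Fin (k + 1))} (g : ℝ → ℝ), M.PosSemidef →
      (M.toR (τ (Fin.last k)) g s' θ')ᵀ = M.toR (τ (Fin.last k)) g θ' s' := by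
    intro M g hM
    have h23 : (M.toBlocks₂₂.toBlocks₁₂)ᵀ = M.toBlocks₂₂.toBlocks₂₁ := by
      ext i j
      exact hM.1.apply (Sum.inr (Sum.inr i)) (Sum.inr (Sum.inl j))
    have h32 : (M.toBlocks₂₂.toBlocks₂₁)ᵀ = M.toBlocks₂₂.toBlocks₁₂ := by
      rw [← h23, Matrix.transpose_transpose]
    have h33 : (M.toBlocks₂₂.toBlocks₂₂)ᵀ = M.toBlocks₂₂.toBlocks₂₂ := by
      ext i j
      exact hM.1.apply (Sum.inr (Sum.inr i)) (Sum.inr (Sum.inr j))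
    simp only [Gram.toR, Matrix.transpose_add, Matrix.transpose_smul, Matrix.transpose_mul,
      Matrix.transpose_transpose, transpose_matInt, h23, h32, h33, Matrix.mul_assoc]
    rw [add_comm (g s' • _)]
  have h1 := hR s' hs' θ' hθ'
  have h2 := hR θ' hθ' s' hs'
  have h3 := congrArg Matrix.transpose h1
  rw [Matrix.transpose_add, e _ hM, e _ hN, ← h2] at h3
  ext b c
  have h4 := congrFun (congrFun h3 (b, j)) (c, i)
  simp only [Matrix.transpose_apply, blockCol, blockRow, Matrix.of_apply, Matrix.smul_apply,
    smul_eq_mul] at h4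
  rw [mul_comm (τ j / τ (Fin.last k)) (τ i / τ (Fin.last k))] at h4
  refine mul_left_cancel₀ ?_ h4
  exact (Real.sqrt_pos.2 (mul_pos (div_pos (hτ i) hT0) (div_pos (hτ j) hT0))).ne'

end XiForm

/-! ### Integrability and continuity of matrix-vector expressions -/

section Reg

variable {α β : Type*} [Fintype α] [Fintype β] {a b : ℝ}

lemma dot_mulVec_comm (M : Matrix α β ℝ) (x : α → ℝ) (y : β → ℝ) :
    x ⬝ᵥ M *ᵥ y = y ⬝ᵥ Mᵀ *ᵥ x := by
  rw [Matrix.mulVec_transpose, dotProduct_comm y, Matrix.dotProduct_mulVec]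

lemma transpose_mulVec_dot (M : Matrix α β ℝ) (x : α → ℝ) (y : β → ℝ) :
    (Mᵀ *ᵥ x) ⬝ᵥ y = x ⬝ᵥ M *ᵥ y := by
  rw [dotProduct_comm, ← dot_mulVec_comm]

lemma intervalIntegrable_mulVec {α : Type*} (hab : a ≤ b) {M : ℝ → Matrix α β ℝ} {g : ℝ → β → ℝ}
    (hM : ∀ i j, ContinuousOn (fun s => M s i j) (Set.Icc a b))
    (hg : ∀ i, IntervalIntegrable (fun s => g s i) volume a b) (i : α) :
    IntervalIntegrable (fun s => (M s *ᵥ g s) i) volume a b := by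
  simp only [Matrix.mulVec, dotProduct]
  refine intervalIntegrable_fun_sum _ fun j _ => (hg j).continuousOn_mul ?_
  rw [Set.uIcc_of_le hab]; exact hM i j

lemma intervalIntegrable_dot (hab : a ≤ b) {x g : ℝ → α → ℝ}
    (hx : ContinuousOn x (Set.Icc a b))
    (hg : ∀ i, IntervalIntegrable (fun s => g s i) volume a b) :
    IntervalIntegrable (fun s => x s ⬝ᵥ g s) volume a b := by
  simp only [dotProduct]
  refine intervalIntegrable_fun_sum _ fun j _ => (hg j).continuousOn_mul ?_
  rw [Set.uIcc_of_le hab]; exact continuousOn_pi.1 hx j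

lemma intervalIntegrable_of_continuousOn {α : Type*} (hab : a ≤ b) {x : ℝ → α → ℝ}
    (hx : ContinuousOn x (Set.Icc a b)) (i : α) :
    IntervalIntegrable (fun s => x s i) volume a b := by
  refine ContinuousOn.intervalIntegrable ?_
  rw [Set.uIcc_of_le hab]; exact continuousOn_pi.1 hx i

lemma continuousOn_mulVec {α : Type*} {I : Set ℝ} {M : ℝ → Matrix α β ℝ} {g : ℝ → β → ℝ}
    (hM : ∀ i j, ContinuousOn (fun s => M s i j) I) (hg : ContinuousOn g I) :
    ContinuousOn (fun s => M s *ᵥ g s) I := by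
  refine continuousOn_pi.2 fun i => ?_
  simp only [Matrix.mulVec, dotProduct]
  exact continuousOn_finsetSum _ fun j _ => (hM i j).mul (continuousOn_pi.1 hg j)

lemma continuousOn_matrix_mul {α γ : Type*} {I : Set ℝ} {M : ℝ → Matrix α β ℝ}
    {N : ℝ → Matrix β γ ℝ} (hM : ∀ i j, ContinuousOn (fun s => M s i j) I)
    (hN : ∀ i j, ContinuousOn (fun s => N s i j) I) (i : α) (j : γ) :
    ContinuousOn (fun s => (M s * N s) i j) I := by
  simp only [Matrix.mul_apply]
  exact continuousOn_finsetSum _ fun l _ => (hM i l).mul (hN l j)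

end Reg

/-! ### Separable operators -/

/-- The operator on `ℝⁿ × L₂ × ⋯ × L₂` with parameters `P`, `Q_i = H_i W_i`, `S_i`,
`R_ij = W_iᵀ Γ_ij W_j`. -/
structure SepOp (k n : ℕ) (κ : Type) where
  P : Matrix (Fin n) (Fin n) ℝ
  H : Fin (k + 1) → Matrix (Fin n) κ ℝ
  W : Fin (k + 1) → ℝ → Matrix κ (Fin n) ℝ
  S : Fin (k + 1) → ℝ → Matrix (Fin n) (Fin n) ℝ
  Γ : Fin (k + 1) → Fin (k + 1) → Matrix κ κ ℝ

section Pairing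

variable {k n : ℕ}

/-- The inner product `T x₀ᵀ y₀ + ∑ᵢ ∫ xᵢᵀ yᵢ`. -/
def pairing (τ : Fin (k + 1) → ℝ) (x₀ : Fin n → ℝ) (x : Fin (k + 1) → ℝ → Fin n → ℝ)
    (y₀ : Fin n → ℝ) (y : Fin (k + 1) → ℝ → Fin n → ℝ) : ℝ :=
  τ (Fin.last k) * (x₀ ⬝ᵥ y₀) + ∑ i, ∫ s in (-τ i)..0, x i s ⬝ᵥ y i s

lemma pairing_comm (τ : Fin (k + 1) → ℝ) (x₀ : Fin n → ℝ) (x : Fin (k + 1) → ℝ → Fin n → ℝ)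
    (y₀ : Fin n → ℝ) (y : Fin (k + 1) → ℝ → Fin n → ℝ) :
    pairing τ x₀ x y₀ y = pairing τ y₀ y x₀ x := by
  simp only [pairing, dotProduct_comm x₀, fun i s => dotProduct_comm (x i s)]

lemma pairing_congr {τ : Fin (k + 1) → ℝ} (hτ : ∀ i, 0 < τ i) (x₀ y₀ : Fin n → ℝ)
    {x x' y y' : Fin (k + 1) → ℝ → Fin n → ℝ} (hx : ∀ i, ∀ s ∈ Set.Icc (-τ i) 0, x i s = x' i s)
    (hy : ∀ i, ∀ s ∈ Set.Icc (-τ i) 0, y i s = y' i s) :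
    pairing τ x₀ x y₀ y = pairing τ x₀ x' y₀ y' := by
  unfold pairing
  congr 1
  refine Finset.sum_congr rfl fun i _ => intervalIntegral.integral_congr fun s hs => ?_
  rw [Set.uIcc_of_le (by linarith [hτ i])] at hs
  simp only [hx i s hs, hy i s hs]

end Pairing

namespace SepOp

variable {k n : ℕ} {κ : Type} [Fintype κ] (Φ : SepOp k n κ) (τ : Fin (k + 1) → ℝ)

/-- The moments `∫ W_i h_i`. -/
def mom {κ : Type} (Φ : SepOp k n κ) (τ : Fin (k + 1) → ℝ)
    (h : Fin (k + 1) → ℝ → Fin n → ℝ) (i : Fin (k + 1)) : κ → ℝ :=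
  vint (-τ i) 0 fun s => Φ.W i s *ᵥ h i s

/-- First component of the operator. -/
def op₀ (h₀ : Fin n → ℝ) (h : Fin (k + 1) → ℝ → Fin n → ℝ) : Fin n → ℝ :=
  Φ.P *ᵥ h₀ + ∑ i, Φ.H i *ᵥ Φ.mom τ h i

/-- The coefficient vector of the finite-rank part of `op₁`. -/
def coef (h₀ : Fin n → ℝ) (h : Fin (k + 1) → ℝ → Fin n → ℝ) (i : Fin (k + 1)) : κ → ℝ :=
  τ (Fin.last k) • ((Φ.H i)ᵀ *ᵥ h₀) + ∑ j, Φ.Γ i j *ᵥ Φ.mom τ h j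

/-- History components of the operator. -/
def op₁ (h₀ : Fin n → ℝ) (h : Fin (k + 1) → ℝ → Fin n → ℝ) (i : Fin (k + 1)) (s : ℝ) :
    Fin n → ℝ :=
  (Φ.W i s)ᵀ *ᵥ Φ.coef τ h₀ h i + τ (Fin.last k) • (Φ.S i s *ᵥ h i s)

/-- The bilinear form of the operator. -/
def bil (h₀ : Fin n → ℝ) (h : Fin (k + 1) → ℝ → Fin n → ℝ)
    (g₀ : Fin n → ℝ) (g : Fin (k + 1) → ℝ → Fin n → ℝ) : ℝ :=
  τ (Fin.last k) * (h₀ ⬝ᵥ Φ.P *ᵥ g₀)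
    + τ (Fin.last k) * (∑ i, g₀ ⬝ᵥ Φ.H i *ᵥ Φ.mom τ h i)
    + τ (Fin.last k) * (∑ i, h₀ ⬝ᵥ Φ.H i *ᵥ Φ.mom τ g i)
    + τ (Fin.last k) * (∑ i, ∫ s in (-τ i)..0, h i s ⬝ᵥ Φ.S i s *ᵥ g i s)
    + ∑ i, ∑ j, Φ.mom τ h i ⬝ᵥ Φ.Γ i j *ᵥ Φ.mom τ g j

/-- Continuity and symmetry of the parameters. -/
structure Regular {κ : Type} (Φ : SepOp k n κ) (τ : Fin (k + 1) → ℝ) : Prop where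
  pos : ∀ i, 0 < τ i
  W_cont : ∀ i a b, ContinuousOn (fun s => Φ.W i s a b) (Set.Icc (-τ i) 0)
  S_cont : ∀ i a b, ContinuousOn (fun s => Φ.S i s a b) (Set.Icc (-τ i) 0)
  P_symm : (Φ.P)ᵀ = Φ.P
  S_symm : ∀ i, ∀ s ∈ Set.Icc (-τ i) 0, (Φ.S i s)ᵀ = Φ.S i s
  Γ_symm : ∀ i j, (Φ.Γ i j)ᵀ = Φ.Γ j i

variable {Φ τ}

lemma Regular.neg_le {κ : Type} {Φ : SepOp k n κ} (R : Φ.Regular τ) (i : Fin (k + 1)) : -τ i ≤ 0 := by linarith [R.pos i]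

lemma Regular.continuousOn_S {κ : Type} {Φ : SepOp k n κ} (R : Φ.Regular τ)
    {h : Fin (k + 1) → ℝ → Fin n → ℝ}
    (hh : ∀ i, ContinuousOn (h i) (Set.Icc (-τ i) 0)) (i : Fin (k + 1)) :
    ContinuousOn (fun s => Φ.S i s *ᵥ h i s) (Set.Icc (-τ i) 0) :=
  continuousOn_mulVec (R.S_cont i) (hh i)

lemma Regular.continuousOn_op₁ (R : Φ.Regular τ) (h₀ : Fin n → ℝ) {h : Fin (k + 1) → ℝ → Fin n → ℝ}
    (hh : ∀ i, ContinuousOn (h i) (Set.Icc (-τ i) 0)) (i : Fin (k + 1)) :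
    ContinuousOn (Φ.op₁ τ h₀ h i) (Set.Icc (-τ i) 0) := by
  have h1 := R.continuousOn_S hh i
  have h2 : ContinuousOn (fun s => (Φ.W i s)ᵀ *ᵥ Φ.coef τ h₀ h i) (Set.Icc (-τ i) 0) :=
    continuousOn_mulVec (fun a b => R.W_cont i b a) continuousOn_const
  exact h2.add (h1.const_smul (τ (Fin.last k)))

/-- Only `h` is continuous, while `g` is merely integrable: the identity is applied with `g` a time
or space derivative of a state. -/
lemma Regular.pairing_op (R : Φ.Regular τ) {h₀ : Fin n → ℝ} {h : Fin (k + 1) → ℝ → Fin n → ℝ}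
    (hh : ∀ i, ContinuousOn (h i) (Set.Icc (-τ i) 0)) {g₀ : Fin n → ℝ}
    {g : Fin (k + 1) → ℝ → Fin n → ℝ}
    (hg : ∀ i a, IntervalIntegrable (fun s => g i s a) volume (-τ i) 0) :
    pairing τ (Φ.op₀ τ h₀ h) (Φ.op₁ τ h₀ h) g₀ g = Φ.bil τ h₀ h g₀ g := by
  have e : ∀ i, ∫ s in (-τ i)..0, Φ.op₁ τ h₀ h i s ⬝ᵥ g i s =
      τ (Fin.last k) * (h₀ ⬝ᵥ Φ.H i *ᵥ Φ.mom τ g i)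
      + ∑ j, Φ.mom τ h j ⬝ᵥ Φ.Γ j i *ᵥ Φ.mom τ g i
      + τ (Fin.last k) * ∫ s in (-τ i)..0, h i s ⬝ᵥ Φ.S i s *ᵥ g i s := by
    intro i
    have hI := Set.uIcc_of_le (R.neg_le i)
    have hWg : ∀ a, IntervalIntegrable (fun s => (Φ.W i s *ᵥ g i s) a) volume (-τ i) 0 :=
      intervalIntegrable_mulVec (R.neg_le i) (R.W_cont i) (hg i)
    have hSg : ∀ a, IntervalIntegrable (fun s => (Φ.S i s *ᵥ g i s) a) volume (-τ i) 0 :=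
      intervalIntegrable_mulVec (R.neg_le i) (R.S_cont i) (hg i)
    have e1 : ∫ s in (-τ i)..0, Φ.op₁ τ h₀ h i s ⬝ᵥ g i s
        = ∫ s in (-τ i)..0, (Φ.coef τ h₀ h i ⬝ᵥ Φ.W i s *ᵥ g i s
          + τ (Fin.last k) * (h i s ⬝ᵥ Φ.S i s *ᵥ g i s)) := by
      refine intervalIntegral.integral_congr fun s hs => ?_
      rw [hI] at hs
      simp only [op₁, add_dotProduct, smul_dotProduct, smul_eq_mul, transpose_mulVec_dot]
      rw [dotProduct_comm (Φ.S i s *ᵥ h i s), dot_mulVec_comm (Φ.S i s) (g i s), R.S_symm i s hs]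
    rw [e1, intervalIntegral.integral_add, intervalIntegral.integral_const_mul, ← dot_vint _ hWg]
    · change Φ.coef τ h₀ h i ⬝ᵥ Φ.mom τ g i + _ = _
      simp only [coef, add_dotProduct, smul_dotProduct, sum_dotProduct, smul_eq_mul,
        transpose_mulVec_dot]
      congr 2
      refine Finset.sum_congr rfl fun j _ => ?_
      rw [dotProduct_comm, dot_mulVec_comm, R.Γ_symm]
    · exact intervalIntegrable_dot (R.neg_le i) continuousOn_const hWg
    · exact (intervalIntegrable_dot (R.neg_le i) (hh i) hSg).const_mul _
  simp only [pairing, bil, e, op₀, add_dotProduct, sum_dotProduct, Finset.sum_add_distrib,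
    Finset.mul_sum]
  rw [Finset.sum_comm (f := fun i j => Φ.mom τ h j ⬝ᵥ Φ.Γ j i *ᵥ Φ.mom τ g i)]
  have e2 : Φ.P *ᵥ h₀ ⬝ᵥ g₀ = h₀ ⬝ᵥ Φ.P *ᵥ g₀ := by
    rw [dotProduct_comm, dot_mulVec_comm, R.P_symm]
  have e3 : ∀ i, (Φ.H i *ᵥ Φ.mom τ h i) ⬝ᵥ g₀ = g₀ ⬝ᵥ Φ.H i *ᵥ Φ.mom τ h i :=
    fun i => dotProduct_comm _ _
  simp only [e2, e3, mul_add, Finset.mul_sum]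
  ring

lemma Regular.bil_comm (R : Φ.Regular τ) (h₀ : Fin n → ℝ) (h : Fin (k + 1) → ℝ → Fin n → ℝ) (g₀ : Fin n → ℝ)
    (g : Fin (k + 1) → ℝ → Fin n → ℝ) : Φ.bil τ h₀ h g₀ g = Φ.bil τ g₀ g h₀ h := by
  have e1 : h₀ ⬝ᵥ Φ.P *ᵥ g₀ = g₀ ⬝ᵥ Φ.P *ᵥ h₀ := by rw [dot_mulVec_comm, R.P_symm]
  have e2 : ∀ i, ∫ s in (-τ i)..0, h i s ⬝ᵥ Φ.S i s *ᵥ g i s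
      = ∫ s in (-τ i)..0, g i s ⬝ᵥ Φ.S i s *ᵥ h i s := by
    intro i
    refine intervalIntegral.integral_congr fun s hs => ?_
    rw [Set.uIcc_of_le (R.neg_le i)] at hs
    rw [dot_mulVec_comm, R.S_symm i s hs]
  have e3 : ∑ i, ∑ j, Φ.mom τ h i ⬝ᵥ Φ.Γ i j *ᵥ Φ.mom τ g j
      = ∑ i, ∑ j, Φ.mom τ g i ⬝ᵥ Φ.Γ i j *ᵥ Φ.mom τ h j := by
    rw [Finset.sum_comm]
    refine Finset.sum_congr rfl fun i _ => Finset.sum_congr rfl fun j _ => ?_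
    rw [dot_mulVec_comm, R.Γ_symm]
  simp only [bil, e1, e2, e3]
  ring

/-- In the error dynamics this moves the operator from the error onto its inverse applied to the
injected correction, where the two cancel. -/
lemma Regular.selfAdjoint (R : Φ.Regular τ) {h₀ : Fin n → ℝ} {h : Fin (k + 1) → ℝ → Fin n → ℝ}
    (hh : ∀ i, ContinuousOn (h i) (Set.Icc (-τ i) 0)) {g₀ : Fin n → ℝ}
    {g : Fin (k + 1) → ℝ → Fin n → ℝ} (hg : ∀ i, ContinuousOn (g i) (Set.Icc (-τ i) 0)) :
    pairing τ (Φ.op₀ τ h₀ h) (Φ.op₁ τ h₀ h) g₀ g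
      = pairing τ h₀ h (Φ.op₀ τ g₀ g) (Φ.op₁ τ g₀ g) := by
  rw [pairing_comm τ h₀,
    R.pairing_op hh fun i => intervalIntegrable_of_continuousOn (R.neg_le i) (hg i),
    R.pairing_op hg fun i => intervalIntegrable_of_continuousOn (R.neg_le i) (hh i),
    R.bil_comm]

/-- The energy identity: `d/dt ⟨Φ u, u⟩ = 2 ⟨Φ u, u̇⟩`. -/
lemma Regular.energy (R : Φ.Regular τ) {t : ℝ} (ht : 0 ≤ t) {u₀ v₀ : ℝ → Fin n → ℝ}
    {u g : Fin (k + 1) → ℝ → ℝ → Fin n → ℝ}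
    (h₀ : ∀ a, IsPrim (fun σ => u₀ σ a) (fun σ => v₀ σ a) 0 t)
    (hc : ∀ σ ∈ Set.Icc 0 t, ∀ i, ContinuousOn (u i σ) (Set.Icc (-τ i) 0))
    (hg : ∀ i a, MemLp (fun p : ℝ × ℝ => g i p.1 p.2 a) 2 (rect t (-τ i) 0))
    (hu : ∀ i, ∀ σ ∈ Set.Icc 0 t, ∀ᵐ s ∂(volume.restrict (Set.Ioc (-τ i) 0)),
      ∀ a, u i σ s a = ∫ σ' in (0 : ℝ)..σ, g i σ' s a) :
    IsPrim (fun σ => pairing τ (Φ.op₀ τ (u₀ σ) (fun i => u i σ))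
        (Φ.op₁ τ (u₀ σ) (fun i => u i σ)) (u₀ σ) (fun i => u i σ))
      (fun σ => 2 * pairing τ (Φ.op₀ τ (u₀ σ) (fun i => u i σ))
        (Φ.op₁ τ (u₀ σ) (fun i => u i σ)) (v₀ σ) (fun i => g i σ)) 0 t := by
  set T := τ (Fin.last k) with hT
  have hm : ∀ i a, IsPrim (fun σ => Φ.mom τ (fun i => u i σ) i a)
      (fun σ => Φ.mom τ (fun i => g i σ) i a) 0 t := fun i =>
    isPrim_moment ht (R.neg_le i) (R.W_cont i) (hg i) (hu i)
  -- Square integrability on the rectangle makes only almost every time slice integrable. That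
  -- suffices, since the derivative is needed only almost everywhere.
  have hgσ : ∀ᵐ σ ∂(volume.restrict (Set.Ioc 0 t)), ∀ i a,
      IntervalIntegrable (fun s => g i σ s a) volume (-τ i) 0 := by
    refine ae_all_iff.2 fun i => ae_all_iff.2 fun a => ?_
    filter_upwards [((hg i a).integrable (by norm_num)).prod_right_ae] with σ hσ
    rw [intervalIntegrable_iff_integrableOn_Ioc_of_le (R.neg_le i)]
    exact hσ
  -- The form is differentiated term by term: bilinear expressions in the present state and the
  -- moments, plus one genuine integral with kernel `S`. Symmetry afterwards merges the resulting
  -- pairs into twice one term.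
  have key : IsPrim (fun σ => Φ.bil τ (u₀ σ) (fun i => u i σ) (u₀ σ) (fun i => u i σ))
      (fun σ => T * (v₀ σ ⬝ᵥ Φ.P *ᵥ u₀ σ + u₀ σ ⬝ᵥ Φ.P *ᵥ v₀ σ)
        + T * (∑ i, (v₀ σ ⬝ᵥ Φ.H i *ᵥ Φ.mom τ (fun i => u i σ) i
            + u₀ σ ⬝ᵥ Φ.H i *ᵥ Φ.mom τ (fun i => g i σ) i))
        + T * (∑ i, (v₀ σ ⬝ᵥ Φ.H i *ᵥ Φ.mom τ (fun i => u i σ) i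
            + u₀ σ ⬝ᵥ Φ.H i *ᵥ Φ.mom τ (fun i => g i σ) i))
        + T * (∑ i, ∫ s in (-τ i)..0,
            (g i σ s ⬝ᵥ Φ.S i s *ᵥ u i σ s + u i σ s ⬝ᵥ Φ.S i s *ᵥ g i σ s))
        + ∑ i, ∑ j, (Φ.mom τ (fun i => g i σ) i ⬝ᵥ Φ.Γ i j *ᵥ Φ.mom τ (fun i => u i σ) j
            + Φ.mom τ (fun i => u i σ) i ⬝ᵥ Φ.Γ i j *ᵥ Φ.mom τ (fun i => g i σ) j)) 0 t := by
    unfold bil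
    refine ((((IsPrim.const_mul ?_ _).add (IsPrim.const_mul ?_ _)).add
      (IsPrim.const_mul ?_ _)).add (IsPrim.const_mul ?_ _)).add ?_
    · exact IsPrim.dot_mulVec ht _ h₀ h₀
    · exact IsPrim.sum _ ht fun i _ => IsPrim.dot_mulVec ht _ h₀ (hm i)
    · exact IsPrim.sum _ ht fun i _ => IsPrim.dot_mulVec ht _ h₀ (hm i)
    · exact IsPrim.sum _ ht fun i _ =>
        isPrim_integral_dot ht (R.neg_le i) (R.S_cont i) (hg i) (hg i) (hu i) (hu i)
    · exact IsPrim.sum _ ht fun i _ => IsPrim.sum _ ht fun j _ =>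
        IsPrim.dot_mulVec ht _ (hm i) (hm j)
  refine (key.congr fun σ hσ => ?_).congr_deriv ?_
  · rw [R.pairing_op (hc σ hσ)]
    exact fun i => intervalIntegrable_of_continuousOn (R.neg_le i) (hc σ hσ i)
  · filter_upwards [(ae_restrict_iff' measurableSet_Ioc).1 hgσ] with σ hσ hσt
    have hcσ := hc σ ⟨hσt.1.le, hσt.2⟩
    rw [R.pairing_op hcσ (hσ hσt)]
    have e1 : v₀ σ ⬝ᵥ Φ.P *ᵥ u₀ σ = u₀ σ ⬝ᵥ Φ.P *ᵥ v₀ σ := by rw [dot_mulVec_comm, R.P_symm]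
    have e2 : ∀ i, ∫ s in (-τ i)..0,
            (g i σ s ⬝ᵥ Φ.S i s *ᵥ u i σ s + u i σ s ⬝ᵥ Φ.S i s *ᵥ g i σ s)
        = 2 * ∫ s in (-τ i)..0, u i σ s ⬝ᵥ Φ.S i s *ᵥ g i σ s := by
      intro i
      rw [← intervalIntegral.integral_const_mul]
      refine intervalIntegral.integral_congr fun s hs => ?_
      rw [Set.uIcc_of_le (R.neg_le i)] at hs
      rw [dot_mulVec_comm _ (g i σ s), R.S_symm i s hs]
      ring
    have e3 : ∑ i, ∑ j, Φ.mom τ (fun i => g i σ) i ⬝ᵥ Φ.Γ i j *ᵥ Φ.mom τ (fun i => u i σ) j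
        = ∑ i, ∑ j, Φ.mom τ (fun i => u i σ) i ⬝ᵥ Φ.Γ i j *ᵥ Φ.mom τ (fun i => g i σ) j := by
      rw [Finset.sum_comm]
      refine Finset.sum_congr rfl fun i _ => Finset.sum_congr rfl fun j _ => ?_
      rw [dot_mulVec_comm, R.Γ_symm]
    simp only [bil, e1, e2, Finset.sum_add_distrib, e3, ← Finset.mul_sum, ← hT]
    ring

end SepOp

/-! ### Algebra of the inverse operator -/

section InverseAlgebra

variable {α β : Type*} [Fintype α] [DecidableEq α] [Fintype β] [DecidableEq β]

/-- The identities between the blocks of an operator and the blocks of its inverse. -/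
structure InverseBlocks (P : Matrix α α ℝ) (H : Matrix α β ℝ) (K G : Matrix β β ℝ)
    (Ph : Matrix α α ℝ) (Hh : Matrix α β ℝ) (Gh : Matrix β β ℝ) : Prop where
  P_symm : Phᵀ = Ph
  G_symm : Ghᵀ = Gh
  e₁ : P * Ph + H * K * Hhᵀ = 1
  e₂ : P * Hh + H * (K * Gh + 1) = 0
  e₃ : Hhᵀ + Hᵀ * Ph + G * K * Hhᵀ = 0
  e₄ : Gh + Hᵀ * Hh + G * (K * Gh + 1) = 0

/-- Put `W = Hᵀ P⁻¹ H - G`, `D = K W - 1` and `E = D⁻¹`. As `K` and `W` are symmetric, `D K = K Dᵀ`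
and `Dᵀ W = W D`, hence `E K = K Eᵀ` and `W E = Eᵀ W`; moreover `K W E = 1 + E`. The last block
collapses to `-W E`, and the six identities follow from these relations. -/
lemma inverseBlocks {P : Matrix α α ℝ} {H : Matrix α β ℝ} {K G : Matrix β β ℝ}
    (hP : Pᵀ = P) (hPu : IsUnit P.det) (hK : Kᵀ = K) (hG : Gᵀ = G)
    (hD : IsUnit (K * Hᵀ * P⁻¹ * H - 1 - K * G).det) (hKG : IsUnit (1 + K * G).det) :
    InverseBlocks P H K G
      ((1 - P⁻¹ * H * (K * Hᵀ * P⁻¹ * H - 1 - K * G)⁻¹ * K * Hᵀ) * P⁻¹)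
      (P⁻¹ * H * (K * Hᵀ * P⁻¹ * H - 1 - K * G)⁻¹)
      (-(((P⁻¹ * H * (K * Hᵀ * P⁻¹ * H - 1 - K * G)⁻¹)ᵀ * H + G) * (1 + K * G)⁻¹)) := by
  set D := K * Hᵀ * P⁻¹ * H - 1 - K * G with hDdef
  set E := D⁻¹
  set V := Hᵀ * P⁻¹ * H with hV
  set W := V - G with hW
  have hPi : (P⁻¹)ᵀ = P⁻¹ := by rw [Matrix.transpose_nonsing_inv, hP]
  have hVt : Vᵀ = V := by
    simp only [hV, Matrix.transpose_mul, Matrix.transpose_transpose, hPi, Matrix.mul_assoc]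
  have hWt : Wᵀ = W := by rw [hW, Matrix.transpose_sub, hVt, hG]
  have hDW : D = K * W - 1 := by
    simp only [hDdef, hW, hV, Matrix.mul_sub, Matrix.mul_assoc]
    abel
  have hDt : Dᵀ = W * K - 1 := by
    rw [hDW, Matrix.transpose_sub, Matrix.transpose_mul, hWt, hK, Matrix.transpose_one]
  have hDE : D * E = 1 := Matrix.mul_nonsing_inv _ hD
  have hED : E * D = 1 := Matrix.nonsing_inv_mul _ hD
  have hDEt : Dᵀ * Eᵀ = 1 := by rw [← Matrix.transpose_mul, hED, Matrix.transpose_one]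
  have hEDt : Eᵀ * Dᵀ = 1 := by rw [← Matrix.transpose_mul, hDE, Matrix.transpose_one]
  have hKF : E * K = K * Eᵀ := by
    have h : D * K = K * Dᵀ := by
      rw [hDt, hDW]; simp only [Matrix.sub_mul, Matrix.mul_sub, Matrix.mul_assoc,
        Matrix.one_mul, Matrix.mul_one]
    calc E * K = E * (K * Dᵀ) * Eᵀ := by
          rw [Matrix.mul_assoc, Matrix.mul_assoc, hDEt, Matrix.mul_one]
      _ = K * Eᵀ := by rw [← h, ← Matrix.mul_assoc E, hED, Matrix.one_mul]
  have hWE : W * E = Eᵀ * W := by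
    have h : Dᵀ * W = W * D := by
      rw [hDt, hDW]; simp only [Matrix.sub_mul, Matrix.mul_sub, Matrix.mul_assoc,
        Matrix.one_mul, Matrix.mul_one]
    calc W * E = Eᵀ * (Dᵀ * W) * E := by
          rw [← Matrix.mul_assoc, hEDt, Matrix.one_mul]
      _ = Eᵀ * W := by rw [h, Matrix.mul_assoc, Matrix.mul_assoc, hDE, Matrix.mul_one]
  have hKWE : K * (W * E) = 1 + E := by
    have : K * W = D + 1 := by rw [hDW]; abel
    rw [← Matrix.mul_assoc, this, Matrix.add_mul, hDE, Matrix.one_mul]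
  have hWKE : W * (K * Eᵀ) = 1 + Eᵀ := by
    have : W * K = Dᵀ + 1 := by rw [hDt]; abel
    rw [← Matrix.mul_assoc, this, Matrix.add_mul, hDEt, Matrix.one_mul]
  have hHt : (P⁻¹ * H * E)ᵀ = Eᵀ * (Hᵀ * P⁻¹) := by
    rw [Matrix.transpose_mul, Matrix.transpose_mul, hPi]
  have hGh : -(((P⁻¹ * H * E)ᵀ * H + G) * (1 + K * G)⁻¹) = -(W * E) := by
    congr 1
    -- The left side is `Eᵀ (W + G) + G`. On the right, `W E K G = W K Eᵀ G = (1 + Eᵀ) G`, while `W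
    -- E = Eᵀ W`.
    have h : (P⁻¹ * H * E)ᵀ * H + G = W * E * (1 + K * G) := by
      have e1 : Eᵀ * W * (K * G) = G + Eᵀ * G := by
        rw [← hWE, ← Matrix.mul_assoc, Matrix.mul_assoc W, hKF, hWKE, Matrix.add_mul,
          Matrix.one_mul]
      rw [hHt, Matrix.mul_assoc, ← hV, hWE, Matrix.mul_add, Matrix.mul_one, e1,
        show V = W + G by rw [hW]; abel, Matrix.mul_add]
      abel
    rw [h, Matrix.mul_assoc, Matrix.mul_nonsing_inv _ hKG, Matrix.mul_one]
  have hPP : P * P⁻¹ = 1 := Matrix.mul_nonsing_inv _ hPu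
  rw [hGh]
  have hPh : (1 - P⁻¹ * H * E * K * Hᵀ) * P⁻¹ = P⁻¹ - P⁻¹ * H * (K * Eᵀ) * (Hᵀ * P⁻¹) := by
    rw [Matrix.sub_mul, Matrix.one_mul, ← hKF]
    simp only [Matrix.mul_assoc]
  have hVW : V = W + G := by rw [hW]; abel
  refine ⟨?_, ?_, ?_, ?_, ?_, ?_⟩
  · rw [hPh, Matrix.transpose_sub, hPi]
    simp only [Matrix.transpose_mul, Matrix.transpose_transpose, hPi, hK]
    rw [hKF]
    simp only [Matrix.mul_assoc]
  · rw [Matrix.transpose_neg, Matrix.transpose_mul, hWt, hWE]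
  · rw [hPh, hHt, Matrix.mul_sub, hPP]
    simp only [Matrix.mul_assoc]
    rw [← Matrix.mul_assoc P, hPP, Matrix.one_mul]
    abel
  · rw [Matrix.mul_neg, hKWE]
    simp only [Matrix.mul_assoc]
    rw [← Matrix.mul_assoc P, hPP, Matrix.one_mul, neg_add_rev, Matrix.mul_add, Matrix.mul_add,
      Matrix.mul_neg, Matrix.mul_neg]
    abel
  · rw [hPh, hHt, Matrix.mul_sub]
    have e1 : Hᵀ * (P⁻¹ * H * (K * Eᵀ) * (Hᵀ * P⁻¹)) = V * (K * Eᵀ) * (Hᵀ * P⁻¹) := by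
      simp only [hV, Matrix.mul_assoc]
    rw [e1, hVW, Matrix.add_mul, hWKE]
    simp only [Matrix.add_mul, Matrix.mul_assoc, Matrix.one_mul]
    abel
  · have e1 : Hᵀ * (P⁻¹ * H * E) = V * E := by simp only [hV, Matrix.mul_assoc]
    rw [e1, hVW, Matrix.mul_neg, hKWE, Matrix.add_mul, neg_add_rev, Matrix.mul_add,
      Matrix.mul_add, Matrix.mul_neg, Matrix.mul_neg, Matrix.mul_one]
    abel

end InverseAlgebra

/-! ### Block vectors -/

section Blocks

variable {ι α β : Type*} [Fintype ι] [Fintype α] [Fintype β]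

lemma blockRow_mulVec {α : Type*} (M : ι → Matrix α β ℝ) (v : β × ι → ℝ) :
    blockRow M *ᵥ v = ∑ i, M i *ᵥ fun b => v (b, i) := by
  funext x
  simp only [blockRow, Matrix.mulVec, dotProduct, Matrix.of_apply, Fintype.sum_prod_type,
    Finset.sum_apply]
  exact Finset.sum_comm

lemma blockCol_mulVec {ι α : Type*} (M : ι → Matrix α β ℝ) (v : β → ℝ) (a : α) (i : ι) :
    (blockCol M *ᵥ v) (a, i) = (M i *ᵥ v) a := rfl

lemma blockDiagonal_mulVec {α : Type*} [DecidableEq ι] (M : ι → Matrix α β ℝ) (v : β × ι → ℝ)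
    (a : α) (i : ι) : (Matrix.blockDiagonal M *ᵥ v) (a, i) = (M i *ᵥ fun b => v (b, i)) a := by
  simp only [Matrix.mulVec, dotProduct, Matrix.blockDiagonal_apply, Fintype.sum_prod_type,
    ite_mul, zero_mul, Finset.sum_ite_eq, Finset.mem_univ, if_true]

lemma submatrix_mulVec_sum {α γ : Type*} (M : Matrix α (β × ι) ℝ) (f : γ → α)
    (v : β × ι → ℝ) (c : γ) :
    (∑ j, M.submatrix f (fun b => (b, j)) *ᵥ fun b => v (b, j)) c = (M *ᵥ v) (f c) := by
  simp only [Finset.sum_apply, Matrix.mulVec, dotProduct, Matrix.submatrix_apply,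
    Fintype.sum_prod_type]
  exact Finset.sum_comm

end Blocks

/-! ### Polynomial matrices -/

section PolyMat

variable {α β : Type*}

lemma continuous_ev (M : Matrix α β ℝ[X]) (a : α) (b : β) :
    Continuous fun s => ev M s a b := (M a b).continuous

lemma ev_det [Fintype α] [DecidableEq α] (M : Matrix α α ℝ[X]) (s : ℝ) :
    (ev M s).det = M.det.eval s :=
  ((Polynomial.evalRingHom s).map_det M).symm

/-- By Cramer's rule the entries of the inverse are quotients of polynomials in `s`; continuity and
absolute continuity of `S⁻¹` come from here. -/
lemma ev_inv [Fintype α] [DecidableEq α] (M : Matrix α α ℝ[X]) (s : ℝ) (a b : α) :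
    (ev M s)⁻¹ a b = (M.det.eval s)⁻¹ * (M.adjugate a b).eval s := by
  have h : (ev M s).adjugate = ev M.adjugate s :=
    ((Polynomial.evalRingHom s).map_adjugate M).symm
  rw [Matrix.inv_def, Matrix.smul_apply, h, ev_det, Ring.inverse_eq_inv']
  rfl

lemma continuousOn_ev_inv [Fintype α] [DecidableEq α] {M : Matrix α α ℝ[X]} {I : Set ℝ}
    (h : ∀ s ∈ I, (ev M s).det ≠ 0) (a b : α) :
    ContinuousOn (fun s => (ev M s)⁻¹ a b) I := by
  simp only [ev_inv]
  refine ContinuousOn.mul (ContinuousOn.inv₀ (Polynomial.continuous _).continuousOn ?_)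
    (Polynomial.continuous _).continuousOn
  intro s hs
  rw [← ev_det]
  exact h s hs

lemma coeff_eq_zero_of_forall_Icc {D : ℕ} {c : Fin (D + 1) → ℝ} {a b : ℝ} (hab : a < b)
    (h : ∀ s ∈ Set.Icc a b, ∑ i, c i * s ^ (i : ℕ) = 0) : c = 0 := by
  set p : ℝ[X] := ∑ i : Fin (D + 1), Polynomial.C (c i) * Polynomial.X ^ (i : ℕ)
  have hp : p = 0 := by
    refine Polynomial.eq_zero_of_infinite_isRoot p ((Set.Icc_infinite hab).mono fun s hs => ?_)
    simp only [Set.mem_ofPred_eq, Polynomial.IsRoot, p, Polynomial.eval_finsetSum,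
      Polynomial.eval_mul, Polynomial.eval_C, Polynomial.eval_pow, Polynomial.eval_X]
    exact h s hs
  funext i
  have h1 := congrArg (fun q => Polynomial.coeff q (i : ℕ)) hp
  simp only [p, Polynomial.finsetSum_coeff, Polynomial.coeff_C_mul, Polynomial.coeff_X_pow,
    Polynomial.coeff_zero] at h1
  rw [Finset.sum_eq_single i] at h1
  · simpa using h1
  · intro j _ hj
    rw [if_neg (fun h => hj (Fin.ext h.symm)), mul_zero]
  · simp

/-- A polynomial with infinitely many roots vanishes; this is used in `θ` and then in `s`. It passes
the symmetry of the functions `R i j` on to their coefficient matrices `Γ i j`. -/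
lemma mono₁_dot_eq_zero {D n : ℕ} {a b a' b' : ℝ} (hab : a < b) (hab' : a' < b')
    {N : Matrix (Fin (D + 1) × Fin n) (Fin (D + 1) × Fin n) ℝ}
    (h : ∀ s ∈ Set.Icc a b, ∀ θ ∈ Set.Icc a' b',
      (mono₁ D (Fin n) s)ᵀ * N * mono₁ D (Fin n) θ = 0) : N = 0 := by
  have h1 : ∀ (x y : Fin n), ∀ s ∈ Set.Icc a b, ∀ θ ∈ Set.Icc a' b',
      ∑ j : Fin (D + 1), (∑ i : Fin (D + 1), N (i, x) (j, y) * s ^ (i : ℕ)) * θ ^ (j : ℕ) = 0 := by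
    intro x y s hs θ hθ
    have := congrFun (congrFun (h s hs θ hθ) x) y
    simp only [Matrix.mul_apply, Matrix.transpose_apply, mono₁, Matrix.of_apply,
      Fintype.sum_prod_type, ite_mul, zero_mul, mul_ite, mul_zero, Finset.sum_ite_eq',
      Finset.mem_univ, if_true, Matrix.zero_apply] at this
    rw [← this]
    refine Finset.sum_congr rfl fun j _ => ?_
    congr 1
    exact Finset.sum_congr rfl fun i _ => mul_comm _ _
  ext ⟨i, x⟩ ⟨j, y⟩
  have h2 : ∀ s ∈ Set.Icc a b, ∑ i : Fin (D + 1), N (i, x) (j, y) * s ^ (i : ℕ) = 0 := by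
    intro s hs
    exact congrFun (coeff_eq_zero_of_forall_Icc
      (c := fun j => ∑ i : Fin (D + 1), N (i, x) (j, y) * s ^ (i : ℕ)) hab' (h1 x y s hs)) j
  exact congrFun (coeff_eq_zero_of_forall_Icc (c := fun i => N (i, x) (j, y)) hab h2) i

end PolyMat

/-! ### Shifted quadruples -/

section Shift

variable {k : ℕ} {μ ν : Type*} [Fintype μ] [Fintype ν] [DecidableEq ν]
  {τ : Fin (k + 1) → ℝ}

/-- The shifts are what makes positivity coercive and what leaves quadratic reserves in the
dissipation inequalities; this computes their share of the form. -/
lemma Params.form_shift (Θ : Params (Fin (k + 1)) μ ν) (U : Matrix μ μ ℝ) (c : ℝ) (v : μ → ℝ)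
    {h : Fin (k + 1) → ℝ → ν → ℝ}
    (hS : ∀ i, IntervalIntegrable (fun s => h i s ⬝ᵥ Θ.S i s *ᵥ h i s) volume (-τ i) 0)
    (hh : ∀ i, IntervalIntegrable (fun s => h i s ⬝ᵥ h i s) volume (-τ i) 0) :
    (Θ.shift U c).form τ v h = Θ.form τ v h + τ (Fin.last k) * (v ⬝ᵥ U *ᵥ v)
      + τ (Fin.last k) * (c * ∑ i, ∫ s in (-τ i)..0, h i s ⬝ᵥ h i s) := by
  have e : ∀ i, ∫ s in (-τ i)..0, h i s ⬝ᵥ (Θ.S i s + c • (1 : Matrix ν ν ℝ)) *ᵥ h i s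
      = (∫ s in (-τ i)..0, h i s ⬝ᵥ Θ.S i s *ᵥ h i s)
        + c * ∫ s in (-τ i)..0, h i s ⬝ᵥ h i s := by
    intro i
    simp only [Matrix.add_mulVec, Matrix.smul_mulVec, Matrix.one_mulVec, dotProduct_add,
      dotProduct_smul, smul_eq_mul]
    rw [intervalIntegral.integral_add (hS i) ((hh i).const_mul c),
      intervalIntegral.integral_const_mul]
  simp only [Params.form, Params.shift, e, Finset.sum_add_distrib, ← Finset.mul_sum]
  rw [Matrix.add_mulVec, dotProduct_add]
  ring

lemma Params.form_neg {μ ν : Type*} [Fintype μ] [Fintype ν] (Θ : Params (Fin (k + 1)) μ ν)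
    (v : μ → ℝ) (h : Fin (k + 1) → ℝ → ν → ℝ) : Θ.neg.form τ v h = -Θ.form τ v h := by
  simp only [Params.form, Params.neg, Matrix.neg_mulVec, dotProduct_neg,
    intervalIntegral.integral_neg, Finset.sum_neg_distrib]
  ring

end Shift

/-! ### The operator of a polynomial quadruple and its inverse -/

namespace PolyParams

variable {k n : ℕ}

/-- The operator of a polynomial quadruple, in separable form. -/
def sep (Θ : PolyParams k n) : SepOp k n (Fin (Θ.deg + 1) × Fin n) where
  P := Θ.P
  H := Θ.H
  W := fun _ => mono₁ Θ.deg (Fin n)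
  S := fun i s => ev (Θ.S i) s
  Γ := Θ.Γ

/-- `𝐊 = diag(∫ Y S_i⁻¹ Yᵀ)`. -/
def Kb (τ : Fin (k + 1) → ℝ) (Θ : PolyParams k n) :
    Matrix ((Fin (Θ.deg + 1) × Fin n) × Fin (k + 1)) ((Fin (Θ.deg + 1) × Fin n) × Fin (k + 1)) ℝ :=
  Matrix.blockDiagonal fun i => matInt (-τ i) 0 fun s =>
    mono₁ Θ.deg (Fin n) s * (ev (Θ.S i) s)⁻¹ * (mono₁ Θ.deg (Fin n) s)ᵀ

/-- `𝚪 = τ_K⁻¹ (Γ_ij)`. -/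
def Γb (τ : Fin (k + 1) → ℝ) (Θ : PolyParams k n) :
    Matrix ((Fin (Θ.deg + 1) × Fin n) × Fin (k + 1)) ((Fin (Θ.deg + 1) × Fin n) × Fin (k + 1)) ℝ :=
  (τ (Fin.last k))⁻¹ • blockCol fun i => blockRow fun j => Θ.Γ i j

/-- `Ĥ = P⁻¹ 𝐇 (𝐊 𝐇ᵀ P⁻¹ 𝐇 - I - 𝐊 𝚪)⁻¹`. -/
def Hh (τ : Fin (k + 1) → ℝ) (Θ : PolyParams k n) :
    Matrix (Fin n) ((Fin (Θ.deg + 1) × Fin n) × Fin (k + 1)) ℝ :=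
  Θ.P⁻¹ * blockRow Θ.H *
    (Θ.Kb τ * (blockRow Θ.H)ᵀ * Θ.P⁻¹ * blockRow Θ.H - 1 - Θ.Kb τ * Θ.Γb τ)⁻¹

/-- `Γ̂ = -(Ĥᵀ 𝐇 + 𝚪) (I + 𝐊 𝚪)⁻¹`. -/
def Γh (τ : Fin (k + 1) → ℝ) (Θ : PolyParams k n) :
    Matrix ((Fin (Θ.deg + 1) × Fin n) × Fin (k + 1)) ((Fin (Θ.deg + 1) × Fin n) × Fin (k + 1)) ℝ :=
  -(((Θ.Hh τ)ᵀ * blockRow Θ.H + Θ.Γb τ) * (1 + Θ.Kb τ * Θ.Γb τ)⁻¹)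

/-- The inverse of the operator of a polynomial quadruple, in separable form. -/
def invSep (τ : Fin (k + 1) → ℝ) (Θ : PolyParams k n) :
    SepOp k n (Fin (Θ.deg + 1) × Fin n) where
  P := (1 - Θ.Hh τ * Θ.Kb τ * (blockRow Θ.H)ᵀ) * Θ.P⁻¹
  H := fun i => (τ (Fin.last k))⁻¹ • (Θ.Hh τ).submatrix id fun a => (a, i)
  W := fun i s => mono₁ Θ.deg (Fin n) s * (ev (Θ.S i) s)⁻¹
  S := fun i s => ((τ (Fin.last k))⁻¹ ^ 2) • (ev (Θ.S i) s)⁻¹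
  Γ := fun i j => (τ (Fin.last k))⁻¹ • (Θ.Γh τ).submatrix (fun a => (a, i)) fun b => (b, j)

lemma inverse_P (τ : Fin (k + 1) → ℝ) (Θ : PolyParams k n) :
    (Θ.inverse τ).P = (Θ.invSep τ).P := rfl

lemma inverse_Q (τ : Fin (k + 1) → ℝ) (Θ : PolyParams k n) (i : Fin (k + 1)) (s : ℝ) :
    (Θ.inverse τ).Q i s = (Θ.invSep τ).H i * (Θ.invSep τ).W i s := by
  change (τ (Fin.last k))⁻¹ • ((Θ.Hh τ).submatrix id (fun a => (a, i)) * mono₁ Θ.deg (Fin n) s *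
    (ev (Θ.S i) s)⁻¹) = ((τ (Fin.last k))⁻¹ • (Θ.Hh τ).submatrix id fun a => (a, i)) *
      (mono₁ Θ.deg (Fin n) s * (ev (Θ.S i) s)⁻¹)
  rw [Matrix.smul_mul, Matrix.mul_assoc]

lemma inverse_S (τ : Fin (k + 1) → ℝ) (Θ : PolyParams k n) (i : Fin (k + 1)) (s : ℝ) :
    (Θ.inverse τ).S i s = (Θ.invSep τ).S i s := rfl

/-- The inverse quadruple has the left factor `S⁻¹ Yᵀ`, the separable form has `(Y S⁻¹)ᵀ`; they
agree where `S` is symmetric. -/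
lemma inverse_R {τ : Fin (k + 1) → ℝ} {Θ : PolyParams k n} {i : Fin (k + 1)} (j : Fin (k + 1))
    {s : ℝ} (θ : ℝ) (hS : (ev (Θ.S i) s)ᵀ = ev (Θ.S i) s) :
    (Θ.inverse τ).R i j s θ
      = ((Θ.invSep τ).W i s)ᵀ * (Θ.invSep τ).Γ i j * (Θ.invSep τ).W j θ := by
  change (τ (Fin.last k))⁻¹ • ((ev (Θ.S i) s)⁻¹ * (mono₁ Θ.deg (Fin n) s)ᵀ
        * (Θ.Γh τ).submatrix (fun a => (a, i)) (fun b => (b, j)) * mono₁ Θ.deg (Fin n) θ *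
          (ev (Θ.S j) θ)⁻¹) =
    (mono₁ Θ.deg (Fin n) s * (ev (Θ.S i) s)⁻¹)ᵀ *
      ((τ (Fin.last k))⁻¹ • (Θ.Γh τ).submatrix (fun a => (a, i)) fun b => (b, j)) *
      (mono₁ Θ.deg (Fin n) θ * (ev (Θ.S j) θ)⁻¹)
  rw [Matrix.transpose_mul, Matrix.transpose_nonsing_inv, hS, Matrix.mul_smul, Matrix.smul_mul]
  simp only [Matrix.mul_assoc]

variable {d : ℕ} {τ : Fin (k + 1) → ℝ} {Θ : PolyParams k n} {ε : ℝ}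

/-- Membership of the shifted quadruple makes `S i s - ε I` positive semidefinite, and adding `ε I`
back makes it definite. -/
lemma S_posDef (hτ : ∀ i, 0 < τ i) (hε : 0 < ε) (hΘ : Θ.eval.shift (-ε • 1) (-ε) ∈ Xi d τ)
    (i : Fin (k + 1)) {s : ℝ} (hs : s ∈ Set.Icc (-τ i) 0) : (ev (Θ.S i) s).PosDef := by
  have h := Xi.S_posSemidef hτ hΘ i hs
  have h1 : (ε • (1 : Matrix (Fin n) (Fin n) ℝ)).PosDef := Matrix.PosDef.one.smul hε
  have h2 := h1.add_posSemidef h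
  convert h2 using 1
  simp only [Params.shift, PolyParams.eval]
  simp

/-- Every symmetry is read off from membership in Ξ. For `Γ` it is first known for the functions `R
i j` and then transferred to coefficients by `mono₁_dot_eq_zero`. -/
lemma sep_regular (hτ : ∀ i, 0 < τ i) (hε : 0 < ε)
    (hΘ : Θ.eval.shift (-ε • 1) (-ε) ∈ Xi d τ) : Θ.sep.Regular τ where
  pos := hτ
  W_cont := fun _ a b => ((continuous_mono₁ _ _).matrix_elem a b).continuousOn
  S_cont := fun i a b => (continuous_ev (Θ.S i) a b).continuousOn
  P_symm := by
    have h := Xi.P_transpose hΘ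
    simp only [Params.shift, PolyParams.eval, Matrix.transpose_add, Matrix.transpose_smul,
      Matrix.transpose_one, add_left_inj] at h
    exact h
  S_symm := fun i s hs => (Matrix.conjTranspose_eq_transpose_of_trivial _).symm.trans
    (S_posDef hτ hε hΘ i hs).1
  Γ_symm := fun i j => by
    have key : (Θ.Γ i j)ᵀ - Θ.Γ j i = 0 := by
      refine mono₁_dot_eq_zero (a := -τ j) (b := 0) (a' := -τ i) (b' := 0)
        (by linarith [hτ j]) (by linarith [hτ i]) fun s hs θ hθ => ?_
      have h := Xi.R_transpose hτ hΘ i j hθ hs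
      simp only [Params.shift, PolyParams.eval, Matrix.transpose_mul,
        Matrix.transpose_transpose] at h
      rw [Matrix.mul_sub, Matrix.sub_mul, ← h, sub_eq_zero, Matrix.mul_assoc]
    exact sub_eq_zero.1 key

lemma form_eq_pairing (R : Θ.sep.Regular τ) (h₀ : Fin n → ℝ) {h : Fin (k + 1) → ℝ → Fin n → ℝ}
    (hh : ∀ i, ContinuousOn (h i) (Set.Icc (-τ i) 0)) :
    Θ.eval.form τ h₀ h = pairing τ (Θ.sep.op₀ τ h₀ h) (Θ.sep.op₁ τ h₀ h) h₀ h := by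
  have hi : ∀ i a, IntervalIntegrable (fun s => h i s a) volume (-τ i) 0 :=
    fun i => intervalIntegrable_of_continuousOn (R.neg_le i) (hh i)
  rw [R.pairing_op hh hi]
  have hW : ∀ i a, IntervalIntegrable
      (fun s => (mono₁ Θ.deg (Fin n) s *ᵥ h i s) a) volume (-τ i) 0 :=
    fun i => intervalIntegrable_mulVec (R.neg_le i) (R.W_cont i) (hi i)
  have e1 : ∀ i, ∫ s in (-τ i)..0, h₀ ⬝ᵥ (Θ.H i * mono₁ Θ.deg (Fin n) s) *ᵥ h i s
      = h₀ ⬝ᵥ Θ.H i *ᵥ Θ.sep.mom τ h i := by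
    intro i
    rw [SepOp.mom]
    simp only [sep]
    rw [dot_mulVec_comm, dotProduct_comm, dot_vint _ (hW i)]
    refine intervalIntegral.integral_congr fun s _ => ?_
    simp only [← Matrix.mulVec_mulVec, transpose_mulVec_dot]
  have e2 : ∀ i j, ∫ s in (-τ i)..0, ∫ θ in (-τ j)..0, h i s ⬝ᵥ
      ((mono₁ Θ.deg (Fin n) s)ᵀ * Θ.Γ i j * mono₁ Θ.deg (Fin n) θ) *ᵥ h j θ
      = Θ.sep.mom τ h i ⬝ᵥ Θ.Γ i j *ᵥ Θ.sep.mom τ h j := by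
    intro i j
    have e3 : ∀ s, ∫ θ in (-τ j)..0, h i s ⬝ᵥ
        ((mono₁ Θ.deg (Fin n) s)ᵀ * Θ.Γ i j * mono₁ Θ.deg (Fin n) θ) *ᵥ h j θ
        = (Θ.Γ i j *ᵥ Θ.sep.mom τ h j) ⬝ᵥ mono₁ Θ.deg (Fin n) s *ᵥ h i s := by
      intro s
      have : ∀ θ, h i s ⬝ᵥ
          ((mono₁ Θ.deg (Fin n) s)ᵀ * Θ.Γ i j * mono₁ Θ.deg (Fin n) θ) *ᵥ h j θ
          = ((Θ.Γ i j)ᵀ *ᵥ (mono₁ Θ.deg (Fin n) s *ᵥ h i s)) ⬝ᵥ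
            (mono₁ Θ.deg (Fin n) θ *ᵥ h j θ) := by
        intro θ
        rw [transpose_mulVec_dot, ← Matrix.mulVec_mulVec, ← Matrix.mulVec_mulVec,
          dot_mulVec_comm, Matrix.transpose_transpose, dotProduct_comm]
      simp_rw [this]
      rw [← dot_vint _ (hW j), transpose_mulVec_dot, dotProduct_comm]
      rfl
    simp_rw [e3]
    rw [← dot_vint _ (hW i), dotProduct_comm]
    rfl
  simp only [Params.form, PolyParams.eval, e1, e2, SepOp.bil]
  simp only [sep]
  ring

/-- The form of the shifted quadruple is nonnegative, and the shift subtracts exactly `ε T (|h₀|² +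
∑ ∫ |hᵢ|²)`. The factor `T` on the histories gives the present and the past the same weight. -/
lemma coercive (hτ : ∀ i, 0 < τ i) (hε : 0 < ε) (hΘ : Θ.eval.shift (-ε • 1) (-ε) ∈ Xi d τ)
    (h₀ : Fin n → ℝ) {h : Fin (k + 1) → ℝ → Fin n → ℝ}
    (hh : ∀ i, ContinuousOn (h i) (Set.Icc (-τ i) 0)) :
    ε * pairing τ h₀ (fun i s => τ (Fin.last k) • h i s) h₀ h
      ≤ pairing τ (Θ.sep.op₀ τ h₀ h) (Θ.sep.op₁ τ h₀ h) h₀ h := by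
  have R := sep_regular hτ hε hΘ
  have hi : ∀ i a, IntervalIntegrable (fun s => h i s a) volume (-τ i) 0 :=
    fun i => intervalIntegrable_of_continuousOn (R.neg_le i) (hh i)
  have h1 := Xi.form_nonneg hτ hΘ h₀ hh
  rw [Params.form_shift, form_eq_pairing R h₀ hh] at h1
  · simp only [Matrix.smul_mulVec, Matrix.one_mulVec, dotProduct_smul, smul_eq_mul] at h1
    have e : pairing τ h₀ (fun i s => τ (Fin.last k) • h i s) h₀ h
        = τ (Fin.last k) * (h₀ ⬝ᵥ h₀)
          + τ (Fin.last k) * ∑ i, ∫ s in (-τ i)..0, h i s ⬝ᵥ h i s := by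
      simp only [pairing, smul_dotProduct, smul_eq_mul, intervalIntegral.integral_const_mul,
        Finset.mul_sum]
    rw [e]
    linarith
  · intro i
    exact intervalIntegrable_dot (R.neg_le i) (hh i)
      (intervalIntegrable_mulVec (R.neg_le i) (R.S_cont i) (hi i))
  · exact fun i => intervalIntegrable_dot (R.neg_le i) (hh i) (hi i)

end PolyParams

/-! ### Coercivity and the explicit inverse operator -/

namespace PolyParams

variable {k n d : ℕ} {τ : Fin (k + 1) → ℝ} {Θ : PolyParams k n} {ε : ℝ}

lemma vint_mulVec_eq_zero {α : Type*} {m : ℕ} {a b : ℝ} (hab : a ≤ b) {h : ℝ → Fin m → ℝ}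
    (hh : ContinuousOn h (Set.Icc a b)) (h0 : ∫ s in a..b, h s ⬝ᵥ h s ≤ 0)
    (M : ℝ → Matrix α (Fin m) ℝ) : vint a b (fun s => M s *ᵥ h s) = 0 := by
  have hnn : 0 ≤ ∫ s in a..b, h s ⬝ᵥ h s :=
    intervalIntegral.integral_nonneg hab fun s _ => Finset.sum_nonneg fun i _ => mul_self_nonneg _
  have hint : IntervalIntegrable (fun s => h s ⬝ᵥ h s) volume a b :=
    intervalIntegrable_dot hab hh (intervalIntegrable_of_continuousOn hab hh)
  have hz := (intervalIntegral.integral_eq_zero_iff_of_le_of_nonneg_ae hab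
    (Filter.Eventually.of_forall fun s => Finset.sum_nonneg fun i _ => mul_self_nonneg _) hint).1
    (le_antisymm h0 hnn)
  funext i
  simp only [vint, Pi.zero_apply]
  rw [intervalIntegral.integral_of_le hab]
  refine integral_eq_zero_of_ae ?_
  filter_upwards [hz] with s hs
  have : h s = 0 := dotProduct_self_eq_zero.1 hs
  simp [this]

/-- Coercivity forces the histories to vanish almost everywhere, and with them all their moments. -/
lemma mom_eq_zero (hτ : ∀ i, 0 < τ i) (hε : 0 < ε) (hΘ : Θ.eval.shift (-ε • 1) (-ε) ∈ Xi d τ)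
    {h₀ : Fin n → ℝ} {h : Fin (k + 1) → ℝ → Fin n → ℝ}
    (hh : ∀ i, ContinuousOn (h i) (Set.Icc (-τ i) 0))
    (h0 : pairing τ (Θ.sep.op₀ τ h₀ h) (Θ.sep.op₁ τ h₀ h) h₀ h ≤ 0) (i : Fin (k + 1)) :
    Θ.sep.mom τ h i = 0 := by
  have hc := (coercive hτ hε hΘ h₀ hh).trans h0
  have hT : 0 < τ (Fin.last k) := hτ _
  have hle : ∀ i, -τ i ≤ 0 := fun i => by linarith [hτ i]
  have hnn : ∀ i, 0 ≤ ∫ s in (-τ i)..0, h i s ⬝ᵥ h i s := fun i =>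
    intervalIntegral.integral_nonneg (hle i)
      fun s _ => Finset.sum_nonneg fun i _ => mul_self_nonneg _
  have h1 : pairing τ h₀ (fun i s => τ (Fin.last k) • h i s) h₀ h ≤ 0 :=
    nonpos_of_mul_nonpos_right hc hε
  simp only [pairing, smul_dotProduct, smul_eq_mul, intervalIntegral.integral_const_mul] at h1
  rw [← Finset.mul_sum, ← mul_add] at h1
  have h2 := nonpos_of_mul_nonpos_right h1 hT
  have h3 : 0 ≤ h₀ ⬝ᵥ h₀ := Finset.sum_nonneg fun i _ => mul_self_nonneg _
  have h4 : ∫ s in (-τ i)..0, h i s ⬝ᵥ h i s ≤ 0 :=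
    (Finset.single_le_sum (fun j _ => hnn j) (Finset.mem_univ i)).trans (by linarith)
  exact vint_mulVec_eq_zero (hle i) (hh i) h4 _

lemma isUnit_det_of_ker {α : Type*} [Fintype α] [DecidableEq α] {M : Matrix α α ℝ}
    (h : ∀ v, M *ᵥ v = 0 → v = 0) : IsUnit M.det := by
  rw [isUnit_iff_ne_zero]
  intro h0
  obtain ⟨v, hv, hv0⟩ := Matrix.exists_mulVec_eq_zero_iff.2 h0
  exact hv (h v hv0)

/-- Tested on zero histories, positivity gives `v·P v ≥ ε |v|²`, so `P` has no kernel. -/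
lemma isUnit_det_P (hτ : ∀ i, 0 < τ i) (hε : 0 < ε)
    (hΘ : Θ.eval.shift (-ε • 1) (-ε) ∈ Xi d τ) : IsUnit Θ.P.det := by
  refine isUnit_det_of_ker fun v hv => ?_
  have hT : 0 < τ (Fin.last k) := hτ _
  have h := Xi.form_nonneg hτ hΘ v (h := fun _ _ => 0) fun i => continuousOn_const
  simp only [Params.form, Params.shift, PolyParams.eval, Matrix.add_mulVec, hv,
    Matrix.smul_mulVec, Matrix.one_mulVec, Matrix.mulVec_zero, dotProduct_zero, zero_add,
    dotProduct_smul, smul_eq_mul, intervalIntegral.integral_zero, Finset.sum_const_zero,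
    mul_zero, add_zero] at h
  have h1 : 0 ≤ v ⬝ᵥ v := Finset.sum_nonneg fun i _ => mul_self_nonneg _
  have h2 : 0 ≤ (τ (Fin.last k) * ε) * -(v ⬝ᵥ v) := by linarith
  have h3 := nonneg_of_mul_nonneg_right h2 (mul_pos hT hε)
  exact dotProduct_self_eq_zero.1 (by linarith)

lemma S_inv_cont (hτ : ∀ i, 0 < τ i) (hε : 0 < ε)
    (hΘ : Θ.eval.shift (-ε • 1) (-ε) ∈ Xi d τ) (i : Fin (k + 1)) (a b : Fin n) :
    ContinuousOn (fun s => (ev (Θ.S i) s)⁻¹ a b) (Set.Icc (-τ i) 0) :=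
  continuousOn_ev_inv (fun _ hs => (S_posDef hτ hε hΘ i hs).det_pos.ne') a b

lemma S_mul_inv (hτ : ∀ i, 0 < τ i) (hε : 0 < ε)
    (hΘ : Θ.eval.shift (-ε • 1) (-ε) ∈ Xi d τ) (i : Fin (k + 1)) {s : ℝ}
    (hs : s ∈ Set.Icc (-τ i) 0) : ev (Θ.S i) s * (ev (Θ.S i) s)⁻¹ = 1 :=
  Matrix.mul_nonsing_inv _ (isUnit_iff_ne_zero.2 (S_posDef hτ hε hΘ i hs).det_pos.ne')

/-- The meaning of `𝐊`: it sends `δ` to the moments of the histories `Sᵢ⁻¹ Yᵀ δᵢ`. Any `h` whose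
image under the operator has zero history part has histories of this shape. -/
lemma Kb_mulVec (hτ : ∀ i, 0 < τ i) (hε : 0 < ε) (hΘ : Θ.eval.shift (-ε • 1) (-ε) ∈ Xi d τ)
    (δ : (Fin (Θ.deg + 1) × Fin n) × Fin (k + 1) → ℝ) (i : Fin (k + 1)) :
    (fun a => (Θ.Kb τ *ᵥ δ) (a, i)) = vint (-τ i) 0 fun s => mono₁ Θ.deg (Fin n) s *ᵥ
      ((ev (Θ.S i) s)⁻¹ *ᵥ ((mono₁ Θ.deg (Fin n) s)ᵀ *ᵥ fun b => δ (b, i))) := by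
  have hle : -τ i ≤ 0 := by linarith [hτ i]
  have hY : ∀ a b, ContinuousOn (fun s => mono₁ Θ.deg (Fin n) s a b) (Set.Icc (-τ i) 0) :=
    fun a b => ((continuous_mono₁ _ _).matrix_elem a b).continuousOn
  have : (fun a => (Θ.Kb τ *ᵥ δ) (a, i)) = (matInt (-τ i) 0 fun s =>
    mono₁ Θ.deg (Fin n) s * (ev (Θ.S i) s)⁻¹ * (mono₁ Θ.deg (Fin n) s)ᵀ) *ᵥ
      fun b => δ (b, i) := by
    funext a
    rw [Kb, blockDiagonal_mulVec]
  rw [this, matInt_mulVec]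
  · simp only [← Matrix.mulVec_mulVec]
  · intro a b
    refine ContinuousOn.intervalIntegrable ?_
    rw [Set.uIcc_of_le hle]
    exact continuousOn_matrix_mul (continuousOn_matrix_mul hY (S_inv_cont hτ hε hΘ i))
      (fun a b => hY b a) a b

lemma Kb_transpose (R : Θ.sep.Regular τ) : (Θ.Kb τ)ᵀ = Θ.Kb τ := by
  rw [Kb, Matrix.blockDiagonal_transpose]
  congr 1
  funext i
  rw [transpose_matInt]
  ext a b
  refine intervalIntegral.integral_congr fun s hs => ?_
  rw [Set.uIcc_of_le (R.neg_le i)] at hs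
  have hS : (ev (Θ.S i) s)ᵀ = ev (Θ.S i) s := R.S_symm i s hs
  simp only [Matrix.transpose_mul, Matrix.transpose_transpose, Matrix.transpose_nonsing_inv, hS,
    Matrix.mul_assoc]

lemma Γb_transpose (R : Θ.sep.Regular τ) : (Θ.Γb τ)ᵀ = Θ.Γb τ := by
  rw [Γb, Matrix.transpose_smul]
  congr 1
  ext ⟨a, i⟩ ⟨b, j⟩
  exact congrFun (congrFun (R.Γ_symm j i) a) b

lemma Γb_mulVec (hT : τ (Fin.last k) ≠ 0) (c : (Fin (Θ.deg + 1) × Fin n) × Fin (k + 1) → ℝ)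
    (i : Fin (k + 1)) : (∑ j, Θ.Γ i j *ᵥ fun b => c (b, j))
      = τ (Fin.last k) • fun a => (Θ.Γb τ *ᵥ c) (a, i) := by
  funext a
  rw [← blockRow_mulVec]
  simp only [Pi.smul_apply, Γb, Matrix.smul_mulVec, blockCol_mulVec, smul_eq_mul]
  rw [mul_inv_cancel_left₀ hT]

/-- If the history `h_i = S_i⁻¹ Yᵀ δ_i` and the present state `h₀` satisfy `⟨Θ h, h⟩ = 0`, then
the moments of `h` vanish. -/
lemma ker_eq_zero (hτ : ∀ i, 0 < τ i) (hε : 0 < ε)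
    (hΘ : Θ.eval.shift (-ε • 1) (-ε) ∈ Xi d τ) {h₀ : Fin n → ℝ}
    {δ c : (Fin (Θ.deg + 1) × Fin n) × Fin (k + 1) → ℝ} (hc : Θ.Kb τ *ᵥ δ = c)
    (hδ : δ = -((blockRow Θ.H)ᵀ *ᵥ h₀ + Θ.Γb τ *ᵥ c))
    (h0 : (Θ.P *ᵥ h₀ + blockRow Θ.H *ᵥ c) ⬝ᵥ h₀ = 0) : c = 0 := by
  have hT : 0 < τ (Fin.last k) := hτ _
  have hle : ∀ i, -τ i ≤ 0 := fun i => by linarith [hτ i]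
  set h : Fin (k + 1) → ℝ → Fin n → ℝ := fun i s =>
    (ev (Θ.S i) s)⁻¹ *ᵥ ((mono₁ Θ.deg (Fin n) s)ᵀ *ᵥ fun b => δ (b, i))
  have hY : ∀ i a b, ContinuousOn (fun s => (mono₁ Θ.deg (Fin n) s)ᵀ a b) (Set.Icc (-τ i) 0) :=
    fun i a b => ((continuous_mono₁ _ _).matrix_elem b a).continuousOn
  have hh : ∀ i, ContinuousOn (h i) (Set.Icc (-τ i) 0) := fun i =>
    continuousOn_mulVec (S_inv_cont hτ hε hΘ i) (continuousOn_mulVec (hY i) continuousOn_const)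
  have hm : ∀ i, Θ.sep.mom τ h i = fun a => c (a, i) := fun i => by
    rw [← hc, Kb_mulVec hτ hε hΘ]; rfl
  have hop₀ : Θ.sep.op₀ τ h₀ h = Θ.P *ᵥ h₀ + blockRow Θ.H *ᵥ c := by
    rw [blockRow_mulVec]
    simp only [SepOp.op₀, hm]
    rfl
  have hcoef : ∀ i, Θ.sep.coef τ h₀ h i = τ (Fin.last k) • -(fun a => δ (a, i)) := by
    intro i
    simp only [SepOp.coef, hm]
    change _ + (∑ j, Θ.Γ i j *ᵥ fun b => c (b, j)) = _
    rw [Γb_mulVec hT.ne', ← smul_add]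
    congr 1
    funext a
    simp only [Pi.add_apply, Pi.neg_apply, hδ, neg_neg]
    rfl
  -- By the choice of `δ` the finite-rank part equals `-T Yᵀ δᵢ`, and the multiplication part `T Sᵢ
  -- hᵢ = T Yᵀ δᵢ` cancels it.
  have hop₁ : ∀ i, ∀ s ∈ Set.Icc (-τ i) 0, Θ.sep.op₁ τ h₀ h i s = 0 := by
    intro i s hs
    rw [SepOp.op₁, hcoef]
    change (mono₁ Θ.deg (Fin n) s)ᵀ *ᵥ _ + τ (Fin.last k) • (ev (Θ.S i) s *ᵥ h i s) = 0
    rw [Matrix.mulVec_smul, ← smul_add, Matrix.mulVec_mulVec _ (ev (Θ.S i) s),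
      S_mul_inv hτ hε hΘ i hs, Matrix.one_mulVec, Matrix.mulVec_neg, neg_add_cancel, smul_zero]
  have hp : pairing τ (Θ.sep.op₀ τ h₀ h) (Θ.sep.op₁ τ h₀ h) h₀ h ≤ 0 := by
    rw [pairing_congr hτ (x' := fun _ _ => 0) (y' := h) _ _ hop₁ (fun _ _ _ => rfl), hop₀]
    simp [pairing, h0]
  funext ⟨a, i⟩
  have := mom_eq_zero hτ hε hΘ hh hp i
  rw [hm] at this
  exact congrFun this a

/-- Both matrices inverted in the formulas have trivial kernel, by `ker_eq_zero`. A kernel vector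
`c` of the first is the moment vector of a history with present state `-P⁻¹ 𝐇 c`, whose image under
the operator is zero. A kernel vector of `1 + 𝐊 𝚪` belongs to a history with present state zero,
whose image has zero history part. In either case `⟨Θh, h⟩ = 0`, hence `c = 0`. -/
lemma invBlocks (hτ : ∀ i, 0 < τ i) (hε : 0 < ε) (hΘ : Θ.eval.shift (-ε • 1) (-ε) ∈ Xi d τ) :
    InverseBlocks Θ.P (blockRow Θ.H) (Θ.Kb τ) (Θ.Γb τ) (Θ.invSep τ).P (Θ.Hh τ) (Θ.Γh τ) := by
  have R := sep_regular hτ hε hΘ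
  have hP := isUnit_det_P hτ hε hΘ
  have hPP : Θ.P * Θ.P⁻¹ = 1 := Matrix.mul_nonsing_inv _ hP
  refine inverseBlocks R.P_symm hP (Kb_transpose R) (Γb_transpose R) ?_ ?_
  · refine isUnit_det_of_ker fun c hc => ?_
    refine ker_eq_zero hτ hε hΘ (h₀ := -(Θ.P⁻¹ *ᵥ (blockRow Θ.H *ᵥ c)))
      (δ := -((blockRow Θ.H)ᵀ *ᵥ -(Θ.P⁻¹ *ᵥ (blockRow Θ.H *ᵥ c)) + Θ.Γb τ *ᵥ c)) ?_ rfl ?_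
    · rw [Matrix.sub_mulVec, Matrix.sub_mulVec, Matrix.one_mulVec, sub_right_comm,
        sub_eq_zero] at hc
      refine Eq.trans ?_ hc
      simp only [Matrix.mulVec_neg, Matrix.mulVec_add, Matrix.mulVec_mulVec, Matrix.mul_assoc]
      abel
    · rw [Matrix.mulVec_neg, Matrix.mulVec_mulVec, hPP, Matrix.one_mulVec, neg_add_cancel,
        zero_dotProduct]
  · refine isUnit_det_of_ker fun c hc => ?_
    refine ker_eq_zero hτ hε hΘ (h₀ := 0)
      (δ := -((blockRow Θ.H)ᵀ *ᵥ 0 + Θ.Γb τ *ᵥ c)) ?_ rfl (by simp)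
    rw [Matrix.add_mulVec, Matrix.one_mulVec, add_eq_zero_iff_eq_neg] at hc
    rw [Matrix.mulVec_zero, zero_add, Matrix.mulVec_neg, Matrix.mulVec_mulVec, ← hc]

lemma invSep_regular (hτ : ∀ i, 0 < τ i) (hε : 0 < ε)
    (hΘ : Θ.eval.shift (-ε • 1) (-ε) ∈ Xi d τ) : (Θ.invSep τ).Regular τ where
  pos := hτ
  W_cont := fun i => continuousOn_matrix_mul
    (fun a b => ((continuous_mono₁ _ _).matrix_elem a b).continuousOn) (S_inv_cont hτ hε hΘ i)
  S_cont := fun i a b => continuousOn_const.mul (S_inv_cont hτ hε hΘ i a b)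
  P_symm := (invBlocks hτ hε hΘ).P_symm
  S_symm := fun i s hs => by
    have hS : (ev (Θ.S i) s)ᵀ = ev (Θ.S i) s := (sep_regular hτ hε hΘ).S_symm i s hs
    simp only [invSep, Matrix.transpose_smul, Matrix.transpose_nonsing_inv, hS]
  Γ_symm := fun i j => by
    have h := (invBlocks hτ hε hΘ).G_symm
    simp only [invSep, Matrix.transpose_smul, Matrix.transpose_submatrix, h]

/-- The operator `invSep` is a right inverse. -/
lemma op_invSep (hτ : ∀ i, 0 < τ i) (hε : 0 < ε) (hΘ : Θ.eval.shift (-ε • 1) (-ε) ∈ Xi d τ)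
    (x₀ : Fin n → ℝ) {x : Fin (k + 1) → ℝ → Fin n → ℝ}
    (hx : ∀ i, ContinuousOn (x i) (Set.Icc (-τ i) 0)) :
    Θ.sep.op₀ τ ((Θ.invSep τ).op₀ τ x₀ x) ((Θ.invSep τ).op₁ τ x₀ x) = x₀ ∧
    ∀ i, ∀ s ∈ Set.Icc (-τ i) 0,
      Θ.sep.op₁ τ ((Θ.invSep τ).op₀ τ x₀ x) ((Θ.invSep τ).op₁ τ x₀ x) i s = x i s := by
  have hT : 0 < τ (Fin.last k) := hτ _
  have hle : ∀ i, -τ i ≤ 0 := fun i => by linarith [hτ i]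
  have R := sep_regular hτ hε hΘ
  have R' := invSep_regular hτ hε hΘ
  have B := invBlocks hτ hε hΘ
  set T := τ (Fin.last k) with hTdef
  -- `y` holds the moments of `x` against `Y Sᵢ⁻¹`, and `β` the coefficients of the finite-rank part
  -- of the inverse, so that `hᵢ = Sᵢ⁻¹ Yᵀ βᵢ + T⁻¹ Sᵢ⁻¹ xᵢ`.
  set y : (Fin (Θ.deg + 1) × Fin n) × Fin (k + 1) → ℝ := fun p => (Θ.invSep τ).mom τ x p.2 p.1
  set β := (Θ.Hh τ)ᵀ *ᵥ x₀ + T⁻¹ • (Θ.Γh τ *ᵥ y) with hβ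
  set h₀ := (Θ.invSep τ).op₀ τ x₀ x with hh₀
  set h := (Θ.invSep τ).op₁ τ x₀ x with hh
  have e₀ : h₀ = (Θ.invSep τ).P *ᵥ x₀ + T⁻¹ • (Θ.Hh τ *ᵥ y) := by
    rw [hh₀, SepOp.op₀]
    congr 1
    funext a
    rw [Pi.smul_apply, show (Θ.Hh τ *ᵥ y) a = (Θ.Hh τ *ᵥ y) (id a) from rfl,
      ← submatrix_mulVec_sum (Θ.Hh τ) id y a, ← Pi.smul_apply, Finset.smul_sum]
    simp only [invSep, Matrix.smul_mulVec]
    rfl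
  have ecoef : ∀ i, (Θ.invSep τ).coef τ x₀ x i = fun a => β (a, i) := by
    intro i
    funext a
    rw [hβ, Pi.add_apply, Pi.smul_apply, ← submatrix_mulVec_sum (Θ.Γh τ) (fun a => (a, i)) y a,
      ← Pi.smul_apply, Finset.smul_sum]
    simp only [SepOp.coef, invSep, Matrix.smul_mulVec, Matrix.transpose_smul, smul_smul]
    rw [← hTdef, mul_inv_cancel₀ hT.ne', one_smul]
    rfl
  have eh : ∀ i, ∀ s ∈ Set.Icc (-τ i) 0, h i s =
      (ev (Θ.S i) s)⁻¹ *ᵥ ((mono₁ Θ.deg (Fin n) s)ᵀ *ᵥ fun b => β (b, i))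
        + T⁻¹ • ((ev (Θ.S i) s)⁻¹ *ᵥ x i s) := by
    intro i s hs
    have hS : (ev (Θ.S i) s)ᵀ = ev (Θ.S i) s := R.S_symm i s hs
    rw [hh, SepOp.op₁, ecoef]
    simp only [invSep, Matrix.transpose_mul, Matrix.transpose_nonsing_inv, hS,
      Matrix.mulVec_mulVec, Matrix.smul_mulVec, smul_smul]
    congr 2
    rw [← hTdef]; field_simp
  have hY : ∀ i a b, ContinuousOn (fun s => mono₁ Θ.deg (Fin n) s a b) (Set.Icc (-τ i) 0) :=
    fun i a b => ((continuous_mono₁ _ _).matrix_elem a b).continuousOn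
  have em : ∀ i, Θ.sep.mom τ h i = fun a => (Θ.Kb τ *ᵥ β + T⁻¹ • y) (a, i) := by
    intro i
    have h1 : Θ.sep.mom τ h i = vint (-τ i) 0 fun s =>
        mono₁ Θ.deg (Fin n) s *ᵥ ((ev (Θ.S i) s)⁻¹ *ᵥ
          ((mono₁ Θ.deg (Fin n) s)ᵀ *ᵥ fun b => β (b, i)))
        + T⁻¹ • ((Θ.invSep τ).W i s *ᵥ x i s) := by
      refine vint_congr (hle i) fun s hs => ?_
      rw [eh i s hs]
      simp only [sep, invSep, Matrix.mulVec_add, Matrix.mulVec_smul, Matrix.mulVec_mulVec]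
    rw [h1, vint_add, vint_smul, ← Kb_mulVec hτ hε hΘ]
    · rfl
    · exact intervalIntegrable_of_continuousOn (hle i) (continuousOn_mulVec (hY i)
        (continuousOn_mulVec (S_inv_cont hτ hε hΘ i)
          (continuousOn_mulVec (fun a b => hY i b a) continuousOn_const)))
    · exact intervalIntegrable_of_continuousOn (hle i)
        ((continuousOn_mulVec (R'.W_cont i) (hx i)).const_smul T⁻¹)
  -- These are the moments of the candidate preimage against `Y`. In `id₀` and `id₁` the
  -- coefficients of `x₀` and of `y` are the left sides of the identities in `InverseBlocks`: `e₁`,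
  -- `e₂` for the present component, `e₃`, `e₄` for the histories.
  set c := Θ.Kb τ *ᵥ β + T⁻¹ • y with hc
  have id₀ : Θ.P *ᵥ h₀ + blockRow Θ.H *ᵥ c = x₀ := by
    have : Θ.P *ᵥ h₀ + blockRow Θ.H *ᵥ c
        = (Θ.P * (Θ.invSep τ).P + blockRow Θ.H * Θ.Kb τ * (Θ.Hh τ)ᵀ) *ᵥ x₀
          + T⁻¹ • ((Θ.P * Θ.Hh τ + blockRow Θ.H * (Θ.Kb τ * Θ.Γh τ + 1)) *ᵥ y) := by
      rw [e₀, hc, hβ]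
      simp only [Matrix.mulVec_add, Matrix.mulVec_smul, Matrix.add_mulVec, Matrix.mulVec_mulVec,
        Matrix.mul_add, Matrix.mul_one, smul_add, Matrix.mul_assoc]
      abel
    rw [this, B.e₁, B.e₂, Matrix.one_mulVec, Matrix.zero_mulVec, smul_zero, add_zero]
  have id₁ : (blockRow Θ.H)ᵀ *ᵥ h₀ + Θ.Γb τ *ᵥ c = -β := by
    have : β + ((blockRow Θ.H)ᵀ *ᵥ h₀ + Θ.Γb τ *ᵥ c)
        = ((Θ.Hh τ)ᵀ + (blockRow Θ.H)ᵀ * (Θ.invSep τ).P + Θ.Γb τ * Θ.Kb τ * (Θ.Hh τ)ᵀ) *ᵥ x₀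
          + T⁻¹ • ((Θ.Γh τ + (blockRow Θ.H)ᵀ * Θ.Hh τ + Θ.Γb τ * (Θ.Kb τ * Θ.Γh τ + 1)) *ᵥ y) := by
      rw [e₀, hc, hβ]
      simp only [Matrix.mulVec_add, Matrix.mulVec_smul, Matrix.add_mulVec, Matrix.mulVec_mulVec,
        Matrix.mul_add, Matrix.mul_one, smul_add, Matrix.mul_assoc]
      abel
    rw [B.e₃, B.e₄, Matrix.zero_mulVec, Matrix.zero_mulVec, smul_zero, add_zero] at this
    exact (neg_eq_of_add_eq_zero_right this).symm
  constructor
  · rw [← id₀, blockRow_mulVec]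
    simp only [SepOp.op₀, em]
    rfl
  · intro i s hs
    have ec : Θ.sep.coef τ h₀ h i = T • -(fun a => β (a, i)) := by
      simp only [SepOp.coef, em]
      change _ + (∑ j, Θ.Γ i j *ᵥ fun b => c (b, j)) = _
      rw [Γb_mulVec hT.ne', ← smul_add]
      congr 1
      funext a
      exact congrFun id₁ (a, i)
    rw [SepOp.op₁, ec, eh i s hs]
    change (mono₁ Θ.deg (Fin n) s)ᵀ *ᵥ _ + T • (ev (Θ.S i) s *ᵥ _) = _
    rw [Matrix.mulVec_smul, ← smul_add, Matrix.mulVec_add, Matrix.mulVec_smul,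
      Matrix.mulVec_mulVec _ (ev (Θ.S i) s), Matrix.mulVec_mulVec _ (ev (Θ.S i) s),
      S_mul_inv hτ hε hΘ i hs, Matrix.one_mulVec, Matrix.one_mulVec, Matrix.mulVec_neg,
      neg_add_cancel_left, smul_smul, mul_inv_cancel₀ hT.ne', one_smul]

end PolyParams

/-! ### Matrix integrals and polynomial kernels in two variables -/

section MatIntAux

variable {α β γ : Type*} [Fintype α] [Fintype β] [Fintype γ] {a b : ℝ}

lemma matInt_congr {α β : Type*} (hab : a ≤ b) {M N : ℝ → Matrix α β ℝ}
    (h : ∀ s ∈ Set.Icc a b, M s = N s) : matInt a b M = matInt a b N := by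
  ext i j
  refine intervalIntegral.integral_congr fun s hs => ?_
  rw [Set.uIcc_of_le hab] at hs
  simp only [h s hs]

lemma matInt_mul {α γ : Type*} (hab : a ≤ b) {M : ℝ → Matrix α β ℝ}
    (hM : ∀ i j, ContinuousOn (fun s => M s i j) (Set.Icc a b)) (C : Matrix β γ ℝ) :
    matInt a b (fun s => M s * C) = matInt a b M * C := by
  ext i j
  simp only [matInt, Matrix.of_apply, Matrix.mul_apply]
  rw [intervalIntegral.integral_finsetSum]
  · simp_rw [intervalIntegral.integral_mul_const]
  · intro l _
    refine IntervalIntegrable.mul_const (ContinuousOn.intervalIntegrable ?_) _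
    rw [Set.uIcc_of_le hab]; exact hM i l

lemma mul_matInt {α γ : Type*} (hab : a ≤ b) {M : ℝ → Matrix β γ ℝ}
    (hM : ∀ i j, ContinuousOn (fun s => M s i j) (Set.Icc a b)) (C : Matrix α β ℝ) :
    matInt a b (fun s => C * M s) = C * matInt a b M := by
  ext i j
  simp only [matInt, Matrix.of_apply, Matrix.mul_apply]
  rw [intervalIntegral.integral_finsetSum]
  · simp_rw [intervalIntegral.integral_const_mul]
  · intro l _
    refine IntervalIntegrable.const_mul (ContinuousOn.intervalIntegrable ?_) _
    rw [Set.uIcc_of_le hab]; exact hM l j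

lemma intervalIntegrable_entry {α β : Type*} (hab : a ≤ b) {M : ℝ → Matrix α β ℝ}
    (hM : ∀ i j, ContinuousOn (fun s => M s i j) (Set.Icc a b)) (i : α) (j : β) :
    IntervalIntegrable (fun s => M s i j) volume a b := by
  refine ContinuousOn.intervalIntegrable ?_
  rw [Set.uIcc_of_le hab]; exact hM i j

lemma continuous_ev₂ {α β : Type*} (M : Matrix α β ℝ[X][X]) (i : α) (j : β) :
    Continuous fun p : ℝ × ℝ => ev₂ M p.1 p.2 i j := by
  have h : ∀ q : ℝ[X][X], Continuous fun p : ℝ × ℝ => Polynomial.evalEval p.1 p.2 q := by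
    intro q
    induction q using Polynomial.induction_on' with
    | add p q hp hq => simp only [Polynomial.evalEval_add]; exact hp.add hq
    | monomial n c =>
      have : (fun p : ℝ × ℝ => Polynomial.evalEval p.1 p.2 (Polynomial.monomial n c))
          = fun p => c.eval p.1 * p.2 ^ n := by
        funext p
        simp [Polynomial.evalEval, Polynomial.eval_monomial]
      rw [this]
      exact (c.continuous.comp continuous_fst).mul (continuous_snd.pow n)
  exact h _

/-- The integral does not notice a continuous extension of `f` beyond the interval, after which
parametric continuity applies. -/
lemma continuous_vint_ev₂ {α : Type*} (hab : a ≤ b) (M : Matrix α β ℝ[X][X]) {f : ℝ → β → ℝ}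
    (hf : ContinuousOn f (Set.Icc a b)) :
    Continuous fun s => vint a b fun θ => ev₂ M s θ *ᵥ f θ := by
  have hfix : ∀ s, (vint a b fun θ => ev₂ M s θ *ᵥ f θ)
      = vint a b fun θ => ev₂ M s θ *ᵥ Set.IccExtend hab ((Set.Icc a b).domRestrict f) θ :=
    fun s => vint_congr hab fun θ hθ => by rw [Set.IccExtend_of_mem _ _ hθ]; rfl
  simp_rw [hfix]
  have hc : Continuous (Set.IccExtend hab ((Set.Icc a b).domRestrict f)) :=
    (continuousOn_iff_continuous_domRestrict.1 hf).Icc_extend'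
  have h2 : Continuous fun p : ℝ × ℝ => ev₂ M p.1 p.2 :=
    continuous_matrix fun a b => continuous_ev₂ _ a b
  refine continuous_vint (f := fun s θ => ev₂ M s θ *ᵥ
    Set.IccExtend hab ((Set.Icc a b).domRestrict f) θ) ?_
  exact h2.matrix_mulVec (hc.comp continuous_snd)

/-- Fubini's theorem for `∫ W(η) Z(η,s) b(s)` with continuous factors. -/
lemma vint_matInt_swap {α : Type*} {c d : ℝ} (hab : a ≤ b) (hcd : c ≤ d) {W : ℝ → Matrix α β ℝ}
    {Z : ℝ → ℝ → Matrix β γ ℝ} {f : ℝ → γ → ℝ}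
    (hW : ∀ i j, ContinuousOn (fun s => W s i j) (Set.Icc a b))
    (hZ : ∀ i j, Continuous fun p : ℝ × ℝ => Z p.1 p.2 i j)
    (hf : ContinuousOn f (Set.Icc c d)) :
    vint c d (fun s => matInt a b (fun η => W η * Z η s) *ᵥ f s)
      = vint a b fun η => W η *ᵥ vint c d fun s => Z η s *ᵥ f s := by
  have hZ1 : ∀ s i j, ContinuousOn (fun η => Z η s i j) (Set.Icc a b) := fun s i j =>
    ((hZ i j).comp (by fun_prop : Continuous fun η : ℝ => (η, s))).continuousOn
  have hZ2 : ∀ η i j, ContinuousOn (fun s => Z η s i j) (Set.Icc c d) := fun η i j =>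
    ((hZ i j).comp (by fun_prop : Continuous fun s : ℝ => (η, s))).continuousOn
  have e1 : ∀ s, matInt a b (fun η => W η * Z η s) *ᵥ f s
      = vint a b fun η => W η *ᵥ (Z η s *ᵥ f s) := by
    intro s
    rw [matInt_mulVec]
    · simp only [Matrix.mulVec_mulVec]
    · exact intervalIntegrable_entry hab (continuousOn_matrix_mul hW (hZ1 s))
  have e2 : ∀ η, W η *ᵥ vint c d (fun s => Z η s *ᵥ f s)
      = vint c d fun s => W η *ᵥ (Z η s *ᵥ f s) := fun η =>
    mulVec_vint _ (intervalIntegrable_of_continuousOn hcd (continuousOn_mulVec (hZ2 η) hf))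
  simp_rw [e1, e2]
  funext i
  simp only [vint]
  refine intervalIntegral_intervalIntegral_swap ?_
  have hc : ContinuousOn (fun p : ℝ × ℝ => (W p.2 *ᵥ (Z p.2 p.1 *ᵥ f p.1)) i)
      (Set.Icc c d ×ˢ Set.Icc a b) := by
    simp only [Matrix.mulVec, dotProduct]
    refine continuousOn_finsetSum _ fun j _ => ContinuousOn.mul ?_ ?_
    · exact (hW i j).comp continuousOn_snd fun p hp => hp.2
    · refine continuousOn_finsetSum _ fun l _ => ContinuousOn.mul ?_ ?_
      · exact ((hZ j l).comp (by fun_prop : Continuous fun p : ℝ × ℝ => (p.2, p.1))).continuousOn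
      · exact (continuousOn_pi.1 hf l).comp continuousOn_fst fun p hp => hp.1
  refine (hc.integrableOn_compact (isCompact_Icc.prod isCompact_Icc)).mono_set ?_
  rw [Set.uIoc_of_le hab, Set.uIoc_of_le hcd]
  exact Set.prod_mono Set.Ioc_subset_Icc_self Set.Ioc_subset_Icc_self

end MatIntAux

/-! ### The gains as compositions with the inverse operator -/

section GainOps

variable {k n m q : ℕ} (τ : Fin (k + 1) → ℝ)

/-- The functional `K₀ x₀ + ∑ᵢ K₁ᵢ xᵢ(-τᵢ) + ∑ᵢ ∫ K₂ᵢ xᵢ`. -/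
def gainOp (𝒦 : ControlGains k n m) (x₀ : Fin n → ℝ) (x : Fin (k + 1) → ℝ → Fin n → ℝ) :
    Fin m → ℝ :=
  𝒦.K₀ *ᵥ x₀ + ∑ i, 𝒦.K₁ i *ᵥ x i (-τ i) + ∑ i, vint (-τ i) 0 fun s => 𝒦.K₂ i s *ᵥ x i s

/-- The functional `H₀ h₀ + ∑ᵢ H₁ᵢ hᵢ(-τᵢ) + ∑ᵢ ∫ H₂ᵢ hᵢ`. -/
def ctrlOp (ℋ : ControlVars k n m) (h₀ : Fin n → ℝ) (h : Fin (k + 1) → ℝ → Fin n → ℝ) :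
    Fin m → ℝ :=
  ℋ.H₀ *ᵥ h₀ + ∑ i, ℋ.H₁ i *ᵥ h i (-τ i) + ∑ i, vint (-τ i) 0 fun s => ev (ℋ.H₂ i) s *ᵥ h i s

/-- First component of the operator given by the variables `Z`. -/
def estOp₀ (𝒵 : EstimVars k n q) (b₀ : Fin q → ℝ) (b : Fin (k + 1) → ℝ → Fin q → ℝ) :
    Fin n → ℝ :=
  𝒵.Z₁ *ᵥ b₀ + ∑ i, 𝒵.Z₂ i *ᵥ b i (-τ i) + ∑ i, vint (-τ i) 0 fun s => ev (𝒵.Z₃ i) s *ᵥ b i s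

/-- History components of the operator given by the variables `Z`. -/
def estOp₁ (𝒵 : EstimVars k n q) (b₀ : Fin q → ℝ) (b : Fin (k + 1) → ℝ → Fin q → ℝ)
    (i : Fin (k + 1)) (s : ℝ) : Fin n → ℝ :=
  τ (Fin.last k) • (ev (𝒵.Z₄ i) s *ᵥ b₀ + ∑ j, ev (𝒵.Z₅ i j) s *ᵥ b j (-τ j)
    + ev (𝒵.Z₆ i) s *ᵥ b i s + ∑ j, vint (-τ j) 0 fun θ => ev₂ (𝒵.Z₇ i j) s θ *ᵥ b j θ)

variable {τ}

lemma continuousOn_estOp₁ (hτ : ∀ i, 0 < τ i) (𝒵 : EstimVars k n q) (b₀ : Fin q → ℝ)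
    {b : Fin (k + 1) → ℝ → Fin q → ℝ} (hb : ∀ i, ContinuousOn (b i) (Set.Icc (-τ i) 0))
    (i : Fin (k + 1)) : ContinuousOn (estOp₁ τ 𝒵 b₀ b i) (Set.Icc (-τ i) 0) := by
  have hle : ∀ i, -τ i ≤ 0 := fun i => by linarith [hτ i]
  refine ContinuousOn.const_smul (c := τ (Fin.last k)) (((ContinuousOn.add ?_ ?_).add ?_).add ?_)
  · exact continuousOn_mulVec (fun a b => (continuous_ev _ a b).continuousOn) continuousOn_const
  · exact continuousOn_finsetSum _ fun j _ =>
      continuousOn_mulVec (fun a b => (continuous_ev _ a b).continuousOn) continuousOn_const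
  · exact continuousOn_mulVec (fun a b => (continuous_ev _ a b).continuousOn) (hb i)
  · refine continuousOn_finsetSum _ fun j _ => ?_
    exact (continuous_vint_ev₂ (hle j) _ (hb j)).continuousOn

variable {d : ℕ} {Θ : PolyParams k n} {ε : ℝ}

/-- Separability gives `K₂` the form `A Wᵢ(s) + T H₂ᵢ(s) Sᵢ(s)` with a constant matrix `A`. This
yields its continuity on the delay interval, and its integral against a history through the moment
of that history. -/
lemma mapLc_K₂ (hτ : ∀ i, 0 < τ i) (hε : 0 < ε) (hΘ : Θ.eval.shift (-ε • 1) (-ε) ∈ Xi d τ)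
    (ℋ : ControlVars k n m) (i : Fin (k + 1)) (s : ℝ) :
    (mapLc τ Θ ℋ).K₂ i s = (ℋ.H₀ * (Θ.invSep τ).H i
      + ∑ j, ℋ.H₁ j * (((Θ.invSep τ).W j (-τ j))ᵀ * (Θ.invSep τ).Γ j i)
      + ∑ j, (matInt (-τ j) 0 fun η => ev (ℋ.H₂ j) η * ((Θ.invSep τ).W j η)ᵀ)
          * (Θ.invSep τ).Γ j i) * (Θ.invSep τ).W i s
      + τ (Fin.last k) • (ev (ℋ.H₂ i) s * (Θ.invSep τ).S i s) := by
  have hle : ∀ i, -τ i ≤ 0 := fun i => by linarith [hτ i]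
  have R := Θ.sep_regular hτ hε hΘ
  have R' := Θ.invSep_regular hτ hε hΘ
  have e1 : ∀ j, ℋ.H₁ j * (Θ.inverse τ).R j i (-τ j) s
      = ℋ.H₁ j * (((Θ.invSep τ).W j (-τ j))ᵀ * (Θ.invSep τ).Γ j i) * (Θ.invSep τ).W i s := by
    intro j
    rw [PolyParams.inverse_R i s (R.S_symm j (-τ j) ⟨le_rfl, hle j⟩)]
    simp only [Matrix.mul_assoc]
  have e2 : ∀ j, (matInt (-τ j) 0 fun η => ev (ℋ.H₂ j) η * (Θ.inverse τ).R j i η s)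
      = (matInt (-τ j) 0 fun η => ev (ℋ.H₂ j) η * ((Θ.invSep τ).W j η)ᵀ)
          * (Θ.invSep τ).Γ j i * (Θ.invSep τ).W i s := by
    intro j
    rw [Matrix.mul_assoc, ← matInt_mul (hle j)]
    · refine matInt_congr (hle j) fun η hη => ?_
      rw [PolyParams.inverse_R i s (R.S_symm j η hη)]
      simp only [Matrix.mul_assoc]
    · exact continuousOn_matrix_mul (fun a b => (continuous_ev _ a b).continuousOn)
        fun a b => R'.W_cont j b a
  change ℋ.H₀ * (Θ.inverse τ).Q i s + ∑ j, ℋ.H₁ j * (Θ.inverse τ).R j i (-τ j) s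
      + τ (Fin.last k) • (ev (ℋ.H₂ i) s * (Θ.inverse τ).S i s)
      + ∑ j, (matInt (-τ j) 0 fun η => ev (ℋ.H₂ j) η * (Θ.inverse τ).R j i η s) = _
  simp only [e1, e2, PolyParams.inverse_Q, PolyParams.inverse_S]
  rw [← Matrix.sum_mul, ← Matrix.sum_mul, Matrix.add_mul, Matrix.add_mul, Matrix.mul_assoc]
  abel

lemma continuousOn_K₂ (hτ : ∀ i, 0 < τ i) (hε : 0 < ε)
    (hΘ : Θ.eval.shift (-ε • 1) (-ε) ∈ Xi d τ) (ℋ : ControlVars k n m) (i : Fin (k + 1))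
    (a : Fin m) (b : Fin n) :
    ContinuousOn (fun s => (mapLc τ Θ ℋ).K₂ i s a b) (Set.Icc (-τ i) 0) := by
  have R' := Θ.invSep_regular hτ hε hΘ
  simp only [mapLc_K₂ hτ hε hΘ, Matrix.add_apply, Matrix.smul_apply]
  have key : ∀ A : Matrix (Fin m) (Fin (Θ.deg + 1) × Fin n) ℝ,
      ContinuousOn (fun s => (A * (Θ.invSep τ).W i s) a b) (Set.Icc (-τ i) 0) := fun A =>
    continuousOn_matrix_mul (M := fun _ => A) (fun _ _ => continuousOn_const) (R'.W_cont i) a b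
  refine ContinuousOn.add (key _) (ContinuousOn.const_smul (c := τ (Fin.last k)) ?_)
  exact continuousOn_matrix_mul (fun a b => (continuous_ev _ a b).continuousOn)
    (R'.S_cont i) a b

/-- Expand `ℋ Θ⁻¹ x` and collect what acts on `x₀`, on the delayed values `xᵢ(-τᵢ)` and on the
histories: these are the formulas of `mapLc`. Thus the feedback applied to `x = Θ h` is `ℋ h`, which
is linear in the decision variables. -/
lemma gainOp_mapLc (hτ : ∀ i, 0 < τ i) (hε : 0 < ε)
    (hΘ : Θ.eval.shift (-ε • 1) (-ε) ∈ Xi d τ) (ℋ : ControlVars k n m) (x₀ : Fin n → ℝ)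
    {x : Fin (k + 1) → ℝ → Fin n → ℝ} (hx : ∀ i, ContinuousOn (x i) (Set.Icc (-τ i) 0)) :
    gainOp τ (mapLc τ Θ ℋ) x₀ x
      = ctrlOp τ ℋ ((Θ.invSep τ).op₀ τ x₀ x) ((Θ.invSep τ).op₁ τ x₀ x) := by
  have hle : ∀ i, -τ i ≤ 0 := fun i => by linarith [hτ i]
  have R' := Θ.invSep_regular hτ hε hΘ
  set Φ := Θ.invSep τ with hΦ
  set T := τ (Fin.last k) with hT
  set N : Fin (k + 1) → Matrix (Fin m) (Fin (Θ.deg + 1) × Fin n) ℝ :=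
    fun j => matInt (-τ j) 0 fun η => ev (ℋ.H₂ j) η * (Φ.W j η)ᵀ
  have cHW : ∀ j a b, ContinuousOn (fun η => (ev (ℋ.H₂ j) η * (Φ.W j η)ᵀ) a b)
      (Set.Icc (-τ j) 0) := fun j =>
    continuousOn_matrix_mul (fun a b => (continuous_ev _ a b).continuousOn)
      fun a b => R'.W_cont j b a
  have cHS : ∀ j a b, ContinuousOn (fun η => (ev (ℋ.H₂ j) η * Φ.S j η) a b)
      (Set.Icc (-τ j) 0) := fun j =>
    continuousOn_matrix_mul (fun a b => (continuous_ev _ a b).continuousOn) (R'.S_cont j)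
  have eK₀ : (mapLc τ Θ ℋ).K₀ = ℋ.H₀ * Φ.P
      + T • ∑ i, ℋ.H₁ i * ((Φ.W i (-τ i))ᵀ * (Φ.H i)ᵀ) + T • ∑ i, N i * (Φ.H i)ᵀ := by
    change ℋ.H₀ * (Θ.inverse τ).P + T • ∑ i, ℋ.H₁ i * ((Θ.inverse τ).Q i (-τ i))ᵀ
      + T • ∑ i, (matInt (-τ i) 0 fun s => ev (ℋ.H₂ i) s * ((Θ.inverse τ).Q i s)ᵀ) = _
    simp only [PolyParams.inverse_Q, Matrix.transpose_mul, PolyParams.inverse_P, ← hΦ]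
    congr 3
    funext i
    rw [← matInt_mul (hle i) (cHW i)]
    simp only [Matrix.mul_assoc]
  have eK₁ : ∀ i, (mapLc τ Θ ℋ).K₁ i = T • (ℋ.H₁ i * Φ.S i (-τ i)) := fun i => rfl
  have eK₂ : ∀ i, (vint (-τ i) 0 fun s => (mapLc τ Θ ℋ).K₂ i s *ᵥ x i s)
      = (ℋ.H₀ * Φ.H i + ∑ j, ℋ.H₁ j * ((Φ.W j (-τ j))ᵀ * Φ.Γ j i) + ∑ j, N j * Φ.Γ j i) *ᵥ
          Φ.mom τ x i
        + T • vint (-τ i) 0 fun s => ev (ℋ.H₂ i) s *ᵥ (Φ.S i s *ᵥ x i s) := by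
    intro i
    have key : ∀ A : Matrix (Fin m) (Fin (Θ.deg + 1) × Fin n) ℝ,
        (vint (-τ i) 0 fun s => (A * Φ.W i s + T • (ev (ℋ.H₂ i) s * Φ.S i s)) *ᵥ x i s)
          = A *ᵥ Φ.mom τ x i
            + T • vint (-τ i) 0 fun s => ev (ℋ.H₂ i) s *ᵥ (Φ.S i s *ᵥ x i s) := by
      intro A
      have c1 : ContinuousOn (fun s => A *ᵥ (Φ.W i s *ᵥ x i s)) (Set.Icc (-τ i) 0) :=
        continuousOn_mulVec (M := fun _ => A) (fun _ _ => continuousOn_const)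
          (continuousOn_mulVec (R'.W_cont i) (hx i))
      have c2 : ContinuousOn (fun s => T • (ev (ℋ.H₂ i) s *ᵥ (Φ.S i s *ᵥ x i s)))
          (Set.Icc (-τ i) 0) := by
        simp only [Matrix.mulVec_mulVec]
        exact (continuousOn_mulVec (cHS i) (hx i)).const_smul T
      simp only [Matrix.add_mulVec, Matrix.smul_mulVec, ← Matrix.mulVec_mulVec]
      rw [vint_add (intervalIntegrable_of_continuousOn (hle i) c1)
        (intervalIntegrable_of_continuousOn (hle i) c2), vint_smul, ← mulVec_vint]
      · rfl
      · exact intervalIntegrable_of_continuousOn (hle i)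
          (continuousOn_mulVec (R'.W_cont i) (hx i))
    simp only [mapLc_K₂ hτ hε hΘ]
    exact key _
  have eh : ∀ i, (vint (-τ i) 0 fun s => ev (ℋ.H₂ i) s *ᵥ Φ.op₁ τ x₀ x i s)
      = N i *ᵥ Φ.coef τ x₀ x i
        + T • vint (-τ i) 0 fun s => ev (ℋ.H₂ i) s *ᵥ (Φ.S i s *ᵥ x i s) := by
    intro i
    simp only [SepOp.op₁, Matrix.mulVec_add, Matrix.mulVec_smul, ← hT]
    rw [vint_add, vint_smul]
    · congr 1
      rw [matInt_mulVec (intervalIntegrable_entry (hle i) (cHW i))]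
      simp only [Matrix.mulVec_mulVec]
    · have := intervalIntegrable_of_continuousOn (hle i)
        (continuousOn_mulVec (g := fun _ => Φ.coef τ x₀ x i) (cHW i) continuousOn_const)
      simpa only [Matrix.mulVec_mulVec] using this
    · have c2 : ContinuousOn (fun s => T • (ev (ℋ.H₂ i) s *ᵥ (Φ.S i s *ᵥ x i s)))
          (Set.Icc (-τ i) 0) := by
        simp only [Matrix.mulVec_mulVec]
        exact (continuousOn_mulVec (cHS i) (hx i)).const_smul T
      exact intervalIntegrable_of_continuousOn (hle i) c2
  simp only [gainOp, ctrlOp, eK₀, eK₁, eK₂, eh]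
  simp only [SepOp.op₀, SepOp.op₁, SepOp.coef, ← hT, Matrix.mulVec_add, Matrix.add_mulVec,
    Matrix.mulVec_smul, Matrix.smul_mulVec, Matrix.mulVec_sum, Matrix.sum_mulVec,
    Finset.sum_add_distrib, ← Matrix.mulVec_mulVec, Finset.smul_sum]
  -- The two sides list the finite-rank terms with the channel of the gain and the channel of the
  -- state summed in opposite order.
  rw [Finset.sum_comm (f := fun x_1 x_2 => ℋ.H₁ x_2 *ᵥ (Φ.W x_2 (-τ x_2))ᵀ *ᵥ
      Φ.Γ x_2 x_1 *ᵥ Φ.mom τ x x_1),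
    Finset.sum_comm (f := fun x_1 x_2 => N x_2 *ᵥ Φ.Γ x_2 x_1 *ᵥ Φ.mom τ x x_1)]
  abel

end GainOps

/-! ### The estimator gains as the inverse operator applied to the decision variables -/

section EstimatorGains

lemma continuous_matInt_mul {α β γ : Type*} [Fintype β] {a b : ℝ} (hab : a ≤ b)
    {W : ℝ → Matrix α β ℝ} {Z : ℝ → ℝ → Matrix β γ ℝ}
    (hW : ∀ i j, ContinuousOn (fun s => W s i j) (Set.Icc a b))
    (hZ : ∀ i j, Continuous fun p : ℝ × ℝ => Z p.1 p.2 i j) (i : α) (j : γ) :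
    Continuous fun s => matInt a b (fun η => W η * Z η s) i j := by
  have hW' : ∀ l, Continuous (Set.IccExtend hab ((Set.Icc a b).domRestrict fun s => W s i l)) :=
    fun l => (continuousOn_iff_continuous_domRestrict.1 (hW i l)).Icc_extend'
  have e : (fun s => matInt a b (fun η => W η * Z η s) i j) = fun s => ∫ η in a..b,
      ∑ l, Set.IccExtend hab ((Set.Icc a b).domRestrict fun s => W s i l) η * Z η s l j := by
    funext s
    refine intervalIntegral.integral_congr fun η hη => ?_
    rw [Set.uIcc_of_le hab] at hη
    simp only [Matrix.mul_apply]
    refine Finset.sum_congr rfl fun l _ => ?_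
    rw [Set.IccExtend_of_mem _ _ hη]; rfl
  rw [e]
  refine intervalIntegral.continuous_parametric_intervalIntegral_of_continuous' ?_ a b
  refine continuous_finsetSum _ fun l _ => ((hW' l).comp continuous_snd).mul ?_
  exact (hZ l j).comp continuous_swap

variable {k n q : ℕ} {τ : Fin (k + 1) → ℝ}

/-- Moments of the history components of the operator given by the variables `Z`. -/
lemma mom_estOp₁ {κ : Type} {Φ : SepOp k n κ} (R : Φ.Regular τ)
    (𝒵 : EstimVars k n q) (b₀ : Fin q → ℝ) {b : Fin (k + 1) → ℝ → Fin q → ℝ}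
    (hb : ∀ i, ContinuousOn (b i) (Set.Icc (-τ i) 0)) (l : Fin (k + 1)) :
    Φ.mom τ (estOp₁ τ 𝒵 b₀ b) l = τ (Fin.last k) •
      ((matInt (-τ l) 0 fun η => Φ.W l η * ev (𝒵.Z₄ l) η) *ᵥ b₀
        + ∑ j, (matInt (-τ l) 0 fun η => Φ.W l η * ev (𝒵.Z₅ l j) η) *ᵥ b j (-τ j)
        + (vint (-τ l) 0 fun s => Φ.W l s *ᵥ (ev (𝒵.Z₆ l) s *ᵥ b l s))
        + ∑ j, vint (-τ j) 0 fun θ =>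
            (matInt (-τ l) 0 fun η => Φ.W l η * ev₂ (𝒵.Z₇ l j) η θ) *ᵥ b j θ) := by
  have hle := R.neg_le
  have cE : ∀ (M : Matrix (Fin n) (Fin q) ℝ[X]) a b, ContinuousOn
      (fun η => (Φ.W l η * ev M η) a b) (Set.Icc (-τ l) 0) := fun M =>
    continuousOn_matrix_mul (R.W_cont l) fun a b => (continuous_ev _ a b).continuousOn
  have c0 : ∀ (M : Matrix (Fin n) (Fin q) ℝ[X]) (y : Fin q → ℝ),
      ContinuousOn (fun η => Φ.W l η *ᵥ (ev M η *ᵥ y)) (Set.Icc (-τ l) 0) := by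
    intro M y
    simp only [Matrix.mulVec_mulVec]
    exact continuousOn_mulVec (cE M) continuousOn_const
  have c6 : ContinuousOn (fun η => Φ.W l η *ᵥ (ev (𝒵.Z₆ l) η *ᵥ b l η)) (Set.Icc (-τ l) 0) := by
    simp only [Matrix.mulVec_mulVec]
    exact continuousOn_mulVec (cE _) (hb l)
  have c7 : ∀ j, ContinuousOn (fun η => vint (-τ j) 0 fun θ => ev₂ (𝒵.Z₇ l j) η θ *ᵥ b j θ)
      (Set.Icc (-τ l) 0) := fun j => (continuous_vint_ev₂ (hle j) _ (hb j)).continuousOn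
  have c7' : ∀ j, ContinuousOn (fun η => Φ.W l η *ᵥ
      vint (-τ j) 0 fun θ => ev₂ (𝒵.Z₇ l j) η θ *ᵥ b j θ) (Set.Icc (-τ l) 0) := fun j =>
    continuousOn_mulVec (R.W_cont l) (c7 j)
  have i0 := fun M y => intervalIntegrable_of_continuousOn (hle l) (c0 M y)
  have i5 := intervalIntegrable_of_continuousOn (hle l)
    (continuousOn_finsetSum (s := Finset.univ) (f := fun j η => Φ.W l η *ᵥ
      (ev (𝒵.Z₅ l j) η *ᵥ b j (-τ j))) fun j _ => c0 (𝒵.Z₅ l j) (b j (-τ j)))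
  have i7 := intervalIntegrable_of_continuousOn (hle l)
    (continuousOn_finsetSum (s := Finset.univ) (f := fun j η => Φ.W l η *ᵥ
      vint (-τ j) 0 fun θ => ev₂ (𝒵.Z₇ l j) η θ *ᵥ b j θ) fun j _ => c7' j)
  have i6 := intervalIntegrable_of_continuousOn (hle l) c6
  simp only [SepOp.mom, estOp₁, Matrix.mulVec_smul, Matrix.mulVec_add, Matrix.mulVec_sum]
  rw [vint_smul, vint_add _ i7, vint_add _ i6, vint_add (i0 _ _) i5]
  · rw [vint_sum _ fun j _ => i0 _ _,
      vint_sum _ fun j _ => intervalIntegrable_of_continuousOn (hle l) (c7' j)]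
    congr 2
    · congr 1
      · congr 1
        · rw [matInt_mulVec (intervalIntegrable_entry (hle l) (cE _))]
          simp only [Matrix.mulVec_mulVec]
        · refine Finset.sum_congr rfl fun j _ => ?_
          rw [matInt_mulVec (intervalIntegrable_entry (hle l) (cE _))]
          simp only [Matrix.mulVec_mulVec]
    · refine Finset.sum_congr rfl fun j _ => ?_
      exact (vint_matInt_swap (hle l) (hle j) (R.W_cont l) (continuous_ev₂ _) (hb j)).symm
  · exact fun a => (i0 _ _ a).add (i5 a)
  · exact fun a => ((i0 _ _ a).add (i5 a)).add (i6 a)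

variable {d : ℕ} {Θ : PolyParams k n} {ε : ℝ}

/-- This is the present component of `𝓛 = Θ⁻¹ 𝒵`. The integrals inside the gains arise from the
moments of the history part of `𝒵 b`, as given by `mom_estOp₁`. -/
lemma injectPresent_mapLo (hτ : ∀ i, 0 < τ i) (hε : 0 < ε)
    (hΘ : Θ.eval.shift (-ε • 1) (-ε) ∈ Xi d τ) (𝒵 : EstimVars k n q) (b₀ : Fin q → ℝ)
    {b : Fin (k + 1) → ℝ → Fin q → ℝ} (hb : ∀ i, ContinuousOn (b i) (Set.Icc (-τ i) 0)) :
    injectPresent τ (mapLo τ Θ 𝒵) b₀ b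
      = (Θ.invSep τ).op₀ τ (estOp₀ τ 𝒵 b₀ b) (estOp₁ τ 𝒵 b₀ b) := by
  have hle : ∀ i, -τ i ≤ 0 := fun i => by linarith [hτ i]
  have R := Θ.invSep_regular hτ hε hΘ
  set Φ := Θ.invSep τ with hΦ
  set T := τ (Fin.last k) with hT
  have cE : ∀ l (M : Matrix (Fin n) (Fin q) ℝ[X]) a b, ContinuousOn
      (fun η => (Φ.W l η * ev M η) a b) (Set.Icc (-τ l) 0) := fun l M =>
    continuousOn_matrix_mul (R.W_cont l) fun a b => (continuous_ev _ a b).continuousOn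
  have cZ7 : ∀ j i s a b, ContinuousOn (fun η => (Φ.W j η * ev₂ (𝒵.Z₇ j i) η s) a b)
      (Set.Icc (-τ j) 0) := fun j i s =>
    continuousOn_matrix_mul (R.W_cont j) fun a b =>
      ((continuous_ev₂ (𝒵.Z₇ j i) a b).comp
        (by fun_prop : Continuous fun η : ℝ => (η, s))).continuousOn
  have e1 : (mapLo τ Θ 𝒵).L₁ = Φ.P * 𝒵.Z₁
      + T • ∑ j, Φ.H j * matInt (-τ j) 0 fun η => Φ.W j η * ev (𝒵.Z₄ j) η := by
    change (Θ.inverse τ).P * 𝒵.Z₁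
      + T • ∑ j, (matInt (-τ j) 0 fun η => (Θ.inverse τ).Q j η * ev (𝒵.Z₄ j) η) = _
    simp only [PolyParams.inverse_Q, PolyParams.inverse_P, ← hΦ, Matrix.mul_assoc]
    simp only [mul_matInt (hle _) (cE _ _)]
  have e2 : ∀ i, (mapLo τ Θ 𝒵).L₂ i = Φ.P * 𝒵.Z₂ i
      + T • ∑ j, Φ.H j * matInt (-τ j) 0 fun η => Φ.W j η * ev (𝒵.Z₅ j i) η := by
    intro i
    change (Θ.inverse τ).P * 𝒵.Z₂ i
      + T • ∑ j, (matInt (-τ j) 0 fun η => (Θ.inverse τ).Q j η * ev (𝒵.Z₅ j i) η) = _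
    simp only [PolyParams.inverse_Q, PolyParams.inverse_P, ← hΦ, Matrix.mul_assoc]
    simp only [mul_matInt (hle _) (cE _ _)]
  have e3 : ∀ i s, (mapLo τ Θ 𝒵).L₃ i s = Φ.P * ev (𝒵.Z₃ i) s
      + T • (Φ.H i * (Φ.W i s * ev (𝒵.Z₆ i) s))
      + T • ∑ j, Φ.H j * matInt (-τ j) 0 fun η => Φ.W j η * ev₂ (𝒵.Z₇ j i) η s := by
    intro i s
    change (Θ.inverse τ).P * ev (𝒵.Z₃ i) s + T • ((Θ.inverse τ).Q i s * ev (𝒵.Z₆ i) s)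
      + T • ∑ j, (matInt (-τ j) 0 fun η => (Θ.inverse τ).Q j η * ev₂ (𝒵.Z₇ j i) η s) = _
    simp only [PolyParams.inverse_Q, PolyParams.inverse_P, ← hΦ, Matrix.mul_assoc]
    simp only [mul_matInt (hle _) (cZ7 _ _ _)]
  have e3' : ∀ i, ∫ s in (-τ i)..0, (mapLo τ Θ 𝒵).L₃ i s *ᵥ b i s
      = Φ.P *ᵥ (vint (-τ i) 0 fun s => ev (𝒵.Z₃ i) s *ᵥ b i s)
      + T • (Φ.H i *ᵥ vint (-τ i) 0 fun s => Φ.W i s *ᵥ (ev (𝒵.Z₆ i) s *ᵥ b i s))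
      + T • ∑ j, Φ.H j *ᵥ vint (-τ i) 0 fun s =>
          (matInt (-τ j) 0 fun η => Φ.W j η * ev₂ (𝒵.Z₇ j i) η s) *ᵥ b i s := by
    intro i
    have cc : ∀ {β : Type} [Fintype β] (M : Matrix (Fin n) β ℝ) {g : ℝ → β → ℝ},
        ContinuousOn g (Set.Icc (-τ i) 0) → ContinuousOn (fun s => M *ᵥ g s)
          (Set.Icc (-τ i) 0) := fun M g hg =>
      continuousOn_mulVec (M := fun _ => M) (fun _ _ => continuousOn_const) hg
    have c3 : ContinuousOn (fun s => ev (𝒵.Z₃ i) s *ᵥ b i s) (Set.Icc (-τ i) 0) :=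
      continuousOn_mulVec (fun a b => (continuous_ev _ a b).continuousOn) (hb i)
    have c6 : ContinuousOn (fun s => Φ.W i s *ᵥ (ev (𝒵.Z₆ i) s *ᵥ b i s)) (Set.Icc (-τ i) 0) := by
      simp only [Matrix.mulVec_mulVec]
      exact continuousOn_mulVec (cE _ _) (hb i)
    have c7 : ∀ j, ContinuousOn (fun s => (matInt (-τ j) 0 fun η =>
        Φ.W j η * ev₂ (𝒵.Z₇ j i) η s) *ᵥ b i s) (Set.Icc (-τ i) 0) := fun j =>
      continuousOn_mulVec (fun a b => (continuous_matInt_mul (hle j) (R.W_cont j)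
        (continuous_ev₂ _) a b).continuousOn) (hb i)
    have cs : ∀ (c : ℝ) {g : ℝ → Fin n → ℝ}, ContinuousOn g (Set.Icc (-τ i) 0) →
        ContinuousOn (fun s => c • g s) (Set.Icc (-τ i) 0) := fun c g hg => hg.const_smul c
    have ca : ∀ {f g : ℝ → Fin n → ℝ}, ContinuousOn f (Set.Icc (-τ i) 0) →
        ContinuousOn g (Set.Icc (-τ i) 0) →
        ContinuousOn (fun s => f s + g s) (Set.Icc (-τ i) 0) := fun hf hg => hf.add hg
    have d3 := cc Φ.P c3
    have d6 := cs T (cc (Φ.H i) c6)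
    have d7 := fun j => cc (Φ.H j) (c7 j)
    have d7' := cs T (continuousOn_finsetSum Finset.univ fun j _ => d7 j)
    have ef : ∀ s, (mapLo τ Θ 𝒵).L₃ i s *ᵥ b i s = Φ.P *ᵥ (ev (𝒵.Z₃ i) s *ᵥ b i s)
        + T • (Φ.H i *ᵥ (Φ.W i s *ᵥ (ev (𝒵.Z₆ i) s *ᵥ b i s)))
        + T • ∑ j, Φ.H j *ᵥ ((matInt (-τ j) 0 fun η =>
          Φ.W j η * ev₂ (𝒵.Z₇ j i) η s) *ᵥ b i s) := by
      intro s
      simp only [e3, Matrix.add_mulVec, Matrix.smul_mulVec, Matrix.sum_mulVec,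
        Matrix.mulVec_mulVec]
    simp only [ef]
    have I := fun {g : ℝ → Fin n → ℝ} (hg : ContinuousOn g (Set.Icc (-τ i) 0)) =>
      intervalIntegrable_of_continuousOn (hle i) hg
    rw [intervalIntegral_eq_vint (I (ca (ca d3 d6) d7')), vint_add (I (ca d3 d6)) (I d7'),
      vint_add (I d3) (I d6), vint_smul, vint_smul, vint_sum _ fun j _ => I (d7 j),
      ← mulVec_vint _ (intervalIntegrable_of_continuousOn (hle i) c3),
      ← mulVec_vint _ (intervalIntegrable_of_continuousOn (hle i) c6)]
    congr 2
    refine Finset.sum_congr rfl fun j _ => ?_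
    rw [← mulVec_vint _ (intervalIntegrable_of_continuousOn (hle i) (c7 j))]
  simp only [injectPresent, e1, e2, e3', SepOp.op₀, mom_estOp₁ R 𝒵 b₀ hb, estOp₀, ← hT]
  simp only [Matrix.mulVec_add, Matrix.add_mulVec,
    Matrix.mulVec_smul, Matrix.smul_mulVec, Matrix.mulVec_sum, Matrix.sum_mulVec,
    Finset.sum_add_distrib, ← Matrix.mulVec_mulVec, Finset.smul_sum, smul_add]
  rw [Finset.sum_comm (f := fun i j => T • Φ.H j *ᵥ
      (matInt (-τ j) 0 fun η => Φ.W j η * ev (𝒵.Z₅ j i) η) *ᵥ b i (-τ i)),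
    Finset.sum_comm (f := fun i j => T • Φ.H j *ᵥ vint (-τ i) 0 fun s =>
      (matInt (-τ j) 0 fun η => Φ.W j η * ev₂ (𝒵.Z₇ j i) η s) *ᵥ b i s)]
  abel

/-- This is the history component of the same composition. The restriction on `s` secures the
symmetry of `Sᵢ(s)`, without which the kernel of the inverse need not have its separable form. -/
lemma injectHistory_mapLo (hτ : ∀ i, 0 < τ i) (hε : 0 < ε)
    (hΘ : Θ.eval.shift (-ε • 1) (-ε) ∈ Xi d τ) (𝒵 : EstimVars k n q) (b₀ : Fin q → ℝ)
    {b : Fin (k + 1) → ℝ → Fin q → ℝ} (hb : ∀ i, ContinuousOn (b i) (Set.Icc (-τ i) 0))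
    (i : Fin (k + 1)) {s : ℝ} (hs : s ∈ Set.Icc (-τ i) 0) :
    injectHistory τ (mapLo τ Θ 𝒵) b₀ b i s
      = (Θ.invSep τ).op₁ τ (estOp₀ τ 𝒵 b₀ b) (estOp₁ τ 𝒵 b₀ b) i s := by
  have hle : ∀ i, -τ i ≤ 0 := fun i => by linarith [hτ i]
  have R := Θ.invSep_regular hτ hε hΘ
  have hS := (Θ.sep_regular hτ hε hΘ).S_symm i s hs
  set Φ := Θ.invSep τ with hΦ
  set T := τ (Fin.last k) with hT
  have cE : ∀ l (M : Matrix (Fin n) (Fin q) ℝ[X]) a b, ContinuousOn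
      (fun η => (Φ.W l η * ev M η) a b) (Set.Icc (-τ l) 0) := fun l M =>
    continuousOn_matrix_mul (R.W_cont l) fun a b => (continuous_ev _ a b).continuousOn
  have cZ7 : ∀ j i s a b, ContinuousOn (fun η => (Φ.W j η * ev₂ (𝒵.Z₇ j i) η s) a b)
      (Set.Icc (-τ j) 0) := fun j i s =>
    continuousOn_matrix_mul (R.W_cont j) fun a b =>
      ((continuous_ev₂ (𝒵.Z₇ j i) a b).comp
        (by fun_prop : Continuous fun η : ℝ => (η, s))).continuousOn
  have e4 : (mapLo τ Θ 𝒵).L₄ i s = T • ((Φ.W i s)ᵀ * ((Φ.H i)ᵀ * 𝒵.Z₁))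
      + T ^ 2 • (Φ.S i s * ev (𝒵.Z₄ i) s)
      + T • ∑ j, (Φ.W i s)ᵀ * (Φ.Γ i j * matInt (-τ j) 0 fun η => Φ.W j η * ev (𝒵.Z₄ j) η) := by
    change T • (((Θ.inverse τ).Q i s)ᵀ * 𝒵.Z₁) + T ^ 2 • ((Θ.inverse τ).S i s * ev (𝒵.Z₄ i) s)
      + T • ∑ j, (matInt (-τ j) 0 fun η => (Θ.inverse τ).R i j s η * ev (𝒵.Z₄ j) η) = _
    simp only [PolyParams.inverse_Q, PolyParams.inverse_S, PolyParams.inverse_R _ _ hS, ← hΦ,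
      Matrix.mul_assoc, Matrix.transpose_mul]
    simp only [← Matrix.mul_assoc _ (Φ.Γ i _), mul_matInt (hle _) (cE _ _)]
  have e5 : ∀ l, (mapLo τ Θ 𝒵).L₅ i l s = T • ((Φ.W i s)ᵀ * ((Φ.H i)ᵀ * 𝒵.Z₂ l))
      + T ^ 2 • (Φ.S i s * ev (𝒵.Z₅ i l) s)
      + T • ∑ j, (Φ.W i s)ᵀ * (Φ.Γ i j * matInt (-τ j) 0 fun η =>
          Φ.W j η * ev (𝒵.Z₅ j l) η) := by
    intro l
    change T • (((Θ.inverse τ).Q i s)ᵀ * 𝒵.Z₂ l)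
      + T ^ 2 • ((Θ.inverse τ).S i s * ev (𝒵.Z₅ i l) s)
      + T • ∑ j, (matInt (-τ j) 0 fun η => (Θ.inverse τ).R i j s η * ev (𝒵.Z₅ j l) η) = _
    simp only [PolyParams.inverse_Q, PolyParams.inverse_S, PolyParams.inverse_R _ _ hS, ← hΦ,
      Matrix.mul_assoc, Matrix.transpose_mul]
    simp only [← Matrix.mul_assoc _ (Φ.Γ i _), mul_matInt (hle _) (cE _ _)]
  have e6 : (mapLo τ Θ 𝒵).L₆ i s = T ^ 2 • (Φ.S i s * ev (𝒵.Z₆ i) s) := rfl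
  have e7 : ∀ j θ, (mapLo τ Θ 𝒵).L₇ i j s θ = T • ((Φ.W i s)ᵀ * ((Φ.H i)ᵀ * ev (𝒵.Z₃ j) θ))
      + T ^ 2 • (Φ.S i s * ev₂ (𝒵.Z₇ i j) s θ)
      + T • ((Φ.W i s)ᵀ * (Φ.Γ i j * (Φ.W j θ * ev (𝒵.Z₆ j) θ)))
      + T • ∑ l, (Φ.W i s)ᵀ * (Φ.Γ i l * matInt (-τ l) 0 fun η =>
          Φ.W l η * ev₂ (𝒵.Z₇ l j) η θ) := by
    intro j θ
    change T • (((Θ.inverse τ).Q i s)ᵀ * ev (𝒵.Z₃ j) θ)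
      + T ^ 2 • ((Θ.inverse τ).S i s * ev₂ (𝒵.Z₇ i j) s θ)
      + T • ((Θ.inverse τ).R i j s θ * ev (𝒵.Z₆ j) θ)
      + T • ∑ l, (matInt (-τ l) 0 fun η => (Θ.inverse τ).R i l s η * ev₂ (𝒵.Z₇ l j) η θ) = _
    simp only [PolyParams.inverse_Q, PolyParams.inverse_S, PolyParams.inverse_R _ _ hS, ← hΦ,
      Matrix.mul_assoc, Matrix.transpose_mul]
    simp only [← Matrix.mul_assoc _ (Φ.Γ i _), mul_matInt (hle _) (cZ7 _ _ _)]
  have e7' : ∀ j, ∫ θ in (-τ j)..0, (mapLo τ Θ 𝒵).L₇ i j s θ *ᵥ b j θ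
      = T • ((Φ.W i s)ᵀ *ᵥ ((Φ.H i)ᵀ *ᵥ vint (-τ j) 0 fun θ => ev (𝒵.Z₃ j) θ *ᵥ b j θ))
      + T ^ 2 • (Φ.S i s *ᵥ vint (-τ j) 0 fun θ => ev₂ (𝒵.Z₇ i j) s θ *ᵥ b j θ)
      + T • ((Φ.W i s)ᵀ *ᵥ (Φ.Γ i j *ᵥ vint (-τ j) 0 fun θ =>
          Φ.W j θ *ᵥ (ev (𝒵.Z₆ j) θ *ᵥ b j θ)))
      + T • ∑ l, (Φ.W i s)ᵀ *ᵥ (Φ.Γ i l *ᵥ vint (-τ j) 0 fun θ =>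
          (matInt (-τ l) 0 fun η => Φ.W l η * ev₂ (𝒵.Z₇ l j) η θ) *ᵥ b j θ) := by
    intro j
    have cc : ∀ {α β : Type} [Fintype β] (M : Matrix α β ℝ) {g : ℝ → β → ℝ},
        ContinuousOn g (Set.Icc (-τ j) 0) → ContinuousOn (fun s => M *ᵥ g s)
          (Set.Icc (-τ j) 0) := fun M g hg =>
      continuousOn_mulVec (M := fun _ => M) (fun _ _ => continuousOn_const) hg
    have c3 : ContinuousOn (fun s => ev (𝒵.Z₃ j) s *ᵥ b j s) (Set.Icc (-τ j) 0) :=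
      continuousOn_mulVec (fun a b => (continuous_ev _ a b).continuousOn) (hb j)
    have c6 : ContinuousOn (fun s => Φ.W j s *ᵥ (ev (𝒵.Z₆ j) s *ᵥ b j s)) (Set.Icc (-τ j) 0) := by
      simp only [Matrix.mulVec_mulVec]
      exact continuousOn_mulVec (cE _ _) (hb j)
    have c7 : ContinuousOn (fun θ => ev₂ (𝒵.Z₇ i j) s θ *ᵥ b j θ) (Set.Icc (-τ j) 0) :=
      continuousOn_mulVec (fun a b => ((continuous_ev₂ (𝒵.Z₇ i j) a b).comp
        (by fun_prop : Continuous fun θ : ℝ => (s, θ))).continuousOn) (hb j)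
    have c8 : ∀ l, ContinuousOn (fun θ => (matInt (-τ l) 0 fun η =>
        Φ.W l η * ev₂ (𝒵.Z₇ l j) η θ) *ᵥ b j θ) (Set.Icc (-τ j) 0) := fun l =>
      continuousOn_mulVec (fun a b => (continuous_matInt_mul (hle l) (R.W_cont l)
        (continuous_ev₂ _) a b).continuousOn) (hb j)
    have ef : ∀ θ, (mapLo τ Θ 𝒵).L₇ i j s θ *ᵥ b j θ
        = T • ((Φ.W i s)ᵀ *ᵥ ((Φ.H i)ᵀ *ᵥ (ev (𝒵.Z₃ j) θ *ᵥ b j θ)))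
        + T ^ 2 • (Φ.S i s *ᵥ (ev₂ (𝒵.Z₇ i j) s θ *ᵥ b j θ))
        + T • ((Φ.W i s)ᵀ *ᵥ (Φ.Γ i j *ᵥ (Φ.W j θ *ᵥ (ev (𝒵.Z₆ j) θ *ᵥ b j θ))))
        + T • ∑ l, (Φ.W i s)ᵀ *ᵥ (Φ.Γ i l *ᵥ ((matInt (-τ l) 0 fun η =>
            Φ.W l η * ev₂ (𝒵.Z₇ l j) η θ) *ᵥ b j θ)) := by
      intro θ
      simp only [e7, Matrix.add_mulVec, Matrix.smul_mulVec, Matrix.sum_mulVec,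
        Matrix.mulVec_mulVec]
    simp only [ef]
    have cs : ∀ (c : ℝ) {g : ℝ → Fin n → ℝ}, ContinuousOn g (Set.Icc (-τ j) 0) →
        ContinuousOn (fun s => c • g s) (Set.Icc (-τ j) 0) := fun c g hg => hg.const_smul c
    have ca : ∀ {f g : ℝ → Fin n → ℝ}, ContinuousOn f (Set.Icc (-τ j) 0) →
        ContinuousOn g (Set.Icc (-τ j) 0) →
        ContinuousOn (fun s => f s + g s) (Set.Icc (-τ j) 0) := fun hf hg => hf.add hg
    have d3 := cs T (cc (Φ.W i s)ᵀ (cc (Φ.H i)ᵀ c3))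
    have d7 := cs (T ^ 2) (cc (Φ.S i s) c7)
    have d6 := cs T (cc (Φ.W i s)ᵀ (cc (Φ.Γ i j) c6))
    have d8 := fun l => cc (Φ.W i s)ᵀ (cc (Φ.Γ i l) (c8 l))
    have d8' := cs T (continuousOn_finsetSum Finset.univ fun l _ => d8 l)
    have I := fun {α : Type} {g : ℝ → α → ℝ} (hg : ContinuousOn g (Set.Icc (-τ j) 0)) =>
      intervalIntegrable_of_continuousOn (hle j) hg
    rw [intervalIntegral_eq_vint (I (ca (ca (ca d3 d7) d6) d8')),
      vint_add (I (ca (ca d3 d7) d6)) (I d8'), vint_add (I (ca d3 d7)) (I d6),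
      vint_add (I d3) (I d7), vint_smul, vint_smul, vint_smul, vint_smul,
      vint_sum _ fun j _ => I (d8 j),
      ← mulVec_vint _ (I (cc (Φ.H i)ᵀ c3)), ← mulVec_vint _ (I c3), ← mulVec_vint _ (I c7),
      ← mulVec_vint _ (I (cc (Φ.Γ i j) c6)), ← mulVec_vint _ (I c6)]
    congr 2
    refine Finset.sum_congr rfl fun l _ => ?_
    rw [← mulVec_vint _ (I (cc (Φ.Γ i l) (c8 l))), ← mulVec_vint _ (I (c8 l))]
  simp only [injectHistory, e4, e5, e6, e7', SepOp.op₁, SepOp.coef, mom_estOp₁ R 𝒵 b₀ hb, ← hT]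
  rw [show estOp₁ τ 𝒵 b₀ b i s = T • (ev (𝒵.Z₄ i) s *ᵥ b₀ + ∑ j, ev (𝒵.Z₅ i j) s *ᵥ b j (-τ j)
    + ev (𝒵.Z₆ i) s *ᵥ b i s + ∑ j, vint (-τ j) 0 fun θ => ev₂ (𝒵.Z₇ i j) s θ *ᵥ b j θ) from rfl]
  simp only [estOp₀, pow_two, mul_smul, Matrix.mulVec_add, Matrix.add_mulVec,
    Matrix.mulVec_smul, Matrix.smul_mulVec, Matrix.mulVec_sum, Matrix.sum_mulVec,
    Finset.sum_add_distrib, ← Matrix.mulVec_mulVec, Finset.smul_sum, smul_add]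
  rw [Finset.sum_comm (f := fun j l => T • (Φ.W i s)ᵀ *ᵥ Φ.Γ i l *ᵥ
      (matInt (-τ l) 0 fun η => Φ.W l η * ev (𝒵.Z₅ l j) η) *ᵥ b j (-τ j)),
    Finset.sum_comm (f := fun j l => T • (Φ.W i s)ᵀ *ᵥ Φ.Γ i l *ᵥ vint (-τ j) 0 fun θ =>
      (matInt (-τ l) 0 fun η => Φ.W l η * ev₂ (𝒵.Z₇ l j) η θ) *ᵥ b j θ)]
  abel

end EstimatorGains

/-! ### Integrals of bilinear expressions -/

section BilinearIntegrals

variable {α β γ : Type*} [Fintype α] [Fintype β] [Fintype γ] {a b : ℝ}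

lemma dot_transpose_mulVec (M : Matrix α β ℝ) (x : β → ℝ) (y : α → ℝ) :
    x ⬝ᵥ Mᵀ *ᵥ y = y ⬝ᵥ M *ᵥ x := (dot_mulVec_comm M y x).symm

lemma integral_dot_mul_mulVec (hab : a ≤ b) {W : ℝ → Matrix β γ ℝ} {h : ℝ → γ → ℝ}
    (hW : ∀ i j, ContinuousOn (fun s => W s i j) (Set.Icc a b))
    (hh : ContinuousOn h (Set.Icc a b)) (v : α → ℝ) (A : Matrix α β ℝ) :
    ∫ s in a..b, v ⬝ᵥ (A * W s) *ᵥ h s = v ⬝ᵥ A *ᵥ vint a b fun s => W s *ᵥ h s := by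
  have c := continuousOn_mulVec hW hh
  rw [mulVec_vint _ (intervalIntegrable_of_continuousOn hab c),
    dot_vint _ (intervalIntegrable_of_continuousOn hab
      (continuousOn_mulVec (M := fun _ => A) (fun _ _ => continuousOn_const) c))]
  simp only [Matrix.mulVec_mulVec]

lemma integral_integral_dot_sep {δ : Type*} [Fintype δ] {c d : ℝ} (hab : a ≤ b) (hcd : c ≤ d)
    {V : ℝ → Matrix β α ℝ} {W : ℝ → Matrix γ δ ℝ} {h : ℝ → α → ℝ} {g : ℝ → δ → ℝ}
    (hV : ∀ i j, ContinuousOn (fun s => V s i j) (Set.Icc a b))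
    (hW : ∀ i j, ContinuousOn (fun s => W s i j) (Set.Icc c d))
    (hh : ContinuousOn h (Set.Icc a b)) (hg : ContinuousOn g (Set.Icc c d))
    (G : Matrix β γ ℝ) :
    ∫ s in a..b, ∫ θ in c..d, h s ⬝ᵥ ((V s)ᵀ * G * W θ) *ᵥ g θ
      = (vint a b fun s => V s *ᵥ h s) ⬝ᵥ G *ᵥ vint c d fun s => W s *ᵥ g s := by
  simp only [integral_dot_mul_mulVec hcd hW hg]
  rw [dotProduct_comm, dot_vint _ (intervalIntegrable_of_continuousOn hab
    (continuousOn_mulVec hV hh))]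
  refine intervalIntegral.integral_congr fun s _ => ?_
  simp only [← Matrix.mulVec_mulVec, dot_transpose_mulVec]

lemma integral_dot_add (hab : a ≤ b) {h f g : ℝ → α → ℝ} (hh : ContinuousOn h (Set.Icc a b))
    (hf : ContinuousOn f (Set.Icc a b)) (hg : ContinuousOn g (Set.Icc a b)) :
    ∫ s in a..b, h s ⬝ᵥ (f s + g s)
      = (∫ s in a..b, h s ⬝ᵥ f s) + ∫ s in a..b, h s ⬝ᵥ g s := by
  simp only [dotProduct_add]
  exact intervalIntegral.integral_add
    (intervalIntegrable_dot hab hh (intervalIntegrable_of_continuousOn hab hf))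
    (intervalIntegrable_dot hab hh (intervalIntegrable_of_continuousOn hab hg))

lemma vint_mulVec_byParts {α : Type*} (hab : a ≤ b) {M M' : ℝ → Matrix α β ℝ} {y y' : ℝ → β → ℝ}
    (hM : ∀ i j, IsPrim (fun s => M s i j) (fun s => M' s i j) a b)
    (hM' : ∀ i j, ContinuousOn (fun s => M' s i j) (Set.Icc a b))
    (hy : ∀ i, IsPrim (fun s => y s i) (fun s => y' s i) a b) :
    (vint a b fun s => M s *ᵥ y' s)
      = M b *ᵥ y b - M a *ᵥ y a - vint a b fun s => M' s *ᵥ y s := by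
  funext i
  have h := (IsPrim.sum Finset.univ hab fun j _ => (hM i j).mul (hy j)).integral_eq
  have hyc : ContinuousOn y (Set.Icc a b) := continuousOn_pi.2 fun j => (hy j).continuousOn
  have i1 := intervalIntegrable_of_continuousOn hab (continuousOn_mulVec hM' hyc) i
  have i2 := intervalIntegrable_mulVec hab (fun i j => (hM i j).continuousOn)
    (fun j => (hy j).int) i
  simp only [Matrix.mulVec, dotProduct] at i1 i2
  simp only [Finset.sum_add_distrib] at h
  rw [intervalIntegral.integral_add i1 i2] at h
  simp only [vint, Pi.sub_apply, Matrix.mulVec, dotProduct]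
  linarith

/-- Integrate the derivative of `yᵀ S y`; symmetry makes its two terms with `y'` equal. -/
lemma integral_quadratic_byParts (hab : a ≤ b) {S S' : ℝ → Matrix α α ℝ} {y y' : ℝ → α → ℝ}
    (hS : ∀ i j, IsPrim (fun s => S s i j) (fun s => S' s i j) a b)
    (hS' : ∀ i j, ContinuousOn (fun s => S' s i j) (Set.Icc a b))
    (hsymm : ∀ s ∈ Set.Icc a b, (S s)ᵀ = S s)
    (hy : ∀ i, IsPrim (fun s => y s i) (fun s => y' s i) a b) :
    2 * ∫ s in a..b, y s ⬝ᵥ S s *ᵥ y' s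
      = y b ⬝ᵥ S b *ᵥ y b - y a ⬝ᵥ S a *ᵥ y a - ∫ s in a..b, y s ⬝ᵥ S' s *ᵥ y s := by
  have h := (IsPrim.dot_mulVec' hab hy hS hy).integral_eq
  have hyc : ContinuousOn y (Set.Icc a b) := continuousOn_pi.2 fun j => (hy j).continuousOn
  have i1 := intervalIntegrable_dot hab hyc
    (intervalIntegrable_of_continuousOn hab (continuousOn_mulVec hS' hyc))
  have i2 := intervalIntegrable_dot hab hyc (intervalIntegrable_mulVec hab
    (fun i j => (hS i j).continuousOn) (fun j => (hy j).int))
  have e : ∫ s in a..b, (y' s ⬝ᵥ S s *ᵥ y s + y s ⬝ᵥ (S' s *ᵥ y s + S s *ᵥ y' s))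
      = ∫ s in a..b, (y s ⬝ᵥ S' s *ᵥ y s + 2 * (y s ⬝ᵥ S s *ᵥ y' s)) := by
    refine intervalIntegral.integral_congr fun s hs => ?_
    rw [Set.uIcc_of_le hab] at hs
    have := dot_transpose_mulVec (S s) (y' s) (y s)
    rw [hsymm s hs] at this
    simp only [dotProduct_add, this]
    ring
  rw [e, intervalIntegral.integral_add i1 (i2.const_mul 2),
    intervalIntegral.integral_const_mul] at h
  linarith

end BilinearIntegrals

/-! ### Derivatives of polynomial matrices -/

section MatDeriv

variable {α β γ : Type*}

lemma matDeriv_const_mul [Fintype β] (C : Matrix α β ℝ) {M : ℝ → Matrix β γ ℝ} {s : ℝ}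
    (hM : ∀ i j, DifferentiableAt ℝ (fun t => M t i j) s) :
    matDeriv (fun t => C * M t) s = C * matDeriv M s := by
  ext i j
  simp only [matDeriv, Matrix.of_apply, Matrix.mul_apply]
  rw [deriv_fun_sum fun l _ => (hM l j).const_mul _]
  exact Finset.sum_congr rfl fun l _ => deriv_const_mul _ (hM l j)

lemma matDeriv_mul_const [Fintype β] {M : ℝ → Matrix α β ℝ} (C : Matrix β γ ℝ) {s : ℝ}
    (hM : ∀ i j, DifferentiableAt ℝ (fun t => M t i j) s) :
    matDeriv (fun t => M t * C) s = matDeriv M s * C := by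
  ext i j
  simp only [matDeriv, Matrix.of_apply, Matrix.mul_apply]
  rw [deriv_fun_sum fun l _ => (hM i l).mul_const _]
  exact Finset.sum_congr rfl fun l _ => deriv_mul_const (hM i l) _

lemma matDeriv_transpose (M : ℝ → Matrix α β ℝ) (s : ℝ) :
    matDeriv (fun t => (M t)ᵀ) s = (matDeriv M s)ᵀ := rfl

lemma matDeriv_ev (M : Matrix α β ℝ[X]) (s : ℝ) :
    matDeriv (ev M) s = ev (M.map Polynomial.derivative) s := by
  ext i j
  exact (M i j).deriv

lemma isPrim_ev (M : Matrix α β ℝ[X]) (i : α) (j : β) {a b : ℝ} (hab : a ≤ b) :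
    IsPrim (fun s => ev M s i j) (fun s => matDeriv (ev M) s i j) a b := by
  simp only [matDeriv_ev]
  exact IsPrim.of_hasDerivAt hab (fun s _ => (M i j).hasDerivAt s)
    (continuous_ev _ i j).continuousOn

lemma continuous_matDeriv_ev (M : Matrix α β ℝ[X]) (i : α) (j : β) :
    Continuous fun s => matDeriv (ev M) s i j := by
  simp only [matDeriv_ev]
  exact continuous_ev _ i j

/-- The monomial matrix as the evaluation of a polynomial matrix. -/
lemma mono₁_eq_ev (d : ℕ) (ν : Type*) [DecidableEq ν] :
    mono₁ d ν = ev (Matrix.of fun (a : Fin (d + 1) × ν) (j : ν) =>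
      if a.2 = j then (X : ℝ[X]) ^ (a.1 : ℕ) else 0) := by
  funext s
  ext a j
  simp only [mono₁, ev, Matrix.of_apply, Matrix.map_apply]
  split_ifs <;> simp

lemma isPrim_mono₁ (d : ℕ) (ν : Type*) [DecidableEq ν] (i : Fin (d + 1) × ν) (j : ν) {a b : ℝ}
    (hab : a ≤ b) : IsPrim (fun s => mono₁ d ν s i j) (fun s => matDeriv (mono₁ d ν) s i j) a b := by
  rw [mono₁_eq_ev]
  exact isPrim_ev _ i j hab

lemma continuous_matDeriv_mono₁ (d : ℕ) (ν : Type*) [DecidableEq ν] (i : Fin (d + 1) × ν)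
    (j : ν) : Continuous fun s => matDeriv (mono₁ d ν) s i j := by
  rw [mono₁_eq_ev]
  exact continuous_matDeriv_ev _ i j

lemma differentiableAt_mono₁ (d : ℕ) (ν : Type*) [DecidableEq ν] (s : ℝ) (i : Fin (d + 1) × ν)
    (j : ν) : DifferentiableAt ℝ (fun t => mono₁ d ν t i j) s := by
  rw [mono₁_eq_ev]
  exact (Polynomial.differentiable _).differentiableAt

variable {k n : ℕ} (Θ : PolyParams k n)

lemma PolyParams.matDeriv_Q (i : Fin (k + 1)) (s : ℝ) :
    matDeriv (Θ.eval.Q i) s = Θ.H i * matDeriv (mono₁ Θ.deg (Fin n)) s :=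
  matDeriv_const_mul _ (differentiableAt_mono₁ _ _ s)

lemma PolyParams.matDeriv_R_left (i j : Fin (k + 1)) (s θ : ℝ) :
    matDeriv (fun s' => Θ.eval.R i j s' θ) s
      = (matDeriv (mono₁ Θ.deg (Fin n)) s)ᵀ * Θ.Γ i j * mono₁ Θ.deg (Fin n) θ := by
  have : (fun s' => Θ.eval.R i j s' θ)
      = fun s' => (mono₁ Θ.deg (Fin n) s')ᵀ * (Θ.Γ i j * mono₁ Θ.deg (Fin n) θ) := by
    funext s'; exact Matrix.mul_assoc _ _ _
  rw [this, matDeriv_mul_const, matDeriv_transpose, Matrix.mul_assoc]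
  exact fun a b => differentiableAt_mono₁ _ _ s b a

lemma PolyParams.matDeriv_R_right (i j : Fin (k + 1)) (s θ : ℝ) :
    matDeriv (fun θ' => Θ.eval.R i j s θ') θ
      = (mono₁ Θ.deg (Fin n) s)ᵀ * Θ.Γ i j * matDeriv (mono₁ Θ.deg (Fin n)) θ :=
  matDeriv_const_mul _ (differentiableAt_mono₁ _ _ θ)

end MatDeriv

/-! ### Double integrals of continuous functions -/

section DoubleIntegrals

variable {α β : Type*} [Fintype α] [Fintype β] {a b c d : ℝ}

lemma integral_integral_eq_prod (hab : a ≤ b) (hcd : c ≤ d) {F : ℝ → ℝ → ℝ}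
    (hF : ContinuousOn (fun p : ℝ × ℝ => F p.1 p.2) (Set.Icc a b ×ˢ Set.Icc c d)) :
    IntegrableOn (fun p : ℝ × ℝ => F p.1 p.2) (Set.Ioc a b ×ˢ Set.Ioc c d)
      ∧ ∫ s in a..b, ∫ θ in c..d, F s θ
        = ∫ p in Set.Ioc a b ×ˢ Set.Ioc c d, F p.1 p.2 := by
  have hi : IntegrableOn (fun p : ℝ × ℝ => F p.1 p.2) (Set.Ioc a b ×ˢ Set.Ioc c d) :=
    (hF.integrableOn_compact (isCompact_Icc.prod isCompact_Icc)).mono_set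
      (Set.prod_mono Set.Ioc_subset_Icc_self Set.Ioc_subset_Icc_self)
  refine ⟨hi, ?_⟩
  rw [Measure.volume_eq_prod] at hi ⊢
  rw [setIntegral_prod _ hi]
  simp only [intervalIntegral.integral_of_le hab, intervalIntegral.integral_of_le hcd]

lemma integral_integral_add (hab : a ≤ b) (hcd : c ≤ d) {F G : ℝ → ℝ → ℝ}
    (hF : ContinuousOn (fun p : ℝ × ℝ => F p.1 p.2) (Set.Icc a b ×ˢ Set.Icc c d))
    (hG : ContinuousOn (fun p : ℝ × ℝ => G p.1 p.2) (Set.Icc a b ×ˢ Set.Icc c d)) :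
    ∫ s in a..b, ∫ θ in c..d, (F s θ + G s θ)
      = (∫ s in a..b, ∫ θ in c..d, F s θ) + ∫ s in a..b, ∫ θ in c..d, G s θ := by
  obtain ⟨iF, eF⟩ := integral_integral_eq_prod hab hcd hF
  obtain ⟨iG, eG⟩ := integral_integral_eq_prod hab hcd hG
  rw [eF, eG, (integral_integral_eq_prod hab hcd (F := fun s θ => F s θ + G s θ)
    (hF.add hG)).2]
  exact integral_add iF iG

lemma integral_integral_swap_of_continuousOn (hab : a ≤ b) (hcd : c ≤ d) {F : ℝ → ℝ → ℝ}
    (hF : ContinuousOn (fun p : ℝ × ℝ => F p.1 p.2) (Set.Icc a b ×ˢ Set.Icc c d)) :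
    ∫ s in a..b, ∫ θ in c..d, F s θ = ∫ θ in c..d, ∫ s in a..b, F s θ := by
  refine intervalIntegral_intervalIntegral_swap ?_
  have h := (integral_integral_eq_prod hab hcd hF).1
  rw [Set.uIoc_of_le hab, Set.uIoc_of_le hcd]
  exact h

lemma continuousOn_prod_dot_mulVec {R : ℝ → ℝ → Matrix α β ℝ} {h : ℝ → α → ℝ} {g : ℝ → β → ℝ}
    (hR : ∀ i j, Continuous fun p : ℝ × ℝ => R p.1 p.2 i j)
    (hh : ContinuousOn h (Set.Icc a b)) (hg : ContinuousOn g (Set.Icc c d)) :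
    ContinuousOn (fun p : ℝ × ℝ => h p.1 ⬝ᵥ R p.1 p.2 *ᵥ g p.2)
      (Set.Icc a b ×ˢ Set.Icc c d) := by
  simp only [dotProduct, Matrix.mulVec]
  refine continuousOn_finsetSum _ fun i _ => ContinuousOn.mul ?_ ?_
  · exact (continuousOn_pi.1 hh i).comp continuousOn_fst fun p hp => hp.1
  · refine continuousOn_finsetSum _ fun j _ => (hR i j).continuousOn.mul ?_
    exact (continuousOn_pi.1 hg j).comp continuousOn_snd fun p hp => hp.2

lemma integral_integral_dot_mulVec (hcd : c ≤ d)
    {R : ℝ → ℝ → Matrix α β ℝ} {h : ℝ → α → ℝ} {g : ℝ → β → ℝ}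
    (hR : ∀ i j, Continuous fun p : ℝ × ℝ => R p.1 p.2 i j)
    (hg : ContinuousOn g (Set.Icc c d)) :
    ∫ s in a..b, ∫ θ in c..d, h s ⬝ᵥ R s θ *ᵥ g θ
      = ∫ s in a..b, h s ⬝ᵥ vint c d fun θ => R s θ *ᵥ g θ := by
  refine intervalIntegral.integral_congr fun s _ => ?_
  have : ∀ i j, ContinuousOn (fun θ => R s θ i j) (Set.Icc c d) := fun i j =>
    ((hR i j).comp (by fun_prop : Continuous fun θ : ℝ => (s, θ))).continuousOn
  exact (dot_vint _ (intervalIntegrable_of_continuousOn hcd (continuousOn_mulVec this hg))).symm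

end DoubleIntegrals

lemma continuous_matrix_mul₂ {α β γ X : Type*} [Fintype β] [TopologicalSpace X]
    {M : X → Matrix α β ℝ} {N : X → Matrix β γ ℝ} (hM : ∀ i j, Continuous fun x => M x i j)
    (hN : ∀ i j, Continuous fun x => N x i j) (i : α) (j : γ) :
    Continuous fun x => (M x * N x) i j := by
  simp only [Matrix.mul_apply]
  exact continuous_finsetSum _ fun l _ => (hM i l).mul (hN l j)

/-! ### The quadratic form of `𝓛₂` -/

section FormL₂

variable {k n m q r p p₁ : ℕ} {sys : DelaySystem k n m q r p p₁} {Θ : PolyParams k n}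
  {e₀ : Fin n → ℝ} {e e' : Fin (k + 1) → ℝ → Fin n → ℝ}

/-- The values `(v, ω, x, φ₁(-τ₁), …, φ_K(-τ_K))`. -/
def lmiVec {a b : ℕ} (τ : Fin (k + 1) → ℝ) (v : Fin a → ℝ) (ω : Fin b → ℝ) (x₀ : Fin n → ℝ)
    (x : Fin (k + 1) → ℝ → Fin n → ℝ) : LmiIdx k n a b → ℝ :=
  Sum.elim (Sum.elim v ω) (Sum.elim x₀ fun j => x j.2 (-τ j.2) j.1)

lemma dot_stateProj {a b : ℕ} (τ : Fin (k + 1) → ℝ) (v : Fin a → ℝ) (ω : Fin b → ℝ)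
    (x₀ : Fin n → ℝ) (x : Fin (k + 1) → ℝ → Fin n → ℝ) :
    lmiVec τ v ω x₀ x ⬝ᵥ stateProj k n a b *ᵥ lmiVec τ v ω x₀ x = x₀ ⬝ᵥ x₀ := by
  simp only [lmiVec, stateProj, Matrix.fromBlocks_mulVec, Sum.elim_comp_inl, Sum.elim_comp_inr,
    sumElim_dotProduct_sumElim, Matrix.zero_mulVec, Matrix.one_mulVec, add_zero, zero_add,
    dotProduct_zero]

lemma dot_blockCol_vec (x : Fin n × Fin (k + 1) → ℝ) (y : Fin (k + 1) → Fin n → ℝ) :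
    x ⬝ᵥ (fun j => y j.2 j.1) = ∑ j, (fun a => x (a, j)) ⬝ᵥ y j := by
  simp only [dotProduct, Fintype.sum_prod_type]
  exact Finset.sum_comm

lemma blockRow_zero {a : Type*} : blockRow (fun _ : Fin (k + 1) => (0 : Matrix a (Fin n) ℝ)) = 0 :=
  rfl

lemma dot_lmiBlocks {a b : ℕ} (τ : Fin (k + 1) → ℝ) (M₁₁ : Matrix (Fin a) (Fin a) ℝ)
    (M₁₂ : Matrix (Fin a) (Fin b) ℝ) (M₂₂ : Matrix (Fin b) (Fin b) ℝ)
    (U₁ : Matrix (Fin a) (Fin n) ℝ) (N₁ : Fin (k + 1) → Matrix (Fin a) (Fin n) ℝ)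
    (U₂ : Matrix (Fin b) (Fin n) ℝ) (N₂ : Fin (k + 1) → Matrix (Fin b) (Fin n) ℝ)
    (E : Matrix (Fin n) (Fin n) ℝ) (G D : Fin (k + 1) → Matrix (Fin n) (Fin n) ℝ)
    (v : Fin a → ℝ) (ω : Fin b → ℝ) (x₀ : Fin n → ℝ) (x : Fin (k + 1) → ℝ → Fin n → ℝ) :
    lmiVec τ v ω x₀ x ⬝ᵥ Matrix.fromBlocks (Matrix.fromBlocks M₁₁ M₁₂ M₁₂ᵀ M₂₂)
        (Matrix.fromBlocks U₁ (blockRow N₁) U₂ (blockRow N₂))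
        (Matrix.fromBlocks U₁ (blockRow N₁) U₂ (blockRow N₂))ᵀ
        (Matrix.fromBlocks E (blockRow G) (blockRow G)ᵀ (Matrix.blockDiagonal D))
        *ᵥ lmiVec τ v ω x₀ x
      = v ⬝ᵥ M₁₁ *ᵥ v + 2 * (v ⬝ᵥ M₁₂ *ᵥ ω) + ω ⬝ᵥ M₂₂ *ᵥ ω
        + 2 * (v ⬝ᵥ U₁ *ᵥ x₀) + 2 * ∑ i, v ⬝ᵥ N₁ i *ᵥ x i (-τ i)
        + 2 * (ω ⬝ᵥ U₂ *ᵥ x₀) + 2 * ∑ i, ω ⬝ᵥ N₂ i *ᵥ x i (-τ i)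
        + x₀ ⬝ᵥ E *ᵥ x₀ + 2 * ∑ i, x₀ ⬝ᵥ G i *ᵥ x i (-τ i)
        + ∑ i, x i (-τ i) ⬝ᵥ D i *ᵥ x i (-τ i) := by
  have hD : Matrix.blockDiagonal D *ᵥ (fun j : Fin n × Fin (k + 1) => x j.2 (-τ j.2) j.1)
      = fun j => (D j.2 *ᵥ x j.2 (-τ j.2)) j.1 := by
    funext ⟨c, i⟩
    exact blockDiagonal_mulVec D _ c i
  simp only [lmiVec, Matrix.fromBlocks_mulVec, Matrix.fromBlocks_transpose,
    Sum.elim_comp_inl, Sum.elim_comp_inr, sumElim_dotProduct_sumElim, dotProduct_add,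
    dot_transpose_mulVec, hD]
  rw [dot_blockCol_vec _ fun i => D i *ᵥ x i (-τ i)]
  simp only [blockRow_mulVec, dotProduct_sum]
  ring

/-- The finite-dimensional part is regrouped by origin: the output and performance terms, the rate
of the present error paired with `P e₀`, the injection terms, and the boundary values at `0` and
`-τᵢ` left by integrating `e'` by parts against `Q` and `S`. -/
lemma mapL₂_P_form (γ : ℝ) (hP : Θ.Pᵀ = Θ.P) (𝒵 : EstimVars k n q)
    (w : Fin r → ℝ) (ζ : Fin p₁ → ℝ) (e₀ : Fin n → ℝ) (e : Fin (k + 1) → ℝ → Fin n → ℝ) :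
    lmiVec sys.τ w ζ e₀ e ⬝ᵥ (mapL₂ sys γ Θ.eval 𝒵).P *ᵥ lmiVec sys.τ w ζ e₀ e
      = sys.T⁻¹ * (2 * (ζ ⬝ᵥ (sys.C₃₀ *ᵥ e₀ + ∑ i, sys.C₃ i *ᵥ e i (-sys.τ i) + sys.D₃ *ᵥ w))
          - γ * (w ⬝ᵥ w) - γ * (ζ ⬝ᵥ ζ))
        + 2 * (e₀ ⬝ᵥ Θ.P *ᵥ (sys.A₀ *ᵥ e₀ + ∑ i, sys.A i *ᵥ e i (-sys.τ i) - sys.B₁ *ᵥ w))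
        + 2 * (e₀ ⬝ᵥ (𝒵.Z₁ *ᵥ (sys.C₂ *ᵥ e₀) + ∑ i, 𝒵.Z₂ i *ᵥ (sys.C₂ *ᵥ e i (-sys.τ i))))
        + 2 * ∑ i, (e₀ ⬝ᵥ Θ.H i *ᵥ (mono₁ Θ.deg (Fin n) 0 *ᵥ e₀
            - mono₁ Θ.deg (Fin n) (-sys.τ i) *ᵥ e i (-sys.τ i)))
        + ∑ i, (e₀ ⬝ᵥ ev (Θ.S i) 0 *ᵥ e₀
            - e i (-sys.τ i) ⬝ᵥ ev (Θ.S i) (-sys.τ i) *ᵥ e i (-sys.τ i)) := by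
  have hsymm : (Θ.P *ᵥ e₀) ⬝ᵥ sys.A₀ *ᵥ e₀ = e₀ ⬝ᵥ Θ.P *ᵥ (sys.A₀ *ᵥ e₀) := by
    conv_lhs => rw [← hP, transpose_mulVec_dot]
  have h := dot_lmiBlocks sys.τ (-(γ / sys.T) • (1 : Matrix (Fin r) (Fin r) ℝ))
    (sys.T⁻¹ • sys.D₃ᵀ) (-(γ / sys.T) • (1 : Matrix (Fin p₁) (Fin p₁) ℝ))
    (-(Θ.P * sys.B₁)ᵀ) (fun _ => 0) (sys.T⁻¹ • sys.C₃₀) (fun i => sys.T⁻¹ • sys.C₃ i)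
    (Θ.P * sys.A₀ + sys.A₀ᵀ * Θ.P + ∑ i, (Θ.eval.Q i 0 + (Θ.eval.Q i 0)ᵀ + Θ.eval.S i 0)
      + 𝒵.Z₁ * sys.C₂ + sys.C₂ᵀ * 𝒵.Z₁ᵀ)
    (fun i => Θ.P * sys.A i - Θ.eval.Q i (-sys.τ i) + 𝒵.Z₂ i * sys.C₂)
    (fun i => -Θ.eval.S i (-sys.τ i)) w ζ e₀ e
  rw [blockRow_zero, Matrix.transpose_smul, Matrix.transpose_transpose] at h
  refine h.trans ?_
  simp only [PolyParams.eval, Matrix.add_mulVec, Matrix.sub_mulVec, Matrix.neg_mulVec,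
    Matrix.smul_mulVec, Matrix.one_mulVec, Matrix.sum_mulVec, Matrix.mulVec_add, Matrix.mulVec_sub,
    Matrix.mulVec_sum, Matrix.zero_mulVec, Matrix.transpose_mul, ← Matrix.mulVec_mulVec,
    dotProduct_add, dotProduct_sub, dotProduct_neg, dotProduct_smul, dotProduct_sum,
    dot_transpose_mulVec, transpose_mulVec_dot, dotProduct_zero, Finset.sum_const_zero, Finset.sum_add_distrib, Finset.sum_sub_distrib,
    Finset.sum_neg_distrib, ← Finset.mul_sum, smul_eq_mul, hsymm]
  ring

/-- The `Q` block collects the terms linear in a history: the rate of the present error against `Q`,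
the boundary terms of `R` at `0` and `-τⱼ`, the derivative of `Q` left by integration by parts, and
the injections `Z₃`, `Z₄`, `Z₅`. -/
lemma mapL₂_Q_form (γ : ℝ) (𝒵 : EstimVars k n q) (w : Fin r → ℝ) (ζ : Fin p₁ → ℝ)
    (e₀ : Fin n → ℝ) (he : ∀ i, ContinuousOn (e i) (Set.Icc (-sys.τ i) 0)) (i : Fin (k + 1)) :
    ∫ s in (-sys.τ i)..0,
        lmiVec sys.τ w ζ e₀ e ⬝ᵥ (mapL₂ sys γ Θ.eval 𝒵).Q i s *ᵥ e i s
      = (sys.A₀ *ᵥ e₀ + ∑ i, sys.A i *ᵥ e i (-sys.τ i) - sys.B₁ *ᵥ w)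
          ⬝ᵥ Θ.H i *ᵥ Θ.sep.mom sys.τ e i
        + sys.T⁻¹ * ∑ j, Θ.sep.mom sys.τ e i ⬝ᵥ Θ.Γ i j *ᵥ (mono₁ Θ.deg (Fin n) 0 *ᵥ e₀
            - mono₁ Θ.deg (Fin n) (-sys.τ j) *ᵥ e j (-sys.τ j))
        - e₀ ⬝ᵥ Θ.H i *ᵥ (vint (-sys.τ i) 0 fun s => matDeriv (mono₁ Θ.deg (Fin n)) s *ᵥ e i s)
        + e₀ ⬝ᵥ (vint (-sys.τ i) 0 fun s => ev (𝒵.Z₃ i) s *ᵥ (sys.C₂ *ᵥ e i s))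
        + ∫ s in (-sys.τ i)..0, e i s ⬝ᵥ (ev (𝒵.Z₄ i) s *ᵥ (sys.C₂ *ᵥ e₀)
            + ∑ j, ev (𝒵.Z₅ i j) s *ᵥ (sys.C₂ *ᵥ e j (-sys.τ j))) := by
  have hle : -sys.τ i ≤ 0 := by linarith [sys.τ_pos i]
  set a := sys.A₀ *ᵥ e₀ + ∑ i, sys.A i *ᵥ e i (-sys.τ i) - sys.B₁ *ᵥ w with ha
  -- `u` gathers all that multiplies `Y(s) eᵢ(s)`, so that its contribution integrates to a moment.
  set u := (Θ.H i)ᵀ *ᵥ a + sys.T⁻¹ • ∑ j, Θ.Γ i j *ᵥ (mono₁ Θ.deg (Fin n) 0 *ᵥ e₀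
            - mono₁ Θ.deg (Fin n) (-sys.τ j) *ᵥ e j (-sys.τ j)) with hu
  have cC : ContinuousOn (fun s => sys.C₂ *ᵥ e i s) (Set.Icc (-sys.τ i) 0) :=
    continuousOn_mulVec (M := fun _ => sys.C₂) (fun _ _ => continuousOn_const) (he i)
  have c1 : ContinuousOn (fun s => mono₁ Θ.deg (Fin n) s *ᵥ e i s) (Set.Icc (-sys.τ i) 0) :=
    continuousOn_mulVec (fun a b => ((continuous_mono₁ _ _).matrix_elem a b).continuousOn) (he i)
  have c2 : ContinuousOn (fun s => matDeriv (mono₁ Θ.deg (Fin n)) s *ᵥ e i s)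
      (Set.Icc (-sys.τ i) 0) :=
    continuousOn_mulVec (fun a b => (continuous_matDeriv_mono₁ _ _ a b).continuousOn) (he i)
  have c3 : ContinuousOn (fun s => ev (𝒵.Z₃ i) s *ᵥ (sys.C₂ *ᵥ e i s)) (Set.Icc (-sys.τ i) 0) :=
    continuousOn_mulVec (fun a b => (continuous_ev _ a b).continuousOn) cC
  have c4 : ContinuousOn (fun s => ev (𝒵.Z₄ i) s *ᵥ (sys.C₂ *ᵥ e₀)
      + ∑ j, ev (𝒵.Z₅ i j) s *ᵥ (sys.C₂ *ᵥ e j (-sys.τ j))) (Set.Icc (-sys.τ i) 0) := by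
    refine ContinuousOn.add ?_ (continuousOn_finsetSum _ fun j _ => ?_)
    · exact continuousOn_mulVec (fun a b => (continuous_ev _ a b).continuousOn) continuousOn_const
    · exact continuousOn_mulVec (fun a b => (continuous_ev _ a b).continuousOn) continuousOn_const
  have I := fun {α : Type} {g : ℝ → α → ℝ} (hg : ContinuousOn g (Set.Icc (-sys.τ i) 0)) =>
    intervalIntegrable_of_continuousOn hle hg
  have J := fun {α : Type} [Fintype α] {g : ℝ → α → ℝ} (x : α → ℝ)
      (hg : ContinuousOn g (Set.Icc (-sys.τ i) 0)) =>
    intervalIntegrable_dot (x := fun _ => x) hle continuousOn_const (I hg)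
  have key : ∀ s, lmiVec sys.τ w ζ e₀ e ⬝ᵥ (mapL₂ sys γ Θ.eval 𝒵).Q i s *ᵥ e i s
      = u ⬝ᵥ mono₁ Θ.deg (Fin n) s *ᵥ e i s
        + -((Θ.H i)ᵀ *ᵥ e₀) ⬝ᵥ matDeriv (mono₁ Θ.deg (Fin n)) s *ᵥ e i s
        + e₀ ⬝ᵥ ev (𝒵.Z₃ i) s *ᵥ (sys.C₂ *ᵥ e i s)
        + e i s ⬝ᵥ (ev (𝒵.Z₄ i) s *ᵥ (sys.C₂ *ᵥ e₀)
            + ∑ j, ev (𝒵.Z₅ i j) s *ᵥ (sys.C₂ *ᵥ e j (-sys.τ j))) := by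
    intro s
    have hcol : ∀ N : Fin (k + 1) → Matrix (Fin n) (Fin n) ℝ,
        (fun j : Fin n × Fin (k + 1) => e j.2 (-sys.τ j.2) j.1) ⬝ᵥ blockCol N *ᵥ e i s
          = ∑ j, e j (-sys.τ j) ⬝ᵥ N j *ᵥ e i s := fun N =>
      dot_blockCol_vec _ fun j => N j *ᵥ e i s
    simp only [lmiVec, mapL₂, PolyParams.matDeriv_Q, Matrix.fromRows_mulVec,
      sumElim_dotProduct_sumElim, hcol]
    simp only [hu, ha, PolyParams.eval, Matrix.add_mulVec, Matrix.sub_mulVec, Matrix.neg_mulVec,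
      Matrix.smul_mulVec, Matrix.sum_mulVec, Matrix.mulVec_add, Matrix.mulVec_sub,
      Matrix.mulVec_sum, Matrix.zero_mulVec, Matrix.transpose_mul, ← Matrix.mulVec_mulVec,
      dotProduct_add, dotProduct_sub, dotProduct_neg, dotProduct_smul, dotProduct_sum,
      add_dotProduct, sub_dotProduct, neg_dotProduct, smul_dotProduct, sum_dotProduct,
      dot_transpose_mulVec, transpose_mulVec_dot, dotProduct_zero, Finset.sum_add_distrib,
      Finset.sum_sub_distrib, ← Finset.mul_sum, smul_eq_mul]
    simp only [dotProduct_comm (Θ.Γ i _ *ᵥ _), dotProduct_comm (Θ.H i *ᵥ _)]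
    ring
  simp only [key]
  rw [intervalIntegral.integral_add, intervalIntegral.integral_add, intervalIntegral.integral_add,
    ← dot_vint _ (I c1), ← dot_vint _ (I c2), ← dot_vint _ (I c3)]
  · change u ⬝ᵥ Θ.sep.mom sys.τ e i + _ + _ + _ = _
    simp only [hu, add_dotProduct, neg_dotProduct, smul_dotProduct, transpose_mulVec_dot,
      sum_dotProduct, smul_eq_mul]
    simp only [dotProduct_comm (Θ.Γ i _ *ᵥ _)]
    ring
  · exact J _ c1
  · exact J _ c2
  · exact (J _ c1).add (J _ c2)
  · exact J _ c3
  · exact ((J _ c1).add (J _ c2)).add (J _ c3)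
  · exact intervalIntegrable_dot hle (he i) (I c4)

lemma mapL₂_S_form (γ : ℝ) (𝒵 : EstimVars k n q)
    (he : ∀ i, ContinuousOn (e i) (Set.Icc (-sys.τ i) 0)) (i : Fin (k + 1)) :
    ∫ s in (-sys.τ i)..0, e i s ⬝ᵥ (mapL₂ sys γ Θ.eval 𝒵).S i s *ᵥ e i s
      = 2 * (∫ s in (-sys.τ i)..0, e i s ⬝ᵥ ev (𝒵.Z₆ i) s *ᵥ (sys.C₂ *ᵥ e i s))
        - ∫ s in (-sys.τ i)..0, e i s ⬝ᵥ matDeriv (ev (Θ.S i)) s *ᵥ e i s := by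
  have hle : -sys.τ i ≤ 0 := by linarith [sys.τ_pos i]
  have cC : ContinuousOn (fun s => sys.C₂ *ᵥ e i s) (Set.Icc (-sys.τ i) 0) :=
    continuousOn_mulVec (M := fun _ => sys.C₂) (fun _ _ => continuousOn_const) (he i)
  have i1 := intervalIntegrable_dot hle (he i) (intervalIntegrable_of_continuousOn hle
    (continuousOn_mulVec (fun a b => (continuous_ev (𝒵.Z₆ i) a b).continuousOn) cC))
  have i2 := intervalIntegrable_dot hle (he i) (intervalIntegrable_of_continuousOn hle
    (continuousOn_mulVec (fun a b => (continuous_matDeriv_ev (Θ.S i) a b).continuousOn) (he i)))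
  rw [← intervalIntegral.integral_const_mul, ← intervalIntegral.integral_sub (i1.const_mul 2) i2]
  refine intervalIntegral.integral_congr fun s _ => ?_
  simp only [mapL₂, PolyParams.eval, Matrix.add_mulVec, Matrix.neg_mulVec, dotProduct_add,
    dotProduct_neg, ← Matrix.mulVec_mulVec, dot_transpose_mulVec, transpose_mulVec_dot]
  ring

/-- The two derivatives of `R` fall on one factor each of `Yᵀ Γ Y`. The symmetrised `Z₇` kernel
gives the `(i, j)` integral and, after exchanging the order of integration, the `(j, i)` integral.
-/
lemma mapL₂_R_form (γ : ℝ) (𝒵 : EstimVars k n q)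
    (he : ∀ i, ContinuousOn (e i) (Set.Icc (-sys.τ i) 0)) (i j : Fin (k + 1)) :
    ∫ s in (-sys.τ i)..0, ∫ θ in (-sys.τ j)..0,
        e i s ⬝ᵥ (mapL₂ sys γ Θ.eval 𝒵).R i j s θ *ᵥ e j θ
      = sys.T * ((∫ s in (-sys.τ i)..0, e i s ⬝ᵥ vint (-sys.τ j) 0 fun θ =>
              ev₂ (𝒵.Z₇ i j) s θ *ᵥ (sys.C₂ *ᵥ e j θ))
            + ∫ s in (-sys.τ j)..0, e j s ⬝ᵥ vint (-sys.τ i) 0 fun θ =>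
              ev₂ (𝒵.Z₇ j i) s θ *ᵥ (sys.C₂ *ᵥ e i θ))
        - (vint (-sys.τ i) 0 fun s => matDeriv (mono₁ Θ.deg (Fin n)) s *ᵥ e i s)
            ⬝ᵥ Θ.Γ i j *ᵥ Θ.sep.mom sys.τ e j
        - Θ.sep.mom sys.τ e i ⬝ᵥ Θ.Γ i j *ᵥ
            vint (-sys.τ j) 0 fun s => matDeriv (mono₁ Θ.deg (Fin n)) s *ᵥ e j s := by
  have hle : ∀ i, -sys.τ i ≤ 0 := fun i => by linarith [sys.τ_pos i]
  have cY : ∀ a b, Continuous fun s => mono₁ Θ.deg (Fin n) s a b := fun a b =>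
    (continuous_mono₁ _ _).matrix_elem a b
  have cY' := continuous_matDeriv_mono₁ Θ.deg (Fin n)
  have cC : ∀ i, ContinuousOn (fun s => sys.C₂ *ᵥ e i s) (Set.Icc (-sys.τ i) 0) := fun i =>
    continuousOn_mulVec (M := fun _ => sys.C₂) (fun _ _ => continuousOn_const) (he i)
  obtain ⟨F₁, h₁⟩ : ∃ F : ℝ → ℝ → ℝ, F = fun s θ => sys.T * (e i s ⬝ᵥ ev₂ (𝒵.Z₇ i j) s θ *ᵥ
      (sys.C₂ *ᵥ e j θ)) := ⟨_, rfl⟩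
  obtain ⟨F₂, h₂⟩ : ∃ F : ℝ → ℝ → ℝ, F = fun s θ => sys.T * (e j θ ⬝ᵥ ev₂ (𝒵.Z₇ j i) θ s *ᵥ
      (sys.C₂ *ᵥ e i s)) := ⟨_, rfl⟩
  obtain ⟨F₃, h₃⟩ : ∃ F : ℝ → ℝ → ℝ, F = fun s θ => e i s ⬝ᵥ
      ((matDeriv (mono₁ Θ.deg (Fin n)) s)ᵀ * -Θ.Γ i j * mono₁ Θ.deg (Fin n) θ) *ᵥ e j θ :=
    ⟨_, rfl⟩
  obtain ⟨F₄, h₄⟩ : ∃ F : ℝ → ℝ → ℝ, F = fun s θ => e i s ⬝ᵥ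
      ((mono₁ Θ.deg (Fin n) s)ᵀ * -Θ.Γ i j * matDeriv (mono₁ Θ.deg (Fin n)) θ) *ᵥ e j θ :=
    ⟨_, rfl⟩
  have k₁ : ContinuousOn (fun p : ℝ × ℝ => F₁ p.1 p.2)
      (Set.Icc (-sys.τ i) 0 ×ˢ Set.Icc (-sys.τ j) 0) := by
    rw [h₁]
    exact continuousOn_const.mul
      (continuousOn_prod_dot_mulVec (R := ev₂ (𝒵.Z₇ i j)) (h := e i)
        (g := fun θ => sys.C₂ *ᵥ e j θ) (continuous_ev₂ _) (he i) (cC j))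
  have k₂ : ContinuousOn (fun p : ℝ × ℝ => F₂ p.1 p.2)
      (Set.Icc (-sys.τ i) 0 ×ˢ Set.Icc (-sys.τ j) 0) := by
    have c : ContinuousOn (fun p : ℝ × ℝ => e j p.1 ⬝ᵥ ev₂ (𝒵.Z₇ j i) p.1 p.2 *ᵥ
        (sys.C₂ *ᵥ e i p.2)) (Set.Icc (-sys.τ j) 0 ×ˢ Set.Icc (-sys.τ i) 0) :=
      continuousOn_prod_dot_mulVec (R := ev₂ (𝒵.Z₇ j i)) (h := e j)
        (g := fun θ => sys.C₂ *ᵥ e i θ) (continuous_ev₂ _) (he j) (cC i)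
    have c' : ContinuousOn (fun p : ℝ × ℝ => e j p.2 ⬝ᵥ ev₂ (𝒵.Z₇ j i) p.2 p.1 *ᵥ
        (sys.C₂ *ᵥ e i p.1)) (Set.Icc (-sys.τ i) 0 ×ˢ Set.Icc (-sys.τ j) 0) :=
      c.comp (f := Prod.swap) continuous_swap.continuousOn fun p hp => ⟨hp.2, hp.1⟩
    rw [h₂]
    exact continuousOn_const.mul c'
  have k₃ : ContinuousOn (fun p : ℝ × ℝ => F₃ p.1 p.2)
      (Set.Icc (-sys.τ i) 0 ×ˢ Set.Icc (-sys.τ j) 0) := by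
    rw [h₃]
    refine continuousOn_prod_dot_mulVec (R := fun s θ => (matDeriv (mono₁ Θ.deg (Fin n)) s)ᵀ *
      -Θ.Γ i j * mono₁ Θ.deg (Fin n) θ) ?_ (he i) (he j)
    exact continuous_matrix_mul₂ (continuous_matrix_mul₂ (M := fun p : ℝ × ℝ =>
        (matDeriv (mono₁ Θ.deg (Fin n)) p.1)ᵀ) (N := fun _ => -Θ.Γ i j)
      (fun a b => (cY' b a).comp continuous_fst) fun _ _ => continuous_const)
      fun a b => (cY a b).comp continuous_snd
  have k₄ : ContinuousOn (fun p : ℝ × ℝ => F₄ p.1 p.2)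
      (Set.Icc (-sys.τ i) 0 ×ˢ Set.Icc (-sys.τ j) 0) := by
    rw [h₄]
    refine continuousOn_prod_dot_mulVec (R := fun s θ => (mono₁ Θ.deg (Fin n) s)ᵀ *
      -Θ.Γ i j * matDeriv (mono₁ Θ.deg (Fin n)) θ) ?_ (he i) (he j)
    exact continuous_matrix_mul₂ (continuous_matrix_mul₂ (M := fun p : ℝ × ℝ =>
        (mono₁ Θ.deg (Fin n) p.1)ᵀ) (N := fun _ => -Θ.Γ i j)
      (fun a b => (cY b a).comp continuous_fst) fun _ _ => continuous_const)
      fun a b => (cY' a b).comp continuous_snd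
  have key : ∀ s θ, e i s ⬝ᵥ (mapL₂ sys γ Θ.eval 𝒵).R i j s θ *ᵥ e j θ
      = F₁ s θ + F₂ s θ + F₃ s θ + F₄ s θ := by
    intro s θ
    simp only [h₁, h₂, h₃, h₄, mapL₂, PolyParams.matDeriv_R_left, PolyParams.matDeriv_R_right]
    simp only [Matrix.add_mulVec, Matrix.sub_mulVec, Matrix.neg_mulVec, Matrix.smul_mulVec,
      Matrix.mul_neg, Matrix.neg_mul, dotProduct_add, dotProduct_sub, dotProduct_neg,
      dotProduct_smul, ← Matrix.mulVec_mulVec, dot_transpose_mulVec, transpose_mulVec_dot,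
      smul_eq_mul]
    ring
  have e₁ : ∫ s in (-sys.τ i)..0, ∫ θ in (-sys.τ j)..0, F₁ s θ
      = sys.T * ∫ s in (-sys.τ i)..0, e i s ⬝ᵥ vint (-sys.τ j) 0 fun θ =>
              ev₂ (𝒵.Z₇ i j) s θ *ᵥ (sys.C₂ *ᵥ e j θ) := by
    simp only [h₁, intervalIntegral.integral_const_mul]
    rw [integral_integral_dot_mulVec (R := ev₂ (𝒵.Z₇ i j)) (hle j) (continuous_ev₂ _) (cC j)]
  have e₂ : ∫ s in (-sys.τ i)..0, ∫ θ in (-sys.τ j)..0, F₂ s θ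
      = sys.T * ∫ s in (-sys.τ j)..0, e j s ⬝ᵥ vint (-sys.τ i) 0 fun θ =>
              ev₂ (𝒵.Z₇ j i) s θ *ᵥ (sys.C₂ *ᵥ e i θ) := by
    rw [integral_integral_swap_of_continuousOn (hle i) (hle j) k₂]
    simp only [h₂, intervalIntegral.integral_const_mul]
    rw [integral_integral_dot_mulVec (R := ev₂ (𝒵.Z₇ j i)) (hle i) (continuous_ev₂ _) (cC i)]
  have e₃ : ∫ s in (-sys.τ i)..0, ∫ θ in (-sys.τ j)..0, F₃ s θ
      = (vint (-sys.τ i) 0 fun s => matDeriv (mono₁ Θ.deg (Fin n)) s *ᵥ e i s)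
            ⬝ᵥ (-Θ.Γ i j) *ᵥ Θ.sep.mom sys.τ e j := by
    rw [h₃]
    exact integral_integral_dot_sep (hle i) (hle j) (fun a b => (cY' a b).continuousOn)
      (fun a b => (cY a b).continuousOn) (he i) (he j) _
  have e₄ : ∫ s in (-sys.τ i)..0, ∫ θ in (-sys.τ j)..0, F₄ s θ
      = Θ.sep.mom sys.τ e i ⬝ᵥ (-Θ.Γ i j) *ᵥ
            vint (-sys.τ j) 0 fun s => matDeriv (mono₁ Θ.deg (Fin n)) s *ᵥ e j s := by
    rw [h₄]
    exact integral_integral_dot_sep (hle i) (hle j) (fun a b => (cY a b).continuousOn)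
      (fun a b => (cY' a b).continuousOn) (he i) (he j) _
  simp only [key]
  rw [integral_integral_add (F := fun s θ => F₁ s θ + F₂ s θ + F₃ s θ) (hle i) (hle j)
      ((k₁.add k₂).add k₃) k₄,
    integral_integral_add (F := fun s θ => F₁ s θ + F₂ s θ) (hle i) (hle j) (k₁.add k₂) k₃,
    integral_integral_add (hle i) (hle j) k₁ k₂, e₁, e₂, e₃, e₄]
  simp only [Matrix.neg_mulVec, dotProduct_neg]
  ring

/-- The quadratic form of `𝓛₂` is the supply rate of the error dynamics. -/
lemma form_mapL₂ (γ : ℝ) (R : Θ.sep.Regular sys.τ) (𝒵 : EstimVars k n q) (w : Fin r → ℝ)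
    (ζ : Fin p₁ → ℝ)
    (he : ∀ i a, IsPrim (fun s => e i s a) (fun s => e' i s a) (-sys.τ i) 0)
    (he₀ : ∀ i, e i 0 = e₀) :
    (mapL₂ sys γ Θ.eval 𝒵).form sys.τ (lmiVec sys.τ w ζ e₀ e) e
      = 2 * pairing sys.τ (Θ.sep.op₀ sys.τ e₀ e) (Θ.sep.op₁ sys.τ e₀ e)
            (sys.A₀ *ᵥ e₀ + ∑ i, sys.A i *ᵥ e i (-sys.τ i) - sys.B₁ *ᵥ w) e'
        + 2 * pairing sys.τ e₀ e
            (estOp₀ sys.τ 𝒵 (sys.C₂ *ᵥ e₀) fun i s => sys.C₂ *ᵥ e i s)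
            (estOp₁ sys.τ 𝒵 (sys.C₂ *ᵥ e₀) fun i s => sys.C₂ *ᵥ e i s)
        + 2 * (ζ ⬝ᵥ (sys.C₃₀ *ᵥ e₀ + ∑ i, sys.C₃ i *ᵥ e i (-sys.τ i) + sys.D₃ *ᵥ w))
        - γ * (w ⬝ᵥ w) - γ * (ζ ⬝ᵥ ζ) := by
  have hle := R.neg_le
  have hT : sys.T ≠ 0 := (sys.τ_pos _).ne'
  have hec : ∀ i, ContinuousOn (e i) (Set.Icc (-sys.τ i) 0) := fun i =>
    continuousOn_pi.2 fun a => (he i a).continuousOn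
  have cY : ∀ a b, Continuous fun s => mono₁ Θ.deg (Fin n) s a b := fun a b =>
    (continuous_mono₁ _ _).matrix_elem a b
  have cC : ∀ i, ContinuousOn (fun s => sys.C₂ *ᵥ e i s) (Set.Icc (-sys.τ i) 0) := fun i =>
    continuousOn_mulVec (M := fun _ => sys.C₂) (fun _ _ => continuousOn_const) (hec i)
  set a := sys.A₀ *ᵥ e₀ + ∑ i, sys.A i *ᵥ e i (-sys.τ i) - sys.B₁ *ᵥ w with ha
  set y := sys.C₃₀ *ᵥ e₀ + ∑ i, sys.C₃ i *ᵥ e i (-sys.τ i) + sys.D₃ *ᵥ w with hy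
  set m' := fun i => vint (-sys.τ i) 0 fun s => matDeriv (mono₁ Θ.deg (Fin n)) s *ᵥ e i s
    with hm'
  set ρ := fun i j => ∫ s in (-sys.τ i)..0, e i s ⬝ᵥ vint (-sys.τ j) 0 fun θ =>
              ev₂ (𝒵.Z₇ i j) s θ *ᵥ (sys.C₂ *ᵥ e j θ) with hρ
  -- The moments of `e'` are replaced by boundary values and moments against `Y'`; the value at `0`
  -- is `e₀` for every channel.
  have hparts : ∀ i, Θ.sep.mom sys.τ e' i = mono₁ Θ.deg (Fin n) 0 *ᵥ e₀
      - mono₁ Θ.deg (Fin n) (-sys.τ i) *ᵥ e i (-sys.τ i) - m' i := by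
    intro i
    have := vint_mulVec_byParts (hle i) (fun a b => isPrim_mono₁ Θ.deg (Fin n) a b (hle i))
      (fun a b => (continuous_matDeriv_mono₁ Θ.deg (Fin n) a b).continuousOn) (he i)
    rw [he₀ i] at this
    exact this
  have hquad : ∀ i, 2 * ∫ s in (-sys.τ i)..0, e i s ⬝ᵥ ev (Θ.S i) s *ᵥ e' i s
      = e₀ ⬝ᵥ ev (Θ.S i) 0 *ᵥ e₀ - e i (-sys.τ i) ⬝ᵥ ev (Θ.S i) (-sys.τ i) *ᵥ e i (-sys.τ i)
        - ∫ s in (-sys.τ i)..0, e i s ⬝ᵥ matDeriv (ev (Θ.S i)) s *ᵥ e i s := by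
    intro i
    have := integral_quadratic_byParts (hle i) (fun a b => isPrim_ev (Θ.S i) a b (hle i))
      (fun a b => (continuous_matDeriv_ev (Θ.S i) a b).continuousOn) (R.S_symm i) (he i)
    rw [he₀ i] at this
    exact this
  have hest : ∀ i, ∫ s in (-sys.τ i)..0, e i s ⬝ᵥ
      estOp₁ sys.τ 𝒵 (sys.C₂ *ᵥ e₀) (fun i s => sys.C₂ *ᵥ e i s) i s
      = sys.T * ((∫ s in (-sys.τ i)..0, e i s ⬝ᵥ (ev (𝒵.Z₄ i) s *ᵥ (sys.C₂ *ᵥ e₀)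
            + ∑ j, ev (𝒵.Z₅ i j) s *ᵥ (sys.C₂ *ᵥ e j (-sys.τ j))))
          + (∫ s in (-sys.τ i)..0, e i s ⬝ᵥ ev (𝒵.Z₆ i) s *ᵥ (sys.C₂ *ᵥ e i s))
          + ∑ j, ρ i j) := by
    intro i
    have c4 : ContinuousOn (fun s => ev (𝒵.Z₄ i) s *ᵥ (sys.C₂ *ᵥ e₀)
        + ∑ j, ev (𝒵.Z₅ i j) s *ᵥ (sys.C₂ *ᵥ e j (-sys.τ j))) (Set.Icc (-sys.τ i) 0) := by
      refine ContinuousOn.add ?_ (continuousOn_finsetSum _ fun j _ => ?_)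
      · exact continuousOn_mulVec (fun a b => (continuous_ev _ a b).continuousOn)
          continuousOn_const
      · exact continuousOn_mulVec (fun a b => (continuous_ev _ a b).continuousOn)
          continuousOn_const
    have c6 : ContinuousOn (fun s => ev (𝒵.Z₆ i) s *ᵥ (sys.C₂ *ᵥ e i s))
        (Set.Icc (-sys.τ i) 0) :=
      continuousOn_mulVec (fun a b => (continuous_ev _ a b).continuousOn) (cC i)
    have c7 : ∀ j, ContinuousOn (fun s => vint (-sys.τ j) 0 fun θ =>
        ev₂ (𝒵.Z₇ i j) s θ *ᵥ (sys.C₂ *ᵥ e j θ)) (Set.Icc (-sys.τ i) 0) := fun j =>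
      (continuous_vint_ev₂ (hle j) _ (cC j)).continuousOn
    simp only [estOp₁, dotProduct_smul, smul_eq_mul, intervalIntegral.integral_const_mul]
    rw [integral_dot_add (hle i) (hec i) (c4.fun_add c6)
        (continuousOn_finsetSum Finset.univ fun j _ => c7 j),
      integral_dot_add (hle i) (hec i) c4 c6]
    simp only [dotProduct_sum]
    rw [intervalIntegral.integral_finsetSum fun j _ => intervalIntegrable_dot (hle i) (hec i)
      (intervalIntegrable_of_continuousOn (hle i) (c7 j))]
    rfl
  have hsym : ∑ i, ∑ j, Θ.sep.mom sys.τ e i ⬝ᵥ Θ.Γ i j *ᵥ m' j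
      = ∑ i, ∑ j, m' i ⬝ᵥ Θ.Γ i j *ᵥ Θ.sep.mom sys.τ e j := by
    rw [Finset.sum_comm]
    refine Finset.sum_congr rfl fun i _ => Finset.sum_congr rfl fun j _ => ?_
    rw [dot_mulVec_comm, show (Θ.Γ j i)ᵀ = Θ.Γ i j from R.Γ_symm j i]
  rw [R.pairing_op hec fun i a => (he i a).int]
  simp only [Params.form, pairing, SepOp.bil, hest]
  rw [mapL₂_P_form γ R.P_symm, ← ha, ← hy]
  simp only [mapL₂_Q_form γ 𝒵 w ζ e₀ hec, mapL₂_S_form γ 𝒵 hec, mapL₂_R_form γ 𝒵 hec, ← ha]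
  have hT' : sys.τ (Fin.last k) = sys.T := rfl
  have hsP : Θ.sep.P = Θ.P := rfl
  have hsH : Θ.sep.H = Θ.H := rfl
  have hsΓ : Θ.sep.Γ = Θ.Γ := rfl
  have hsS : ∀ i s, Θ.sep.S i s = ev (Θ.S i) s := fun _ _ => rfl
  have hquad' := congrArg (fun f => ∑ i, f i) (funext hquad)
  have hcomm : ∑ i, ∑ j, ρ j i = ∑ i, ∑ j, ρ i j := Finset.sum_comm
  simp only [← Finset.mul_sum, Finset.sum_sub_distrib] at hquad'
  simp only [hT', hsP, hsH, hsΓ, hsS, hρ, hm', hparts, estOp₀, Matrix.mulVec_sub, dotProduct_sub,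
    dotProduct_add, dotProduct_sum, Finset.sum_add_distrib, Finset.sum_sub_distrib,
    ← Finset.mul_sum, mul_add, mul_sub, mul_assoc (2 : ℝ) sys.T,
    mul_inv_cancel_left₀ hT] at hsym hcomm ⊢
  -- Three facts remain to be combined: integration by parts in the `S` terms, symmetry of `Γ`
  -- between the moments against `Y` and against `Y'`, and the renaming of channels in the `Z₇`
  -- terms.
  linear_combination (-sys.T) * hquad' + hsym + sys.T * hcomm

end FormL₂

/-! ### The quadratic form of `𝓛₁` -/

section FormL₁

variable {k n m q r p p₁ : ℕ} {sys : DelaySystem k n m q r p p₁} {Θ : PolyParams k n}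
  {h₀ : Fin n → ℝ} {h : Fin (k + 1) → ℝ → Fin n → ℝ}

/-- The vector `Yᵀ Hᵢᵀ h₀ + Sᵢ hᵢ`, taken at `-τᵢ`, is `T⁻¹` times the part of the delayed value of
`Θ h` that involves no moments. The summand `½ Sᵢ(0)` of `E₁₀` doubles to the boundary term at `0`.
-/
lemma mapL₁_P_form (γ : ℝ) (ℋ : ControlVars k n m)
    (ζ : Fin p → ℝ) (w : Fin r → ℝ) (h₀ : Fin n → ℝ) (h : Fin (k + 1) → ℝ → Fin n → ℝ) :
    lmiVec sys.τ ζ w h₀ h ⬝ᵥ (mapL₁ sys γ Θ.eval ℋ).P *ᵥ lmiVec sys.τ ζ w h₀ h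
      = sys.T⁻¹ * (2 * (ζ ⬝ᵥ (sys.C₁₀ *ᵥ (Θ.P *ᵥ h₀) + sys.D₁ *ᵥ w))
          - γ * (ζ ⬝ᵥ ζ) - γ * (w ⬝ᵥ w))
        + 2 * ∑ i, ζ ⬝ᵥ sys.C₁ i *ᵥ ((mono₁ Θ.deg (Fin n) (-sys.τ i))ᵀ *ᵥ ((Θ.H i)ᵀ *ᵥ h₀)
            + ev (Θ.S i) (-sys.τ i) *ᵥ h i (-sys.τ i))
        + 2 * (h₀ ⬝ᵥ (sys.A₀ *ᵥ (Θ.P *ᵥ h₀) + sys.B₁ *ᵥ w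
            + sys.B₂ *ᵥ (ℋ.H₀ *ᵥ h₀ + ∑ i, ℋ.H₁ i *ᵥ h i (-sys.τ i))))
        + 2 * sys.T * ∑ i, h₀ ⬝ᵥ sys.A i *ᵥ
            ((mono₁ Θ.deg (Fin n) (-sys.τ i))ᵀ *ᵥ ((Θ.H i)ᵀ *ᵥ h₀)
              + ev (Θ.S i) (-sys.τ i) *ᵥ h i (-sys.τ i))
        + ∑ i, (h₀ ⬝ᵥ ev (Θ.S i) 0 *ᵥ h₀
            - h i (-sys.τ i) ⬝ᵥ ev (Θ.S i) (-sys.τ i) *ᵥ h i (-sys.τ i)) := by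
  set E : Matrix (Fin n) (Fin n) ℝ := sys.A₀ * Θ.eval.P
    + ∑ i, (sys.T • (sys.A i * (Θ.eval.Q i (-sys.τ i))ᵀ) + (1 / 2 : ℝ) • Θ.eval.S i 0)
    + sys.B₂ * ℋ.H₀ with hE
  have h := dot_lmiBlocks sys.τ (-(γ / sys.T) • (1 : Matrix (Fin p) (Fin p) ℝ))
    (sys.T⁻¹ • sys.D₁) (-(γ / sys.T) • (1 : Matrix (Fin r) (Fin r) ℝ))
    (sys.T⁻¹ • (sys.C₁₀ * Θ.eval.P) + ∑ i, sys.C₁ i * (Θ.eval.Q i (-sys.τ i))ᵀ)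
    (fun i => sys.C₁ i * Θ.eval.S i (-sys.τ i)) sys.B₁ᵀ (fun _ => 0) (E + Eᵀ)
    (fun i => sys.T • (sys.A i * Θ.eval.S i (-sys.τ i)) + sys.B₂ * ℋ.H₁ i)
    (fun i => -Θ.eval.S i (-sys.τ i)) ζ w h₀ h
  rw [blockRow_zero, Matrix.transpose_smul] at h
  refine h.trans ?_
  have hE2 : h₀ ⬝ᵥ (E + Eᵀ) *ᵥ h₀ = 2 * (h₀ ⬝ᵥ E *ᵥ h₀) := by
    rw [Matrix.add_mulVec, dotProduct_add, dot_transpose_mulVec]; ring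
  rw [hE2]
  simp only [hE, PolyParams.eval, Matrix.add_mulVec, Matrix.neg_mulVec,
    Matrix.smul_mulVec, Matrix.one_mulVec, Matrix.sum_mulVec, Matrix.mulVec_add,
    Matrix.mulVec_sum, Matrix.zero_mulVec, Matrix.transpose_mul, ← Matrix.mulVec_mulVec,
    dotProduct_add, dotProduct_neg, dotProduct_smul, dotProduct_sum, mul_add,
    dot_transpose_mulVec, dotProduct_zero, Finset.sum_const_zero,
    Finset.sum_add_distrib, Finset.sum_sub_distrib, Finset.sum_neg_distrib, ← Finset.mul_sum,
    smul_eq_mul]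
  ring

/-- The `Q` block supplies the moment parts of the present and delayed values of `x = Θ h`, which
are missing from `mapL₁_P_form`, as well as the integral part of the control. -/
lemma mapL₁_Q_form (γ : ℝ) (ℋ : ControlVars k n m) (ζ : Fin p → ℝ) (w : Fin r → ℝ)
    (h₀ : Fin n → ℝ) (hh : ∀ i, ContinuousOn (h i) (Set.Icc (-sys.τ i) 0)) (i : Fin (k + 1)) :
    ∫ s in (-sys.τ i)..0,
        lmiVec sys.τ ζ w h₀ h ⬝ᵥ (mapL₁ sys γ Θ.eval ℋ).Q i s *ᵥ h i s
      = sys.T⁻¹ * (ζ ⬝ᵥ (sys.C₁₀ *ᵥ (Θ.H i *ᵥ Θ.sep.mom sys.τ h i)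
            + ∑ j, sys.C₁ j *ᵥ ((mono₁ Θ.deg (Fin n) (-sys.τ j))ᵀ *ᵥ
                (Θ.Γ j i *ᵥ Θ.sep.mom sys.τ h i))))
        + h₀ ⬝ᵥ (sys.A₀ *ᵥ (Θ.H i *ᵥ Θ.sep.mom sys.τ h i)
            + ∑ j, sys.A j *ᵥ ((mono₁ Θ.deg (Fin n) (-sys.τ j))ᵀ *ᵥ
                (Θ.Γ j i *ᵥ Θ.sep.mom sys.τ h i)))
        + h₀ ⬝ᵥ Θ.H i *ᵥ (vint (-sys.τ i) 0 fun s => matDeriv (mono₁ Θ.deg (Fin n)) s *ᵥ h i s)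
        + h₀ ⬝ᵥ sys.B₂ *ᵥ (vint (-sys.τ i) 0 fun s => ev (ℋ.H₂ i) s *ᵥ h i s) := by
  have hle : -sys.τ i ≤ 0 := by linarith [sys.τ_pos i]
  set N₁ := sys.C₁₀ * Θ.H i
    + ∑ j, sys.C₁ j * ((mono₁ Θ.deg (Fin n) (-sys.τ j))ᵀ * Θ.Γ j i) with hN₁
  set N₂ := sys.A₀ * Θ.H i
    + ∑ j, sys.A j * ((mono₁ Θ.deg (Fin n) (-sys.τ j))ᵀ * Θ.Γ j i) with hN₂
  have cY : ∀ a b, ContinuousOn (fun s => mono₁ Θ.deg (Fin n) s a b) (Set.Icc (-sys.τ i) 0) :=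
    fun a b => ((continuous_mono₁ _ _).matrix_elem a b).continuousOn
  have cY' : ∀ a b, ContinuousOn (fun s => matDeriv (mono₁ Θ.deg (Fin n)) s a b)
      (Set.Icc (-sys.τ i) 0) := fun a b => (continuous_matDeriv_mono₁ _ _ a b).continuousOn
  have cH : ∀ a b, ContinuousOn (fun s => ev (ℋ.H₂ i) s a b) (Set.Icc (-sys.τ i) 0) :=
    fun a b => (continuous_ev _ a b).continuousOn
  have J : ∀ {α β : Type} [Fintype α] [Fintype β] (v : α → ℝ) (A : Matrix α β ℝ)
      {W : ℝ → Matrix β (Fin n) ℝ}, (∀ a b, ContinuousOn (fun s => W s a b)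
        (Set.Icc (-sys.τ i) 0)) →
      IntervalIntegrable (fun s => v ⬝ᵥ (A * W s) *ᵥ h i s) volume (-sys.τ i) 0 :=
    fun v A W hW => intervalIntegrable_dot (x := fun _ => v) hle continuousOn_const
      (intervalIntegrable_of_continuousOn hle (continuousOn_mulVec
        (continuousOn_matrix_mul (M := fun _ => A) (fun _ _ => continuousOn_const) hW) (hh i)))
  have key : ∀ s, lmiVec sys.τ ζ w h₀ h ⬝ᵥ (mapL₁ sys γ Θ.eval ℋ).Q i s *ᵥ h i s
      = (sys.T⁻¹ • ζ) ⬝ᵥ (N₁ * mono₁ Θ.deg (Fin n) s) *ᵥ h i s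
        + h₀ ⬝ᵥ (N₂ * mono₁ Θ.deg (Fin n) s) *ᵥ h i s
        + h₀ ⬝ᵥ (Θ.H i * matDeriv (mono₁ Θ.deg (Fin n)) s) *ᵥ h i s
        + h₀ ⬝ᵥ (sys.B₂ * ev (ℋ.H₂ i) s) *ᵥ h i s := by
    intro s
    simp only [lmiVec, mapL₁, PolyParams.matDeriv_Q, Matrix.fromRows_mulVec,
      sumElim_dotProduct_sumElim]
    simp only [hN₁, hN₂, PolyParams.eval, Matrix.add_mulVec, Matrix.smul_mulVec,
      Matrix.sum_mulVec, Matrix.zero_mulVec, ← Matrix.mulVec_mulVec, dotProduct_add,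
      dotProduct_smul, dotProduct_sum, smul_dotProduct, dotProduct_zero, ← Finset.mul_sum,
      smul_eq_mul, mul_add]
    ring
  simp only [key]
  rw [intervalIntegral.integral_add (((J _ _ cY).add (J _ _ cY)).add (J _ _ cY')) (J _ _ cH),
    intervalIntegral.integral_add ((J _ _ cY).add (J _ _ cY)) (J _ _ cY'),
    intervalIntegral.integral_add (J _ _ cY) (J _ _ cY),
    integral_dot_mul_mulVec hle cY (hh i), integral_dot_mul_mulVec hle cY (hh i),
    integral_dot_mul_mulVec hle cY' (hh i), integral_dot_mul_mulVec hle cH (hh i)]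
  change _ ⬝ᵥ N₁ *ᵥ Θ.sep.mom sys.τ h i + _ ⬝ᵥ N₂ *ᵥ Θ.sep.mom sys.τ h i + _ + _ = _
  simp only [hN₁, hN₂, Matrix.add_mulVec, Matrix.sum_mulVec, ← Matrix.mulVec_mulVec,
    smul_dotProduct, smul_eq_mul]

lemma mapL₁_R_form (γ : ℝ) (R : Θ.sep.Regular sys.τ) (ℋ : ControlVars k n m)
    (hh : ∀ i, ContinuousOn (h i) (Set.Icc (-sys.τ i) 0)) (i j : Fin (k + 1)) :
    ∫ s in (-sys.τ i)..0, ∫ θ in (-sys.τ j)..0,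
        h i s ⬝ᵥ (mapL₁ sys γ Θ.eval ℋ).R i j s θ *ᵥ h j θ
      = (vint (-sys.τ i) 0 fun s => matDeriv (mono₁ Θ.deg (Fin n)) s *ᵥ h i s)
            ⬝ᵥ Θ.Γ i j *ᵥ Θ.sep.mom sys.τ h j
        + Θ.sep.mom sys.τ h i ⬝ᵥ Θ.Γ i j *ᵥ
            vint (-sys.τ j) 0 fun s => matDeriv (mono₁ Θ.deg (Fin n)) s *ᵥ h j s := by
  have hle := R.neg_le
  have cY : ∀ a b, Continuous fun s => mono₁ Θ.deg (Fin n) s a b := fun a b =>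
    (continuous_mono₁ _ _).matrix_elem a b
  have cY' := continuous_matDeriv_mono₁ Θ.deg (Fin n)
  obtain ⟨F₃, h₃⟩ : ∃ F : ℝ → ℝ → ℝ, F = fun s θ => h i s ⬝ᵥ
      ((matDeriv (mono₁ Θ.deg (Fin n)) s)ᵀ * Θ.Γ i j * mono₁ Θ.deg (Fin n) θ) *ᵥ h j θ :=
    ⟨_, rfl⟩
  obtain ⟨F₄, h₄⟩ : ∃ F : ℝ → ℝ → ℝ, F = fun s θ => h i s ⬝ᵥ
      ((mono₁ Θ.deg (Fin n) s)ᵀ * Θ.Γ i j * matDeriv (mono₁ Θ.deg (Fin n)) θ) *ᵥ h j θ :=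
    ⟨_, rfl⟩
  have k₃ : ContinuousOn (fun p : ℝ × ℝ => F₃ p.1 p.2)
      (Set.Icc (-sys.τ i) 0 ×ˢ Set.Icc (-sys.τ j) 0) := by
    rw [h₃]
    refine continuousOn_prod_dot_mulVec (R := fun s θ => (matDeriv (mono₁ Θ.deg (Fin n)) s)ᵀ *
      Θ.Γ i j * mono₁ Θ.deg (Fin n) θ) ?_ (hh i) (hh j)
    exact continuous_matrix_mul₂ (continuous_matrix_mul₂ (M := fun p : ℝ × ℝ =>
        (matDeriv (mono₁ Θ.deg (Fin n)) p.1)ᵀ) (N := fun _ => Θ.Γ i j)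
      (fun a b => (cY' b a).comp continuous_fst) fun _ _ => continuous_const)
      fun a b => (cY a b).comp continuous_snd
  have k₄ : ContinuousOn (fun p : ℝ × ℝ => F₄ p.1 p.2)
      (Set.Icc (-sys.τ i) 0 ×ˢ Set.Icc (-sys.τ j) 0) := by
    rw [h₄]
    refine continuousOn_prod_dot_mulVec (R := fun s θ => (mono₁ Θ.deg (Fin n) s)ᵀ *
      Θ.Γ i j * matDeriv (mono₁ Θ.deg (Fin n)) θ) ?_ (hh i) (hh j)
    exact continuous_matrix_mul₂ (continuous_matrix_mul₂ (M := fun p : ℝ × ℝ =>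
        (mono₁ Θ.deg (Fin n) p.1)ᵀ) (N := fun _ => Θ.Γ i j)
      (fun a b => (cY b a).comp continuous_fst) fun _ _ => continuous_const)
      fun a b => (cY' a b).comp continuous_snd
  have key : ∀ s θ, h i s ⬝ᵥ (mapL₁ sys γ Θ.eval ℋ).R i j s θ *ᵥ h j θ = F₃ s θ + F₄ s θ := by
    intro s θ
    simp only [h₃, h₄, mapL₁, PolyParams.matDeriv_R_left, Matrix.add_mulVec, dotProduct_add,
      Matrix.transpose_mul, Matrix.transpose_transpose, Matrix.mul_assoc,
      show (Θ.Γ j i)ᵀ = Θ.Γ i j from R.Γ_symm j i]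
  have e₃ : ∫ s in (-sys.τ i)..0, ∫ θ in (-sys.τ j)..0, F₃ s θ
      = (vint (-sys.τ i) 0 fun s => matDeriv (mono₁ Θ.deg (Fin n)) s *ᵥ h i s)
            ⬝ᵥ Θ.Γ i j *ᵥ Θ.sep.mom sys.τ h j := by
    rw [h₃]
    exact integral_integral_dot_sep (hle i) (hle j) (fun a b => (cY' a b).continuousOn)
      (fun a b => (cY a b).continuousOn) (hh i) (hh j) _
  have e₄ : ∫ s in (-sys.τ i)..0, ∫ θ in (-sys.τ j)..0, F₄ s θ
      = Θ.sep.mom sys.τ h i ⬝ᵥ Θ.Γ i j *ᵥ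
            vint (-sys.τ j) 0 fun s => matDeriv (mono₁ Θ.deg (Fin n)) s *ᵥ h j s := by
    rw [h₄]
    exact integral_integral_dot_sep (hle i) (hle j) (fun a b => (cY a b).continuousOn)
      (fun a b => (cY' a b).continuousOn) (hh i) (hh j) _
  simp only [key]
  rw [integral_integral_add (hle i) (hle j) k₃ k₄, e₃, e₄]

end FormL₁

/-! ### States in the image of the operator -/

section Image

/-- Integration by parts for `∫ hᵀ y'` when `y = S h`. -/
lemma integral_dot_deriv_of_eq_mulVec {α : Type*} [Fintype α] {a b : ℝ} (hab : a ≤ b)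
    {S S' : ℝ → Matrix α α ℝ} {h h' y y' : ℝ → α → ℝ}
    (hS : ∀ i j, IsPrim (fun s => S s i j) (fun s => S' s i j) a b)
    (hS' : ∀ i j, ContinuousOn (fun s => S' s i j) (Set.Icc a b))
    (hsymm : ∀ s ∈ Set.Icc a b, (S s)ᵀ = S s)
    (hh : ∀ i, IsPrim (fun s => h s i) (fun s => h' s i) a b)
    (hy : ∀ i, IsPrim (fun s => y s i) (fun s => y' s i) a b)
    (hyS : ∀ s ∈ Set.Icc a b, y s = S s *ᵥ h s) :
    2 * ∫ s in a..b, h s ⬝ᵥ y' s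
      = h b ⬝ᵥ S b *ᵥ h b - h a ⬝ᵥ S a *ᵥ h a + ∫ s in a..b, h s ⬝ᵥ S' s *ᵥ h s := by
  classical
  -- With `y = S h` one has `∫ hᵀ y' = [hᵀ S h] - ∫ h'ᵀ S h`. By symmetry, twice the last integral
  -- is `[hᵀ S h] - ∫ hᵀ S' h`.
  have h1 := integral_quadratic_byParts hab hS hS' hsymm hh
  have h2 := (IsPrim.dot_mulVec hab (1 : Matrix α α ℝ) hh hy).integral_eq
  simp only [Matrix.one_mulVec] at h2
  have hhc : ContinuousOn h (Set.Icc a b) := continuousOn_pi.2 fun j => (hh j).continuousOn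
  have hyc : ContinuousOn y (Set.Icc a b) := continuousOn_pi.2 fun j => (hy j).continuousOn
  have i1 : IntervalIntegrable (fun s => h' s ⬝ᵥ y s) volume a b := by
    simpa only [dotProduct_comm] using intervalIntegrable_dot hab hyc fun j => (hh j).int
  have i2 := intervalIntegrable_dot hab hhc fun j => (hy j).int
  rw [intervalIntegral.integral_add i1 i2, hyS a ⟨le_rfl, hab⟩, hyS b ⟨hab, le_rfl⟩] at h2
  have e : ∫ s in a..b, h' s ⬝ᵥ y s = ∫ s in a..b, h s ⬝ᵥ S s *ᵥ h' s := by
    refine intervalIntegral.integral_congr fun s hs => ?_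
    rw [Set.uIcc_of_le hab] at hs
    have := dot_transpose_mulVec (S s) (h' s) (h s)
    rw [hsymm s hs] at this
    simp only [hyS s hs, this]
  rw [e] at h2
  linarith

variable {k n d : ℕ} {τ : Fin (k + 1) → ℝ} {Θ : PolyParams k n} {ε : ℝ}
  {h₀ : Fin n → ℝ} {h x x' : Fin (k + 1) → ℝ → Fin n → ℝ}

lemma exists_isPrim_ev_inv {M : Matrix (Fin n) (Fin n) ℝ[X]} {a b : ℝ} (hab : a ≤ b)
    (hM : ∀ s ∈ Set.Icc a b, (ev M s).det ≠ 0) (i j : Fin n) :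
    ∃ N' : ℝ → ℝ, IsPrim (fun s => (ev M s)⁻¹ i j) N' a b := by
  have hD : ∀ s ∈ Set.Icc a b, M.det.eval s ≠ 0 := fun s hs => by
    rw [← ev_det]; exact hM s hs
  refine ⟨fun s => -(M.det.derivative.eval s) / M.det.eval s ^ 2 * (M.adjugate i j).eval s
    + (M.det.eval s)⁻¹ * (M.adjugate i j).derivative.eval s, ?_⟩
  simp only [ev_inv]
  refine IsPrim.of_hasDerivAt hab (fun s hs => ?_) ?_
  · exact ((M.det.hasDerivAt s).inv (hD s hs)).mul ((M.adjugate i j).hasDerivAt s)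
  · have c : ∀ P : ℝ[X], ContinuousOn (fun s => P.eval s) (Set.Icc a b) := fun P =>
      P.continuous.continuousOn
    exact (((c _).neg.div ((c _).pow 2) fun s hs => pow_ne_zero 2 (hD s hs)).mul (c _)).add
      (((c _).inv₀ hD).mul (c _))

/-- The preimage of an element of the state space satisfies the boundary condition. -/
lemma StateSpacePreserving.eq_at_zero (hτ : ∀ i, 0 < τ i) (hε : 0 < ε)
    (hΘ : Θ.eval.shift (-ε • 1) (-ε) ∈ Xi d τ) (hX : StateSpacePreserving τ Θ.eval)
    (hh : ∀ i, ContinuousOn (h i) (Set.Icc (-τ i) 0)) (i : Fin (k + 1))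
    (h0 : Θ.sep.op₁ τ h₀ h i 0 = Θ.sep.op₀ τ h₀ h) : h i 0 = h₀ := by
  have hle : ∀ i, -τ i ≤ 0 := fun i => by linarith [hτ i]
  have hT : τ (Fin.last k) ≠ 0 := (hτ _).ne'
  -- Since `Qⱼ(s) = Rᵢⱼ(0, s)`, the integral parts of the present component and of history `i` at `s
  -- = 0` coincide.
  have e1 : ∀ j, (mono₁ Θ.deg (Fin n) 0)ᵀ *ᵥ (Θ.Γ i j *ᵥ Θ.sep.mom τ h j)
      = Θ.H j *ᵥ Θ.sep.mom τ h j := by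
    intro j
    have c : ∀ a, IntervalIntegrable (fun s => (mono₁ Θ.deg (Fin n) s *ᵥ h j s) a) volume
        (-τ j) 0 := intervalIntegrable_of_continuousOn (hle j) (continuousOn_mulVec
          (fun a b => ((continuous_mono₁ _ _).matrix_elem a b).continuousOn) (hh j))
    rw [SepOp.mom, Matrix.mulVec_mulVec]
    change _ *ᵥ vint (-τ j) 0 (fun s => mono₁ Θ.deg (Fin n) s *ᵥ h j s) =
      _ *ᵥ vint (-τ j) 0 (fun s => mono₁ Θ.deg (Fin n) s *ᵥ h j s)
    rw [mulVec_vint _ c, mulVec_vint _ c]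
    funext a
    refine intervalIntegral.integral_congr fun s hs => ?_
    rw [Set.uIcc_of_le (hle j)] at hs
    have := hX.Q_eq i j s hs
    simp only [PolyParams.eval] at this
    simp only [Matrix.mulVec_mulVec, this]
  have e2 : Θ.P *ᵥ h₀ = τ (Fin.last k) • ((mono₁ Θ.deg (Fin n) 0)ᵀ *ᵥ ((Θ.H i)ᵀ *ᵥ h₀))
      + τ (Fin.last k) • (ev (Θ.S i) 0 *ᵥ h₀) := by
    have := hX.P_eq i
    simp only [PolyParams.eval, Matrix.transpose_mul] at this
    rw [this, Matrix.add_mulVec, Matrix.smul_mulVec, Matrix.smul_mulVec, Matrix.mulVec_mulVec]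
  -- After these integral parts, the relation `P = T Qᵢ(0)ᵀ + T Sᵢ(0)` removes the `Qᵢ(0)ᵀ h₀`
  -- terms. Only `T Sᵢ(0) hᵢ(0) = T Sᵢ(0) h₀` is left, and `Sᵢ(0)` is invertible.
  have e3 : ev (Θ.S i) 0 *ᵥ h i 0 = ev (Θ.S i) 0 *ᵥ h₀ := by
    simp only [SepOp.op₁, SepOp.op₀, SepOp.coef, PolyParams.sep, Matrix.mulVec_add,
      Matrix.mulVec_smul, Matrix.mulVec_sum] at h0
    have e1' : ∑ j, (mono₁ Θ.deg (Fin n) 0)ᵀ *ᵥ (Θ.Γ i j *ᵥ Θ.sep.mom τ h j)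
      = ∑ j, Θ.H j *ᵥ Θ.sep.mom τ h j := Finset.sum_congr rfl fun j _ => e1 j
    simp only [PolyParams.sep] at e1'
    rw [e1', e2] at h0
    refine smul_right_injective _ hT (?_ : _ • _ = _ • _)
    have := congrArg (fun v => v - τ (Fin.last k) • ((mono₁ Θ.deg (Fin n) 0)ᵀ *ᵥ
      ((Θ.H i)ᵀ *ᵥ h₀)) - ∑ j, Θ.H j *ᵥ SepOp.mom ⟨Θ.P, Θ.H, fun _ => mono₁ Θ.deg (Fin n),
        fun i => ev (Θ.S i), Θ.Γ⟩ τ h j) h0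
    convert this using 1 <;> abel
  have hu : IsUnit (ev (Θ.S i) 0).det :=
    isUnit_iff_ne_zero.2 (PolyParams.S_posDef hτ hε hΘ i ⟨hle i, le_rfl⟩).det_pos.ne'
  exact Matrix.mulVec_injective_of_isUnit ((Matrix.isUnit_iff_isUnit_det _).2 hu) e3

/-- If `x = Θ h` with `x` absolutely continuous, then `∫ hᵀ x'` is obtained by parts. -/
lemma PolyParams.integral_dot_deriv_op (hτ : ∀ i, 0 < τ i) (hε : 0 < ε)
    (hΘ : Θ.eval.shift (-ε • 1) (-ε) ∈ Xi d τ)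
    (hh : ∀ i, ContinuousOn (h i) (Set.Icc (-τ i) 0))
    (hx : ∀ i, ∀ s ∈ Set.Icc (-τ i) 0, x i s = Θ.sep.op₁ τ h₀ h i s)
    (hx' : ∀ i a, IsPrim (fun s => x i s a) (fun s => x' i s a) (-τ i) 0)
    (h0 : ∀ i, h i 0 = h₀) (i : Fin (k + 1)) :
    2 * ∫ s in (-τ i)..0, h i s ⬝ᵥ x' i s
      = 2 * (Θ.sep.coef τ h₀ h i ⬝ᵥ
          vint (-τ i) 0 fun s => matDeriv (mono₁ Θ.deg (Fin n)) s *ᵥ h i s)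
        + τ (Fin.last k) * (h₀ ⬝ᵥ ev (Θ.S i) 0 *ᵥ h₀
            - h i (-τ i) ⬝ᵥ ev (Θ.S i) (-τ i) *ᵥ h i (-τ i)
            + ∫ s in (-τ i)..0, h i s ⬝ᵥ matDeriv (ev (Θ.S i)) s *ᵥ h i s) := by
  have hle : -τ i ≤ 0 := by linarith [hτ i]
  have hT : τ (Fin.last k) ≠ 0 := (hτ _).ne'
  set β := Θ.sep.coef τ h₀ h i
  set T := τ (Fin.last k)
  set Y := mono₁ Θ.deg (Fin n) with hY
  have pY : ∀ a, IsPrim (fun s => ((Y s)ᵀ *ᵥ β) a) (fun s => ((matDeriv Y s)ᵀ *ᵥ β) a) (-τ i) 0 := by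
    intro a
    simp only [Matrix.mulVec, dotProduct, Matrix.transpose_apply, mul_comm _ (β _)]
    exact IsPrim.sum _ hle fun b _ => (isPrim_mono₁ Θ.deg (Fin n) b a hle).const_mul _
  -- Removing the finite-rank part of `xᵢ` leaves `y = Sᵢ hᵢ`, which is absolutely continuous. As
  -- `Sᵢ⁻¹` has absolutely continuous entries, `hᵢ = Sᵢ⁻¹ y` is absolutely continuous too, although
  -- it is only assumed continuous.
  set y : ℝ → Fin n → ℝ := fun s => T⁻¹ • (x i s - (Y s)ᵀ *ᵥ β) with hy
  set y' : ℝ → Fin n → ℝ := fun s => T⁻¹ • (x' i s - (matDeriv Y s)ᵀ *ᵥ β) with hy'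
  have py : ∀ a, IsPrim (fun s => y s a) (fun s => y' s a) (-τ i) 0 := fun a =>
    ((hx' i a).sub (pY a)).const_mul _
  have hyS : ∀ s ∈ Set.Icc (-τ i) 0, y s = ev (Θ.S i) s *ᵥ h i s := by
    intro s hs
    have e : x i s - (Y s)ᵀ *ᵥ β = T • (ev (Θ.S i) s *ᵥ h i s) := by
      rw [hx i s hs]
      exact add_sub_cancel_left _ _
    rw [hy]
    simp only [e, smul_smul, inv_mul_cancel₀ hT, one_smul]
  have hdet : ∀ s ∈ Set.Icc (-τ i) 0, (ev (Θ.S i) s).det ≠ 0 := fun s hs =>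
    (S_posDef hτ hε hΘ i hs).det_pos.ne'
  choose N hN using exists_isPrim_ev_inv hle hdet
  have ph : ∀ a, ∃ h' : ℝ → ℝ, IsPrim (fun s => h i s a) h' (-τ i) 0 := by
    intro a
    refine ⟨_, (IsPrim.sum Finset.univ hle fun b _ => (hN a b).mul (py b)).congr fun s hs => ?_⟩
    have : (ev (Θ.S i) s)⁻¹ *ᵥ y s = h i s := by
      rw [hyS s hs, Matrix.mulVec_mulVec,
        Matrix.nonsing_inv_mul _ (isUnit_iff_ne_zero.2 (hdet s hs)), Matrix.one_mulVec]
    exact congrFun this a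
  choose g hg using ph
  have key := integral_dot_deriv_of_eq_mulVec hle (h' := fun s a => g a s)
    (fun a b => isPrim_ev (Θ.S i) a b hle)
    (fun a b => (continuous_matDeriv_ev (Θ.S i) a b).continuousOn)
    ((sep_regular hτ hε hΘ).S_symm i) hg py hyS
  rw [h0 i] at key
  have cY' : ContinuousOn (fun s => matDeriv Y s *ᵥ h i s) (Set.Icc (-τ i) 0) :=
    continuousOn_mulVec (fun a b => (continuous_matDeriv_mono₁ _ _ a b).continuousOn) (hh i)
  have i1 : IntervalIntegrable (fun s => β ⬝ᵥ matDeriv Y s *ᵥ h i s) volume (-τ i) 0 :=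
    intervalIntegrable_dot hle continuousOn_const (intervalIntegrable_of_continuousOn hle cY')
  have i2 := intervalIntegrable_dot hle (hh i) fun a => (py a).int
  rw [dot_vint _ (intervalIntegrable_of_continuousOn hle cY'), ← key]
  have e : ∫ s in (-τ i)..0, h i s ⬝ᵥ x' i s
      = ∫ s in (-τ i)..0, (β ⬝ᵥ matDeriv Y s *ᵥ h i s + T * (h i s ⬝ᵥ y' s)) := by
    refine intervalIntegral.integral_congr fun s _ => ?_
    simp only [hy', dotProduct_smul, dotProduct_sub, smul_eq_mul, mul_inv_cancel_left₀ hT,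
      dot_transpose_mulVec]
    ring
  rw [e, intervalIntegral.integral_add i1 (i2.const_mul _), intervalIntegral.integral_const_mul]
  ring

end Image

/-! ### The supply rate of the state feedback dynamics -/

section FormL₁

variable {k n m q r p p₁ d : ℕ} {sys : DelaySystem k n m q r p p₁} {Θ : PolyParams k n}
  {h₀ x₀ : Fin n → ℝ} {h x x' : Fin (k + 1) → ℝ → Fin n → ℝ} {ε : ℝ}

/-- The quadratic form of `𝓛₁` is the supply rate of the state feedback dynamics. -/
lemma form_mapL₁ (γ : ℝ) (hε : 0 < ε) (hΘ : Θ.eval.shift (-ε • 1) (-ε) ∈ Xi d sys.τ)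
    (ℋ : ControlVars k n m) (w : Fin r → ℝ) (ζ : Fin p → ℝ)
    (hh : ∀ i, ContinuousOn (h i) (Set.Icc (-sys.τ i) 0))
    (hx₀ : Θ.sep.op₀ sys.τ h₀ h = x₀)
    (hx : ∀ i, ∀ s ∈ Set.Icc (-sys.τ i) 0, x i s = Θ.sep.op₁ sys.τ h₀ h i s)
    (hx' : ∀ i a, IsPrim (fun s => x i s a) (fun s => x' i s a) (-sys.τ i) 0)
    (h0 : ∀ i, h i 0 = h₀) :
    (mapL₁ sys γ Θ.eval ℋ).form sys.τ (lmiVec sys.τ ζ w h₀ h) h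
      = 2 * pairing sys.τ h₀ h
            (sys.A₀ *ᵥ x₀ + ∑ i, sys.A i *ᵥ x i (-sys.τ i) + sys.B₁ *ᵥ w
              + sys.B₂ *ᵥ ctrlOp sys.τ ℋ h₀ h) x'
        + 2 * (ζ ⬝ᵥ (sys.C₁₀ *ᵥ x₀ + ∑ i, sys.C₁ i *ᵥ x i (-sys.τ i) + sys.D₁ *ᵥ w))
        - γ * (ζ ⬝ᵥ ζ) - γ * (w ⬝ᵥ w) := by
  have R := PolyParams.sep_regular sys.τ_pos hε hΘ
  have hle := R.neg_le
  have hT : sys.T ≠ 0 := (sys.τ_pos _).ne'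
  have hq := congrArg (fun f => ∑ i, f i)
    (funext (PolyParams.integral_dot_deriv_op sys.τ_pos hε hΘ hh hx hx' h0))
  set m' := fun i => vint (-sys.τ i) 0 fun s => matDeriv (mono₁ Θ.deg (Fin n)) s *ᵥ h i s
    with hm'
  have hsym : ∑ i, ∑ j, Θ.sep.mom sys.τ h i ⬝ᵥ Θ.Γ i j *ᵥ m' j
      = ∑ i, ∑ j, m' i ⬝ᵥ Θ.Γ i j *ᵥ Θ.sep.mom sys.τ h j := by
    rw [Finset.sum_comm]
    refine Finset.sum_congr rfl fun i _ => Finset.sum_congr rfl fun j _ => ?_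
    rw [dot_mulVec_comm, show (Θ.Γ j i)ᵀ = Θ.Γ i j from R.Γ_symm j i]
  have hT' : sys.τ (Fin.last k) = sys.T := rfl
  have hsP : Θ.sep.P = Θ.P := rfl
  have hsH : Θ.sep.H = Θ.H := rfl
  have hsΓ : Θ.sep.Γ = Θ.Γ := rfl
  have hsS : ∀ i s, Θ.sep.S i s = ev (Θ.S i) s := fun _ _ => rfl
  have hsW : ∀ i s, Θ.sep.W i s = mono₁ Θ.deg (Fin n) s := fun _ _ => rfl
  have hxτ : ∀ i, x i (-sys.τ i) = _ := fun i => hx i _ ⟨le_rfl, hle i⟩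
  have hcoef : ∀ i, Θ.sep.coef sys.τ h₀ h i ⬝ᵥ m' i
      = sys.T * (h₀ ⬝ᵥ Θ.H i *ᵥ m' i) + ∑ j, m' i ⬝ᵥ Θ.Γ i j *ᵥ Θ.sep.mom sys.τ h j := by
    intro i
    simp only [SepOp.coef, add_dotProduct, smul_dotProduct, sum_dotProduct, smul_eq_mul, hT',
      hsH, hsΓ, transpose_mulVec_dot]
    congr 1
    exact Finset.sum_congr rfl fun j _ => dotProduct_comm _ _
  simp only [Params.form, pairing]
  rw [mapL₁_P_form γ]
  simp only [mapL₁_Q_form γ ℋ ζ w h₀ hh, mapL₁_R_form γ R ℋ hh, hxτ, ← hx₀]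
  have hmS : ∀ i s, (mapL₁ sys γ Θ.eval ℋ).S i s = matDeriv (ev (Θ.S i)) s := fun _ _ => rfl
  have hc₁ : ∑ i, ∑ j, ζ ⬝ᵥ sys.C₁ j *ᵥ ((mono₁ Θ.deg (Fin n) (-sys.τ j))ᵀ *ᵥ
      (Θ.Γ j i *ᵥ Θ.sep.mom sys.τ h i)) = ∑ i, ∑ j, ζ ⬝ᵥ sys.C₁ i *ᵥ
      ((mono₁ Θ.deg (Fin n) (-sys.τ i))ᵀ *ᵥ (Θ.Γ i j *ᵥ Θ.sep.mom sys.τ h j)) :=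
    Finset.sum_comm
  have hc₂ : ∑ i, ∑ j, h₀ ⬝ᵥ sys.A j *ᵥ ((mono₁ Θ.deg (Fin n) (-sys.τ j))ᵀ *ᵥ
      (Θ.Γ j i *ᵥ Θ.sep.mom sys.τ h i)) = ∑ i, ∑ j, h₀ ⬝ᵥ sys.A i *ᵥ
      ((mono₁ Θ.deg (Fin n) (-sys.τ i))ᵀ *ᵥ (Θ.Γ i j *ᵥ Θ.sep.mom sys.τ h j)) :=
    Finset.sum_comm
  simp only [hm'] at hcoef
  simp only [hcoef] at hq
  simp only [hmS, hT', hsP, hsH, hsΓ, hsS, hsW, hm', ctrlOp, SepOp.op₀, SepOp.op₁, SepOp.coef,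
    Matrix.mulVec_add, Matrix.mulVec_smul, Matrix.mulVec_sum, dotProduct_add, dotProduct_smul,
    dotProduct_sum, smul_eq_mul, Finset.sum_add_distrib, Finset.sum_sub_distrib,
    ← Finset.mul_sum, mul_add, mul_sub, mul_assoc (2 : ℝ) sys.T,
    mul_inv_cancel_left₀ hT] at hsym hc₁ hc₂ hq ⊢
  -- What remains is the integration by parts of each history, the symmetry of `Γ` in the moment
  -- terms, and the renaming of channels in the double sums coming from the delayed output and the
  -- delayed dynamics.
  linear_combination (-1) * hq + hsym + 2 * hc₁ + 2 * sys.T * hc₂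

end FormL₁

/-! ### Dissipation inequalities -/

section Dissipation

variable {k n m q r p p₁ d : ℕ} {sys : DelaySystem k n m q r p p₁} {Θ : PolyParams k n}
  {ε : ℝ}

/-- The squared norm of `ℝⁿ × L₂ × ⋯ × L₂`. -/
def sqNorm (τ : Fin (k + 1) → ℝ) (x₀ : Fin n → ℝ) (x : Fin (k + 1) → ℝ → Fin n → ℝ) : ℝ :=
  x₀ ⬝ᵥ x₀ + ∑ i, ∫ s in (-τ i)..0, x i s ⬝ᵥ x i s

lemma sqNorm_nonneg {τ : Fin (k + 1) → ℝ} (hτ : ∀ i, 0 < τ i) (x₀ : Fin n → ℝ)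
    (x : Fin (k + 1) → ℝ → Fin n → ℝ) : 0 ≤ sqNorm τ x₀ x :=
  add_nonneg (Finset.sum_nonneg fun i _ => mul_self_nonneg _)
    (Finset.sum_nonneg fun i _ => intervalIntegral.integral_nonneg (by linarith [hτ i])
      fun s _ => Finset.sum_nonneg fun a _ => mul_self_nonneg _)

lemma pairing_add {τ : Fin (k + 1) → ℝ} (hτ : ∀ i, 0 < τ i) {x₀ y₀ z₀ : Fin n → ℝ}
    {x y z : Fin (k + 1) → ℝ → Fin n → ℝ} (hx : ∀ i, ContinuousOn (x i) (Set.Icc (-τ i) 0))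
    (hy : ∀ i a, IntervalIntegrable (fun s => y i s a) volume (-τ i) 0)
    (hz : ∀ i a, IntervalIntegrable (fun s => z i s a) volume (-τ i) 0) :
    pairing τ x₀ x (y₀ + z₀) (fun i s => y i s + z i s)
      = pairing τ x₀ x y₀ y + pairing τ x₀ x z₀ z := by
  have hle : ∀ i, -τ i ≤ 0 := fun i => by linarith [hτ i]
  simp only [pairing, dotProduct_add]
  simp only [fun i => intervalIntegral.integral_add (intervalIntegrable_dot (hle i) (hx i) (hy i))
    (intervalIntegrable_dot (hle i) (hx i) (hz i)), Finset.sum_add_distrib]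
  ring

lemma PolyParams.op_nonneg (hε : 0 < ε) {τ : Fin (k + 1) → ℝ} (hτ : ∀ i, 0 < τ i)
    (hΘ : Θ.eval.shift (-ε • 1) (-ε) ∈ Xi d τ) (h₀ : Fin n → ℝ)
    {h : Fin (k + 1) → ℝ → Fin n → ℝ} (hh : ∀ i, ContinuousOn (h i) (Set.Icc (-τ i) 0)) :
    0 ≤ pairing τ (Θ.sep.op₀ τ h₀ h) (Θ.sep.op₁ τ h₀ h) h₀ h := by
  refine le_trans ?_ (coercive hτ hε hΘ h₀ hh)
  have e : pairing τ h₀ (fun i s => τ (Fin.last k) • h i s) h₀ h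
      = τ (Fin.last k) * sqNorm τ h₀ h := by
    simp only [pairing, sqNorm, smul_dotProduct, smul_eq_mul,
      intervalIntegral.integral_const_mul, ← Finset.mul_sum]
    ring
  rw [e]
  exact mul_nonneg hε.le (mul_nonneg (hτ _).le (sqNorm_nonneg hτ _ _))

/-- With `h = Θ⁻¹ x` the pairing equals `⟨h, Θ h⟩`, so positivity of the inverse needs no inspection
of its parameters. -/
lemma PolyParams.invOp_nonneg (hε : 0 < ε) {τ : Fin (k + 1) → ℝ} (hτ : ∀ i, 0 < τ i)
    (hΘ : Θ.eval.shift (-ε • 1) (-ε) ∈ Xi d τ) (x₀ : Fin n → ℝ)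
    {x : Fin (k + 1) → ℝ → Fin n → ℝ} (hx : ∀ i, ContinuousOn (x i) (Set.Icc (-τ i) 0)) :
    0 ≤ pairing τ ((Θ.invSep τ).op₀ τ x₀ x) ((Θ.invSep τ).op₁ τ x₀ x) x₀ x := by
  have h := op_nonneg hε hτ hΘ ((Θ.invSep τ).op₀ τ x₀ x)
    (fun i => (Θ.invSep_regular hτ hε hΘ).continuousOn_op₁ x₀ hx i)
  obtain ⟨e₀, e₁⟩ := op_invSep hτ hε hΘ x₀ hx
  rw [e₀, pairing_congr hτ _ _ e₁ fun _ _ _ => rfl, pairing_comm] at h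
  exact h

lemma form_shift_neg_le {μ : Type} [Fintype μ] {α : Type} [Fintype α] [DecidableEq α]
    {τ : Fin (k + 1) → ℝ} (hτ : ∀ i, 0 < τ i)
    {Ψ : Params (Fin (k + 1)) μ α} {U : Matrix μ μ ℝ} {c : ℝ} (hΨ : (Ψ.shift U c).neg ∈ Xi d τ)
    (hS : ∀ i a b, ContinuousOn (fun s => Ψ.S i s a b) (Set.Icc (-τ i) 0)) (v : μ → ℝ)
    {h : Fin (k + 1) → ℝ → α → ℝ} (hh : ∀ i, ContinuousOn (h i) (Set.Icc (-τ i) 0)) :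
    Ψ.form τ v h + τ (Fin.last k) * (v ⬝ᵥ U *ᵥ v)
      + τ (Fin.last k) * (c * ∑ i, ∫ s in (-τ i)..0, h i s ⬝ᵥ h i s) ≤ 0 := by
  have hle : ∀ i, -τ i ≤ 0 := fun i => by linarith [hτ i]
  have h1 := Xi.form_nonneg hτ hΨ v hh
  rw [Params.form_neg, Params.form_shift] at h1
  · linarith
  · exact fun i => intervalIntegrable_dot (hle i) (hh i)
      (intervalIntegrable_of_continuousOn (hle i) (continuousOn_mulVec (hS i) (hh i)))
  · exact fun i => intervalIntegrable_dot (hle i) (hh i)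
      (intervalIntegrable_of_continuousOn (hle i) (hh i))

lemma dot_smul_stateProj {a b : ℕ} (τ : Fin (k + 1) → ℝ) (v : Fin a → ℝ) (ω : Fin b → ℝ)
    (x₀ : Fin n → ℝ) (x : Fin (k + 1) → ℝ → Fin n → ℝ) (c : ℝ) :
    lmiVec τ v ω x₀ x ⬝ᵥ (c • stateProj k n a b) *ᵥ lmiVec τ v ω x₀ x = c * (x₀ ⬝ᵥ x₀) := by
  rw [Matrix.smul_mulVec, dotProduct_smul, dot_stateProj, smul_eq_mul]

/-- Dissipation inequality for the estimation error. -/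
lemma error_dissipation {γ ε₂ : ℝ} (hγ : 0 < γ) (hε : 0 < ε)
    (hΘ : Θ.eval.shift (-ε • 1) (-ε) ∈ Xi d sys.τ) (𝒵 : EstimVars k n q)
    (hL : ((mapL₂ sys γ Θ.eval 𝒵).shift (ε₂ • stateProj k n r p₁) ε₂).neg ∈ Xi d sys.τ)
    (w : Fin r → ℝ) {e₀ : Fin n → ℝ} {e e' : Fin (k + 1) → ℝ → Fin n → ℝ}
    (he : ∀ i a, IsPrim (fun s => e i s a) (fun s => e' i s a) (-sys.τ i) 0)
    (he₀ : ∀ i, e i 0 = e₀) {ζ : Fin p₁ → ℝ}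
    (hζ : ζ = sys.C₃₀ *ᵥ e₀ + ∑ i, sys.C₃ i *ᵥ e i (-sys.τ i) + sys.D₃ *ᵥ w) :
    2 * pairing sys.τ (Θ.sep.op₀ sys.τ e₀ e) (Θ.sep.op₁ sys.τ e₀ e)
          (sys.A₀ *ᵥ e₀ + ∑ i, sys.A i *ᵥ e i (-sys.τ i) - sys.B₁ *ᵥ w
            + injectPresent sys.τ (mapLo sys.τ Θ 𝒵) (sys.C₂ *ᵥ e₀) fun i s => sys.C₂ *ᵥ e i s)
          (fun i s => e' i s + injectHistory sys.τ (mapLo sys.τ Θ 𝒵) (sys.C₂ *ᵥ e₀)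
            (fun i s => sys.C₂ *ᵥ e i s) i s)
      ≤ γ * (w ⬝ᵥ w) - γ⁻¹ * (ζ ⬝ᵥ ζ) - sys.T * (ε₂ * sqNorm sys.τ e₀ e) := by
  have R := PolyParams.sep_regular sys.τ_pos hε hΘ
  have hle := R.neg_le
  have hec : ∀ i, ContinuousOn (e i) (Set.Icc (-sys.τ i) 0) := fun i =>
    continuousOn_pi.2 fun a => (he i a).continuousOn
  have cC : ∀ i, ContinuousOn (fun s => sys.C₂ *ᵥ e i s) (Set.Icc (-sys.τ i) 0) := fun i =>
    continuousOn_mulVec (M := fun _ => sys.C₂) (fun _ _ => continuousOn_const) (hec i)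
  have cE := continuousOn_estOp₁ sys.τ_pos 𝒵 (sys.C₂ *ᵥ e₀) cC
  have cI := fun i => (Θ.invSep_regular sys.τ_pos hε hΘ).continuousOn_op₁
    (estOp₀ sys.τ 𝒵 (sys.C₂ *ᵥ e₀) fun i s => sys.C₂ *ᵥ e i s) cE i
  -- The free output variable is set to `γ⁻¹ ζ`, which maximises `2 v·ζ - γ |v|²` over `v`, with
  -- maximum `γ⁻¹ |ζ|²`.
  have h1 := form_shift_neg_le sys.τ_pos hL (h := e) ?_ (lmiVec sys.τ w (γ⁻¹ • ζ) e₀ e) hec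
  · rw [form_mapL₂ γ R 𝒵 w _ he he₀, dot_smul_stateProj,
      ← hζ] at h1
    -- The injected correction is `Θ⁻¹ 𝒵 b` with `b` the measured error. Self-adjointness moves `Θ`
    -- across the pairing and leaves `⟨e, 𝒵 b⟩`, the injection term of `form_mapL₂`.
    rw [pairing_congr (y' := fun i s => e' i s + (Θ.invSep sys.τ).op₁ sys.τ
        (estOp₀ sys.τ 𝒵 (sys.C₂ *ᵥ e₀) fun i s => sys.C₂ *ᵥ e i s)
        (estOp₁ sys.τ 𝒵 (sys.C₂ *ᵥ e₀) fun i s => sys.C₂ *ᵥ e i s) i s) sys.τ_pos _ _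
        (fun _ _ _ => rfl)
        (fun i s hs => by rw [injectHistory_mapLo sys.τ_pos hε hΘ 𝒵 _ cC i hs]),
      injectPresent_mapLo sys.τ_pos hε hΘ 𝒵 _ cC,
      pairing_add sys.τ_pos (fun i => R.continuousOn_op₁ e₀ hec i) (fun i a => (he i a).int)
        (fun i => intervalIntegrable_of_continuousOn (hle i) (cI i)),
      R.selfAdjoint hec cI]
    obtain ⟨q₀, q₁⟩ := PolyParams.op_invSep sys.τ_pos hε hΘ
      (estOp₀ sys.τ 𝒵 (sys.C₂ *ᵥ e₀) fun i s => sys.C₂ *ᵥ e i s) cE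
    rw [q₀, pairing_congr sys.τ_pos _ _ (fun _ _ _ => rfl) q₁]
    simp only [smul_dotProduct, dotProduct_smul, smul_eq_mul] at h1
    rw [mul_inv_cancel_left₀ hγ.ne'] at h1
    simp only [sqNorm]
    change _ + sys.T * _ + sys.T * _ ≤ 0 at h1
    linarith
  · intro i a b
    change ContinuousOn (fun s => -matDeriv (ev (Θ.S i)) s a b + (ev (𝒵.Z₆ i) s * sys.C₂) a b
      + (sys.C₂ᵀ * (ev (𝒵.Z₆ i) s)ᵀ) a b) _
    have c6 : ∀ a b, ContinuousOn (fun s => ev (𝒵.Z₆ i) s a b) (Set.Icc (-sys.τ i) 0) :=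
      fun a b => (continuous_ev _ a b).continuousOn
    exact ((continuous_matDeriv_ev _ a b).continuousOn.neg.add (continuousOn_matrix_mul
      (N := fun _ => sys.C₂) c6 (fun _ _ => continuousOn_const) a b)).add
      (continuousOn_matrix_mul (M := fun _ => sys.C₂ᵀ) (N := fun s => (ev (𝒵.Z₆ i) s)ᵀ)
        (fun _ _ => continuousOn_const) (fun a b => c6 b a) a b)

/-- Dissipation inequality for the plant state. -/
lemma state_dissipation {γ ε₁ : ℝ} (hγ : 0 < γ) (hε : 0 < ε)
    (hΘ : Θ.eval.shift (-ε • 1) (-ε) ∈ Xi d sys.τ) (hX : StateSpacePreserving sys.τ Θ.eval)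
    (ℋ : ControlVars k n m)
    (hL : ((mapL₁ sys γ Θ.eval ℋ).shift (ε₁ • stateProj k n p r) ε₁).neg ∈ Xi d sys.τ)
    (w : Fin r → ℝ) (u : Fin m → ℝ) {x₀ : Fin n → ℝ} {x x' : Fin (k + 1) → ℝ → Fin n → ℝ}
    (hx' : ∀ i a, IsPrim (fun s => x i s a) (fun s => x' i s a) (-sys.τ i) 0)
    (hx₀ : ∀ i, x i 0 = x₀) {ζ : Fin p → ℝ}
    (hζ : ζ = sys.C₁₀ *ᵥ x₀ + ∑ i, sys.C₁ i *ᵥ x i (-sys.τ i) + sys.D₁ *ᵥ w) :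
    2 * pairing sys.τ ((Θ.invSep sys.τ).op₀ sys.τ x₀ x) ((Θ.invSep sys.τ).op₁ sys.τ x₀ x)
          (sys.A₀ *ᵥ x₀ + ∑ i, sys.A i *ᵥ x i (-sys.τ i) + sys.B₁ *ᵥ w
            + sys.B₂ *ᵥ (gainOp sys.τ (mapLc sys.τ Θ ℋ) x₀ x + u)) x'
      ≤ γ * (w ⬝ᵥ w) - γ⁻¹ * (ζ ⬝ᵥ ζ)
        - sys.T * (ε₁ * sqNorm sys.τ ((Θ.invSep sys.τ).op₀ sys.τ x₀ x)
            ((Θ.invSep sys.τ).op₁ sys.τ x₀ x))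
        + sys.T * (2 * ((Θ.invSep sys.τ).op₀ sys.τ x₀ x ⬝ᵥ sys.B₂ *ᵥ u)) := by
  have R := PolyParams.sep_regular sys.τ_pos hε hΘ
  have hle := R.neg_le
  have hxc : ∀ i, ContinuousOn (x i) (Set.Icc (-sys.τ i) 0) := fun i =>
    continuousOn_pi.2 fun a => (hx' i a).continuousOn
  obtain ⟨q₀, q₁⟩ := PolyParams.op_invSep sys.τ_pos hε hΘ x₀ hxc
  have hhc := fun i => (Θ.invSep_regular sys.τ_pos hε hΘ).continuousOn_op₁ x₀ hxc i
  rw [gainOp_mapLc sys.τ_pos hε hΘ ℋ x₀ hxc]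
  set h₀ := (Θ.invSep sys.τ).op₀ sys.τ x₀ x
  set h := (Θ.invSep sys.τ).op₁ sys.τ x₀ x
  -- Here the structural conditions enter: the preimage of a compatible state is compatible, so the
  -- boundary terms at `0` involve `h₀` alone.
  have h0 : ∀ i, h i 0 = h₀ := fun i =>
    hX.eq_at_zero sys.τ_pos hε hΘ hhc i (by rw [q₀, q₁ i 0 ⟨hle i, le_rfl⟩, hx₀ i])
  have h1 := form_shift_neg_le sys.τ_pos hL (h := h)
    (fun i a b => (continuous_matDeriv_ev (Θ.S i) a b).continuousOn)
    (lmiVec sys.τ (γ⁻¹ • ζ) w h₀ h) hhc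
  rw [form_mapL₁ γ hε hΘ ℋ w _ hhc q₀ (fun i s hs => (q₁ i s hs).symm) hx' h0,
    dot_smul_stateProj, ← hζ] at h1
  simp only [smul_dotProduct, dotProduct_smul, smul_eq_mul] at h1
  rw [mul_inv_cancel_left₀ hγ.ne'] at h1
  have hT' : sys.τ (Fin.last k) = sys.T := rfl
  simp only [sqNorm, pairing, Matrix.mulVec_add, dotProduct_add, hT'] at h1 ⊢
  linarith

/-- The coupling between the controller and the estimator. -/
lemma coupling_bound {ε₁ ε₂ ε₃ ρ : ℝ} (hε₃ : 0 ≤ ε₃) {𝒦 : ControlGains k n m}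
    (hK : ∀ i a b, ContinuousOn (fun s => 𝒦.K₂ i s a b) (Set.Icc (-sys.τ i) 0))
    (hC : ((coupling sys 𝒦 ε₁ ε₂ ρ).shift (ε₃ • couplingProj k n) 0).neg ∈ Xi d sys.τ)
    (h₀ e₀ : Fin n → ℝ) {h e : Fin (k + 1) → ℝ → Fin n → ℝ}
    (hh : ∀ i, ContinuousOn (h i) (Set.Icc (-sys.τ i) 0))
    (he : ∀ i, ContinuousOn (e i) (Set.Icc (-sys.τ i) 0)) :
    2 * (h₀ ⬝ᵥ sys.B₂ *ᵥ gainOp sys.τ 𝒦 e₀ e)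
      ≤ ε₁ * sqNorm sys.τ h₀ h + ρ * (ε₂ * sqNorm sys.τ e₀ e) := by
  have hle : ∀ i, -sys.τ i ≤ 0 := fun i => by linarith [sys.τ_pos i]
  have hT : 0 < sys.τ (Fin.last k) := sys.τ_pos _
  set v : Fin n ⊕ (Fin n ⊕ (Fin n × Fin (k + 1))) → ℝ :=
    Sum.elim h₀ (Sum.elim e₀ fun j => e j.2 (-sys.τ j.2) j.1) with hv
  set f : Fin (k + 1) → ℝ → Fin n ⊕ Fin n → ℝ := fun i s => Sum.elim (e i s) (h i s) with hf
  have hfc : ∀ i, ContinuousOn (f i) (Set.Icc (-sys.τ i) 0) := by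
    intro i
    refine continuousOn_pi.2 fun a => ?_
    cases a with
    | inl a => exact continuousOn_pi.1 (he i) a
    | inr a => exact continuousOn_pi.1 (hh i) a
  have h1 := form_shift_neg_le sys.τ_pos hC (h := f) (fun i a b => continuousOn_const) v hfc
  have eU : v ⬝ᵥ (ε₃ • couplingProj k n) *ᵥ v = ε₃ * (h₀ ⬝ᵥ h₀) := by
    simp only [hv, couplingProj, Matrix.smul_mulVec, dotProduct_smul, smul_eq_mul,
      Matrix.fromBlocks_mulVec, Sum.elim_comp_inl, sumElim_dotProduct_sumElim,
      Matrix.zero_mulVec, Matrix.one_mulVec, add_zero, dotProduct_zero]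
  have eR : ∀ i j s θ, f i s ⬝ᵥ (coupling sys 𝒦 ε₁ ε₂ ρ).R i j s θ *ᵥ f j θ = 0 := by
    intro i j s θ
    simp only [coupling, Matrix.zero_mulVec, dotProduct_zero]
  have eP : v ⬝ᵥ (coupling sys 𝒦 ε₁ ε₂ ρ).P *ᵥ v = -ε₁ * (h₀ ⬝ᵥ h₀) - ρ * ε₂ * (e₀ ⬝ᵥ e₀)
      + 2 * (h₀ ⬝ᵥ sys.B₂ *ᵥ (𝒦.K₀ *ᵥ e₀ + ∑ i, 𝒦.K₁ i *ᵥ e i (-sys.τ i))) := by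
    set V : Matrix (Fin n) (Fin n ⊕ (Fin n × Fin (k + 1))) ℝ :=
      Matrix.fromCols (sys.B₂ * 𝒦.K₀) (blockRow fun i => sys.B₂ * 𝒦.K₁ i) with hV
    have eV : V *ᵥ Sum.elim e₀ (fun j => e j.2 (-sys.τ j.2) j.1)
        = sys.B₂ *ᵥ (𝒦.K₀ *ᵥ e₀ + ∑ i, 𝒦.K₁ i *ᵥ e i (-sys.τ i)) := by
      rw [hV, Matrix.fromCols_mulVec_sumElim, blockRow_mulVec]
      simp only [Matrix.mulVec_add, Matrix.mulVec_sum, Matrix.mulVec_mulVec]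
    change v ⬝ᵥ Matrix.fromBlocks (-ε₁ • 1) V Vᵀ (Matrix.fromBlocks (-(ρ * ε₂) • 1) 0 0 0) *ᵥ v
      = _
    simp only [hv, Matrix.fromBlocks_mulVec, Sum.elim_comp_inl, Sum.elim_comp_inr,
      sumElim_dotProduct_sumElim, dotProduct_add, dot_transpose_mulVec, eV, Matrix.zero_mulVec,
      Matrix.smul_mulVec, Matrix.one_mulVec, dotProduct_smul, smul_eq_mul, dotProduct_zero,
      add_zero]
    ring
  have eQ : ∀ i, ∫ s in (-sys.τ i)..0, v ⬝ᵥ (coupling sys 𝒦 ε₁ ε₂ ρ).Q i s *ᵥ f i s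
      = h₀ ⬝ᵥ sys.B₂ *ᵥ vint (-sys.τ i) 0 fun s => 𝒦.K₂ i s *ᵥ e i s := by
    intro i
    rw [← integral_dot_mul_mulVec (hle i) (hK i) (he i)]
    refine intervalIntegral.integral_congr fun s _ => ?_
    simp only [hv, hf, coupling, Matrix.fromBlocks_mulVec, Sum.elim_comp_inl, Sum.elim_comp_inr,
      sumElim_dotProduct_sumElim, Matrix.zero_mulVec, dotProduct_zero, add_zero]
  have eS : ∀ i, ∫ s in (-sys.τ i)..0, f i s ⬝ᵥ (coupling sys 𝒦 ε₁ ε₂ ρ).S i s *ᵥ f i s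
      = -(ρ * ε₂) * (∫ s in (-sys.τ i)..0, e i s ⬝ᵥ e i s)
        + -ε₁ * ∫ s in (-sys.τ i)..0, h i s ⬝ᵥ h i s := by
    intro i
    have J : ∀ {g : Fin (k + 1) → ℝ → Fin n → ℝ},
        (∀ i, ContinuousOn (g i) (Set.Icc (-sys.τ i) 0)) →
        IntervalIntegrable (fun s => g i s ⬝ᵥ g i s) volume (-sys.τ i) 0 := fun hg =>
      intervalIntegrable_dot (hle i) (hg i) (intervalIntegrable_of_continuousOn (hle i) (hg i))
    rw [← intervalIntegral.integral_const_mul, ← intervalIntegral.integral_const_mul,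
      ← intervalIntegral.integral_add ((J he).const_mul _) ((J hh).const_mul _)]
    refine intervalIntegral.integral_congr fun s _ => ?_
    simp only [hf, coupling, Matrix.fromBlocks_mulVec, Sum.elim_comp_inl, Sum.elim_comp_inr,
      sumElim_dotProduct_sumElim, Matrix.zero_mulVec, Matrix.smul_mulVec, Matrix.one_mulVec,
      dotProduct_smul, smul_eq_mul, add_zero, zero_add]
  simp only [Params.form, eP, eQ, eS, eR, eU, intervalIntegral.integral_zero,
    Finset.sum_const_zero, Finset.sum_add_distrib, ← Finset.mul_sum, zero_mul, mul_zero,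
    add_zero] at h1
  -- The term `ε₃ |h₀|²` contributed by the shift has the favourable sign and is dropped; the common
  -- factor `T` is then divided out.
  have h2 : 0 ≤ h₀ ⬝ᵥ h₀ := Finset.sum_nonneg fun i _ => mul_self_nonneg _
  have h3 := mul_nonneg hε₃ h2
  simp only [sqNorm, gainOp, Matrix.mulVec_add, Matrix.mulVec_sum, dotProduct_add,
    dotProduct_sum] at h1 ⊢
  refine le_of_mul_le_mul_left ?_ hT
  have h4 := mul_nonneg hT.le h3
  linarith

end Dissipation

/-! ### Square integrability along trajectories -/

section Stability

variable {α β : Type*} [Fintype β] {t a b : ℝ}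

lemma memLp_mulVec {X : Type*} [MeasurableSpace X] {μ : Measure X} (M : Matrix α β ℝ)
    {f : X → β → ℝ} (hf : ∀ j, MemLp (fun x => f x j) 2 μ) (i : α) :
    MemLp (fun x => (M *ᵥ f x) i) 2 μ := by
  simp only [Matrix.mulVec, dotProduct]
  exact memLp_finsetSum _ fun j _ => (hf j).const_mul _

lemma memLp_sum_apply {X : Type*} [MeasurableSpace X] {μ : Measure X} {ι : Type*} [Fintype ι]
    {f : ι → X → α → ℝ} {i : α} (hf : ∀ j, MemLp (fun x => f j x i) 2 μ) :
    MemLp (fun x => (∑ j, f j x) i) 2 μ := by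
  simp only [Finset.sum_apply]
  exact memLp_finsetSum _ fun j _ => hf j

lemma memLp_mulVec_snd {M : ℝ → Matrix α β ℝ}
    (hM : ∀ i j, ContinuousOn (fun s => M s i j) (Set.Icc a b)) {f : ℝ → ℝ → β → ℝ}
    (hf : ∀ j, MemLp (fun p : ℝ × ℝ => f p.1 p.2 j) 2 (rect t a b)) (i : α) :
    MemLp (fun p : ℝ × ℝ => (M p.2 *ᵥ f p.1 p.2) i) 2 (rect t a b) := by
  simp only [Matrix.mulVec, dotProduct]
  exact memLp_finsetSum _ fun j _ => memLp_mul_snd (F := fun σ s => f σ s j) (hM i j) (hf j)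

lemma memLp_intervalIntegral (hab : a ≤ b) {f : ℝ → ℝ → ℝ}
    (hf : MemLp (fun p : ℝ × ℝ => f p.1 p.2) 2 (rect t a b)) :
    MemLp (fun σ => ∫ s in a..b, f σ s) 2 (volume.restrict (Set.Ioc 0 t)) := by
  simp only [intervalIntegral.integral_of_le hab]
  exact memLp_integral_right hf

lemma memLp_fst {f : ℝ → ℝ} (hf : MemLp f 2 (volume.restrict (Set.Ioc 0 t))) :
    MemLp (fun p : ℝ × ℝ => f p.1) 2 (rect t a b) :=
  hf.comp_fst _

lemma memLp_of_continuousOn {f : ℝ → ℝ} (hf : ContinuousOn f (Set.Icc a b)) :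
    MemLp f 2 (volume.restrict (Set.Ioc a b)) := by
  obtain ⟨C, hC⟩ := exists_bound_of_continuousOn hf
  refine MemLp.of_bound
    ((hf.mono Set.Ioc_subset_Icc_self).aestronglyMeasurable measurableSet_Ioc) C ?_
  filter_upwards [ae_restrict_mem measurableSet_Ioc] with s hs
  exact hC s (Set.Ioc_subset_Icc_self hs)

lemma ae_rect_mem : ∀ᵐ p ∂(rect t a b), p.1 ∈ Set.Ioc 0 t ∧ p.2 ∈ Set.Ioc a b :=
  (Measure.quasiMeasurePreserving_fst.ae (ae_restrict_mem measurableSet_Ioc)).and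
    (Measure.quasiMeasurePreserving_snd.ae (ae_restrict_mem measurableSet_Ioc))

/-- Translates of a square integrable function. -/
lemma memLp_translate {f : ℝ → ℝ} (hb : b ≤ 0)
    (hf : MemLp f 2 (volume.restrict (Set.Ioc a t))) :
    MemLp (fun p : ℝ × ℝ => f (p.1 + p.2)) 2 (rect t a b) := by
  have h1 : MemLp (fun p : ℝ × ℝ => f p.1) 2
      ((volume.restrict (Set.Ioc a t)).prod (volume.restrict (Set.Ioc a b))) := hf.comp_fst _
  rw [Measure.prod_restrict] at h1
  -- The shear `(σ, s) ↦ (σ + s, s)` preserves Lebesgue measure. As `b ≤ 0`, it maps `(0, t] × (a,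
  -- b]` into `(a, t] × (a, b]`.
  have hmp : MeasurePreserving (fun p : ℝ × ℝ => (p.1 + p.2, p.2)) (volume.prod volume)
      (volume.prod volume) := measurePreserving_add_prod volume volume
  have h2 := h1.comp_measurePreserving
    (hmp.restrict_preimage (measurableSet_Ioc.prod measurableSet_Ioc))
  refine h2.mono_measure ?_
  rw [rect, Measure.prod_restrict]
  refine Measure.restrict_mono (fun p hp => ?_) le_rfl
  simp only [Set.mem_prod, Set.mem_Ioc, Set.mem_preimage] at hp ⊢
  refine ⟨⟨?_, ?_⟩, hp.2⟩ <;> linarith [hp.1.1, hp.1.2, hp.2.1, hp.2.2]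

/-- Expanding the polynomial kernel in powers of `θ` gives a finite sum of polynomials in `s` times
moments depending on `σ`, each of them square integrable. -/
lemma memLp_vint_ev₂ {α : Type*} {c d : ℝ} (hcd : c ≤ d) (M : Matrix α β ℝ[X][X])
    {f : ℝ → ℝ → β → ℝ} (hf : ∀ j, MemLp (fun p : ℝ × ℝ => f p.1 p.2 j) 2 (rect t c d))
    (i : α) :
    MemLp (fun p : ℝ × ℝ => vint c d (fun θ => ev₂ M p.2 θ *ᵥ f p.1 θ) i) 2 (rect t a b) := by
  have hint : ∀ᵐ σ ∂(volume.restrict (Set.Ioc 0 t)), ∀ j, IntervalIntegrable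
      (fun θ => f σ θ j) volume c d := by
    refine ae_all_iff.2 fun j => ?_
    filter_upwards [((hf j).integrable (by norm_num)).prod_right_ae] with σ hσ
    rw [intervalIntegrable_iff_integrableOn_Ioc_of_le hcd]
    exact hσ
  have h1 : MemLp (fun p : ℝ × ℝ => ∑ j, ∑ l ∈ Finset.range ((M i j).natDegree + 1),
      ((M i j).coeff l).eval p.2 * ∫ θ in c..d, θ ^ l * f p.1 θ j) 2 (rect t a b) := by
    refine memLp_finsetSum _ fun j _ => memLp_finsetSum _ fun l _ => ?_
    refine memLp_mul_snd (F := fun σ _ => ∫ θ in c..d, θ ^ l * f σ θ j)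
      (Polynomial.continuous _).continuousOn
      (memLp_fst (f := fun σ => ∫ θ in c..d, θ ^ l * f σ θ j) ?_)
    exact memLp_intervalIntegral hcd (memLp_mul_snd (F := fun σ s => f σ s j)
      (continuous_pow l).continuousOn (hf j))
  refine h1.ae_eq ?_
  filter_upwards [Measure.quasiMeasurePreserving_fst.ae hint] with p hp
  have hpol : ∀ j θ, Polynomial.evalEval p.2 θ (M i j)
      = ∑ l ∈ Finset.range ((M i j).natDegree + 1), ((M i j).coeff l).eval p.2 * θ ^ l := by
    intro j θ
    rw [Polynomial.evalEval, Polynomial.eval_eq_sum_range (p := M i j),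
      Polynomial.eval_finsetSum]
    simp only [Polynomial.eval_mul, Polynomial.eval_pow, Polynomial.eval_C]
  simp only [vint, Matrix.mulVec, dotProduct, ev₂, Matrix.map_apply, hpol, Finset.sum_mul,
    mul_assoc]
  have J : ∀ j l, IntervalIntegrable
      (fun θ => ((M i j).coeff l).eval p.2 * (θ ^ l * f p.1 θ j)) volume c d := fun j l =>
    ((hp j).continuousOn_mul (continuous_pow l).continuousOn).const_mul _
  rw [intervalIntegral.integral_finsetSum fun j _ => intervalIntegrable_fun_sum _ fun l _ => J j l]
  refine Finset.sum_congr rfl fun j _ => ?_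
  rw [intervalIntegral.integral_finsetSum fun l _ => J j l]
  simp only [intervalIntegral.integral_const_mul]

end Stability

/-! ### Square integrability of the operators along trajectories -/

section Operators

variable {k n q : ℕ} {τ : Fin (k + 1) → ℝ} {t : ℝ}

lemma SepOp.Regular.memLp_op₀ {κ : Type} [Fintype κ] {Φ : SepOp k n κ} (R : Φ.Regular τ)
    {u₀ : ℝ → Fin n → ℝ} {u : Fin (k + 1) → ℝ → ℝ → Fin n → ℝ}
    (h₀ : ∀ a, MemLp (fun σ => u₀ σ a) 2 (volume.restrict (Set.Ioc 0 t)))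
    (hu : ∀ i a, MemLp (fun p : ℝ × ℝ => u i p.1 p.2 a) 2 (rect t (-τ i) 0)) (a : Fin n) :
    MemLp (fun σ => Φ.op₀ τ (u₀ σ) (fun i => u i σ) a) 2 (volume.restrict (Set.Ioc 0 t)) := by
  have hm : ∀ i c, MemLp (fun σ => Φ.mom τ (fun i => u i σ) i c) 2
      (volume.restrict (Set.Ioc 0 t)) := fun i c =>
    memLp_intervalIntegral (R.neg_le i) (f := fun σ s => (Φ.W i s *ᵥ u i σ s) c)
      (memLp_mulVec_snd (R.W_cont i) (hu i) c)
  exact (memLp_mulVec _ h₀ a).add (memLp_sum_apply fun i => memLp_mulVec _ (hm i) a)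

lemma SepOp.Regular.memLp_op₁ {κ : Type} [Fintype κ] {Φ : SepOp k n κ} (R : Φ.Regular τ)
    {u₀ : ℝ → Fin n → ℝ} {u : Fin (k + 1) → ℝ → ℝ → Fin n → ℝ}
    (h₀ : ∀ a, MemLp (fun σ => u₀ σ a) 2 (volume.restrict (Set.Ioc 0 t)))
    (hu : ∀ i a, MemLp (fun p : ℝ × ℝ => u i p.1 p.2 a) 2 (rect t (-τ i) 0))
    (i : Fin (k + 1)) (a : Fin n) :
    MemLp (fun p : ℝ × ℝ => Φ.op₁ τ (u₀ p.1) (fun i => u i p.1) i p.2 a) 2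
      (rect t (-τ i) 0) := by
  have hm : ∀ i c, MemLp (fun σ => Φ.mom τ (fun i => u i σ) i c) 2
      (volume.restrict (Set.Ioc 0 t)) := fun i c =>
    memLp_intervalIntegral (R.neg_le i) (f := fun σ s => (Φ.W i s *ᵥ u i σ s) c)
      (memLp_mulVec_snd (R.W_cont i) (hu i) c)
  have hc : ∀ c, MemLp (fun σ => Φ.coef τ (u₀ σ) (fun i => u i σ) i c) 2
      (volume.restrict (Set.Ioc 0 t)) := fun c =>
    ((memLp_mulVec _ h₀ c).const_mul _).add (memLp_sum_apply fun j => memLp_mulVec _ (hm j) c)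
  exact (memLp_mulVec_snd (M := fun s => (Φ.W i s)ᵀ)
    (f := fun σ _ => Φ.coef τ (u₀ σ) (fun i => u i σ) i) (fun a b => R.W_cont i b a)
    (fun c => memLp_fst (hc c)) a).add
    ((memLp_mulVec_snd (R.S_cont i) (hu i) a).const_mul (τ (Fin.last k)))

variable {b₀ : ℝ → Fin q → ℝ} {b : Fin (k + 1) → ℝ → ℝ → Fin q → ℝ}

lemma memLp_estOp₀ (hτ : ∀ i, 0 < τ i) (𝒵 : EstimVars k n q)
    (h₀ : ∀ a, MemLp (fun σ => b₀ σ a) 2 (volume.restrict (Set.Ioc 0 t)))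
    (hτb : ∀ i a, MemLp (fun σ => b i σ (-τ i) a) 2 (volume.restrict (Set.Ioc 0 t)))
    (hb : ∀ i a, MemLp (fun p : ℝ × ℝ => b i p.1 p.2 a) 2 (rect t (-τ i) 0)) (a : Fin n) :
    MemLp (fun σ => estOp₀ τ 𝒵 (b₀ σ) (fun i => b i σ) a) 2 (volume.restrict (Set.Ioc 0 t)) := by
  have h3 : ∀ i, MemLp (fun σ => vint (-τ i) 0 (fun s => ev (𝒵.Z₃ i) s *ᵥ b i σ s) a) 2
      (volume.restrict (Set.Ioc 0 t)) := fun i =>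
    memLp_intervalIntegral (by linarith [hτ i]) (f := fun σ s => (ev (𝒵.Z₃ i) s *ᵥ b i σ s) a)
      (memLp_mulVec_snd (fun c d => (continuous_ev _ c d).continuousOn) (hb i) a)
  exact ((memLp_mulVec 𝒵.Z₁ h₀ a).add
    (memLp_sum_apply fun i => memLp_mulVec (𝒵.Z₂ i) (hτb i) a)).add (memLp_sum_apply h3)

lemma memLp_estOp₁ (hτ : ∀ i, 0 < τ i) (𝒵 : EstimVars k n q)
    (h₀ : ∀ a, MemLp (fun σ => b₀ σ a) 2 (volume.restrict (Set.Ioc 0 t)))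
    (hτb : ∀ i a, MemLp (fun σ => b i σ (-τ i) a) 2 (volume.restrict (Set.Ioc 0 t)))
    (hb : ∀ i a, MemLp (fun p : ℝ × ℝ => b i p.1 p.2 a) 2 (rect t (-τ i) 0))
    (i : Fin (k + 1)) (a : Fin n) :
    MemLp (fun p : ℝ × ℝ => estOp₁ τ 𝒵 (b₀ p.1) (fun i => b i p.1) i p.2 a) 2
      (rect t (-τ i) 0) := by
  have c : ∀ (M : Matrix (Fin n) (Fin q) ℝ[X]) c d, ContinuousOn (fun s => ev M s c d)
      (Set.Icc (-τ i) 0) := fun M c d => (continuous_ev _ c d).continuousOn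
  have h4 := memLp_mulVec_snd (f := fun σ _ => b₀ σ) (c (𝒵.Z₄ i)) (fun d => memLp_fst (h₀ d)) a
  have h5 : ∀ j, MemLp (fun p : ℝ × ℝ => (ev (𝒵.Z₅ i j) p.2 *ᵥ b j p.1 (-τ j)) a) 2
      (rect t (-τ i) 0) := fun j => memLp_mulVec_snd (f := fun σ _ => b j σ (-τ j)) (c _)
      (fun d => memLp_fst (hτb j d)) a
  have h6 := memLp_mulVec_snd (c (𝒵.Z₆ i)) (hb i) a
  have h7 : ∀ j, MemLp (fun p : ℝ × ℝ => vint (-τ j) 0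
      (fun θ => ev₂ (𝒵.Z₇ i j) p.2 θ *ᵥ b j p.1 θ) a) 2 (rect t (-τ i) 0) := fun j =>
    memLp_vint_ev₂ (by linarith [hτ j]) _ (hb j) a
  exact MemLp.const_mul (((h4.add (memLp_sum_apply h5)).add h6).add (memLp_sum_apply h7)) _

end Operators

/-! ### Histories of absolutely continuous functions -/

section Translate

variable {u f : ℝ → ℝ}

lemma isPrim_translate (hf : ∀ a b, IntervalIntegrable f volume a b)
    (hu : ∀ σ, u σ = ∫ s in (0 : ℝ)..σ, f s) (σ : ℝ) {a b : ℝ} (hab : a ≤ b) :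
    IsPrim (fun s => u (σ + s)) (fun s => f (σ + s)) a b := by
  refine ⟨hab, ?_, fun s _ => ?_⟩
  · have := (hf (σ + a) (σ + b)).comp_add_left σ
    simpa using this
  · rw [intervalIntegral.integral_comp_add_left, hu, hu,
      intervalIntegral.integral_add_adjacent_intervals (hf _ _) (hf _ _)]

/-- The integral equals `u (σ + s) - u s`, and `u s = 0` as `s ≤ 0`. This is how the zero initial
history of the plant is used. -/
lemma translate_eq_integral (hf : ∀ a b, IntervalIntegrable f volume a b)
    (hu : ∀ σ, u σ = ∫ s in (0 : ℝ)..σ, f s) (hu₀ : ∀ σ ≤ 0, u σ = 0) (σ : ℝ) {s : ℝ}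
    (hs : s ≤ 0) : u (σ + s) = ∫ σ' in (0 : ℝ)..σ, f (σ' + s) := by
  rw [intervalIntegral.integral_comp_add_right, zero_add,
    ← intervalIntegral.integral_interval_sub_left (hf 0 _) (hf 0 s), ← hu, ← hu, hu₀ s hs,
    sub_zero]

end Translate

/-- The estimated histories `φ` are absolutely continuous in `s`, with derivative `ψ` in `L₂`. -/
structure IsHistory {k n : ℕ} (τ : Fin (k + 1) → ℝ) (xh : ℝ → Fin n → ℝ)
    (φ ψ : Fin (k + 1) → ℝ → ℝ → Fin n → ℝ) : Prop where
  cont : ContinuousOn xh (Set.Ici 0)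
  mem : ∀ i a t, MemLp (fun p : ℝ × ℝ => ψ i p.1 p.2 a) 2 (rect t (-τ i) 0)
  int : ∀ i t, 0 ≤ t → ∀ a, IntervalIntegrable (fun s => ψ i t s a) volume (-τ i) 0
  eq : ∀ i t, 0 ≤ t → ∀ s ∈ Set.Icc (-τ i) 0, ∀ a, φ i t s a = xh t a - ∫ θ in s..0, ψ i t θ a

namespace IsHistory

variable {k n m : ℕ} {τ : Fin (k + 1) → ℝ} {xh : ℝ → Fin n → ℝ}
  {φ ψ : Fin (k + 1) → ℝ → ℝ → Fin n → ℝ} {t : ℝ}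

lemma apply_zero (h : IsHistory τ xh φ ψ) (hτ : ∀ i, 0 < τ i) (i : Fin (k + 1)) (ht : 0 ≤ t) :
    φ i t 0 = xh t := by
  funext a
  rw [h.eq i t ht 0 ⟨by linarith [hτ i], le_rfl⟩ a]
  simp

lemma isPrim (h : IsHistory τ xh φ ψ) (hτ : ∀ i, 0 < τ i) (i : Fin (k + 1)) (ht : 0 ≤ t)
    (a : Fin n) : IsPrim (fun s => φ i t s a) (fun s => ψ i t s a) (-τ i) 0 := by
  have hle : -τ i ≤ 0 := by linarith [hτ i]
  refine ⟨hle, h.int i t ht a, fun s hs => ?_⟩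
  have h1 := (h.int i t ht a).mono_set (c := -τ i) (d := s)
    (by rw [Set.uIcc_of_le hs.1, Set.uIcc_of_le hle]; exact Set.Icc_subset_Icc_right hs.2)
  have h2 := (h.int i t ht a).mono_set (c := s) (d := 0)
    (by rw [Set.uIcc_of_le hs.2, Set.uIcc_of_le hle]; exact Set.Icc_subset_Icc_left hs.1)
  have h3 := intervalIntegral.integral_add_adjacent_intervals h1 h2
  rw [h.eq i t ht s hs, h.eq i t ht _ ⟨le_rfl, hle⟩]
  linarith

lemma continuousOn (h : IsHistory τ xh φ ψ) (hτ : ∀ i, 0 < τ i) (ht : 0 ≤ t) (i : Fin (k + 1)) :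
    ContinuousOn (φ i t) (Set.Icc (-τ i) 0) :=
  continuousOn_pi.2 fun a => (h.isPrim hτ i ht a).continuousOn

lemma memLp_present (h : IsHistory τ xh φ ψ) (a : Fin n) :
    MemLp (fun σ => xh σ a) 2 (volume.restrict (Set.Ioc 0 t)) :=
  memLp_of_continuousOn ((continuousOn_pi.1 h.cont a).mono Set.Icc_subset_Ici_self)

/-- The value at the end of the history is the present value minus `∫ ψ`, and both are square
integrable in time. -/
lemma memLp_delayed (h : IsHistory τ xh φ ψ) (hτ : ∀ i, 0 < τ i) (i : Fin (k + 1)) (a : Fin n) :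
    MemLp (fun σ => φ i σ (-τ i) a) 2 (volume.restrict (Set.Ioc 0 t)) := by
  have hle : -τ i ≤ 0 := by linarith [hτ i]
  refine MemLp.ae_eq ?_ (h.memLp_present a |>.sub
    (memLp_intervalIntegral hle (f := fun σ s => ψ i σ s a) (h.mem i a t)))
  filter_upwards [ae_restrict_mem measurableSet_Ioc] with σ hσ
  exact (h.eq i σ hσ.1.le _ ⟨le_rfl, hle⟩ a).symm

/-- `φ` is rebuilt from its value at `-τᵢ` and the primitive of `ψ` in `s`. This also provides joint
measurability, which is not part of the hypotheses. -/
lemma memLp (h : IsHistory τ xh φ ψ) (hτ : ∀ i, 0 < τ i) (i : Fin (k + 1)) (a : Fin n) :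
    MemLp (fun p : ℝ × ℝ => φ i p.1 p.2 a) 2 (rect t (-τ i) 0) := by
  refine MemLp.ae_eq ?_ ((memLp_fst (h.memLp_delayed hτ i a)).add
    (memLp_primitive_right (g := fun σ s => ψ i σ s a) (h.mem i a t)))
  filter_upwards [ae_rect_mem] with p hp
  exact ((h.isPrim hτ i hp.1.1.le a).eq p.2 (Set.Ioc_subset_Icc_self hp.2)).symm

lemma memLp_gainOp (h : IsHistory τ xh φ ψ) (hτ : ∀ i, 0 < τ i) {𝒦 : ControlGains k n m}
    (hK : ∀ i a b, ContinuousOn (fun s => 𝒦.K₂ i s a b) (Set.Icc (-τ i) 0)) (a : Fin m) :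
    MemLp (fun σ => gainOp τ 𝒦 (xh σ) (fun i => φ i σ) a) 2 (volume.restrict (Set.Ioc 0 t)) := by
  have h2 : ∀ i, MemLp (fun σ => vint (-τ i) 0 (fun s => 𝒦.K₂ i s *ᵥ φ i σ s) a) 2
      (volume.restrict (Set.Ioc 0 t)) := fun i =>
    memLp_intervalIntegral (by linarith [hτ i]) (f := fun σ s => (𝒦.K₂ i s *ᵥ φ i σ s) a)
      (memLp_mulVec_snd (hK i) (h.memLp hτ i) a)
  exact ((memLp_mulVec 𝒦.K₀ h.memLp_present a).add
    (memLp_sum_apply fun i => memLp_mulVec (𝒦.K₁ i) (h.memLp_delayed hτ i) a)).add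
    (memLp_sum_apply h2)

end IsHistory

lemma control_eq_gainOp {k n m : ℕ} {τ : Fin (k + 1) → ℝ} (hτ : ∀ i, 0 < τ i)
    {𝒦 : ControlGains k n m}
    (hK : ∀ i a b, ContinuousOn (fun s => 𝒦.K₂ i s a b) (Set.Icc (-τ i) 0))
    {xh : ℝ → Fin n → ℝ} {φ : Fin (k + 1) → ℝ → ℝ → Fin n → ℝ} {t : ℝ}
    (hφ : ∀ i, ContinuousOn (φ i t) (Set.Icc (-τ i) 0)) :
    control τ 𝒦 xh φ t = gainOp τ 𝒦 (xh t) (fun i => φ i t) := by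
  simp only [control, gainOp]
  congr 1
  refine Finset.sum_congr rfl fun i _ => ?_
  have hle : -τ i ≤ 0 := by linarith [hτ i]
  exact intervalIntegral_eq_vint (intervalIntegrable_of_continuousOn hle
    (continuousOn_mulVec (hK i) (hφ i)))

lemma gainOp_add {k n m : ℕ} {τ : Fin (k + 1) → ℝ} (hτ : ∀ i, 0 < τ i)
    {𝒦 : ControlGains k n m}
    (hK : ∀ i a b, ContinuousOn (fun s => 𝒦.K₂ i s a b) (Set.Icc (-τ i) 0))
    {x₀ y₀ : Fin n → ℝ} {x y : Fin (k + 1) → ℝ → Fin n → ℝ}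
    (hx : ∀ i, ContinuousOn (x i) (Set.Icc (-τ i) 0))
    (hy : ∀ i, ContinuousOn (y i) (Set.Icc (-τ i) 0)) :
    gainOp τ 𝒦 (x₀ + y₀) (fun i s => x i s + y i s) = gainOp τ 𝒦 x₀ x + gainOp τ 𝒦 y₀ y := by
  have hle : ∀ i, -τ i ≤ 0 := fun i => by linarith [hτ i]
  simp only [gainOp, Matrix.mulVec_add]
  have e : ∀ i, vint (-τ i) 0 (fun s => 𝒦.K₂ i s *ᵥ x i s + 𝒦.K₂ i s *ᵥ y i s)
      = vint (-τ i) 0 (fun s => 𝒦.K₂ i s *ᵥ x i s) + vint (-τ i) 0 fun s => 𝒦.K₂ i s *ᵥ y i s :=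
    fun i => vint_add
      (intervalIntegrable_of_continuousOn (hle i) (continuousOn_mulVec (hK i) (hx i)))
      (intervalIntegrable_of_continuousOn (hle i) (continuousOn_mulVec (hK i) (hy i)))
  simp only [e, Finset.sum_add_distrib]
  abel

/-! ### Regularity of closed-loop trajectories -/

namespace ClosedLoop

variable {k n m q r p p₁ : ℕ} {sys : DelaySystem k n m q r p p₁} {𝒦 : ControlGains k n m}
  {𝓛 : EstimGains k n q} {w : ℝ → Fin r → ℝ} {x xh : ℝ → Fin n → ℝ}
  {φ : Fin (k + 1) → ℝ → ℝ → Fin n → ℝ} {z : ℝ → Fin p → ℝ} {ze : ℝ → Fin p₁ → ℝ}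

/-- Passes to components and from closed to half-open intervals, which differ by null sets. -/
lemma exists_isHistory (S : ClosedLoop sys 𝒦 𝓛 w x xh φ z ze) :
    ∃ ψ : Fin (k + 1) → ℝ → ℝ → Fin n → ℝ, IsHistory sys.τ xh φ ψ ∧
      ∀ i t, 0 ≤ t → ∀ᵐ s ∂(volume.restrict (Set.Ioc (-sys.τ i) 0)),
        φ i t s = ∫ σ in (0 : ℝ)..t,
          (ψ i σ s + injectHistory sys.τ 𝓛 (sys.C₂ *ᵥ xh σ - sys.C₂ *ᵥ x σ)
            (fun j s' => sys.C₂ *ᵥ φ j σ s' - sys.C₂ *ᵥ x (σ + s')) i s) := by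
  obtain ⟨ψ, hψ⟩ := S.φ_eq
  have hint : ∀ i t, 0 ≤ t → ∀ a, IntervalIntegrable (fun s => ψ i t s a) volume (-sys.τ i) 0 := by
    intro i t ht a
    rw [intervalIntegrable_iff_integrableOn_Icc_of_le (by linarith [sys.τ_pos i])]
    exact (((hψ i).2.1 t ht).1.eval a).integrable (by norm_num)
  refine ⟨ψ, ⟨S.xh_cont, fun i a t => ?_, hint, fun i t ht s hs a => ?_⟩, fun i t ht => ?_⟩
  · rcases le_total 0 t with ht | ht
    · have h1 := ((hψ i).1 t ht).eval a
      refine h1.mono_measure ?_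
      rw [rect, Measure.prod_restrict, ← Measure.volume_eq_prod]
      exact Measure.restrict_mono
        (Set.prod_mono Set.Ioc_subset_Icc_self Set.Ioc_subset_Icc_self) le_rfl
    · have : rect t (-sys.τ i) 0 = 0 := by
        rw [rect, Set.Ioc_eq_empty (not_lt.2 ht), Measure.restrict_empty, Measure.zero_prod]
      rw [this]
      exact memLp_measure_zero
  · rw [((hψ i).2.1 t ht).2 s hs, intervalIntegral_eq_vint fun b =>
      (hint i t ht b).mono_set (by
        rw [Set.uIcc_of_le hs.2, Set.uIcc_of_le (by linarith [sys.τ_pos i])]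
        exact Set.Icc_subset_Icc_left hs.1)]
    rfl
  · exact ae_restrict_of_ae_restrict_of_subset Set.Ioc_subset_Icc_self ((hψ i).2.2 t ht)

/-- The right-hand side of the plant equation, extended by zero to `t ≤ 0`. -/
def plantRate (sys : DelaySystem k n m q r p p₁) (𝒦 : ControlGains k n m) (w : ℝ → Fin r → ℝ)
    (x xh : ℝ → Fin n → ℝ) (φ : Fin (k + 1) → ℝ → ℝ → Fin n → ℝ) (σ : ℝ) : Fin n → ℝ :=
  Set.indicator (Set.Ioi 0) (fun σ => sys.A₀ *ᵥ x σ + ∑ i, sys.A i *ᵥ x (σ - sys.τ i)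
    + sys.B₁ *ᵥ w σ + sys.B₂ *ᵥ control sys.τ 𝒦 xh φ σ) σ

variable {ψ : Fin (k + 1) → ℝ → ℝ → Fin n → ℝ}

lemma memLp_plantRate (S : ClosedLoop sys 𝒦 𝓛 w x xh φ z ze) (hψ : IsHistory sys.τ xh φ ψ)
    (hK : ∀ i a b, ContinuousOn (fun s => 𝒦.K₂ i s a b) (Set.Icc (-sys.τ i) 0))
    (hw : MemLp w 2 (volume.restrict (Set.Ici (0 : ℝ)))) (c t : ℝ) (a : Fin n) :
    MemLp (fun σ => plantRate sys 𝒦 w x xh φ σ a) 2 (volume.restrict (Set.Ioc c t)) := by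
  have e : (fun σ => plantRate sys 𝒦 w x xh φ σ a) = Set.indicator (Set.Ioi 0)
      (fun σ => (sys.A₀ *ᵥ x σ + ∑ i, sys.A i *ᵥ x (σ - sys.τ i)
        + sys.B₁ *ᵥ w σ + sys.B₂ *ᵥ control sys.τ 𝒦 xh φ σ) a) := by
    funext σ
    simp only [plantRate, Set.indicator]
    split_ifs <;> rfl
  rw [e, memLp_indicator_iff_restrict measurableSet_Ioi, Measure.restrict_restrict measurableSet_Ioi]
  have hx : ∀ (c : ℝ) b, MemLp (fun σ => x (σ - c) b) 2 (volume.restrict (Set.Ioc 0 t)) :=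
    fun c b => memLp_of_continuousOn
      ((continuous_pi_iff.1 S.x_cont b).comp (continuous_id.sub continuous_const)).continuousOn
  have hx₀ : ∀ b, MemLp (fun σ => x σ b) 2 (volume.restrict (Set.Ioc 0 t)) := fun b =>
    memLp_of_continuousOn (continuous_pi_iff.1 S.x_cont b).continuousOn
  have hw' : ∀ b, MemLp (fun σ => w σ b) 2 (volume.restrict (Set.Ioc 0 t)) := fun b =>
    (hw.eval b).mono_measure
      (Measure.restrict_mono (fun s hs => hs.1.le) le_rfl)
  have hu : ∀ b, MemLp (fun σ => control sys.τ 𝒦 xh φ σ b) 2 (volume.restrict (Set.Ioc 0 t)) := by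
    intro b
    refine MemLp.ae_eq ?_ (hψ.memLp_gainOp sys.τ_pos hK b)
    filter_upwards [ae_restrict_mem measurableSet_Ioc] with σ hσ
    rw [control_eq_gainOp sys.τ_pos hK fun i => hψ.continuousOn sys.τ_pos hσ.1.le i]
  have key := (((memLp_mulVec sys.A₀ hx₀ a).add
    (memLp_sum_apply fun i => memLp_mulVec (sys.A i) (hx (sys.τ i)) a)).add
    (memLp_mulVec sys.B₁ hw' a)).add (memLp_mulVec sys.B₂ hu a)
  have hsub : Set.Ioi 0 ∩ Set.Ioc c t ⊆ Set.Ioc 0 t := fun s hs => ⟨hs.1, hs.2.2⟩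
  exact key.mono_measure (Measure.restrict_mono hsub le_rfl)

lemma intervalIntegrable_plantRate (S : ClosedLoop sys 𝒦 𝓛 w x xh φ z ze)
    (hψ : IsHistory sys.τ xh φ ψ)
    (hK : ∀ i a b, ContinuousOn (fun s => 𝒦.K₂ i s a b) (Set.Icc (-sys.τ i) 0))
    (hw : MemLp w 2 (volume.restrict (Set.Ici (0 : ℝ)))) (a : Fin n) (c d : ℝ) :
    IntervalIntegrable (fun σ => plantRate sys 𝒦 w x xh φ σ a) volume c d :=
  ⟨(S.memLp_plantRate hψ hK hw c d a).integrable (by norm_num),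
    (S.memLp_plantRate hψ hK hw d c a).integrable (by norm_num)⟩

/-- As `x` vanishes for `t ≤ 0`, extending its rate by zero makes `x` a primitive on the whole line.
Its histories, in `s` as well as in time, are then translates of a single primitive. -/
lemma x_eq_integral (S : ClosedLoop sys 𝒦 𝓛 w x xh φ z ze) (hψ : IsHistory sys.τ xh φ ψ)
    (hK : ∀ i a b, ContinuousOn (fun s => 𝒦.K₂ i s a b) (Set.Icc (-sys.τ i) 0))
    (hw : MemLp w 2 (volume.restrict (Set.Ici (0 : ℝ)))) (a : Fin n) (t : ℝ) :
    x t a = ∫ σ in (0 : ℝ)..t, plantRate sys 𝒦 w x xh φ σ a := by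
  rcases le_total 0 t with ht | ht
  · have e : ∫ σ in (0 : ℝ)..t,
        (sys.A₀ *ᵥ x σ + ∑ i, sys.A i *ᵥ x (σ - sys.τ i) + sys.B₁ *ᵥ w σ
          + sys.B₂ *ᵥ control sys.τ 𝒦 xh φ σ)
        = ∫ σ in (0 : ℝ)..t, plantRate sys 𝒦 w x xh φ σ := by
      rw [intervalIntegral.integral_of_le ht, intervalIntegral.integral_of_le ht]
      refine setIntegral_congr_fun measurableSet_Ioc fun σ hσ => ?_
      simp only [plantRate, Set.indicator_of_mem (Set.mem_Ioi.2 hσ.1)]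
    rw [S.x_eq t ht, e, intervalIntegral_eq_vint fun b =>
      S.intervalIntegrable_plantRate hψ hK hw b 0 t]
    rfl
  · rw [S.x_zero t ht, intervalIntegral.integral_symm, intervalIntegral.integral_of_le ht,
      setIntegral_eq_zero_of_forall_eq_zero]
    · simp
    · intro σ hσ
      simp only [plantRate, Set.indicator_of_notMem (fun h : σ ∈ Set.Ioi 0 => not_lt.2 hσ.2 h),
        Pi.zero_apply]

end ClosedLoop

/-! ### The history of the plant state and the error dynamics -/

namespace ClosedLoop

variable {k n m q r p p₁ d : ℕ} {sys : DelaySystem k n m q r p p₁} {𝒦 : ControlGains k n m}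
  {𝓛 : EstimGains k n q} {w : ℝ → Fin r → ℝ} {x xh : ℝ → Fin n → ℝ}
  {φ ψ : Fin (k + 1) → ℝ → ℝ → Fin n → ℝ} {z : ℝ → Fin p → ℝ} {ze : ℝ → Fin p₁ → ℝ}

/-- The history of `x`. -/
def hist (x : ℝ → Fin n → ℝ) (_ : Fin (k + 1)) (σ s : ℝ) : Fin n → ℝ := x (σ + s)

/-- The estimation error of the history. -/
def err (x : ℝ → Fin n → ℝ) (φ : Fin (k + 1) → ℝ → ℝ → Fin n → ℝ) (i : Fin (k + 1)) (σ s : ℝ) :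
    Fin n → ℝ := φ i σ s - x (σ + s)

lemma isPrim_hist (S : ClosedLoop sys 𝒦 𝓛 w x xh φ z ze) (hψ : IsHistory sys.τ xh φ ψ)
    (hK : ∀ i a b, ContinuousOn (fun s => 𝒦.K₂ i s a b) (Set.Icc (-sys.τ i) 0))
    (hw : MemLp w 2 (volume.restrict (Set.Ici (0 : ℝ)))) (i : Fin (k + 1)) (σ : ℝ) (a : Fin n) :
    IsPrim (fun s => hist x i σ s a) (fun s => hist (plantRate sys 𝒦 w x xh φ) i σ s a)
      (-sys.τ i) 0 :=
  isPrim_translate (u := fun s => x s a) (f := fun s => plantRate sys 𝒦 w x xh φ s a)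
    (S.intervalIntegrable_plantRate hψ hK hw a) (S.x_eq_integral hψ hK hw a) σ
    (by linarith [sys.τ_pos i])

lemma continuousOn_hist (S : ClosedLoop sys 𝒦 𝓛 w x xh φ z ze) (i : Fin (k + 1)) (σ : ℝ)
    (I : Set ℝ) : ContinuousOn (hist x i σ) I :=
  (S.x_cont.comp (continuous_const.add continuous_id)).continuousOn

lemma memLp_hist_plantRate (S : ClosedLoop sys 𝒦 𝓛 w x xh φ z ze) (hψ : IsHistory sys.τ xh φ ψ)
    (hK : ∀ i a b, ContinuousOn (fun s => 𝒦.K₂ i s a b) (Set.Icc (-sys.τ i) 0))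
    (hw : MemLp w 2 (volume.restrict (Set.Ici (0 : ℝ)))) (i : Fin (k + 1)) (a : Fin n) (t : ℝ) :
    MemLp (fun p : ℝ × ℝ => hist (plantRate sys 𝒦 w x xh φ) i p.1 p.2 a) 2
      (rect t (-sys.τ i) 0) :=
  memLp_translate (f := fun s => plantRate sys 𝒦 w x xh φ s a) le_rfl
    (S.memLp_plantRate hψ hK hw _ _ a)

/-- The time derivative of the history is the same translated rate as its space derivative in
`isPrim_hist`: the history solves the transport equation. -/
lemma hist_eq_integral (S : ClosedLoop sys 𝒦 𝓛 w x xh φ z ze) (hψ : IsHistory sys.τ xh φ ψ)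
    (hK : ∀ i a b, ContinuousOn (fun s => 𝒦.K₂ i s a b) (Set.Icc (-sys.τ i) 0))
    (hw : MemLp w 2 (volume.restrict (Set.Ici (0 : ℝ)))) (i : Fin (k + 1)) (a : Fin n) (t : ℝ)
    {s : ℝ} (hs : s ≤ 0) :
    hist x i t s a = ∫ σ in (0 : ℝ)..t, hist (plantRate sys 𝒦 w x xh φ) i σ s a :=
  translate_eq_integral (u := fun s => x s a) (f := fun s => plantRate sys 𝒦 w x xh φ s a)
    (S.intervalIntegrable_plantRate hψ hK hw a) (S.x_eq_integral hψ hK hw a)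
    (fun σ hσ => by rw [S.x_zero σ hσ]; rfl) t hs

lemma isPrim_x (S : ClosedLoop sys 𝒦 𝓛 w x xh φ z ze) (hψ : IsHistory sys.τ xh φ ψ)
    (hK : ∀ i a b, ContinuousOn (fun s => 𝒦.K₂ i s a b) (Set.Icc (-sys.τ i) 0))
    (hw : MemLp w 2 (volume.restrict (Set.Ici (0 : ℝ)))) (a : Fin n) {t : ℝ} (ht : 0 ≤ t) :
    IsPrim (fun σ => x σ a) (fun σ => plantRate sys 𝒦 w x xh φ σ a) 0 t :=
  ⟨ht, S.intervalIntegrable_plantRate hψ hK hw a 0 t, fun σ _ => by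
    rw [S.x_eq_integral hψ hK hw a σ, S.x_zero 0 le_rfl, Pi.zero_apply, zero_add]⟩

/-- The control acts on the estimate, which is the true state plus the error. By linearity it is the
nominal state feedback plus `𝒦 e`, the perturbation that the coupling condition controls. -/
lemma plantRate_eq (S : ClosedLoop sys 𝒦 𝓛 w x xh φ z ze) (hψ : IsHistory sys.τ xh φ ψ)
    (hK : ∀ i a b, ContinuousOn (fun s => 𝒦.K₂ i s a b) (Set.Icc (-sys.τ i) 0)) {σ : ℝ}
    (hσ : 0 < σ) :
    plantRate sys 𝒦 w x xh φ σ = sys.A₀ *ᵥ x σ + ∑ i, sys.A i *ᵥ hist x i σ (-sys.τ i)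
      + sys.B₁ *ᵥ w σ + sys.B₂ *ᵥ (gainOp sys.τ 𝒦 (x σ) (fun i => hist x i σ)
        + gainOp sys.τ 𝒦 (xh σ - x σ) fun i => err x φ i σ) := by
  have hφ := fun i => hψ.continuousOn sys.τ_pos hσ.le i
  have hx := fun i => S.continuousOn_hist i σ (Set.Icc (-sys.τ i) 0)
  rw [plantRate, Set.indicator_of_mem (Set.mem_Ioi.2 hσ), control_eq_gainOp sys.τ_pos hK hφ,
    ← gainOp_add (y := fun i => err x φ i σ) sys.τ_pos hK hx fun i => (hφ i).sub (hx i)]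
  simp only [err, hist, add_sub_cancel, ← sub_eq_add_neg]

lemma isPrim_err (S : ClosedLoop sys 𝒦 𝓛 w x xh φ z ze) (hψ : IsHistory sys.τ xh φ ψ)
    (hK : ∀ i a b, ContinuousOn (fun s => 𝒦.K₂ i s a b) (Set.Icc (-sys.τ i) 0))
    (hw : MemLp w 2 (volume.restrict (Set.Ici (0 : ℝ)))) (i : Fin (k + 1)) {σ : ℝ} (hσ : 0 ≤ σ)
    (a : Fin n) :
    IsPrim (fun s => err x φ i σ s a)
      (fun s => (ψ i σ s - hist (plantRate sys 𝒦 w x xh φ) i σ s) a) (-sys.τ i) 0 :=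
  (hψ.isPrim sys.τ_pos i hσ a).sub (S.isPrim_hist hψ hK hw i σ a)

lemma continuousOn_err (S : ClosedLoop sys 𝒦 𝓛 w x xh φ z ze) (hψ : IsHistory sys.τ xh φ ψ)
    {σ : ℝ} (hσ : 0 ≤ σ) (i : Fin (k + 1)) : ContinuousOn (err x φ i σ) (Set.Icc (-sys.τ i) 0) :=
  (hψ.continuousOn sys.τ_pos hσ i).sub (S.continuousOn_hist i σ _)

lemma memLp_err₀ (S : ClosedLoop sys 𝒦 𝓛 w x xh φ z ze) (hψ : IsHistory sys.τ xh φ ψ) (t : ℝ)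
    (a : Fin n) : MemLp (fun σ => (xh σ - x σ) a) 2 (volume.restrict (Set.Ioc 0 t)) :=
  (hψ.memLp_present a).sub
    (memLp_of_continuousOn (continuous_pi_iff.1 S.x_cont a).continuousOn)

lemma memLp_hist_delayed (S : ClosedLoop sys 𝒦 𝓛 w x xh φ z ze) (t : ℝ) (i : Fin (k + 1))
    (a : Fin n) : MemLp (fun σ => hist x i σ (-sys.τ i) a) 2 (volume.restrict (Set.Ioc 0 t)) :=
  memLp_of_continuousOn
    ((continuous_pi_iff.1 S.x_cont a).comp (continuous_id.add continuous_const)).continuousOn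

lemma memLp_err_delayed (S : ClosedLoop sys 𝒦 𝓛 w x xh φ z ze) (hψ : IsHistory sys.τ xh φ ψ)
    (t : ℝ) (i : Fin (k + 1)) (a : Fin n) :
    MemLp (fun σ => err x φ i σ (-sys.τ i) a) 2 (volume.restrict (Set.Ioc 0 t)) :=
  (hψ.memLp_delayed sys.τ_pos i a).sub (S.memLp_hist_delayed t i a)

lemma memLp_err (S : ClosedLoop sys 𝒦 𝓛 w x xh φ z ze) (hψ : IsHistory sys.τ xh φ ψ)
    (t : ℝ) (i : Fin (k + 1)) (a : Fin n) :
    MemLp (fun p : ℝ × ℝ => err x φ i p.1 p.2 a) 2 (rect t (-sys.τ i) 0) := by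
  refine (hψ.memLp sys.τ_pos i a).sub ?_
  exact memLp_translate (f := fun s => x s a) le_rfl
    (memLp_of_continuousOn (continuous_pi_iff.1 S.x_cont a).continuousOn)

/-- Measured error of the present state. -/
def meas₀ (sys : DelaySystem k n m q r p p₁) (x xh : ℝ → Fin n → ℝ) (σ : ℝ) : Fin q → ℝ :=
  sys.C₂ *ᵥ (xh σ - x σ)

/-- Measured error of the history. -/
def meas (sys : DelaySystem k n m q r p p₁) (x : ℝ → Fin n → ℝ)
    (φ : Fin (k + 1) → ℝ → ℝ → Fin n → ℝ) (i : Fin (k + 1)) (σ s : ℝ) : Fin q → ℝ :=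
  sys.C₂ *ᵥ err x φ i σ s

section Estimator

variable {Θ : PolyParams k n} {ε : ℝ} {𝒵 : EstimVars k n q}

lemma continuousOn_meas (S : ClosedLoop sys 𝒦 𝓛 w x xh φ z ze) (hψ : IsHistory sys.τ xh φ ψ)
    {σ : ℝ} (hσ : 0 ≤ σ) (i : Fin (k + 1)) :
    ContinuousOn (meas sys x φ i σ) (Set.Icc (-sys.τ i) 0) :=
  continuousOn_mulVec (M := fun _ => sys.C₂) (fun _ _ => continuousOn_const)
    (S.continuousOn_err hψ hσ i)

lemma memLp_injectPresent (S : ClosedLoop sys 𝒦 𝓛 w x xh φ z ze) (hψ : IsHistory sys.τ xh φ ψ)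
    (hε : 0 < ε) (hΘ : Θ.eval.shift (-ε • 1) (-ε) ∈ Xi d sys.τ) (t : ℝ) (a : Fin n) :
    MemLp (fun σ => injectPresent sys.τ (mapLo sys.τ Θ 𝒵) (meas₀ sys x xh σ)
      (fun i => meas sys x φ i σ) a) 2 (volume.restrict (Set.Ioc 0 t)) := by
  have h₀ : ∀ a, MemLp (fun σ => meas₀ sys x xh σ a) 2 (volume.restrict (Set.Ioc 0 t)) :=
    memLp_mulVec _ (S.memLp_err₀ hψ t)
  have h₁ : ∀ i a, MemLp (fun σ => meas sys x φ i σ (-sys.τ i) a) 2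
      (volume.restrict (Set.Ioc 0 t)) := fun i => memLp_mulVec _ (S.memLp_err_delayed hψ t i)
  have h₂ : ∀ i a, MemLp (fun p : ℝ × ℝ => meas sys x φ i p.1 p.2 a) 2
      (rect t (-sys.τ i) 0) := fun i => memLp_mulVec _ (S.memLp_err hψ t i)
  refine MemLp.ae_eq ?_ ((Θ.invSep_regular sys.τ_pos hε hΘ).memLp_op₀
    (u := fun i σ => estOp₁ sys.τ 𝒵 (meas₀ sys x xh σ) (fun i => meas sys x φ i σ) i)
    (memLp_estOp₀ sys.τ_pos 𝒵 h₀ h₁ h₂) (memLp_estOp₁ sys.τ_pos 𝒵 h₀ h₁ h₂) a)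
  filter_upwards [ae_restrict_mem measurableSet_Ioc] with σ hσ
  rw [injectPresent_mapLo sys.τ_pos hε hΘ 𝒵 _ (S.continuousOn_meas hψ hσ.1.le)]

lemma memLp_injectHistory (S : ClosedLoop sys 𝒦 𝓛 w x xh φ z ze) (hψ : IsHistory sys.τ xh φ ψ)
    (hε : 0 < ε) (hΘ : Θ.eval.shift (-ε • 1) (-ε) ∈ Xi d sys.τ) (t : ℝ) (i : Fin (k + 1))
    (a : Fin n) :
    MemLp (fun p : ℝ × ℝ => injectHistory sys.τ (mapLo sys.τ Θ 𝒵) (meas₀ sys x xh p.1)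
      (fun i => meas sys x φ i p.1) i p.2 a) 2 (rect t (-sys.τ i) 0) := by
  have h₀ : ∀ a, MemLp (fun σ => meas₀ sys x xh σ a) 2 (volume.restrict (Set.Ioc 0 t)) :=
    memLp_mulVec _ (S.memLp_err₀ hψ t)
  have h₁ : ∀ i a, MemLp (fun σ => meas sys x φ i σ (-sys.τ i) a) 2
      (volume.restrict (Set.Ioc 0 t)) := fun i => memLp_mulVec _ (S.memLp_err_delayed hψ t i)
  have h₂ : ∀ i a, MemLp (fun p : ℝ × ℝ => meas sys x φ i p.1 p.2 a) 2
      (rect t (-sys.τ i) 0) := fun i => memLp_mulVec _ (S.memLp_err hψ t i)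
  refine MemLp.ae_eq ?_ ((Θ.invSep_regular sys.τ_pos hε hΘ).memLp_op₁
    (u := fun i σ => estOp₁ sys.τ 𝒵 (meas₀ sys x xh σ) (fun i => meas sys x φ i σ) i)
    (memLp_estOp₀ sys.τ_pos 𝒵 h₀ h₁ h₂) (memLp_estOp₁ sys.τ_pos 𝒵 h₀ h₁ h₂) i a)
  filter_upwards [ae_rect_mem] with p hp
  rw [injectHistory_mapLo sys.τ_pos hε hΘ 𝒵 _ (S.continuousOn_meas hψ hp.1.1.le) i
    (Set.Ioc_subset_Icc_self hp.2)]

/-- The right-hand side of the equation for the present estimation error. -/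
def errRate₀ (sys : DelaySystem k n m q r p p₁) (𝓛 : EstimGains k n q) (w : ℝ → Fin r → ℝ)
    (x xh : ℝ → Fin n → ℝ) (φ : Fin (k + 1) → ℝ → ℝ → Fin n → ℝ) (σ : ℝ) : Fin n → ℝ :=
  sys.A₀ *ᵥ (xh σ - x σ) + ∑ i, sys.A i *ᵥ err x φ i σ (-sys.τ i) - sys.B₁ *ᵥ w σ
    + injectPresent sys.τ 𝓛 (meas₀ sys x xh σ) (fun i => meas sys x φ i σ)

/-- The right-hand side of the equation for the estimation error of the history. -/
def errRate (sys : DelaySystem k n m q r p p₁) (𝒦 : ControlGains k n m) (𝓛 : EstimGains k n q)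
    (w : ℝ → Fin r → ℝ) (x xh : ℝ → Fin n → ℝ) (φ ψ : Fin (k + 1) → ℝ → ℝ → Fin n → ℝ)
    (i : Fin (k + 1)) (σ s : ℝ) : Fin n → ℝ :=
  ψ i σ s - hist (plantRate sys 𝒦 w x xh φ) i σ s
    + injectHistory sys.τ 𝓛 (meas₀ sys x xh σ) (fun i => meas sys x φ i σ) i s

lemma memLp_w {t : ℝ} (hw : MemLp w 2 (volume.restrict (Set.Ici (0 : ℝ)))) (a : Fin r) :
    MemLp (fun σ => w σ a) 2 (volume.restrict (Set.Ioc 0 t)) :=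
  (hw.eval a).mono_measure (Measure.restrict_mono (fun _ hs => hs.1.le) le_rfl)

/-- In the difference of the estimator and plant equations `B₂ u` cancels, while `B₁ w`, absent from
the estimator, appears with a minus sign. -/
lemma isPrim_err₀ (S : ClosedLoop sys 𝒦 (mapLo sys.τ Θ 𝒵) w x xh φ z ze)
    (hψ : IsHistory sys.τ xh φ ψ)
    (hK : ∀ i a b, ContinuousOn (fun s => 𝒦.K₂ i s a b) (Set.Icc (-sys.τ i) 0))
    (hw : MemLp w 2 (volume.restrict (Set.Ici (0 : ℝ))))
    (hε : 0 < ε) (hΘ : Θ.eval.shift (-ε • 1) (-ε) ∈ Xi d sys.τ) {t : ℝ} (ht : 0 ≤ t)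
    (a : Fin n) :
    IsPrim (fun σ => (xh σ - x σ) a)
      (fun σ => errRate₀ sys (mapLo sys.τ Θ 𝒵) w x xh φ σ a) 0 t := by
  set F := plantRate sys 𝒦 w x xh φ with hF
  set v := errRate₀ sys (mapLo sys.τ Θ 𝒵) w x xh φ with hv
  have hvm : ∀ t a, MemLp (fun σ => v σ a) 2 (volume.restrict (Set.Ioc 0 t)) := fun t a =>
    (((memLp_mulVec sys.A₀ (S.memLp_err₀ hψ t) a).add
      (memLp_sum_apply fun i => memLp_mulVec (sys.A i) (S.memLp_err_delayed hψ t i) a)).sub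
      (memLp_mulVec sys.B₁ (memLp_w hw) a)).add (S.memLp_injectPresent hψ hε hΘ t a)
  have hvi : ∀ t, 0 ≤ t → ∀ a, IntervalIntegrable (fun σ => v σ a) volume 0 t := fun t ht a => by
    rw [intervalIntegrable_iff_integrableOn_Ioc_of_le ht]
    exact (hvm t a).integrable (by norm_num)
  have hFi := S.intervalIntegrable_plantRate hψ hK hw
  -- The rate of the estimate is the error rate `v` plus the plant rate `F`; each is integrable on
  -- its own, so the integral splits.
  have hxh : ∀ t, 0 ≤ t → xh t a = (∫ σ in (0 : ℝ)..t, v σ a) + x t a := by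
    intro t ht
    have e : ∫ σ in (0 : ℝ)..t,
        (sys.A₀ *ᵥ xh σ + ∑ i, sys.A i *ᵥ φ i σ (-sys.τ i)
          + sys.B₂ *ᵥ control sys.τ 𝒦 xh φ σ
          + injectPresent sys.τ (mapLo sys.τ Θ 𝒵) (sys.C₂ *ᵥ xh σ - sys.C₂ *ᵥ x σ)
              (fun j s => sys.C₂ *ᵥ φ j σ s - sys.C₂ *ᵥ x (σ + s)))
        = ∫ σ in (0 : ℝ)..t, (v σ + F σ) := by
      rw [intervalIntegral.integral_of_le ht, intervalIntegral.integral_of_le ht]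
      refine setIntegral_congr_fun measurableSet_Ioc fun σ hσ => ?_
      simp only [hF, plantRate, Set.indicator_of_mem (Set.mem_Ioi.2 hσ.1), hv, errRate₀]
      unfold meas₀ meas err
      simp only [Matrix.mulVec_sub, Finset.sum_sub_distrib, ← sub_eq_add_neg]
      abel
    rw [S.xh_eq t ht, e, intervalIntegral_eq_vint (f := fun σ => v σ + F σ) fun b =>
      (hvi t ht b).add (hFi b 0 t)]
    change ∫ σ in (0 : ℝ)..t, (v σ a + F σ a) = _
    rw [intervalIntegral.integral_add (hvi t ht a) (hFi a 0 t), S.x_eq_integral hψ hK hw a t]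
  refine ⟨ht, hvi t ht a, fun σ hσ => ?_⟩
  have h0 := hxh 0 le_rfl
  rw [intervalIntegral.integral_same, zero_add] at h0
  simp only [Pi.sub_apply, h0, hxh σ hσ.1]
  ring

lemma memLp_errRate (S : ClosedLoop sys 𝒦 (mapLo sys.τ Θ 𝒵) w x xh φ z ze)
    (hψ : IsHistory sys.τ xh φ ψ)
    (hK : ∀ i a b, ContinuousOn (fun s => 𝒦.K₂ i s a b) (Set.Icc (-sys.τ i) 0))
    (hw : MemLp w 2 (volume.restrict (Set.Ici (0 : ℝ))))
    (hε : 0 < ε) (hΘ : Θ.eval.shift (-ε • 1) (-ε) ∈ Xi d sys.τ) (t : ℝ) (i : Fin (k + 1))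
    (a : Fin n) :
    MemLp (fun p : ℝ × ℝ => errRate sys 𝒦 (mapLo sys.τ Θ 𝒵) w x xh φ ψ i p.1 p.2 a) 2
      (rect t (-sys.τ i) 0) :=
  ((hψ.mem i a t).sub (S.memLp_hist_plantRate hψ hK hw i a t)).add
    (S.memLp_injectHistory hψ hε hΘ t i a)

/-- The true history satisfies the transport equation, so subtracting it from the estimated one
replaces the space derivative `ψ` by that of the error and leaves the injected correction unchanged.
-/
lemma err_eq_integral (S : ClosedLoop sys 𝒦 (mapLo sys.τ Θ 𝒵) w x xh φ z ze)
    (hψ : IsHistory sys.τ xh φ ψ)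
    (hφ : ∀ i t, 0 ≤ t → ∀ᵐ s ∂(volume.restrict (Set.Ioc (-sys.τ i) 0)),
        φ i t s = ∫ σ in (0 : ℝ)..t,
          (ψ i σ s + injectHistory sys.τ (mapLo sys.τ Θ 𝒵) (sys.C₂ *ᵥ xh σ - sys.C₂ *ᵥ x σ)
            (fun j s' => sys.C₂ *ᵥ φ j σ s' - sys.C₂ *ᵥ x (σ + s')) i s))
    (hK : ∀ i a b, ContinuousOn (fun s => 𝒦.K₂ i s a b) (Set.Icc (-sys.τ i) 0))
    (hw : MemLp w 2 (volume.restrict (Set.Ici (0 : ℝ))))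
    (hε : 0 < ε) (hΘ : Θ.eval.shift (-ε • 1) (-ε) ∈ Xi d sys.τ) {t : ℝ} (ht : 0 ≤ t)
    (i : Fin (k + 1)) :
    ∀ᵐ s ∂(volume.restrict (Set.Ioc (-sys.τ i) 0)), ∀ a, err x φ i t s a
      = ∫ σ in (0 : ℝ)..t, errRate sys 𝒦 (mapLo sys.τ Θ 𝒵) w x xh φ ψ i σ s a := by
  have J : ∀ {f : ℝ → ℝ → Fin n → ℝ},
      (∀ a, MemLp (fun p : ℝ × ℝ => f p.1 p.2 a) 2 (rect t (-sys.τ i) 0)) →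
      ∀ᵐ s ∂(volume.restrict (Set.Ioc (-sys.τ i) 0)), ∀ a,
        IntervalIntegrable (fun σ => f σ s a) volume 0 t := by
    intro f hf
    refine ae_all_iff.2 fun a => ?_
    filter_upwards [((hf a).integrable (by norm_num)).prod_left_ae] with s hs
    rw [intervalIntegrable_iff_integrableOn_Ioc_of_le ht]
    exact hs
  filter_upwards [hφ i t ht, J fun a => hψ.mem i a t,
    J (f := fun σ => injectHistory sys.τ (mapLo sys.τ Θ 𝒵) (meas₀ sys x xh σ)
      (fun i => meas sys x φ i σ) i) fun a => S.memLp_injectHistory hψ hε hΘ t i a,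
    J (f := hist (plantRate sys 𝒦 w x xh φ) i) fun a => S.memLp_hist_plantRate hψ hK hw i a t,
    ae_restrict_mem measurableSet_Ioc] with s h1 h2 h3 h4 hs a
  have e : φ i t s a = ∫ σ in (0 : ℝ)..t, (ψ i σ s a + injectHistory sys.τ (mapLo sys.τ Θ 𝒵)
      (meas₀ sys x xh σ) (fun i => meas sys x φ i σ) i s a) := by
    rw [h1]
    simp only [← Matrix.mulVec_sub]
    exact congrFun (intervalIntegral_eq_vint fun b => (h2 b).add (h3 b)) a
  have e' := S.hist_eq_integral hψ hK hw i a t hs.2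
  rw [err, Pi.sub_apply, e, show x (t + s) a = hist x i t s a from rfl, e',
    ← intervalIntegral.integral_sub ((h2 a).add (h3 a)) (h4 a)]
  refine intervalIntegral.integral_congr fun σ _ => ?_
  simp only [errRate, Pi.add_apply, Pi.sub_apply]
  ring

end Estimator

end ClosedLoop

/-! ### The `L₂` gains -/

section Norm

lemma enorm_toLp_sq {a : ℕ} (v : Fin a → ℝ) :
    ‖WithLp.toLp 2 v‖ₑ ^ (2 : ℝ) = ENNReal.ofReal (v ⬝ᵥ v) := by
  rw [← ofReal_norm, ENNReal.ofReal_rpow_of_nonneg (norm_nonneg _) (by norm_num),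
    Real.rpow_two, EuclideanSpace.norm_sq_eq]
  simp only [dotProduct, Real.norm_eq_abs, sq, abs_mul_abs_self]

lemma normL₂_eq {a : ℕ} (f : ℝ → Fin a → ℝ) :
    normL₂ f = (∫⁻ t in Set.Ioi (0 : ℝ), ENNReal.ofReal (f t ⬝ᵥ f t)) ^ (1 / 2 : ℝ) := by
  rw [normL₂, eLpNorm_eq_lintegral_rpow_enorm_toReal (by norm_num) (by norm_num),
    restrict_Ioi_eq_restrict_Ici]
  simp only [ENNReal.toReal_ofNat, enorm_toLp_sq]

lemma integrable_dot_self {a : ℕ} {μ : Measure ℝ} {f : ℝ → Fin a → ℝ}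
    (hf : ∀ i, MemLp (fun t => f t i) 2 μ) : Integrable (fun t => f t ⬝ᵥ f t) μ := by
  simp only [dotProduct]
  exact integrable_finsetSum _ fun i _ => (hf i).integrable_mul (hf i)

lemma dot_self_nonneg {a : ℕ} (v : Fin a → ℝ) : 0 ≤ v ⬝ᵥ v :=
  Finset.sum_nonneg fun i _ => mul_self_nonneg (v i)

/-- An `L₂` bound on all intervals `[0, t]` gives an `L₂` bound on `[0, ∞)`. -/
lemma normL₂_le_of_forall {a b : ℕ} {f f' : ℝ → Fin a → ℝ} {g : ℝ → Fin b → ℝ} {C : ℝ}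
    (hC : 0 ≤ C) (hff : ∀ᵐ t ∂(volume.restrict (Set.Ici (0 : ℝ))), f t = f' t)
    (hf : ∀ t i, MemLp (fun t => f' t i) 2 (volume.restrict (Set.Ioc 0 t)))
    (hg : ∀ t i, MemLp (fun t => g t i) 2 (volume.restrict (Set.Ioc 0 t)))
    (h : ∀ t, 0 ≤ t → ∫ s in (0 : ℝ)..t, f' s ⬝ᵥ f' s ≤ C * ∫ s in (0 : ℝ)..t, g s ⬝ᵥ g s) :
    normL₂ f ≤ ENNReal.ofReal (√C) * normL₂ g := by
  have hU : Set.Ioi (0 : ℝ) = ⋃ N : ℕ, Set.Ioc (0 : ℝ) N := by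
    ext s
    simp only [Set.mem_Ioi, Set.mem_iUnion, Set.mem_Ioc]
    exact ⟨fun hs => ⟨⌈s⌉₊, hs, Nat.le_ceil s⟩, fun ⟨_, hs⟩ => hs.1⟩
  have key : ∫⁻ t in Set.Ioi (0 : ℝ), ENNReal.ofReal (f t ⬝ᵥ f t)
      ≤ ENNReal.ofReal C * ∫⁻ t in Set.Ioi (0 : ℝ), ENNReal.ofReal (g t ⬝ᵥ g t) := by
    have e1 : ∫⁻ t in Set.Ioi (0 : ℝ), ENNReal.ofReal (f t ⬝ᵥ f t)
        = ∫⁻ t in Set.Ioi (0 : ℝ), ENNReal.ofReal (f' t ⬝ᵥ f' t) := by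
      rw [← restrict_Ioi_eq_restrict_Ici] at hff
      exact lintegral_congr_ae (hff.mono fun t ht => by simp only [ht])
    rw [e1]
    conv_lhs => rw [hU]
    -- The integral over the half line is the supremum of those over `(0, N]`, where the functions
    -- are square integrable and the hypothesis applies.
    rw [setLIntegral_iUnion_of_directed]
    · refine iSup_le fun N => ?_
      have hN : (0 : ℝ) ≤ N := N.cast_nonneg
      have h1 := h N hN
      rw [intervalIntegral.integral_of_le hN, intervalIntegral.integral_of_le hN] at h1
      rw [← ofReal_integral_eq_lintegral_ofReal (integrable_dot_self (hf N))
        (Filter.Eventually.of_forall fun t => dot_self_nonneg _)]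
      refine (ENNReal.ofReal_le_ofReal h1).trans ?_
      rw [ENNReal.ofReal_mul hC, ofReal_integral_eq_lintegral_ofReal (integrable_dot_self (hg N))
        (Filter.Eventually.of_forall fun t => dot_self_nonneg _)]
      exact mul_le_mul_right (lintegral_mono_set fun s hs => hs.1) _
    · exact Monotone.directed_le fun N M hNM => Set.Ioc_subset_Ioc_right (Nat.cast_le.2 hNM)
  rw [normL₂_eq, normL₂_eq]
  refine (ENNReal.rpow_le_rpow key (by norm_num)).trans ?_
  rw [ENNReal.mul_rpow_of_nonneg _ _ (by norm_num),
    ENNReal.ofReal_rpow_of_nonneg hC (by norm_num), ← Real.sqrt_eq_rpow]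

end Norm

/-! ### From dissipation inequalities to energy bounds -/

section Storage

/-- A storage function that starts at zero and stays nonnegative bounds the output energy. -/
lemma integral_le_of_storage {a b : ℕ} {V V' : ℝ → ℝ} {t : ℝ} (hV : IsPrim V V' 0 t)
    (h0 : V 0 = 0) (ht : 0 ≤ V t) {w : ℝ → Fin a → ℝ} {ζ : ℝ → Fin b → ℝ} {γ c : ℝ} (hγ : 0 < γ)
    (hw : ∀ i, MemLp (fun t => w t i) 2 (volume.restrict (Set.Ioc 0 t)))
    (hζ : ∀ i, MemLp (fun t => ζ t i) 2 (volume.restrict (Set.Ioc 0 t)))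
    (h : ∀ σ ∈ Set.Ioc 0 t, V' σ ≤ c * (w σ ⬝ᵥ w σ) - γ⁻¹ * (ζ σ ⬝ᵥ ζ σ)) :
    ∫ σ in (0 : ℝ)..t, ζ σ ⬝ᵥ ζ σ ≤ γ * c * ∫ σ in (0 : ℝ)..t, w σ ⬝ᵥ w σ := by
  have iw := (integrable_dot_self hw).const_mul c
  have iζ := (integrable_dot_self hζ).const_mul γ⁻¹
  have h1 := hV.integral_eq
  rw [h0, sub_zero, intervalIntegral.integral_of_le hV.le] at h1
  have h2 := setIntegral_mono_on
    ((intervalIntegrable_iff_integrableOn_Ioc_of_le hV.le).1 hV.int) (iw.sub iζ)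
    measurableSet_Ioc h
  simp only [Pi.sub_apply] at h2
  rw [integral_sub iw iζ, integral_const_mul, integral_const_mul, h1] at h2
  rw [intervalIntegral.integral_of_le hV.le, intervalIntegral.integral_of_le hV.le]
  -- From `0 ≤ V t ≤ c ∫ |w|² - γ⁻¹ ∫ |ζ|²`, multiplied by `γ`.
  have h3 := mul_le_mul_of_nonneg_left (ht.trans h2) hγ.le
  rw [mul_zero, mul_sub, mul_inv_cancel_left₀ hγ.ne', ← mul_assoc] at h3
  linarith

/-- Vanishing almost everywhere has to suffice: the integrated equation determines the estimated
histories at time zero only for almost every `s`. -/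
lemma pairing_eq_zero {k n : ℕ} {τ : Fin (k + 1) → ℝ} (hτ : ∀ i, 0 < τ i) (x₀ : Fin n → ℝ)
    (x : Fin (k + 1) → ℝ → Fin n → ℝ) {y : Fin (k + 1) → ℝ → Fin n → ℝ}
    (hy : ∀ i, ∀ᵐ s ∂(volume.restrict (Set.Ioc (-τ i) 0)), y i s = 0) :
    pairing τ x₀ x 0 y = 0 := by
  have e : ∀ i, ∫ s in (-τ i)..0, x i s ⬝ᵥ y i s = 0 := by
    intro i
    rw [intervalIntegral.integral_of_le (by linarith [hτ i])]
    exact integral_eq_zero_of_ae ((hy i).mono fun s hs => by simp [hs])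
  simp only [pairing, e, dotProduct_zero, mul_zero, Finset.sum_const_zero, add_zero]

end Storage

/-! ### Storage functions of the closed loop -/

namespace ClosedLoop

variable {k n m q r p p₁ d : ℕ} {sys : DelaySystem k n m q r p p₁} {𝒦 : ControlGains k n m}
  {𝓛 : EstimGains k n q} {w : ℝ → Fin r → ℝ} {x xh : ℝ → Fin n → ℝ}
  {φ ψ : Fin (k + 1) → ℝ → ℝ → Fin n → ℝ} {z : ℝ → Fin p → ℝ} {ze : ℝ → Fin p₁ → ℝ}
  {Θ : PolyParams k n} {ε : ℝ} {𝒵 : EstimVars k n q} {t : ℝ}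

/-- The regulated output. -/
def outState (sys : DelaySystem k n m q r p p₁) (w : ℝ → Fin r → ℝ) (x : ℝ → Fin n → ℝ) (σ : ℝ) :
    Fin p → ℝ :=
  sys.C₁₀ *ᵥ x σ + ∑ i, sys.C₁ i *ᵥ hist x i σ (-sys.τ i) + sys.D₁ *ᵥ w σ

/-- The regulated estimation error. -/
def outErr (sys : DelaySystem k n m q r p p₁) (w : ℝ → Fin r → ℝ) (x xh : ℝ → Fin n → ℝ)
    (φ : Fin (k + 1) → ℝ → ℝ → Fin n → ℝ) (σ : ℝ) : Fin p₁ → ℝ :=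
  sys.C₃₀ *ᵥ (xh σ - x σ) + ∑ i, sys.C₃ i *ᵥ err x φ i σ (-sys.τ i) + sys.D₃ *ᵥ w σ

lemma memLp_outState (S : ClosedLoop sys 𝒦 𝓛 w x xh φ z ze)
    (hw : MemLp w 2 (volume.restrict (Set.Ici (0 : ℝ)))) (t : ℝ) (a : Fin p) :
    MemLp (fun σ => outState sys w x σ a) 2 (volume.restrict (Set.Ioc 0 t)) := by
  have hx : ∀ b, MemLp (fun σ => x σ b) 2 (volume.restrict (Set.Ioc 0 t)) := fun b =>
    memLp_of_continuousOn (continuous_pi_iff.1 S.x_cont b).continuousOn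
  exact ((memLp_mulVec sys.C₁₀ hx a).add (memLp_sum_apply fun i =>
    memLp_mulVec (sys.C₁ i) (S.memLp_hist_delayed t i) a)).add (memLp_mulVec sys.D₁ (memLp_w hw) a)

lemma memLp_outErr (S : ClosedLoop sys 𝒦 𝓛 w x xh φ z ze) (hψ : IsHistory sys.τ xh φ ψ)
    (hw : MemLp w 2 (volume.restrict (Set.Ici (0 : ℝ)))) (t : ℝ) (a : Fin p₁) :
    MemLp (fun σ => outErr sys w x xh φ σ a) 2 (volume.restrict (Set.Ioc 0 t)) :=
  ((memLp_mulVec sys.C₃₀ (S.memLp_err₀ hψ t) a).add (memLp_sum_apply fun i =>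
    memLp_mulVec (sys.C₃ i) (S.memLp_err_delayed hψ t i) a)).add
    (memLp_mulVec sys.D₃ (memLp_w hw) a)

/-- The storage function of the estimation error. -/
def errStorage (sys : DelaySystem k n m q r p p₁) (Θ : PolyParams k n) (x xh : ℝ → Fin n → ℝ)
    (φ : Fin (k + 1) → ℝ → ℝ → Fin n → ℝ) (σ : ℝ) : ℝ :=
  pairing sys.τ (Θ.sep.op₀ sys.τ (xh σ - x σ) (fun i => err x φ i σ))
    (Θ.sep.op₁ sys.τ (xh σ - x σ) (fun i => err x φ i σ)) (xh σ - x σ) (fun i => err x φ i σ)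

/-- The supply to the storage function of the estimation error. -/
def errSupply (sys : DelaySystem k n m q r p p₁) (𝒦 : ControlGains k n m) (𝓛 : EstimGains k n q)
    (Θ : PolyParams k n) (w : ℝ → Fin r → ℝ) (x xh : ℝ → Fin n → ℝ)
    (φ ψ : Fin (k + 1) → ℝ → ℝ → Fin n → ℝ) (σ : ℝ) : ℝ :=
  2 * pairing sys.τ (Θ.sep.op₀ sys.τ (xh σ - x σ) (fun i => err x φ i σ))
    (Θ.sep.op₁ sys.τ (xh σ - x σ) (fun i => err x φ i σ))
    (errRate₀ sys 𝓛 w x xh φ σ) (fun i => errRate sys 𝒦 𝓛 w x xh φ ψ i σ)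

/-- The storage function of the plant state. -/
def stateStorage (sys : DelaySystem k n m q r p p₁) (Θ : PolyParams k n) (x : ℝ → Fin n → ℝ)
    (σ : ℝ) : ℝ :=
  pairing sys.τ ((Θ.invSep sys.τ).op₀ sys.τ (x σ) (fun i => hist x i σ))
    ((Θ.invSep sys.τ).op₁ sys.τ (x σ) (fun i => hist x i σ)) (x σ) (fun i => hist x i σ)

/-- The supply to the storage function of the plant state. -/
def stateSupply (sys : DelaySystem k n m q r p p₁) (𝒦 : ControlGains k n m) (Θ : PolyParams k n)
    (w : ℝ → Fin r → ℝ) (x xh : ℝ → Fin n → ℝ) (φ : Fin (k + 1) → ℝ → ℝ → Fin n → ℝ) (σ : ℝ) : ℝ :=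
  2 * pairing sys.τ ((Θ.invSep sys.τ).op₀ sys.τ (x σ) (fun i => hist x i σ))
    ((Θ.invSep sys.τ).op₁ sys.τ (x σ) (fun i => hist x i σ))
    (plantRate sys 𝒦 w x xh φ σ) (fun i => hist (plantRate sys 𝒦 w x xh φ) i σ)

lemma isPrim_errStorage (S : ClosedLoop sys 𝒦 (mapLo sys.τ Θ 𝒵) w x xh φ z ze)
    (hψ : IsHistory sys.τ xh φ ψ)
    (hφ : ∀ i t, 0 ≤ t → ∀ᵐ s ∂(volume.restrict (Set.Ioc (-sys.τ i) 0)),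
        φ i t s = ∫ σ in (0 : ℝ)..t,
          (ψ i σ s + injectHistory sys.τ (mapLo sys.τ Θ 𝒵) (sys.C₂ *ᵥ xh σ - sys.C₂ *ᵥ x σ)
            (fun j s' => sys.C₂ *ᵥ φ j σ s' - sys.C₂ *ᵥ x (σ + s')) i s))
    (hK : ∀ i a b, ContinuousOn (fun s => 𝒦.K₂ i s a b) (Set.Icc (-sys.τ i) 0))
    (hw : MemLp w 2 (volume.restrict (Set.Ici (0 : ℝ))))
    (hε : 0 < ε) (hΘ : Θ.eval.shift (-ε • 1) (-ε) ∈ Xi d sys.τ) (ht : 0 ≤ t) :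
    IsPrim (errStorage sys Θ x xh φ) (errSupply sys 𝒦 (mapLo sys.τ Θ 𝒵) Θ w x xh φ ψ) 0 t :=
  (Θ.sep_regular sys.τ_pos hε hΘ).energy (u₀ := fun σ => xh σ - x σ) (u := err x φ) ht
    (S.isPrim_err₀ hψ hK hw hε hΘ ht)
    (fun _ hσ i => S.continuousOn_err hψ hσ.1 i)
    (g := errRate sys 𝒦 (mapLo sys.τ Θ 𝒵) w x xh φ ψ)
    (S.memLp_errRate hψ hK hw hε hΘ t)
    (fun i _ hσ => S.err_eq_integral hψ hφ hK hw hε hΘ hσ.1 i)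

lemma errStorage_zero (S : ClosedLoop sys 𝒦 𝓛 w x xh φ z ze)
    (hφ : ∀ i t, 0 ≤ t → ∀ᵐ s ∂(volume.restrict (Set.Ioc (-sys.τ i) 0)),
        φ i t s = ∫ σ in (0 : ℝ)..t,
          (ψ i σ s + injectHistory sys.τ 𝓛 (sys.C₂ *ᵥ xh σ - sys.C₂ *ᵥ x σ)
            (fun j s' => sys.C₂ *ᵥ φ j σ s' - sys.C₂ *ᵥ x (σ + s')) i s)) :
    errStorage sys Θ x xh φ 0 = 0 := by
  have h0 : xh 0 - x 0 = 0 := by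
    rw [S.xh_eq 0 le_rfl, S.x_zero 0 le_rfl, intervalIntegral.integral_same, sub_zero]
  unfold errStorage
  rw [h0]
  refine pairing_eq_zero sys.τ_pos _ _ fun i => ?_
  filter_upwards [hφ i 0 le_rfl, ae_restrict_mem measurableSet_Ioc] with s h1 hs
  rw [err, h1, intervalIntegral.integral_same, S.x_zero _ (by linarith [hs.2]), sub_zero]

lemma errStorage_nonneg (S : ClosedLoop sys 𝒦 𝓛 w x xh φ z ze) (hψ : IsHistory sys.τ xh φ ψ)
    (hε : 0 < ε) (hΘ : Θ.eval.shift (-ε • 1) (-ε) ∈ Xi d sys.τ) (ht : 0 ≤ t) :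
    0 ≤ errStorage sys Θ x xh φ t :=
  PolyParams.op_nonneg hε sys.τ_pos hΘ _ fun i => S.continuousOn_err hψ ht i

lemma isPrim_stateStorage (S : ClosedLoop sys 𝒦 𝓛 w x xh φ z ze) (hψ : IsHistory sys.τ xh φ ψ)
    (hK : ∀ i a b, ContinuousOn (fun s => 𝒦.K₂ i s a b) (Set.Icc (-sys.τ i) 0))
    (hw : MemLp w 2 (volume.restrict (Set.Ici (0 : ℝ))))
    (hε : 0 < ε) (hΘ : Θ.eval.shift (-ε • 1) (-ε) ∈ Xi d sys.τ) (ht : 0 ≤ t) :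
    IsPrim (stateStorage sys Θ x) (stateSupply sys 𝒦 Θ w x xh φ) 0 t :=
  (Θ.invSep_regular sys.τ_pos hε hΘ).energy (u₀ := x) (u := hist x) ht
    (fun a => S.isPrim_x hψ hK hw a ht) (fun σ _ i => S.continuousOn_hist i σ _)
    (g := hist (plantRate sys 𝒦 w x xh φ)) (fun i a => S.memLp_hist_plantRate hψ hK hw i a t)
    (fun i σ _ => by
      filter_upwards [ae_restrict_mem measurableSet_Ioc] with s hs a
      exact S.hist_eq_integral hψ hK hw i a σ hs.2)

lemma stateStorage_zero (S : ClosedLoop sys 𝒦 𝓛 w x xh φ z ze) : stateStorage sys Θ x 0 = 0 := by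
  unfold stateStorage
  rw [S.x_zero 0 le_rfl]
  refine pairing_eq_zero sys.τ_pos _ _ fun i => ?_
  filter_upwards [ae_restrict_mem measurableSet_Ioc] with s hs
  rw [hist, S.x_zero _ (by linarith [hs.2])]

/-- The space derivative of the error is `ψ` minus the translated plant rate, so the time rate of
the error is its space derivative plus the injection, as `error_dissipation` requires. -/
lemma errSupply_le {γ ε₂ : ℝ} (S : ClosedLoop sys 𝒦 (mapLo sys.τ Θ 𝒵) w x xh φ z ze)
    (hψ : IsHistory sys.τ xh φ ψ)
    (hK : ∀ i a b, ContinuousOn (fun s => 𝒦.K₂ i s a b) (Set.Icc (-sys.τ i) 0))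
    (hw : MemLp w 2 (volume.restrict (Set.Ici (0 : ℝ)))) (hγ : 0 < γ)
    (hε : 0 < ε) (hΘ : Θ.eval.shift (-ε • 1) (-ε) ∈ Xi d sys.τ)
    (hL : ((mapL₂ sys γ Θ.eval 𝒵).shift (ε₂ • stateProj k n r p₁) ε₂).neg ∈ Xi d sys.τ)
    {σ : ℝ} (hσ : 0 ≤ σ) :
    errSupply sys 𝒦 (mapLo sys.τ Θ 𝒵) Θ w x xh φ ψ σ ≤ γ * (w σ ⬝ᵥ w σ)
      - γ⁻¹ * (outErr sys w x xh φ σ ⬝ᵥ outErr sys w x xh φ σ)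
      - sys.T * (ε₂ * sqNorm sys.τ (xh σ - x σ) fun i => err x φ i σ) :=
  error_dissipation hγ hε hΘ 𝒵 hL (w σ)
    (e' := fun i s => ψ i σ s - hist (plantRate sys 𝒦 w x xh φ) i σ s)
    (fun i a => S.isPrim_err hψ hK hw i hσ a)
    (fun i => by rw [err, hψ.apply_zero sys.τ_pos i hσ, add_zero]) rfl

/-- For the plant history the time derivative is the space derivative, so the pairing in
`state_dissipation` is the rate of the storage function once `plantRate_eq` has split the control.
-/
lemma stateSupply_le {γ ε₁ : ℝ} {ℋ : ControlVars k n m}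
    (S : ClosedLoop sys (mapLc sys.τ Θ ℋ) 𝓛 w x xh φ z ze) (hψ : IsHistory sys.τ xh φ ψ)
    (hw : MemLp w 2 (volume.restrict (Set.Ici (0 : ℝ)))) (hγ : 0 < γ)
    (hε : 0 < ε) (hΘ : Θ.eval.shift (-ε • 1) (-ε) ∈ Xi d sys.τ)
    (hX : StateSpacePreserving sys.τ Θ.eval)
    (hL : ((mapL₁ sys γ Θ.eval ℋ).shift (ε₁ • stateProj k n p r) ε₁).neg ∈ Xi d sys.τ)
    {σ : ℝ} (hσ : 0 < σ) :
    stateSupply sys (mapLc sys.τ Θ ℋ) Θ w x xh φ σ ≤ γ * (w σ ⬝ᵥ w σ)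
      - γ⁻¹ * (outState sys w x σ ⬝ᵥ outState sys w x σ)
      - sys.T * (ε₁ * sqNorm sys.τ ((Θ.invSep sys.τ).op₀ sys.τ (x σ) (fun i => hist x i σ))
          ((Θ.invSep sys.τ).op₁ sys.τ (x σ) (fun i => hist x i σ)))
      + sys.T * (2 * ((Θ.invSep sys.τ).op₀ sys.τ (x σ) (fun i => hist x i σ) ⬝ᵥ sys.B₂ *ᵥ
          gainOp sys.τ (mapLc sys.τ Θ ℋ) (xh σ - x σ) fun i => err x φ i σ)) := by
  have hK := continuousOn_K₂ sys.τ_pos hε hΘ ℋ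
  unfold stateSupply
  rw [S.plantRate_eq hψ hK hσ]
  exact state_dissipation hγ hε hΘ hX ℋ hL (w σ) _ (fun i a => S.isPrim_hist hψ hK hw i σ a)
    (fun i => by rw [hist, add_zero]) rfl

end ClosedLoop

end MultiDelay

end

/-! ### The two gain bounds -/

theorem theorem7 {k n m q r p p₁ : ℕ} (sys : DelaySystem k n m q r p p₁)
    (d : ℕ) (ε ε₁ ε₂ ε₃ γ₁ γ₂ ρ : ℝ)
    (hε : 0 < ε) (hε₁ : 0 < ε₁) (hε₂ : 0 < ε₂) (hε₃ : 0 ≤ ε₃)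
    (hγ₁ : 0 < γ₁) (hγ₂ : 0 < γ₂) (hρ : 0 < ρ)
    (Θ₁ Θ₂ : PolyParams k n) (ℋ : ControlVars k n m) (𝒵 : EstimVars k n q)
    (hΘ₁ : StateSpacePreserving sys.τ Θ₁.eval)
    (hP₁ : Θ₁.eval.shift (-ε • 1) (-ε) ∈ Xi d sys.τ)
    (hL₁ : ((mapL₁ sys γ₁ Θ₁.eval ℋ).shift (ε₁ • stateProj k n p r) ε₁).neg ∈ Xi d sys.τ)
    (hP₂ : Θ₂.eval.shift (-ε • 1) (-ε) ∈ Xi d sys.τ)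
    (hL₂ : ((mapL₂ sys γ₂ Θ₂.eval 𝒵).shift (ε₂ • stateProj k n r p₁) ε₂).neg ∈ Xi d sys.τ)
    (hC : ((coupling sys (mapLc sys.τ Θ₁ ℋ) ε₁ ε₂ ρ).shift
      (ε₃ • couplingProj k n) 0).neg ∈ Xi d sys.τ)
    (w : ℝ → Fin r → ℝ) (hw : MemLp w 2 (volume.restrict (Set.Ici (0 : ℝ))))
    (z : ℝ → Fin p → ℝ) (ze : ℝ → Fin p₁ → ℝ)
    (hsol : ∃ x xh φ,
      ClosedLoop sys (mapLc sys.τ Θ₁ ℋ) (mapLo sys.τ Θ₂ 𝒵) w x xh φ z ze) :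
    normL₂ z ≤ ENNReal.ofReal (√(γ₁ * (γ₁ + ρ * γ₂))) * normL₂ w ∧
      normL₂ ze ≤ ENNReal.ofReal γ₂ * normL₂ w := by
  obtain ⟨x, xh, φ, S⟩ := hsol
  obtain ⟨ψ, hψ, hφ⟩ := S.exists_isHistory
  have hK := continuousOn_K₂ sys.τ_pos hε hP₁ ℋ
  have hT : 0 < sys.T := sys.τ_pos _
  have hV₂ := fun t ht => S.isPrim_errStorage (t := t) hψ hφ hK hw hε hP₂ ht
  have hV₁ := fun t ht => S.isPrim_stateStorage (t := t) hψ hK hw hε hP₁ ht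
  have hd₂ := fun σ (hσ : 0 < σ) => S.errSupply_le hψ hK hw hγ₂ hε hP₂ hL₂ hσ.le
  have hd₁ := fun σ (hσ : 0 < σ) => S.stateSupply_le hψ hw hγ₁ hε hP₁ hΘ₁ hL₁ hσ
  have hw' := fun t a => ClosedLoop.memLp_w (t := t) hw a
  constructor
  · refine normL₂_le_of_forall (f' := ClosedLoop.outState sys w x) (by positivity) ?_
      (S.memLp_outState hw) hw' fun t ht => ?_
    · exact S.z_eq
    -- The storage function is `V₁ + ρ V₂`. Its supply has `c = γ₁ + ρ γ₂` in front of `|w|²`, and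
    -- the output is weighted by `γ₁⁻¹`, whence the constant `γ₁ (γ₁ + ρ γ₂)`.
    · refine integral_le_of_storage ((hV₁ t ht).add ((hV₂ t ht).const_mul ρ)) ?_ ?_ hγ₁ (hw' t)
        (S.memLp_outState hw t) fun σ hσ => ?_
      · rw [S.stateStorage_zero, S.errStorage_zero hφ, mul_zero, add_zero]
      · exact add_nonneg (PolyParams.invOp_nonneg hε sys.τ_pos hP₁ _ fun i =>
          S.continuousOn_hist i t _) (mul_nonneg hρ.le (S.errStorage_nonneg hψ hε hP₂ ht))
      · have h₁ := hd₁ σ hσ.1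
        have h₂ := mul_le_mul_of_nonneg_left (hd₂ σ hσ.1) hρ.le
        -- Multiplied by `T`, the coupling bound is absorbed exactly by the reserve `T ε₁ ‖h‖²` of
        -- the plant inequality and `ρ` times the reserve `T ε₂ ‖e‖²` of the error inequality.
        have h₃ := mul_le_mul_of_nonneg_left (coupling_bound hε₃ hK hC
          ((Θ₁.invSep sys.τ).op₀ sys.τ (x σ) fun i => ClosedLoop.hist x i σ) (xh σ - x σ)
          (fun i => (Θ₁.invSep_regular sys.τ_pos hε hP₁).continuousOn_op₁ (x σ)
            (fun i => S.continuousOn_hist i σ _) i)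
          (fun i => S.continuousOn_err hψ hσ.1.le i)) hT.le
        -- The contribution of the error output is nonpositive in the sum and is discarded.
        have h₄ := mul_nonneg hρ.le (mul_nonneg (inv_nonneg.2 hγ₂.le)
          (dot_self_nonneg (ClosedLoop.outErr sys w x xh φ σ)))
        linarith
  -- The error inequality stands on its own, with `c = γ₂`; the squared gain is `γ₂ * γ₂`, so its
  -- root is `γ₂`.
  · have h := normL₂_le_of_forall (f' := ClosedLoop.outErr sys w x xh φ) (C := γ₂ * γ₂)
      (mul_self_nonneg γ₂) S.ze_eq (S.memLp_outErr hψ hw) hw' fun t ht =>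
        integral_le_of_storage (hV₂ t ht) (S.errStorage_zero hφ)
          (S.errStorage_nonneg hψ hε hP₂ ht) hγ₂ (hw' t) (S.memLp_outErr hψ hw t) fun σ hσ => by
            have h₁ := hd₂ σ hσ.1
            have h₂ := mul_nonneg hT.le (mul_nonneg hε₂.le (sqNorm_nonneg sys.τ_pos (xh σ - x σ)
              fun i => ClosedLoop.err x φ i σ))
            linarith
    rwa [Real.sqrt_mul_self hγ₂.le] at h
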